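/- **Proposition (Kohnen's operator as the translate of a 2-adic Hecke operator).** Let $k\ge 1$ be an integer, $M$ an odd positive integer, and let $S_{k+1/2}(\Gamma_0(4M))$ be the space of holomorphic cusp forms of weight $k+1/2$ on $\Gamma_0(4M)$ with trivial character (automorphy factor $j(\alpha,z)=\varepsilon_d^{-1}\left(\frac cd\right)(cz+d)^{1/2}$). *Kohnen's operator and the plus space.* For $\xi=(\alpha,\phi)$ in Shimura's group $\mathcal G$ (pairs with $\alpha\in GL_2(\mathbb R)^+$, $\phi$ holomorphic on the upper half plane and $\phi(z)^2=t\det(\alpha)^{-1/2}(cz+d)$, $|t|=1$) put $f|[\xi]_{k+1/2}(z)=f(\alpha z)\phi(z)^{-2k-1}$. Let $\Delta_0(4M)=\{(\alpha,j(\alpha,z)):\alpha\in\Gamma_0(4M)\}$, $\rho=\left(\begin{pmatrix}4&1\\0&4\end{pmatrix},e^{\pi i/4}\right)$, and let $Q(f)=\sum_v f|[\xi_v]_{k+1/2}$, where $\Delta_0(4M)\rho\Delta_0(4M)=\bigsqcup_v\Delta_0(4M)\xi_v$. Let $S^+_{k+1/2}(4M)$ be the space of $f=\sum a(n)e^{2\pi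 i nz}\in S_{k+1/2}(\Gamma_0(4M))$ with $a(n)=0$ unless $(-1)^kn\equiv 0,1 \pmod 4$. *The 2-adic Hecke algebra.* For a prime $p$ let $\widetilde{SL}_2(\mathbb Q_p)=SL_2(\mathbb Q_p)\times\{\pm1\}$ with multiplication given by the cocycle $\sigma_p(g,h)=(\tau(gh)\tau(g),\tau(gh)\tau(h))_p\,s_p(g)s_p(h)s_p(gh)$, where $\tau(g)=c$ if $c\neq0$ and $\tau(g)=d$ if $c=0$, and $s_p(g)=(c,d)_p$ if $cd\ne0$ and $\mathrm{ord}_p(c)$ is odd, $s_p(g)=1$ otherwise; similarly for $\mathbb R$ with $s_\infty=1$, and $\widetilde{SL}_2(\mathbb A)=SL_2(\mathbb A)\times\{\pm1\}$ with the product cocycle. It contains $SL_2(\mathbb Q)$ through $s_{\mathbb Q}(\alpha)=(\alpha,\prod_\nu s_\nu(\alpha))$. Let $S$ be the inverse image in $\widetilde{SL}_2(\mathbb Q_2)$ of $K_0^2(4)=\{g\in SL_2(\mathbb Z_2): c\in4\mathbb Z_2\}$, and $\gamma$ the genuine character of $S$ that is trivial on $K_1^2(4)=\{g\in K_0^2(4):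 a\equiv1 \bmod 4\}$ and has $\gamma((-I,1))=-i^{2k+1}$; put $\zeta_8=(1+\gamma((-I,1)))/\sqrt2$. The Hecke algebra $H(S,\gamma)$ consists of the locally constant, compactly supported $F$ on $\widetilde{SL}_2(\mathbb Q_2)$ with $F(xgy)=\overline{\gamma(x)}\,\overline{\gamma(y)}F(g)$ for $x,y\in S$. Let $\mathcal T_n,\mathcal U_n\in H(S,\gamma)$ be supported on $S(h(2^n),1)S$ and $S(w(2^{-n}),1)S$, with values $1$ at $(h(2^n),1)$ and $\overline{\zeta_8}$ at $(w(2^{-n}),1)$ respectively, where $h(t)=\begin{pmatrix}t&0\\0&t^{-1}\end{pmatrix}$, $w(t)=\begin{pmatrix}0&t\\-t^{-1}&0\end{pmatrix}$. *Translation.* Put $J((g,\epsilon),z)=\epsilon(cz+d)^{1/2}$ on $\widetilde{SL}_2(\mathbb R)$, with $-\pi\le\arg(cz+d)<\pi$. For $f\in S_{k+1/2}(\Gamma_0(4M))$ let $\Phi_f(s_{\mathbb Q}(\alpha)\tilde g_\infty(\kappa,1))=f(\tilde g_\infty i)J(\tilde g_\infty,i)^{-2k-1}$ for $\alpha\in SL_2(\mathbb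 Q)$, $\tilde g_\infty\in\widetilde{SL}_2(\mathbb R)$, and $\kappa\in\prod_q SL_2(\mathbb Z_q)$ with $c\equiv0$, $a\equiv d\equiv1\pmod{4M}$. For $\mathcal T\in H(S,\gamma)$ let $(\mathcal T\Phi)(\tilde g)=\int_{\widetilde{SL}_2(\mathbb Q_2)}\mathcal T(\tilde x)\Phi(\tilde g\tilde x)\,d\tilde x$, with Haar measure giving $S$ measure one, and let $q(\mathcal T)(f)(z)=(\mathcal T\Phi_f)(\tilde g_\infty)J(\tilde g_\infty,i)^{2k+1}$, where $\tilde g_\infty i=z$. *Claim.* $\mathcal T_1,\mathcal U_1,\mathcal U_2$ are elements of $H(S,\gamma)$; the operators $Q$, $q(\mathcal T_1)$, $q(\mathcal U_1)$, $q(\mathcal U_2)$ map $S_{k+1/2}(\Gamma_0(4M))$ into itself; and for every $f\in S_{k+1/2}(\Gamma_0(4M))$ $$Q(f)=\left(\frac{2}{2k+1}\right)q(\mathcal U_2)(f)=\left(\frac{2}{2k+1}\right)q(\mathcal U_1)\,q(\mathcal T_1)(f),$$ where $\left(\frac{2}{2k+1}\right)$ is the Jacobi symbol. Consequently $S^+_{k+1/2}(4M)$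 is the $2$-eigenspace of $\widetilde Q_2'=q(\mathcal U_1)q(\mathcal T_1)/\sqrt2$ on $S_{k+1/2}(\Gamma_0(4M))$. -/

import Mathlib

open UpperHalfPlane Filter Topology MeasureTheory
open scoped MatrixGroups RestrictedProduct Manifold

namespace KohnenPlus

noncomputable section

/-! ### Shimura's group and cusp forms of half-integral weight -/

/-- Shimura's group `𝒢`: pairs `(α, φ)` with `α ∈ GL₂(ℝ)⁺` and `φ` holomorphic on `ℍ` such that
`φ(z)² = t · det(α)^(-1/2) · (c z + d)` for some `t` on the unit circle. -/
@[ext]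
structure ShimuraGroup where
  mat : GL (Fin 2) ℝ
  aut : ℍ → ℂ
  det_pos : 0 < mat.det.val
  holo : MDifferentiable 𝓘(ℂ) 𝓘(ℂ) aut
  sq : ∃ t : ℂ, ‖t‖ = 1 ∧
    ∀ z : ℍ, aut z ^ 2 = t * ((mat.det.val ^ (-(1 / 2) : ℝ) : ℝ) : ℂ) * denom mat z

/-- The group law `(α, φ(z)) (β, ψ(z)) = (αβ, φ(βz) ψ(z))`. -/
instance : Mul ShimuraGroup where
  mul ξ η :=
    { mat := ξ.mat * η.mat
      aut := fun z => ξ.aut (η.mat • z) * η.aut z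
      det_pos := by
        rw [map_mul, Units.val_mul]
        exact mul_pos ξ.det_pos η.det_pos
      holo := (ξ.holo.comp (mdifferentiable_smul η.det_pos)).mul η.holo
      sq := by
        obtain ⟨t, ht, h⟩ := ξ.sq
        obtain ⟨u, hu, h'⟩ := η.sq
        refine ⟨t * u, by rw [norm_mul, ht, hu, mul_one], fun z => ?_⟩
        have hc := denom_cocycle_σ ξ.mat η.mat z
        rw [UpperHalfPlane.σ, if_pos η.det_pos] at hc
        simp only [ContinuousAlgEquiv.refl_apply] at hc
        rw [mul_pow, h, h', map_mul, Units.val_mul,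
          Real.mul_rpow ξ.det_pos.le η.det_pos.le, hc]
        push_cast
        ring }

/-- The slash operator `(f|[(α, φ)]_{k+1/2})(z) = f(αz) φ(z)^(-2k-1)`. -/
def slash (k : ℕ) (f : ℍ → ℂ) (ξ : ShimuraGroup) : ℍ → ℂ :=
  fun z => f (ξ.mat • z) * (ξ.aut z ^ (2 * k + 1))⁻¹

/-- Shimura's extension of the quadratic residue symbol `(c/d)` to odd `d` of either sign. -/
def shimuraSymbol (c d : ℤ) : ℤ :=
  if c < 0 ∧ d < 0 then -jacobiSym c d.natAbs else jacobiSym c d.natAbs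

/-- `ε_d = 1` or `i` according as `d ≡ 1` or `3` modulo `4`. -/
def epsilonFactor (d : ℤ) : ℂ := if d % 4 = 1 then 1 else Complex.I

/-- The theta automorphy factor `j(α, z) = ε_d⁻¹ (c/d) (cz+d)^(1/2)`. -/
def thetaFactor (α : SL(2, ℤ)) (z : ℍ) : ℂ :=
  (epsilonFactor (α 1 1))⁻¹ * (shimuraSymbol (α 1 0) (α 1 1) : ℂ) *
    ((α 1 0 : ℂ) * (z : ℂ) + (α 1 1 : ℂ)) ^ (1 / 2 : ℂ)

/-- `Δ₀(N) = {(α, j(α, z)) : α ∈ Γ₀(N)} ⊆ 𝒢`. -/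
def Delta0 (N : ℕ) : Set ShimuraGroup :=
  {ξ | ∃ α ∈ CongruenceSubgroup.Gamma0 N, ξ.mat = Matrix.SpecialLinearGroup.mapGL ℝ α ∧
    ∀ z, ξ.aut z = thetaFactor α z}

/-- `f` is a cusp form of weight `k + 1/2` on `Γ₀(N)` (with `4 ∣ N`) and trivial character:
holomorphic, invariant under `Δ₀(N)`, and vanishing at every cusp. -/
structure IsCuspForm (k N : ℕ) (f : ℍ → ℂ) : Prop where
  holo : MDifferentiable 𝓘(ℂ) 𝓘(ℂ) f
  invariant : ∀ ξ ∈ Delta0 N, slash k f ξ = f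
  zero_at_cusps : ∀ ξ : ShimuraGroup,
    (∃ α : SL(2, ℤ), ξ.mat = Matrix.SpecialLinearGroup.mapGL ℝ α) → IsZeroAtImInfty (slash k f ξ)

/-- The space `S_{k+1/2}(Γ₀(N))`. -/
def cuspForms (k N : ℕ) : Set (ℍ → ℂ) := {f | IsCuspForm k N f}

/-- Kohnen's plus space: the cusp forms `f = ∑ a(n) qⁿ` of weight `k + 1/2` on `Γ₀(4M)` such that
`a(n) = 0` unless `(-1)^k n ≡ 0, 1 (mod 4)`. -/
def plusSpace (k M : ℕ) : Set (ℍ → ℂ) :=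
  {f | f ∈ cuspForms k (4 * M) ∧ ∃ a : ℕ → ℂ,
    (∀ z : ℍ, HasSum (fun n : ℕ => a n * Complex.exp (2 * Real.pi * Complex.I * n * (z : ℂ)))
      (f z)) ∧
    ∀ n : ℕ, a n ≠ 0 → ((-1 : ℤ) ^ k * n) % 4 = 0 ∨ ((-1 : ℤ) ^ k * n) % 4 = 1}

/-- The set of left cosets `Δ ξ_v` in the double coset `Δ ξ Δ = ⋃ Δ ξ_v`. -/
def leftCosets (Δ : Set ShimuraGroup) (ξ : ShimuraGroup) : Set (Set ShimuraGroup) :=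
  {C | ∃ η, (∃ δ ∈ Δ, ∃ δ' ∈ Δ, η = δ * ξ * δ') ∧ C = {x | ∃ δ ∈ Δ, x = δ * η}}

/-- The double coset operator `f|[Δ ξ Δ] = ∑_v f|[ξ_v]_{k+1/2}`, where `ΔξΔ = ⋃_v Δ ξ_v`. -/
def doubleCosetOperator (k : ℕ) (Δ : Set ShimuraGroup) (ξ : ShimuraGroup) (f : ℍ → ℂ) : ℍ → ℂ :=
  fun z => ∑ᶠ C : leftCosets Δ ξ, slash k f C.2.choose z

/-- The element `ρ = ((4, 1; 0, 4), e^{πi/4})` of `𝒢`. -/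
def rho : ShimuraGroup where
  mat := Matrix.GeneralLinearGroup.mkOfDetNeZero !![4, 1; 0, 4] (by simp)
  aut := fun _ => Complex.exp (Real.pi * Complex.I / 4)
  det_pos := by simp [Matrix.GeneralLinearGroup.mkOfDetNeZero]
  holo := mdifferentiable_const
  sq := by
    refine ⟨Complex.I, by simp, fun z => ?_⟩
    have h1 : Complex.exp (Real.pi * Complex.I / 4) ^ 2 = Complex.I := by
      rw [← Complex.exp_nat_mul]
      have : ((2 : ℕ) : ℂ) * (Real.pi * Complex.I / 4) = Real.pi / 2 * Complex.I := by
        push_cast; ring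
      rw [this, Complex.exp_pi_div_two_mul_I]
    have h2 : ((4 : ℝ) * 4) ^ (-(1 / 2) : ℝ) = 4⁻¹ := by
      rw [show ((4 : ℝ) * 4) = 4 ^ (2 : ℝ) by norm_num, ← Real.rpow_mul (by norm_num)]
      norm_num
    rw [h1]
    simp [Matrix.GeneralLinearGroup.mkOfDetNeZero, denom] at h2 ⊢
    rw [h2]
    push_cast
    ring

/-- Kohnen's operator `Q = [Δ₀(N) ρ Δ₀(N)]` on `S_{k+1/2}(Γ₀(N))`. -/
def kohnenQ (k N : ℕ) (f : ℍ → ℂ) : ℍ → ℂ := doubleCosetOperator k (Delta0 N) rho f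

/-! ### The local double covers -/

open Classical in
/-- The Hilbert symbol of a field `K`: it is `1` when `z² = a x² + b y²` has a nontrivial
solution in `K`, and `-1` otherwise. -/
def hilbertSymbol {K : Type*} [Field K] (a b : K) : ℤˣ :=
  if ∃ x y z : K, (x ≠ 0 ∨ y ≠ 0 ∨ z ≠ 0) ∧ z ^ 2 = a * x ^ 2 + b * y ^ 2 then 1 else -1

open Classical in
/-- `τ(g) = c` if `c ≠ 0`, and `τ(g) = d` if `c = 0`. -/
def tau {K : Type*} [Field K] (g : SL(2, K)) : K :=
  if g 1 0 ≠ 0 then g 1 0 else g 1 1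

/-- `σ(g, h) = (τ(gh)τ(g), τ(gh)τ(h)) s(g) s(h) s(gh)`. -/
def cocycle {K : Type*} [Field K] (s : SL(2, K) → ℤˣ) (g h : SL(2, K)) : ℤˣ :=
  hilbertSymbol (tau (g * h) * tau g) (tau (g * h) * tau h) * s g * s h * s (g * h)

instance factPrime (p : Nat.Primes) : Fact (p : ℕ).Prime := ⟨p.2⟩

open Classical in
/-- `s_p(g) = (c, d)_p` if `cd ≠ 0` and `ord_p(c)` is odd, and `1` otherwise. -/
def sPadic (p : Nat.Primes) (g : SL(2, ℚ_[p])) : ℤˣ :=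
  if g 1 0 * g 1 1 ≠ 0 ∧ Odd (g 1 0).valuation then hilbertSymbol (g 1 0) (g 1 1) else 1

/-- The cocycle `σ_p` on `SL₂(ℚ_p)`. -/
def cocyclePadic (p : Nat.Primes) : SL(2, ℚ_[p]) → SL(2, ℚ_[p]) → ℤˣ := cocycle (sPadic p)

/-- The cocycle `σ_∞` on `SL₂(ℝ)`; here `s_∞ = 1`. -/
def cocycleReal : SL(2, ℝ) → SL(2, ℝ) → ℤˣ := cocycle (fun _ => 1)

/-- The double cover of `SL₂(ℚ_p)`: the set `SL₂(ℚ_p) × {±1}` with the law given by `σ_p`. -/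
@[ext]
structure PadicCover (p : Nat.Primes) where
  mat : SL(2, ℚ_[p])
  sgn : ℤˣ

instance (p : Nat.Primes) : Mul (PadicCover p) where
  mul g h := ⟨g.mat * h.mat, g.sgn * h.sgn * cocyclePadic p g.mat h.mat⟩

/-! ### The adelic double cover -/

/-- `SL₂(ℤ_p)` as a subgroup of `SL₂(ℚ_p)`. -/
def SL2Zp (p : Nat.Primes) : Subgroup SL(2, ℚ_[p]) :=
  (Matrix.SpecialLinearGroup.map (n := Fin 2) (PadicInt.Coe.ringHom (p := p))).range

theorem mem_SL2Zp {p : Nat.Primes} {g : SL(2, ℚ_[p])} :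
    g ∈ SL2Zp p ↔ ∀ i j, ‖g i j‖ ≤ 1 := by
  constructor
  · rintro ⟨h, rfl⟩ i j
    exact (h i j).2
  · intro H
    refine ⟨⟨Matrix.of fun i j => (⟨g i j, H i j⟩ : ℤ_[p]), ?_⟩, ?_⟩
    · apply Subtype.ext
      have := g.det_coe
      rw [Matrix.det_fin_two] at this ⊢
      exact this
    · ext i j
      rfl

/-- `SL₂` of the finite adeles of `ℚ`: the restricted product of the groups `SL₂(ℚ_p)` with
respect to the subgroups `SL₂(ℤ_p)`. -/
abbrev SL2FiniteAdele : Type := Πʳ p : Nat.Primes, [SL(2, ℚ_[p]), (SL2Zp p : Set SL(2, ℚ_[p]))]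

/-- The double cover of `SL₂(𝔸)`: triples of an infinite component, a finite component, and a
sign. -/
@[ext]
structure AdelicCover where
  inf : SL(2, ℝ)
  fin : SL2FiniteAdele
  sgn : ℤˣ

/-- The law `(g, ε₁)(h, ε₂) = (gh, ε₁ ε₂ ∏_ν σ_ν(g_ν, h_ν))`. -/
instance : Mul AdelicCover where
  mul g h := ⟨g.inf * h.inf, g.fin * h.fin,
    g.sgn * h.sgn * (cocycleReal g.inf h.inf *
      ∏ᶠ p : Nat.Primes, cocyclePadic p (g.fin p) (h.fin p))⟩

/-- The inclusion `SL₂(ℚ) → SL₂(ℚ_p)`. -/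
def ratToPadic (p : Nat.Primes) : SL(2, ℚ) →* SL(2, ℚ_[p]) :=
  Matrix.SpecialLinearGroup.map (Rat.castHom ℚ_[p])

theorem ratToPadic_mem (α : SL(2, ℚ)) : ∀ᶠ p : Nat.Primes in cofinite,
    ratToPadic p α ∈ (SL2Zp p : Set SL(2, ℚ_[p])) := by
  have key : ∀ q : ℚ, ∀ᶠ p : Nat.Primes in cofinite, ‖(q : ℚ_[p])‖ ≤ 1 := by
    intro q
    have hfin : {p : Nat.Primes | (p : ℕ) ∣ q.den}.Finite := by
      refine Set.Finite.of_finite_image (f := fun p : Nat.Primes => (p : ℕ)) ?_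
        (fun _ _ _ _ h => Nat.Primes.coe_nat_injective h)
      refine (Set.finite_Iic q.den).subset ?_
      rintro _ ⟨p, hp, rfl⟩
      exact Nat.le_of_dvd q.den_pos hp
    rw [Filter.eventually_cofinite]
    exact hfin.subset fun p hp => by
      by_contra hd
      exact hp (Padic.norm_rat_le_one hd)
  have : ∀ᶠ p : Nat.Primes in cofinite, ∀ i j, ‖((α i j : ℚ) : ℚ_[p])‖ ≤ 1 := by
    rw [Filter.eventually_all]
    intro i
    rw [Filter.eventually_all]
    exact fun j => key _
  filter_upwards [this] with p hp
  exact mem_SL2Zp.2 hp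

/-- The diagonal embedding of `SL₂(ℚ)` in `SL₂` of the finite adeles. -/
def ratDiagonal (α : SL(2, ℚ)) : SL2FiniteAdele := ⟨fun p => ratToPadic p α, ratToPadic_mem α⟩

/-- The splitting `s_ℚ(α) = (α, ∏_ν s_ν(α))` of the adelic double cover over `SL₂(ℚ)`. -/
def rationalSplitting (α : SL(2, ℚ)) : AdelicCover :=
  ⟨Matrix.SpecialLinearGroup.map (Rat.castHom ℝ) α, ratDiagonal α,
    ∏ᶠ p : Nat.Primes, sPadic p (ratToPadic p α)⟩

/-- The inclusion of the double cover of `SL₂(ℝ)` at the infinite place. -/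
def ofReal (g : SL(2, ℝ)) (ε : ℤˣ) : AdelicCover := ⟨g, 1, ε⟩

/-- The inclusion of the double cover of `SL₂(ℚ_p)` at the place `p`. -/
def ofPadic {p : Nat.Primes} (x : PadicCover p) : AdelicCover :=
  ⟨1, RestrictedProduct.mulSingle SL2Zp p x.mat, x.sgn⟩

/-- The element `(κ, 1)` for `κ` in `SL₂` of the finite adeles. -/
def ofFinite (κ : SL2FiniteAdele) : AdelicCover := ⟨1, κ, 1⟩

/-- `K₁(N)`: all `κ` whose components are `(a, b; c, d) ∈ SL₂(ℤ_q)` with `c ≡ 0` and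
`a, d ≡ 1` modulo `N ℤ_q`. -/
def K1Adelic (N : ℕ) : Set SL2FiniteAdele :=
  {κ | ∀ q : Nat.Primes, κ q ∈ SL2Zp q ∧ ‖κ q 1 0‖ ≤ ‖(N : ℚ_[q])‖ ∧
    ‖κ q 0 0 - 1‖ ≤ ‖(N : ℚ_[q])‖ ∧ ‖κ q 1 1 - 1‖ ≤ ‖(N : ℚ_[q])‖}

/-! ### Translation between functions on `ℍ` and functions on the adelic double cover -/

/-- The factor `J((g, ε), z) = ε (cz+d)^(1/2)`. The square root is the one with argument in
`[-π/2, π/2)`, obtained by conjugating the principal branch: it is the branch for which `J` is an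
automorphy factor for the law given by `σ_∞` (the branches differ only for `c = 0 > d`). -/
def autJ (g : SL(2, ℝ)) (ε : ℤˣ) (z : ℍ) : ℂ :=
  ((ε : ℤ) : ℂ) *
    starRingEnd ℂ ((starRingEnd ℂ ((g 1 0 : ℂ) * (z : ℂ) + (g 1 1 : ℂ))) ^ (1 / 2 : ℂ))

open Classical in
/-- The function `Φ_f` on the adelic double cover:
`Φ_f(s_ℚ(α) g_∞ (κ, 1)) = f(g_∞ i) J(g_∞, i)^(-2k-1)` for `α ∈ SL₂(ℚ)`, `g_∞` in the double cover
of `SL₂(ℝ)` and `κ ∈ K₁(N)`. -/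
def adelicLift (k N : ℕ) (f : ℍ → ℂ) (g : AdelicCover) : ℂ :=
  if h : ∃ x : SL(2, ℝ) × ℤˣ, ∃ α : SL(2, ℚ), ∃ κ ∈ K1Adelic N,
      g = rationalSplitting α * ofReal x.1 x.2 * ofFinite κ then
    f (h.choose.1 • UpperHalfPlane.I) *
      (autJ h.choose.1 h.choose.2 UpperHalfPlane.I ^ (2 * k + 1))⁻¹
  else 0

/-- The function `f_Φ(z) = Φ(g_∞) J(g_∞, i)^(2k+1)`, where `g_∞ i = z`. -/
def classicalForm (k : ℕ) (Φ : AdelicCover → ℂ) (z : ℍ) : ℂ :=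
  Φ (ofReal z.toSL2R 1) * autJ z.toSL2R 1 UpperHalfPlane.I ^ (2 * k + 1)

/-! ### The `2`-adic Hecke algebra -/

/-- The place `2`. -/
abbrev two : Nat.Primes := ⟨2, Nat.prime_two⟩

/-- The group `K₀²(4)`, as a subset of `SL₂(ℚ₂)`. -/
def K0four : Set SL(2, ℚ_[two]) := {g | g ∈ SL2Zp two ∧ ‖g 1 0‖ ≤ ‖(4 : ℚ_[two])‖}

/-- The group `K₁²(4)`, as a subset of `SL₂(ℚ₂)`. -/
def K1four : Set SL(2, ℚ_[two]) := {g | g ∈ K0four ∧ ‖g 0 0 - 1‖ ≤ ‖(4 : ℚ_[two])‖}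

theorem continuous_entry (i j : Fin 2) : Continuous fun g : SL(2, ℚ_[two]) => g i j :=
  (continuous_apply_apply i j).comp continuous_subtype_val

theorem K0four_eq : K0four = (⋂ i, ⋂ j, (fun g : SL(2, ℚ_[two]) => g i j) ⁻¹'
      Metric.closedBall (0 : ℚ_[two]) 1) ∩
    (fun g : SL(2, ℚ_[two]) => g 1 0) ⁻¹' Metric.closedBall (0 : ℚ_[two]) ‖(4 : ℚ_[two])‖ := by
  ext g
  simp only [K0four, Set.mem_inter_iff, Set.mem_iInter, Set.mem_preimage, Metric.mem_closedBall,
    dist_zero_right]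
  exact and_congr_left fun _ => mem_SL2Zp

theorem isCompact_K0four : IsCompact K0four := by
  have hc : IsClosed K0four := by
    rw [K0four_eq]
    exact IsClosed.inter (isClosed_iInter fun i => isClosed_iInter fun j =>
      Metric.isClosed_closedBall.preimage (continuous_entry i j))
      (Metric.isClosed_closedBall.preimage (continuous_entry 1 0))
  have hK : IsCompact (Set.univ.pi fun _ : Fin 2 => Set.univ.pi fun _ : Fin 2 =>
      Metric.closedBall (0 : ℚ_[two]) 1) :=
    isCompact_univ_pi fun _ => isCompact_univ_pi fun _ => isCompact_closedBall _ _
  refine (Matrix.SpecialLinearGroup.isClosedEmbedding_val.isCompact_preimage hK).of_isClosed_subset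
    hc ?_
  intro g hg i _ j _
  simpa using mem_SL2Zp.1 hg.1 i j

theorem isOpen_K0four : IsOpen K0four := by
  rw [K0four_eq]
  exact IsOpen.inter (isOpen_iInter_of_finite fun i => isOpen_iInter_of_finite fun j =>
    (IsUltrametricDist.isOpen_closedBall _ one_ne_zero).preimage (continuous_entry i j))
    ((IsUltrametricDist.isOpen_closedBall _ (by simp)).preimage (continuous_entry 1 0))

theorem one_mem_K0four : (1 : SL(2, ℚ_[two])) ∈ K0four :=
  ⟨one_mem _, by simp⟩

instance : MeasurableSpace SL(2, ℚ_[two]) := borel _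

instance : BorelSpace SL(2, ℚ_[two]) := ⟨rfl⟩

/-- The Haar measure on `SL₂(ℚ₂)` for which `K₀²(4)` has measure one. -/
def haarTwo : Measure SL(2, ℚ_[two]) :=
  Measure.haarMeasure ⟨⟨K0four, isCompact_K0four⟩,
    ⟨1, mem_interior.2 ⟨K0four, subset_rfl, isOpen_K0four, one_mem_K0four⟩⟩⟩

/-- The subgroup `S`, the complete inverse image of `K₀²(4)` in the double cover of `SL₂(ℚ₂)`. -/
def coverS : Set (PadicCover two) := {x | x.mat ∈ K0four}

/-- The value `γ((-I, 1)) = -i^(2k+1)`. -/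
def gammaNegOne (k : ℕ) : ℂ := -Complex.I ^ (2 * k + 1)

open Classical in
/-- The genuine character `γ` of `S = K₁²(4) × M₂`, where the centre `M₂` is cyclic of order four
with generator `(-I, 1)`: it is trivial on `K₁²(4)`, maps `(I, ε)` to `ε`, and takes the value
`-i^(2k+1)` at `(-I, 1)`. An element with `d ≡ 1 (mod 4)` is `(κ, 1)(I, ε)` with `κ ∈ K₁²(4)`;
any other `(g, ε) ∈ S` is `(-g, 1)(-I, 1)(I, ε σ₂(-g, -I))` with `-g ∈ K₁²(4)`. -/
def gammaChar (k : ℕ) (x : PadicCover two) : ℂ :=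
  if x.mat ∈ K1four then ((x.sgn : ℤ) : ℂ)
  else ((x.sgn * cocyclePadic two (-x.mat) (-1) : ℤˣ) : ℤ) * gammaNegOne k

/-- The number `γ((w(1), 1)) = (1 + γ((-I, 1)))/√2`. -/
def zetaEight (k : ℕ) : ℂ := (1 + gammaNegOne k) / (Real.sqrt 2 : ℂ)

/-- Membership of a function on the double cover of `SL₂(ℚ₂)` in the genuine Hecke algebra
`H(S, γ)`. Local constancy is expressed through small subgroups `U × {1}` with `U ⊆ K₁²(4)`, on
which the cover splits, and compactness of the support through its image in `SL₂(ℚ₂)`. -/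
structure IsHeckeElement (k : ℕ) (F : PadicCover two → ℂ) : Prop where
  equivariant : ∀ x ∈ coverS, ∀ y ∈ coverS, ∀ g,
    F (x * g * y) = starRingEnd ℂ (gammaChar k x) * starRingEnd ℂ (gammaChar k y) * F g
  locally_constant : ∀ g, ∃ U ∈ 𝓝 (1 : SL(2, ℚ_[two])), U ⊆ K1four ∧
    ∀ u ∈ U, F (g * ⟨u, 1⟩) = F g
  compact_support : ∃ C : Set SL(2, ℚ_[two]), IsCompact C ∧ ∀ g, F g ≠ 0 → g.mat ∈ C

open Classical in
/-- The function supported on `S g S` with value `γ̄(x) c γ̄(y)` at `x g y`, for `x, y ∈ S`. -/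
def supportedOn (k : ℕ) (g : PadicCover two) (c : ℂ) (h : PadicCover two) : ℂ :=
  if H : ∃ xy : PadicCover two × PadicCover two,
      xy.1 ∈ coverS ∧ xy.2 ∈ coverS ∧ h = xy.1 * g * xy.2 then
    starRingEnd ℂ (gammaChar k H.choose.1) * c * starRingEnd ℂ (gammaChar k H.choose.2)
  else 0

/-- `2` as a unit of `ℚ₂`. -/
def twoUnit : (ℚ_[two])ˣ := Units.mk0 2 two_ne_zero

/-- `h(t) = (t, 0; 0, t⁻¹)`. -/
def hMat (t : (ℚ_[two])ˣ) : SL(2, ℚ_[two]) :=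
  ⟨!![(t : ℚ_[two]), 0; 0, ((t⁻¹ : (ℚ_[two])ˣ) : ℚ_[two])], by simp [Matrix.det_fin_two]⟩

/-- `w(t) = (0, t; -t⁻¹, 0)`. -/
def wMat (t : (ℚ_[two])ˣ) : SL(2, ℚ_[two]) :=
  ⟨!![0, (t : ℚ_[two]); -((t⁻¹ : (ℚ_[two])ˣ) : ℚ_[two]), 0], by simp [Matrix.det_fin_two]⟩

/-- The element `𝒯_n`, supported on `S (h(2ⁿ), 1) S`; here `γ((h(2ⁿ), 1)) = 1`. -/
def heckeT (k : ℕ) (n : ℤ) : PadicCover two → ℂ := supportedOn k ⟨hMat (twoUnit ^ n), 1⟩ 1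

/-- The element `𝒰_n`, supported on `S (w(2⁻ⁿ), 1) S`. Here `γ` is extended by
`γ((w(2⁻ⁿ), 1)) = γ((h(2⁻ⁿ), 1)) γ((w(1), 1)) (2⁻ⁿ, -1)₂ = γ((w(1), 1))`. -/
def heckeU (k : ℕ) (n : ℤ) : PadicCover two → ℂ :=
  supportedOn k ⟨wMat (twoUnit ^ (-n)), 1⟩ (starRingEnd ℂ (zetaEight k))

/-- The action `(T Φ)(g) = ∫ T(x) Φ(g x) dx`, the integral being over the double cover of
`SL₂(ℚ₂)` for the Haar measure giving `S` measure one. That measure is half the sum of the two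
copies of `haarTwo` on the sheets `SL₂(ℚ₂) × {ε}`, `ε = ±1`. -/
def heckeAction (T : PadicCover two → ℂ) (Φ : AdelicCover → ℂ) (g : AdelicCover) : ℂ :=
  (1 / 2) * ∑ ε : ℤˣ, ∫ x : SL(2, ℚ_[two]), T ⟨x, ε⟩ * Φ (g * ofPadic ⟨x, ε⟩) ∂haarTwo

/-- The classical operator `q(T)(f) = f_{T(Φ_f)}` on `S_{k+1/2}(Γ₀(N))`. -/
def heckeTranslate (k N : ℕ) (T : PadicCover two → ℂ) (f : ℍ → ℂ) : ℍ → ℂ :=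
  classicalForm k (heckeAction T (adelicLift k N f))

end

end KohnenPlus

open KohnenPlus

open UpperHalfPlane Filter Topology MeasureTheory
open scoped MatrixGroups RestrictedProduct Manifold

namespace KohnenPlus

/-! ### The Hilbert symbol of a field -/

section HilbertField

variable {K : Type*} [Field K]

/-! Write n(x) and n⁻(x) for the upper and lower unipotent matrices, and J = i^(2k+1). The
equalities hold because `Q` and q(𝒰₂) are both multiples of the same sum Σ_ν f|n(1/4)n⁻(4Mν), ν = 0,
1, 2, 3, and because the two constants in front, one a power of e^(πi/4) and one a value of 𝒰₂,
differ by the Jacobi symbol.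

For `Q` the sum comes from cosets. An element of Δ₀(4M) whose lower left entry is divisible by 16
can be moved from the right of ρ to its left without change of multiplier, and modulo such elements
only the n⁻(4Mν) remain (`exists_conj_upper`, `leftCoset_bijective`, `kohnenQ_eq`). For q(𝒰₂) the
integrand is right invariant under S, so the integral is a sum over cosets of K₀²(4). These have the
rational representatives n⁻(-4Mν)n(-1/4), which lie in the level group at every odd prime. Left
invariance under SL₂(ℚ) therefore trades such an element at the place 2 for its inverse at the real
place (`IsAutomorphic.mul_ofPadic_rat`, `heckeTranslate_eq`). The value of 𝒰₂ there follows from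
n⁻(4)n(-1/4)n⁻(4) = -w(1/4) (`heckeU_two_upperU`), and the constants are compared in
`inv_rhoPhase_pow`. The identity 𝒰₂ = 𝒰₁𝒯₁ holds on automorphic functions because w(1/2)n(b)h(2) =
n⁻(-4b)w(1/4) also runs through the cosets of 𝒰₂, and no sign appears because (2,-2)₂ = 1
(`heckeAction_heckeU_heckeT`).

For this to make sense the covers must be associative, s_ℚ must be multiplicative, and Φ_f must be
well defined. Associativity needs bimultiplicative Hilbert symbols and (x, 1-x) = 1
(`kubota_cocycle`). Multiplicativity of s_ℚ is the product formula, hence quadratic reciprocity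
(`globalHilbert_eq_one`, `splitSign_mul`). The splitting sign on Γ₀(N) ∩ Γ₁(4) turns out to be
Shimura's quadratic symbol (`splitSign_eq_shimuraSymbol`), so invariance under the theta multiplier
is exactly left invariance under s_ℚ, and Φ_f is well defined (`decomposition_unique`).

For the eigenspace put v_ν = f|n(1/4)n⁻(4Mν). Translation by 1/4 sends v₂ to Jf and multiplies v₁
and v₃ by scalars in {1, J}. Linear algebra with these relations shows that Qf has the required
eigenvalue if and only if v₀ + v₂ is the right multiple of f (`eigen_iff`). Since v₂ = J f(z - 1/4),
the latter is a condition on f(z ± 1/4), and the corresponding operator acts on exp(2πinz) by w or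
by -w, according to whether n satisfies the plus condition (`quarterEigenvalue_eq`,
`mem_plusSpace_iff`). -/

theorem hilbertSymbol_eq_one_iff {a b : K} : hilbertSymbol a b = 1 ↔
    ∃ x y z : K, (x ≠ 0 ∨ y ≠ 0 ∨ z ≠ 0) ∧ z ^ 2 = a * x ^ 2 + b * y ^ 2 := by
  unfold hilbertSymbol
  split_ifs with h
  · simpa using h
  · simpa using h

theorem hilbertSymbol_comm (a b : K) : hilbertSymbol a b = hilbertSymbol b a := by
  have : ∀ a b : K, hilbertSymbol a b = 1 → hilbertSymbol b a = 1 := by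
    intro a b h
    obtain ⟨x, y, z, h0, h⟩ := hilbertSymbol_eq_one_iff.1 h
    exact hilbertSymbol_eq_one_iff.2 ⟨y, x, z, by tauto, by rw [h, add_comm]⟩
  rcases Int.units_eq_one_or (hilbertSymbol a b) with h | h
  · rw [h, this a b h]
  · rcases Int.units_eq_one_or (hilbertSymbol b a) with h' | h'
    · rw [h', this b a h']
    · rw [h, h']

theorem hilbertSymbol_eq_one_of_add_eq_sq {a b c : K} (h : a + b = c ^ 2) :
    hilbertSymbol a b = 1 :=
  hilbertSymbol_eq_one_iff.2 ⟨1, 1, c, by simp, by rw [← h]; ring⟩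

theorem hilbertSymbol_self_neg (a : K) : hilbertSymbol a (-a) = 1 :=
  hilbertSymbol_eq_one_of_add_eq_sq (c := 0) (by ring)

theorem hilbertSymbol_one_sub (a : K) : hilbertSymbol a (1 - a) = 1 :=
  hilbertSymbol_eq_one_of_add_eq_sq (c := 1) (by ring)

theorem hilbertSymbol_isSquare_left {a : K} (h : IsSquare a) (b : K) : hilbertSymbol a b = 1 := by
  obtain ⟨s, rfl⟩ := h
  exact hilbertSymbol_eq_one_iff.2 ⟨1, 0, s, by simp, by ring⟩

theorem hilbertSymbol_isSquare_right (a : K) {b : K} (h : IsSquare b) : hilbertSymbol a b = 1 := by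
  rw [hilbertSymbol_comm, hilbertSymbol_isSquare_left h]

@[simp] theorem hilbertSymbol_one_left (b : K) : hilbertSymbol 1 b = 1 :=
  hilbertSymbol_isSquare_left ⟨1, by simp⟩ b

@[simp] theorem hilbertSymbol_one_right (a : K) : hilbertSymbol a 1 = 1 :=
  hilbertSymbol_isSquare_right a ⟨1, by simp⟩

/-- Dividing a solution by y exhibits b as a norm from K(√a); a solution with y = 0 forces a to be a
square. In this form the multiplicative structure becomes visible. -/
theorem hilbertSymbol_eq_one_iff_norm {a b : K} : hilbertSymbol a b = 1 ↔
    IsSquare a ∨ ∃ z x : K, b = z ^ 2 - a * x ^ 2 := by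
  constructor
  · intro h
    obtain ⟨x, y, z, h0, h⟩ := hilbertSymbol_eq_one_iff.1 h
    by_cases hy : y = 0
    · left
      subst hy
      have hx : x ≠ 0 := by
        rintro rfl
        have : z = 0 := by simpa using h
        simp [this] at h0
      refine ⟨z / x, ?_⟩
      field_simp
      linear_combination -h
    · right
      refine ⟨z / y, x / y, ?_⟩
      field_simp
      linear_combination -h
  · rintro (h | ⟨z, x, h⟩)
    · exact hilbertSymbol_isSquare_left h b
    · exact hilbertSymbol_eq_one_iff.2 ⟨x, 1, z, by simp, by rw [h]; ring⟩

/-- Norms from K(√a) are closed under products, by Brahmagupta's identity. -/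
theorem hilbertSymbol_mul_eq_one {a b c : K} (h : hilbertSymbol a b = 1) (h' : hilbertSymbol a c = 1) : hilbertSymbol a (b * c) = 1 := by
  rw [hilbertSymbol_eq_one_iff_norm] at h h' ⊢
  rcases h with h | ⟨z, x, h⟩
  · exact Or.inl h
  rcases h' with h' | ⟨w, v, h'⟩
  · exact Or.inl h'
  exact Or.inr ⟨z * w + a * x * v, z * v + x * w, by rw [h, h']; ring⟩

theorem hilbertSymbol_mul_sq_right (a b : K) {c : K} (hc : c ≠ 0) :
    hilbertSymbol a (b * c ^ 2) = hilbertSymbol a b := by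
  have : ∀ {b c : K}, c ≠ 0 → hilbertSymbol a b = 1 → hilbertSymbol a (b * c ^ 2) = 1 := by
    intro b c hc h
    obtain ⟨x, y, z, h0, h⟩ := hilbertSymbol_eq_one_iff.1 h
    refine hilbertSymbol_eq_one_iff.2 ⟨x, y / c, z, ?_, ?_⟩
    · simpa [hc] using h0
    · rw [h]; field_simp
  have h2 : b = b * c ^ 2 * c⁻¹ ^ 2 := by field_simp
  rcases Int.units_eq_one_or (hilbertSymbol a b) with h | h
  · rw [h, this hc h]
  · rcases Int.units_eq_one_or (hilbertSymbol a (b * c ^ 2)) with h' | h'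
    · have := this (inv_ne_zero hc) h'
      rw [← h2] at this
      rw [h', this]
    · rw [h, h']

theorem hilbertSymbol_mul_of_eq_one {a b m : K} (hm : m ≠ 0)
    (h : hilbertSymbol a m = 1) : hilbertSymbol a (b * m) = hilbertSymbol a b := by
  rcases Int.units_eq_one_or (hilbertSymbol a b) with h' | h'
  · rw [h', hilbertSymbol_mul_eq_one h' h]
  · rcases Int.units_eq_one_or (hilbertSymbol a (b * m)) with h'' | h''
    · have := hilbertSymbol_mul_eq_one h'' h
      rw [mul_assoc, ← sq, hilbertSymbol_mul_sq_right a b hm] at this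
      rw [this, h'']
    · rw [h', h'']

/-- A field whose Hilbert symbol is bimultiplicative; by symmetry multiplicativity in the second
variable is enough. -/
class HilbertBimultiplicative (K : Type*) [Field K] : Prop where
  mul_right : ∀ a b c : K, a ≠ 0 → b ≠ 0 → c ≠ 0 →
    hilbertSymbol a (b * c) = hilbertSymbol a b * hilbertSymbol a c

/-- It suffices that each norm group has index at most two. -/
theorem HilbertBimultiplicative.of_index_two
    (H : ∀ a b c : K, a ≠ 0 → b ≠ 0 → c ≠ 0 → hilbertSymbol a b ≠ 1 → hilbertSymbol a c ≠ 1 →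
      hilbertSymbol a (b * c) = 1) : HilbertBimultiplicative K where
  mul_right a b c ha hb hc := by
    rcases Int.units_eq_one_or (hilbertSymbol a c) with h | h
    · rw [hilbertSymbol_mul_of_eq_one hc h, h, mul_one]
    rcases Int.units_eq_one_or (hilbertSymbol a b) with h' | h'
    · rw [mul_comm b c, hilbertSymbol_mul_of_eq_one hb h', h', one_mul]
    · rw [H a b c ha hb hc (by rw [h']; decide) (by rw [h]; decide), h, h']; decide

theorem hilbertSymbol_inv_right (a : K) {b : K} (hb : b ≠ 0) :
    hilbertSymbol a b⁻¹ = hilbertSymbol a b := by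
  rw [← hilbertSymbol_mul_sq_right a b⁻¹ hb]
  congr 1
  field_simp

theorem hilbertSymbol_inv_left {a : K} (ha : a ≠ 0) (b : K) :
    hilbertSymbol a⁻¹ b = hilbertSymbol a b := by
  rw [hilbertSymbol_comm, hilbertSymbol_inv_right b ha, hilbertSymbol_comm]

variable [HilbertBimultiplicative K]

theorem hilbertSymbol_mul_right {a b c : K} (ha : a ≠ 0) (hb : b ≠ 0) (hc : c ≠ 0) :
    hilbertSymbol a (b * c) = hilbertSymbol a b * hilbertSymbol a c :=
  HilbertBimultiplicative.mul_right a b c ha hb hc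

theorem hilbertSymbol_mul_left {a b c : K} (ha : a ≠ 0) (hb : b ≠ 0) (hc : c ≠ 0) :
    hilbertSymbol (a * b) c = hilbertSymbol a c * hilbertSymbol b c := by
  rw [hilbertSymbol_comm, hilbertSymbol_mul_right hc ha hb, hilbertSymbol_comm c a,
    hilbertSymbol_comm c b]

theorem hilbertSymbol_neg_left {a b : K} (ha : a ≠ 0) (hb : b ≠ 0) :
    hilbertSymbol (-a) b = hilbertSymbol (-1) b * hilbertSymbol a b := by
  rw [← neg_one_mul a, hilbertSymbol_mul_left (by simp) ha hb]

theorem hilbertSymbol_neg_right {a b : K} (ha : a ≠ 0) (hb : b ≠ 0) :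
    hilbertSymbol a (-b) = hilbertSymbol a (-1) * hilbertSymbol a b := by
  rw [← neg_one_mul b, hilbertSymbol_mul_right ha (by simp) hb]

theorem hilbertSymbol_self {a : K} (ha : a ≠ 0) : hilbertSymbol a a = hilbertSymbol a (-1) := by
  have h := hilbertSymbol_self_neg a
  rw [hilbertSymbol_neg_right ha ha] at h
  exact (mul_eq_one_iff_eq_inv.1 h).symm ▸ by simp

end HilbertField

/-! ### The real Hilbert symbol -/

theorem hilbertSymbol_real (a : ℝ) {b : ℝ} (hb : b ≠ 0) :
    hilbertSymbol a b = if a < 0 ∧ b < 0 then -1 else 1 := by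
  split_ifs with h
  · refine (Int.units_eq_one_or _).resolve_left fun h1 => ?_
    obtain ⟨x, y, z, h0, h1⟩ := hilbertSymbol_eq_one_iff.1 h1
    have hx : x = 0 := by
      by_contra hx
      nlinarith [sq_pos_of_ne_zero hx, sq_nonneg y, sq_nonneg z,
        mul_pos_of_neg_of_neg h.1 (neg_lt_zero.2 (sq_pos_of_ne_zero hx)),
        mul_nonneg (neg_nonneg.2 h.2.le) (sq_nonneg y)]
    have hy : y = 0 := by
      by_contra hy
      nlinarith [sq_pos_of_ne_zero hy, sq_nonneg z, sq_nonneg x,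
        mul_pos_of_neg_of_neg h.2 (neg_lt_zero.2 (sq_pos_of_ne_zero hy)),
        mul_nonneg (neg_nonneg.2 h.1.le) (sq_nonneg x)]
    have hz : z = 0 := by simpa [hx, hy] using h1
    simp [hx, hy, hz] at h0
  · by_cases ha' : a < 0
    · have : 0 < b := by
        rcases lt_or_gt_of_ne hb with hb | hb
        · exact absurd ⟨ha', hb⟩ h
        · exact hb
      exact hilbertSymbol_isSquare_right a ⟨√b, (Real.mul_self_sqrt this.le).symm⟩
    · exact hilbertSymbol_isSquare_left ⟨√a, (Real.mul_self_sqrt (not_lt.1 ha')).symm⟩ b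

instance : HilbertBimultiplicative ℝ := by
  refine .of_index_two fun a b c ha hb hc h h' => ?_
  rw [hilbertSymbol_real _ hb] at h
  rw [hilbertSymbol_real _ hc] at h'
  have h : a < 0 ∧ b < 0 := by by_contra h1; simp [h1] at h
  have h' : a < 0 ∧ c < 0 := by by_contra h1; simp [h1] at h'
  have : 0 < b * c := mul_pos_of_neg_of_neg h.2 h'.2
  exact hilbertSymbol_isSquare_right a ⟨√(b * c), (Real.mul_self_sqrt this.le).symm⟩

/-! ### The `p`-adic Hilbert symbol -/

section Padic

variable {p : ℕ} [hp : Fact p.Prime]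

theorem norm_four_le_one : ‖(4 : ℚ_[p])‖ ≤ 1 := by
  exact_mod_cast Padic.norm_int_le_one (p := p) 4

theorem norm_four_of_ne_two (h2 : p ≠ 2) : ‖(4 : ℚ_[p])‖ = 1 := by
  have : Nat.Coprime p 4 := by
    rw [show 4 = 2 ^ 2 by norm_num]
    exact ((Nat.coprime_primes hp.out Nat.prime_two).2 h2).pow_right 2
  exact_mod_cast Padic.norm_natCast_eq_one_iff.2 this

/-- Hensel's lemma for X² - x at the point 1, where the derivative is 2 and |2|² = |4|. Measuring
against |4| treats all primes at once: the condition is x ≡ 1 modulo p for odd p and modulo 8 for p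
= 2. -/
theorem isSquare_of_norm_sub_one_lt {x : ℚ_[p]} (hx : ‖x - 1‖ < ‖(4 : ℚ_[p])‖) : IsSquare x := by
  have hx1 : ‖x‖ ≤ 1 := by
    have := Padic.nonarchimedean (x - 1) 1
    rw [sub_add_cancel] at this
    exact this.trans (max_le (hx.le.trans norm_four_le_one) (by simp))
  obtain ⟨x', rfl⟩ : ∃ x' : ℤ_[p], (x' : ℚ_[p]) = x := ⟨⟨x, hx1⟩, rfl⟩
  have := hensels_lemma (p := p) (F := (Polynomial.X ^ 2 - Polynomial.C x' : Polynomial ℤ_[p]))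
    (a := 1) (by
      have h1 : (Polynomial.aeval (1 : ℤ_[p])) (Polynomial.X ^ 2 - Polynomial.C x') = 1 - x' := by
        simp
      have h2 : (Polynomial.aeval (1 : ℤ_[p])) (Polynomial.derivative (Polynomial.X ^ 2 -
          Polynomial.C x')) = 2 := by simp; norm_num
      rw [h1, h2, ← norm_pow, norm_sub_rev, PadicInt.norm_def, PadicInt.norm_def]
      have h3 : (((2 : ℤ_[p]) ^ 2 : ℤ_[p]) : ℚ_[p]) = 4 := by
        rw [PadicInt.coe_pow, ← Nat.cast_ofNat (n := 2), PadicInt.coe_natCast]; norm_num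
      rw [h3]
      exact_mod_cast hx)
  obtain ⟨z, hz, -⟩ := this
  refine ⟨z, ?_⟩
  have hz : z ^ 2 - x' = 0 := by simpa using hz
  have hz := congrArg (fun t : ℤ_[p] => (t : ℚ_[p])) hz
  simp only [PadicInt.coe_sub, PadicInt.coe_pow, PadicInt.coe_zero] at hz
  linear_combination -hz

theorem exists_unit_mul_zpow {x : ℚ_[p]} (hx : x ≠ 0) :
    ∃ u : ℚ_[p], ‖u‖ = 1 ∧ x = u * (p : ℚ_[p]) ^ x.valuation := by
  have hp0 : (p : ℚ_[p]) ≠ 0 := by exact_mod_cast hp.out.ne_zero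
  have hp0' : (p : ℝ) ≠ 0 := by exact_mod_cast hp.out.ne_zero
  refine ⟨x * (p : ℚ_[p]) ^ (-x.valuation), ?_, ?_⟩
  · rw [norm_mul, Padic.norm_eq_zpow_neg_valuation hx, Padic.norm_p_zpow, ← zpow_add₀ hp0']
    simp
  · rw [mul_assoc, ← zpow_add₀ hp0]
    simp

theorem exists_unit_mul_sq {x : ℚ_[p]} (hx : x ≠ 0) (h : Even x.valuation) :
    ∃ u s : ℚ_[p], ‖u‖ = 1 ∧ s ≠ 0 ∧ x = u * s ^ 2 := by
  have hp0 : (p : ℚ_[p]) ≠ 0 := by exact_mod_cast hp.out.ne_zero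
  obtain ⟨u, hu, h1⟩ := exists_unit_mul_zpow hx
  obtain ⟨m, hm⟩ := h
  refine ⟨u, (p : ℚ_[p]) ^ m, hu, zpow_ne_zero _ hp0, ?_⟩
  rw [sq, ← zpow_add₀ hp0, ← hm]
  exact h1

theorem valuation_eq_zero_of_norm_eq_one {u : ℚ_[p]} (hu : ‖u‖ = 1) : u.valuation = 0 := by
  have hu0 : u ≠ 0 := by rintro rfl; simp at hu
  have hp1 : (1 : ℝ) < p := by exact_mod_cast hp.out.one_lt
  rw [Padic.norm_eq_zpow_neg_valuation hu0, zpow_eq_one_iff_right₀ (by positivity) hp1.ne'] at hu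
  omega

theorem ne_zero_of_norm_eq_one {u : ℚ_[p]} (hu : ‖u‖ = 1) : u ≠ 0 := by
  rintro rfl; simp at hu

theorem norm_eq_one_of_norm_sub_one_lt {u : ℚ_[p]} (hu : ‖u - 1‖ < 1) : ‖u‖ = 1 := by
  have := Padic.norm_eq_of_norm_sub_lt_right (z1 := u) (z2 := 1) (by simpa using hu)
  simpa using this

/-- Squares modulo `p` lift when `p` is odd. -/
theorem isSquare_of_toZMod (h2 : p ≠ 2) {u : ℤ_[p]} (hu : ‖u‖ = 1)
    (h : IsSquare (PadicInt.toZMod u)) : IsSquare (u : ℚ_[p]) := by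
  obtain ⟨s, hs⟩ := h
  obtain ⟨t, rfl⟩ := ZMod.ringHom_surjective (PadicInt.toZMod (p := p)) s
  have hker : ∀ x : ℤ_[p], PadicInt.toZMod x = 0 ↔ ‖x‖ < 1 := by
    intro x
    rw [← RingHom.mem_ker, PadicInt.ker_toZMod, IsLocalRing.mem_maximalIdeal,
      PadicInt.mem_nonunits]
  have ht : ‖t‖ = 1 := by
    by_contra ht
    have ht := lt_of_le_of_ne (PadicInt.norm_le_one t) ht
    rw [(hker t).2 ht, mul_zero, hker] at hs
    exact hs.ne hu
  have h1 : ‖u - t * t‖ < 1 := by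
    rw [← hker, map_sub, map_mul, hs, sub_self]
  have ht0 : (t : ℚ_[p]) ≠ 0 := ne_zero_of_norm_eq_one (by rw [← PadicInt.norm_def, ht])
  -- The quotient by the square of a lifted root is congruent to 1, where Hensel applies.
  have : IsSquare ((u : ℚ_[p]) / (t * t)) := by
    apply isSquare_of_norm_sub_one_lt
    rw [norm_four_of_ne_two h2, div_sub_one (mul_ne_zero ht0 ht0), norm_div, norm_mul,
      ← PadicInt.norm_def, ht, mul_one, div_one]
    rw [PadicInt.norm_def] at h1
    exact_mod_cast h1
  obtain ⟨w, hw⟩ := this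
  refine ⟨w * t, ?_⟩
  field_simp at hw
  linear_combination hw

theorem toZMod_eq_zero_iff {x : ℤ_[p]} : PadicInt.toZMod x = 0 ↔ ‖x‖ < 1 := by
  rw [← RingHom.mem_ker, PadicInt.ker_toZMod, IsLocalRing.mem_maximalIdeal,
    PadicInt.mem_nonunits]

/-- Over the residue field a nondegenerate binary form u x² + v y² represents 1. Any lift of the
solution makes u x² + v y² ≡ 1 modulo p, hence a square. -/
theorem hilbertSymbol_units_of_ne_two (h2 : p ≠ 2) {u v : ℚ_[p]} (hu : ‖u‖ = 1) (hv : ‖v‖ = 1) :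
    hilbertSymbol u v = 1 := by
  set u' : ℤ_[p] := ⟨u, hu.le⟩
  set v' : ℤ_[p] := ⟨v, hv.le⟩
  have hu' : PadicInt.toZMod u' ≠ 0 := fun h => (toZMod_eq_zero_iff.1 h).ne hu
  have hv' : PadicInt.toZMod v' ≠ 0 := fun h => (toZMod_eq_zero_iff.1 h).ne hv
  have hodd : Fintype.card (ZMod p) % 2 = 1 := by
    rw [ZMod.card]; exact (hp.out.eq_two_or_odd).resolve_left h2
  obtain ⟨a, b, hab⟩ := FiniteField.exists_root_sum_quadratic
    (f := Polynomial.C (PadicInt.toZMod u') * Polynomial.X ^ 2)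
    (g := Polynomial.C (PadicInt.toZMod v') * Polynomial.X ^ 2 - 1)
    (by simpa using Polynomial.degree_C_mul_X_pow 2 hu')
    (by
      rw [Polynomial.degree_sub_eq_left_of_degree_lt]
      · simpa using Polynomial.degree_C_mul_X_pow 2 hv'
      · rw [Polynomial.degree_C_mul_X_pow 2 hv', Polynomial.degree_one]; norm_num) hodd
  obtain ⟨x, rfl⟩ := ZMod.ringHom_surjective (PadicInt.toZMod (p := p)) a
  obtain ⟨y, rfl⟩ := ZMod.ringHom_surjective (PadicInt.toZMod (p := p)) b
  have h0 : PadicInt.toZMod (u' * x ^ 2 + v' * y ^ 2) = 1 := by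
    simp at hab
    simp only [map_add, map_mul, map_pow]
    linear_combination hab
  have hn : ‖u' * x ^ 2 + v' * y ^ 2‖ = 1 := by
    by_contra hn
    have := toZMod_eq_zero_iff.2 (lt_of_le_of_ne (PadicInt.norm_le_one _) hn)
    rw [h0] at this
    exact one_ne_zero this
  obtain ⟨z, hz⟩ := isSquare_of_toZMod h2 hn (by rw [h0]; exact IsSquare.one)
  refine hilbertSymbol_eq_one_iff.2 ⟨x, y, z, ?_, ?_⟩
  · by_contra! hcon
    rw [PadicInt.coe_eq_zero, PadicInt.coe_eq_zero] at hcon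
    rw [hcon.1, hcon.2.1] at h0
    simp at h0
  · rw [sq, ← hz]
    push_cast
    rfl

end Padic

/-! ### Units and squares in ℚ₂ -/

section Two

theorem norm_two_eq : ‖(2 : ℚ_[2])‖ = 2⁻¹ := by simpa using Padic.norm_p (p := 2)

theorem norm_four_eq : ‖(4 : ℚ_[2])‖ = 4⁻¹ := by
  rw [show (4 : ℚ_[2]) = 2 * 2 by norm_num, norm_mul, norm_two_eq]; norm_num

theorem norm_lt_one_iff_two {x : ℚ_[2]} : ‖x‖ < 1 ↔ ‖x‖ ≤ 2⁻¹ := by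
  simpa using Padic.norm_lt_pow_iff_norm_le_pow_sub_one x 0

theorem norm_add_units_two {a b : ℚ_[2]} (ha : ‖a‖ = 1) (hb : ‖b‖ = 1) : ‖a + b‖ < 1 := by
  obtain ⟨a, rfl⟩ : ∃ x : ℤ_[2], (x : ℚ_[2]) = a := ⟨⟨a, ha.le⟩, rfl⟩
  obtain ⟨b, rfl⟩ : ∃ x : ℤ_[2], (x : ℚ_[2]) = b := ⟨⟨b, hb.le⟩, rfl⟩
  rw [← PadicInt.norm_def] at ha hb
  have ha' : PadicInt.toZMod a ≠ 0 := fun h => (toZMod_eq_zero_iff.1 h).ne ha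
  have hb' : PadicInt.toZMod b ≠ 0 := fun h => (toZMod_eq_zero_iff.1 h).ne hb
  have key : ∀ a b : ZMod 2, a ≠ 0 → b ≠ 0 → a + b = 0 := by decide
  have := key _ _ ha' hb'
  rw [← map_add] at this
  simpa [PadicInt.norm_def] using toZMod_eq_zero_iff.1 this

/-- If `u ≡ 1` modulo `4` but not modulo `8` and similarly `v`, then `uv` is a square. -/
theorem isSquare_mul_of_norm_sub_one_le {u v : ℚ_[2]} (hu : ‖u - 1‖ ≤ ‖(4 : ℚ_[2])‖)
    (hv : ‖v - 1‖ ≤ ‖(4 : ℚ_[2])‖) (hu' : ¬ IsSquare u) (hv' : ¬ IsSquare v) :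
    IsSquare (u * v) := by
  have h4 : ‖(4 : ℚ_[2])‖ = 4⁻¹ := norm_four_eq
  have hu2 : ‖u - 1‖ = ‖(4 : ℚ_[2])‖ :=
    le_antisymm hu (not_lt.1 fun h => hu' (isSquare_of_norm_sub_one_lt h))
  have hv2 : ‖v - 1‖ = ‖(4 : ℚ_[2])‖ :=
    le_antisymm hv (not_lt.1 fun h => hv' (isSquare_of_norm_sub_one_lt h))
  have hu1 : ‖u‖ = 1 := norm_eq_one_of_norm_sub_one_lt (by rw [hu2, h4]; norm_num)
  have h0 : (4 : ℚ_[2]) ≠ 0 := by norm_num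
  have h1 : ‖u * ((v - 1) / 4) + (u - 1) / 4‖ < 1 := by
    apply norm_add_units_two
    · rw [norm_mul, hu1, norm_div, hv2, div_self (by rw [h4]; norm_num), one_mul]
    · rw [norm_div, hu2, div_self (by rw [h4]; norm_num)]
  apply isSquare_of_norm_sub_one_lt
  rw [show u * v - 1 = 4 * (u * ((v - 1) / 4) + (u - 1) / 4) by field_simp; ring, norm_mul]
  exact mul_lt_of_lt_one_right (by rw [h4]; norm_num) h1

/-- A nonsquare u ≡ 1 modulo 4 is 1 + 4·(unit). Adding 4v, with v a unit, makes it ≡ 1 modulo 8,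
hence a square, and this solves z² = u + v·2². -/
theorem hilbertSymbol_units_two {u v : ℚ_[2]} (hu : ‖u - 1‖ ≤ ‖(4 : ℚ_[2])‖) (hv : ‖v‖ = 1) :
    hilbertSymbol u v = 1 := by
  by_cases hs : IsSquare u
  · exact hilbertSymbol_isSquare_left hs v
  have h4 : ‖(4 : ℚ_[2])‖ = 4⁻¹ := norm_four_eq
  have hu2 : ‖u - 1‖ = ‖(4 : ℚ_[2])‖ :=
    le_antisymm hu (not_lt.1 fun h => hs (isSquare_of_norm_sub_one_lt h))
  have h1 : ‖(u - 1) / 4 + v‖ < 1 := by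
    apply norm_add_units_two _ hv
    rw [norm_div, hu2, div_self (by rw [h4]; norm_num)]
  obtain ⟨z, hz⟩ : IsSquare (u + v * 2 ^ 2) := by
    apply isSquare_of_norm_sub_one_lt
    rw [show u + v * 2 ^ 2 - 1 = 4 * ((u - 1) / 4 + v) by field_simp; ring, norm_mul]
    exact mul_lt_of_lt_one_right (by rw [h4]; norm_num) h1
  rw [← hilbertSymbol_mul_sq_right u v (two_ne_zero)]
  exact hilbertSymbol_eq_one_of_add_eq_sq (c := z) (by rw [hz, sq])

theorem norm_sub_one_or_add_one {u : ℚ_[2]} (hu : ‖u‖ = 1) :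
    ‖u - 1‖ ≤ ‖(4 : ℚ_[2])‖ ∨ ‖-u - 1‖ ≤ ‖(4 : ℚ_[2])‖ := by
  have h4 : ‖(4 : ℚ_[2])‖ = 4⁻¹ := norm_four_eq
  have h2 : ‖(2 : ℚ_[2])‖ = 2⁻¹ := norm_two_eq
  by_cases h : ‖(u - 1) / 2‖ < 1
  · left
    rw [norm_lt_one_iff_two, norm_div, h2, div_inv_eq_mul] at h
    rw [h4]; linarith
  · right
    have h1 : ‖u - 1‖ < 1 := by
      rw [sub_eq_add_neg]; exact norm_add_units_two hu (by simp)
    rw [norm_lt_one_iff_two] at h1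
    have h3 : ‖(u - 1) / 2‖ = 1 := by
      apply le_antisymm _ (not_lt.1 h)
      rw [norm_div, h2, div_inv_eq_mul]; linarith
    have := norm_add_units_two h3 (b := 1) (by simp)
    rw [norm_lt_one_iff_two, show (u - 1) / 2 + 1 = -(-u - 1) / 2 by ring, norm_div, norm_neg, h2,
      div_inv_eq_mul] at this
    rw [h4]; linarith

end Two

/-! ### Norm groups of index at most two, and bimultiplicativity over ℚ_p -/

section Padic

variable {p : ℕ} [hp : Fact p.Prime]

theorem hilbertSymbol_units {u v : ℚ_[p]} (hu : ‖u‖ = 1) (hu4 : ‖u - 1‖ ≤ ‖(4 : ℚ_[p])‖)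
    (hv : ‖v‖ = 1) : hilbertSymbol u v = 1 := by
  rcases eq_or_ne p 2 with rfl | h2
  · exact hilbertSymbol_units_two hu4 hv
  · exact hilbertSymbol_units_of_ne_two h2 hu hv

theorem hilbertSymbol_eq_one_of_even {u v : ℚ_[p]} (hu : ‖u‖ = 1)
    (hu4 : ‖u - 1‖ ≤ ‖(4 : ℚ_[p])‖) (hv0 : v ≠ 0) (hv : Even v.valuation) :
    hilbertSymbol u v = 1 := by
  obtain ⟨w, s, hw, hs, rfl⟩ := exists_unit_mul_sq hv0 hv
  rw [hilbertSymbol_mul_sq_right u w hs, hilbertSymbol_units hu hu4 hw]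

/-- Squares have index at most two among the units congruent to 1 modulo 4: for odd p this is the
quadratic character of the residue field, for p = 2 it is the group {1, 5} modulo 8. -/
theorem isSquare_mul_units {u v : ℚ_[p]} (hu : ‖u‖ = 1) (hv : ‖v‖ = 1)
    (hu4 : ‖u - 1‖ ≤ ‖(4 : ℚ_[p])‖) (hv4 : ‖v - 1‖ ≤ ‖(4 : ℚ_[p])‖)
    (hu' : ¬ IsSquare u) (hv' : ¬ IsSquare v) : IsSquare (u * v) := by
  rcases eq_or_ne p 2 with rfl | h2
  · exact isSquare_mul_of_norm_sub_one_le hu4 hv4 hu' hv'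
  obtain ⟨u, rfl⟩ : ∃ x : ℤ_[p], (x : ℚ_[p]) = u := ⟨⟨u, hu.le⟩, rfl⟩
  obtain ⟨v, rfl⟩ : ∃ x : ℤ_[p], (x : ℚ_[p]) = v := ⟨⟨v, hv.le⟩, rfl⟩
  rw [← PadicInt.norm_def] at hu hv
  have h1 : ¬ IsSquare (PadicInt.toZMod u) := fun h => hu' (isSquare_of_toZMod h2 hu h)
  have h2' : ¬ IsSquare (PadicInt.toZMod v) := fun h => hv' (isSquare_of_toZMod h2 hv h)
  have := isSquare_of_toZMod h2 (u := u * v) (by rw [norm_mul, hu, hv, one_mul]) (by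
    rw [map_mul]
    rw [← quadraticChar_neg_one_iff_not_isSquare] at h1 h2'
    rw [← quadraticChar_one_iff_isSquare, map_mul, h1, h2']
    · norm_num
    · intro h0
      rcases mul_eq_zero.1 h0 with h | h
      · simp [h] at h1
      · simp [h] at h2')
  exact_mod_cast this

/-- Once some m of odd valuation is a norm, every class modulo squares and m is represented by a
unit, so only units need to be tested. -/
theorem index_two_of_units {a m : ℚ_[p]} (hm : m ≠ 0) (hm' : Odd m.valuation)
    (ham : hilbertSymbol a m = 1)
    (H : ∀ b c : ℚ_[p], ‖b‖ = 1 → ‖c‖ = 1 → hilbertSymbol a b ≠ 1 → hilbertSymbol a c ≠ 1 →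
      hilbertSymbol a (b * c) = 1) (b c : ℚ_[p]) (hb : b ≠ 0) (hc : c ≠ 0)
    (hab : hilbertSymbol a b ≠ 1) (hac : hilbertSymbol a c ≠ 1) :
    hilbertSymbol a (b * c) = 1 := by
  have key : ∀ b : ℚ_[p], b ≠ 0 → ∃ u t : ℚ_[p], ‖u‖ = 1 ∧ t ≠ 0 ∧ hilbertSymbol a t = 1 ∧
      b = u * t := by
    intro b hb
    rcases Int.even_or_odd b.valuation with h | h
    · obtain ⟨u, s, hu, hs, rfl⟩ := exists_unit_mul_sq hb h
      exact ⟨u, s ^ 2, hu, pow_ne_zero 2 hs,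
        hilbertSymbol_isSquare_right a ⟨s, sq s⟩, rfl⟩
    · obtain ⟨u, s, hu, hs, h1⟩ := exists_unit_mul_sq (mul_ne_zero hb (inv_ne_zero hm)) (by
        rw [Padic.valuation_mul hb (inv_ne_zero hm), Padic.valuation_inv]
        exact h.add_odd hm'.neg)
      refine ⟨u, m * s ^ 2, hu, mul_ne_zero hm (pow_ne_zero 2 hs), ?_, ?_⟩
      · rw [hilbertSymbol_mul_sq_right a m hs, ham]
      · rw [mul_left_comm, ← h1]; field_simp
  obtain ⟨u, t, hu, ht, hat, rfl⟩ := key b hb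
  obtain ⟨v, s, hv, hs, has, rfl⟩ := key c hc
  have hu0 := ne_zero_of_norm_eq_one hu
  have hv0 := ne_zero_of_norm_eq_one hv
  rw [hilbertSymbol_mul_of_eq_one ht hat] at hab
  rw [hilbertSymbol_mul_of_eq_one hs has] at hac
  rw [mul_mul_mul_comm]
  exact hilbertSymbol_mul_eq_one (H u v hu hv hab hac)
    (hilbertSymbol_mul_eq_one hat has)

/-- Here -a itself is a norm of odd valuation, so units suffice. The unit norm m moves every unit
into the class 1 modulo 4, where two nonsquares multiply to a square. -/
theorem index_two_of_odd {a m : ℚ_[p]} (ha : a ≠ 0) (ha' : Odd a.valuation)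
    (hm : ‖m‖ = 1) (ham : hilbertSymbol a m = 1)
    (H : ∀ b : ℚ_[p], ‖b‖ = 1 → ‖b - 1‖ ≤ ‖(4 : ℚ_[p])‖ ∨ ‖b * m - 1‖ ≤ ‖(4 : ℚ_[p])‖)
    (b c : ℚ_[p]) (hb : b ≠ 0) (hc : c ≠ 0) (hab : hilbertSymbol a b ≠ 1)
    (hac : hilbertSymbol a c ≠ 1) : hilbertSymbol a (b * c) = 1 := by
  -- The relation (a, -a) = 1 supplies the norm of odd valuation.
  refine index_two_of_units (neg_ne_zero.2 ha) (by
    rw [← neg_one_mul, Padic.valuation_mul (by simp) ha,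
      valuation_eq_zero_of_norm_eq_one (by simp), zero_add]; exact ha')
    (hilbertSymbol_self_neg a) ?_ b c hb hc hab hac
  clear hab hac hb hc b c
  have hm0 := ne_zero_of_norm_eq_one hm
  have key : ∀ b : ℚ_[p], ‖b‖ = 1 → ∃ t : ℚ_[p], ‖t‖ = 1 ∧ hilbertSymbol a t = 1 ∧
      ‖b * t - 1‖ ≤ ‖(4 : ℚ_[p])‖ := by
    intro b hb
    rcases H b hb with h | h
    · exact ⟨1, by simp, by simp, by simpa using h⟩
    · exact ⟨m, hm, ham, h⟩
  intro b c hb hc hab hac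
  obtain ⟨t, ht, hat, hbt⟩ := key b hb
  obtain ⟨s, hs, has, hcs⟩ := key c hc
  have hb0 := ne_zero_of_norm_eq_one hb
  have hc0 := ne_zero_of_norm_eq_one hc
  have ht0 := ne_zero_of_norm_eq_one ht
  have hs0 := ne_zero_of_norm_eq_one hs
  have h1 := isSquare_mul_units (by rw [norm_mul, hb, ht, one_mul])
    (by rw [norm_mul, hc, hs, one_mul]) hbt hcs
    (fun h => hab (by rw [← hilbertSymbol_mul_of_eq_one ht0 hat,
      hilbertSymbol_isSquare_right a h]))
    (fun h => hac (by rw [← hilbertSymbol_mul_of_eq_one hs0 has,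
      hilbertSymbol_isSquare_right a h]))
  rw [mul_mul_mul_comm] at h1
  rw [← hilbertSymbol_mul_of_eq_one (mul_ne_zero ht0 hs0)
    (hilbertSymbol_mul_eq_one hat has), hilbertSymbol_isSquare_right a h1]

theorem hilbertSymbol_mul_sq_left {K : Type*} [Field K] (a b : K) {c : K} (hc : c ≠ 0) :
    hilbertSymbol (a * c ^ 2) b = hilbertSymbol a b := by
  rw [hilbertSymbol_comm, hilbertSymbol_mul_sq_right b a hc, hilbertSymbol_comm]

theorem exists_prime_mul_unit_mul_sq {x : ℚ_[p]} (hx : x ≠ 0) (h : Odd x.valuation) :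
    ∃ u s : ℚ_[p], ‖u‖ = 1 ∧ s ≠ 0 ∧ x = p * u * s ^ 2 := by
  have hp0 : (p : ℚ_[p]) ≠ 0 := by exact_mod_cast hp.out.ne_zero
  obtain ⟨u, s, hu, hs, h1⟩ := exists_unit_mul_sq (mul_ne_zero hx (inv_ne_zero hp0)) (by
    rw [Padic.valuation_mul hx (inv_ne_zero hp0), Padic.valuation_inv, Padic.valuation_p]
    exact h.add_odd (by decide))
  refine ⟨u, s, hu, hs, ?_⟩
  rw [mul_assoc, ← h1]; field_simp

theorem valuation_prime_mul_unit {u : ℚ_[p]} (hu : ‖u‖ = 1) : (p * u : ℚ_[p]).valuation = 1 := by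
  have hp0 : (p : ℚ_[p]) ≠ 0 := by exact_mod_cast hp.out.ne_zero
  rw [Padic.valuation_mul hp0 (ne_zero_of_norm_eq_one hu), Padic.valuation_p,
    valuation_eq_zero_of_norm_eq_one hu, add_zero]

theorem norm_two_mul_unit_sub_one {a : ℚ_[2]} (ha : ‖a - 1‖ ≤ ‖(4 : ℚ_[2])‖ ) {b : ℚ_[2]}
    (hb : ‖b - 1‖ ≤ ‖(4 : ℚ_[2])‖) : ‖a * b - 1‖ ≤ ‖(4 : ℚ_[2])‖ := by
  have hb1 : ‖b‖ = 1 := norm_eq_one_of_norm_sub_one_lt (hb.trans_lt (by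
    rw [norm_four_eq]; norm_num))
  rw [show a * b - 1 = (a - 1) * b + (b - 1) by ring]
  refine (Padic.nonarchimedean _ _).trans (max_le ?_ hb)
  rwa [norm_mul, hb1, mul_one]

/-- Modulo squares there are three cases. If a is a unit ≡ 1 modulo 4, elements of even valuation
have symbol 1. If a is a unit ≡ 3 modulo 4, which happens only for p = 2, then 1 - a is a norm of
valuation one. If a has odd valuation, then -a is a norm, and for p = 2 the unit norm 1 - a ≡ -1
modulo 4 handles the units ≡ 3. -/
instance padicHilbert_bimultiplicative : HilbertBimultiplicative ℚ_[p] := by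
  refine .of_index_two fun a b c ha hb hc hab hac => ?_
  rcases Int.even_or_odd a.valuation with hv | hv
  · obtain ⟨a, s, ha1, hs, rfl⟩ := exists_unit_mul_sq ha hv
    rw [hilbertSymbol_mul_sq_left a _ hs] at hab hac ⊢
    by_cases ha4 : ‖a - 1‖ ≤ ‖(4 : ℚ_[p])‖
    · have key : ∀ b, b ≠ 0 → hilbertSymbol a b ≠ 1 → Odd b.valuation := fun b hb h => by
        by_contra h'
        exact h (hilbertSymbol_eq_one_of_even ha1 ha4 hb (Int.not_odd_iff_even.1 h'))
      apply hilbertSymbol_eq_one_of_even ha1 ha4 (mul_ne_zero hb hc)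
      rw [Padic.valuation_mul hb hc]
      exact (key b hb hab).add_odd (key c hc hac)
    · obtain rfl : p = 2 := by
        by_contra h2
        rw [norm_four_of_ne_two h2] at ha4
        apply ha4
        rw [sub_eq_add_neg]
        exact (Padic.nonarchimedean _ _).trans (by simp [ha1])
      have ha4' := (norm_sub_one_or_add_one ha1).resolve_left ha4
      have h2 : ‖1 - a‖ = ‖(2 : ℚ_[2])‖ := by
        have h22 : ‖(2 : ℚ_[2])‖ = 2⁻¹ := norm_two_eq
        have := Padic.norm_eq_of_norm_sub_lt_right (z1 := 1 - a) (z2 := 2) (by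
          rw [show 1 - a - 2 = -a - 1 by ring]
          refine ha4'.trans_lt ?_
          rw [norm_four_eq, norm_two_eq]; norm_num)
        exact this
      have h0 : 1 - a ≠ 0 := by
        intro h
        rw [h, norm_two_eq] at h2
        norm_num at h2
      have hval : (1 - a).valuation = 1 := by
        rw [Padic.norm_eq_zpow_neg_valuation h0, norm_two_eq] at h2
        have h3 : ((2 : ℕ) : ℝ) ^ (-(1 - a).valuation) = ((2 : ℕ) : ℝ) ^ (-1 : ℤ) := by
          rw [h2]; norm_num
        have := zpow_right_injective₀ (by norm_num) (by norm_num) h3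
        omega
      -- The relation (a, 1 - a) = 1 makes 1 - a a uniformizing norm.
      refine index_two_of_units h0 (by rw [hval]; decide) (hilbertSymbol_one_sub a) ?_ b c hb hc
        hab hac
      intro b c hb hc hab hac
      have key : ∀ b : ℚ_[2], ‖b‖ = 1 → hilbertSymbol a b ≠ 1 → ‖-b - 1‖ ≤ ‖(4 : ℚ_[2])‖ := by
        intro b hb h
        refine (norm_sub_one_or_add_one hb).resolve_left fun h' => h ?_
        rw [hilbertSymbol_comm, hilbertSymbol_units hb h' ha1]
      have := norm_two_mul_unit_sub_one (key b hb hab) (key c hc hac)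
      rw [neg_mul_neg] at this
      rw [hilbertSymbol_comm, hilbertSymbol_units (by rw [norm_mul, hb, hc, one_mul]) this ha1]
  · obtain ⟨a, s, ha1, hs, rfl⟩ := exists_prime_mul_unit_mul_sq ha hv
    rw [hilbertSymbol_mul_sq_left _ _ hs] at hab hac ⊢
    have hp0 : (p : ℚ_[p]) ≠ 0 := by exact_mod_cast hp.out.ne_zero
    have h0 := mul_ne_zero hp0 (ne_zero_of_norm_eq_one ha1)
    have hodd : Odd (p * a : ℚ_[p]).valuation := by
      rw [valuation_prime_mul_unit ha1]; decide
    rcases eq_or_ne p 2 with rfl | h2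
    · have h1 : ‖((2 : ℕ) : ℚ_[2]) * a‖ < 1 := by
        rw [norm_mul, ha1, mul_one]; exact Padic.norm_p_lt_one
      have hn : ‖1 - ((2 : ℕ) : ℚ_[2]) * a‖ = 1 :=
        norm_eq_one_of_norm_sub_one_lt (by rwa [sub_sub_cancel_left, norm_neg])
      refine index_two_of_odd h0 hodd hn (hilbertSymbol_one_sub _) ?_ b c hb hc hab hac
      intro b hb
      rcases norm_sub_one_or_add_one hb with h | h
      · exact Or.inl h
      right
      have h3 : ‖-(1 - ((2 : ℕ) : ℚ_[2]) * a) - 1‖ ≤ ‖(4 : ℚ_[2])‖ := by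
        have h4 := norm_add_units_two ha1 (b := -1) (by simp)
        rw [norm_lt_one_iff_two] at h4
        rw [show -(1 - ((2 : ℕ) : ℚ_[2]) * a) - 1 = 2 * (a + -1) by push_cast; ring, norm_mul,
          norm_two_eq, norm_four_eq]
        linarith
      have := norm_two_mul_unit_sub_one h h3
      rwa [neg_mul_neg] at this
    · refine index_two_of_odd h0 hodd (m := 1) (by simp) (by simp) ?_ b c hb hc hab hac
      intro b hb
      left
      rw [norm_four_of_ne_two h2, sub_eq_add_neg]
      exact (Padic.nonarchimedean _ _).trans (by simp [hb])

/-! ### Nontrivial values -/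

theorem exists_primitive_solution {a b : ℚ_[p]} (h : hilbertSymbol a b = 1) :
    ∃ x y z : ℤ_[p], (‖x‖ = 1 ∨ ‖y‖ = 1 ∨ ‖z‖ = 1) ∧
      (z : ℚ_[p]) ^ 2 = a * (x : ℚ_[p]) ^ 2 + b * (y : ℚ_[p]) ^ 2 := by
  obtain ⟨x, y, z, h0, h⟩ := hilbertSymbol_eq_one_iff.1 h
  obtain ⟨t, ht0, hx, hy, hz, ht⟩ : ∃ t : ℚ_[p], t ≠ 0 ∧ ‖x‖ ≤ ‖t‖ ∧ ‖y‖ ≤ ‖t‖ ∧ ‖z‖ ≤ ‖t‖ ∧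
      (‖x‖ = ‖t‖ ∨ ‖y‖ = ‖t‖ ∨ ‖z‖ = ‖t‖) := by
    have hne : ∀ t : ℚ_[p], ‖x‖ ≤ ‖t‖ → ‖y‖ ≤ ‖t‖ → ‖z‖ ≤ ‖t‖ → t ≠ 0 := by
      rintro t hx hy hz rfl
      simp at hx hy hz
      simp [hx, hy, hz] at h0
    rcases le_total ‖x‖ ‖y‖ with h1 | h1
    · rcases le_total ‖y‖ ‖z‖ with h2 | h2
      · exact ⟨z, hne z (h1.trans h2) h2 le_rfl, h1.trans h2, h2, le_rfl, by tauto⟩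
      · exact ⟨y, hne y h1 le_rfl h2, h1, le_rfl, h2, by tauto⟩
    · rcases le_total ‖x‖ ‖z‖ with h2 | h2
      · exact ⟨z, hne z h2 (h1.trans h2) le_rfl, h2, h1.trans h2, le_rfl, by tauto⟩
      · exact ⟨x, hne x le_rfl h1 h2, le_rfl, h1, h2, by tauto⟩
  have ht' : 0 < ‖t‖ := norm_pos_iff.2 ht0
  refine ⟨⟨x / t, by rwa [norm_div, div_le_one ht']⟩, ⟨y / t, by rwa [norm_div, div_le_one ht']⟩,
    ⟨z / t, by rwa [norm_div, div_le_one ht']⟩, ?_, ?_⟩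
  · change ‖x / t‖ = 1 ∨ ‖y / t‖ = 1 ∨ ‖z / t‖ = 1
    simpa only [norm_div, div_eq_one_iff_eq ht'.ne'] using ht
  · change (z / t) ^ 2 = a * (x / t) ^ 2 + b * (y / t) ^ 2
    field_simp
    exact h

/-- Reduce a primitive solution of z² = u x² + p y² modulo p. If p ∤ x then u is a square modulo p;
if p ∣ x then p divides z and then y, contradicting primitivity. -/
theorem hilbertSymbol_unit_prime {u : ℤ_[p]}
    (h : ¬ IsSquare (PadicInt.toZMod u)) : hilbertSymbol (u : ℚ_[p]) p = -1 := by
  refine (Int.units_eq_one_or _).resolve_left fun h1 => ?_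
  obtain ⟨x, y, z, h0, h1⟩ := exists_primitive_solution h1
  have h1 : z ^ 2 = u * x ^ 2 + p * y ^ 2 := Subtype.ext (by push_cast; exact h1)
  have hmod := congrArg PadicInt.toZMod h1
  simp only [map_pow, map_add, map_mul, map_natCast, CharP.cast_eq_zero, zero_mul, add_zero]
    at hmod
  by_cases hx : PadicInt.toZMod x = 0
  · have hz : PadicInt.toZMod z = 0 := by simpa [hx] using hmod
    rw [toZMod_eq_zero_iff] at hx hz
    obtain ⟨x', rfl⟩ := (PadicInt.norm_lt_one_iff_dvd x).1 hx
    obtain ⟨z', rfl⟩ := (PadicInt.norm_lt_one_iff_dvd z).1 hz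
    have hp0 : (p : ℤ_[p]) ≠ 0 := by exact_mod_cast hp.out.ne_zero
    have hy : (p : ℤ_[p]) ∣ y ^ 2 := ⟨z' ^ 2 - u * x' ^ 2, mul_left_cancel₀ hp0 (by
      linear_combination -h1)⟩
    have hy := PadicInt.prime_p.dvd_of_dvd_pow hy
    rw [← PadicInt.norm_lt_one_iff_dvd] at hy
    rcases h0 with h0 | h0 | h0 <;> linarith
  · apply h
    refine ⟨PadicInt.toZMod z / PadicInt.toZMod x, ?_⟩
    field_simp
    exact hmod.symm

end Padic

theorem norm_lt_one_of_toZModPow {x : ℤ_[2]} (h : 4 * PadicInt.toZModPow (p := 2) 3 x = 0) :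
    ‖x‖ < 1 := by
  have : PadicInt.toZModPow (p := 2) 3 (4 * x) = 0 := by
    rw [map_mul, map_ofNat]; exact h
  rw [← RingHom.mem_ker, PadicInt.ker_toZModPow, Ideal.mem_span_singleton] at this
  obtain ⟨c, hc⟩ := this
  rw [PadicInt.norm_lt_one_iff_dvd]
  refine ⟨c, mul_left_cancel₀ (show (4 : ℤ_[2]) ≠ 0 by norm_num) ?_⟩
  rw [hc]; push_cast; ring

/-- A primitive solution has an odd coordinate, so a check in ℤ/8 decides the symbol; the equation
4x = 0 in ℤ/8 expresses that x is even. -/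
theorem hilbertSymbol_two_eq_neg_one {a b : ℤ}
    (h : ∀ x y z : ZMod 8, z ^ 2 = a * x ^ 2 + b * y ^ 2 → 4 * x = 0 ∧ 4 * y = 0 ∧ 4 * z = 0) :
    hilbertSymbol (a : ℚ_[2]) b = -1 := by
  refine (Int.units_eq_one_or _).resolve_left fun h1 => ?_
  obtain ⟨x, y, z, h0, h1⟩ := exists_primitive_solution h1
  have h1 : z ^ 2 = a * x ^ 2 + b * y ^ 2 := Subtype.ext (by push_cast; exact h1)
  have hmod := congrArg (PadicInt.toZModPow (p := 2) 3) h1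
  simp only [map_pow, map_add, map_mul, map_intCast] at hmod
  obtain ⟨hx, hy, hz⟩ := h _ _ _ hmod
  have hx := norm_lt_one_of_toZModPow hx
  have hy := norm_lt_one_of_toZModPow hy
  have hz := norm_lt_one_of_toZModPow hz
  rcases h0 with h0 | h0 | h0 <;> linarith

theorem hilbertSymbol_two_neg_one_neg_one : hilbertSymbol (-1 : ℚ_[2]) (-1) = -1 := by
  have := hilbertSymbol_two_eq_neg_one (a := -1) (b := -1) (by decide)
  simpa using this

theorem hilbertSymbol_two_two_five : hilbertSymbol (2 : ℚ_[2]) 5 = -1 := by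
  have := hilbertSymbol_two_eq_neg_one (a := 2) (b := 5) (by decide)
  simpa using this

/-! ### The product formula -/

theorem eventually_norm_rat_le_one (q : ℚ) :
    ∀ᶠ p : Nat.Primes in cofinite, ‖(q : ℚ_[p])‖ ≤ 1 := by
  have hfin : {p : Nat.Primes | (p : ℕ) ∣ q.den}.Finite := by
    refine Set.Finite.of_finite_image (f := fun p : Nat.Primes => (p : ℕ)) ?_
      (fun _ _ _ _ h => Nat.Primes.coe_nat_injective h)
    refine (Set.finite_Iic q.den).subset ?_
    rintro _ ⟨p, hp, rfl⟩
    exact Nat.le_of_dvd q.den_pos hp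
  rw [Filter.eventually_cofinite]
  exact hfin.subset fun p hp => by
    by_contra hd
    exact hp (Padic.norm_rat_le_one hd)

theorem eventually_norm_rat_eq_one {q : ℚ} (hq : q ≠ 0) :
    ∀ᶠ p : Nat.Primes in cofinite, ‖(q : ℚ_[p])‖ = 1 := by
  filter_upwards [eventually_norm_rat_le_one q, eventually_norm_rat_le_one q⁻¹] with p h1 h2
  apply le_antisymm h1
  rw [Rat.cast_inv, norm_inv] at h2
  have h0 : 0 < ‖(q : ℚ_[p])‖ := norm_pos_iff.2 (by exact_mod_cast hq)
  exact (inv_le_one₀ h0).1 h2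

theorem eventually_ne_two : ∀ᶠ p : Nat.Primes in cofinite, (p : ℕ) ≠ 2 := by
  rw [Filter.eventually_cofinite]
  refine (Set.finite_singleton (⟨2, Nat.prime_two⟩ : Nat.Primes)).subset ?_
  intro p hp
  exact Subtype.ext (not_not.1 hp)

theorem finite_mulSupport_hilbert {a b : ℚ} (ha : a ≠ 0) (hb : b ≠ 0) :
    (Function.mulSupport fun p : Nat.Primes => hilbertSymbol (a : ℚ_[p]) (b : ℚ_[p])).Finite := by
  have : ∀ᶠ p : Nat.Primes in cofinite, hilbertSymbol (a : ℚ_[p]) (b : ℚ_[p]) = 1 := by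
    filter_upwards [eventually_norm_rat_eq_one ha, eventually_norm_rat_eq_one hb,
      eventually_ne_two] with p h1 h2 h3
    exact hilbertSymbol_units_of_ne_two h3 h1 h2
  exact Filter.eventually_cofinite.1 this

/-- The product of the local Hilbert symbols of two rational numbers. -/
noncomputable def globalHilbert (a b : ℚ) : ℤˣ :=
  hilbertSymbol (a : ℝ) (b : ℝ) * ∏ᶠ p : Nat.Primes, hilbertSymbol (a : ℚ_[p]) (b : ℚ_[p])

theorem globalHilbert_comm (a b : ℚ) : globalHilbert a b = globalHilbert b a := by
  unfold globalHilbert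
  rw [hilbertSymbol_comm]
  congr 2
  ext p : 1
  rw [hilbertSymbol_comm]

theorem globalHilbert_mul_left {a b c : ℚ} (ha : a ≠ 0) (hb : b ≠ 0) (hc : c ≠ 0) :
    globalHilbert (a * b) c = globalHilbert a c * globalHilbert b c := by
  unfold globalHilbert
  have : ∀ p : Nat.Primes, hilbertSymbol ((a * b : ℚ) : ℚ_[p]) (c : ℚ_[p]) =
      hilbertSymbol (a : ℚ_[p]) (c : ℚ_[p]) * hilbertSymbol (b : ℚ_[p]) (c : ℚ_[p]) := by
    intro p
    rw [Rat.cast_mul, hilbertSymbol_mul_left] <;> exact_mod_cast ‹_›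
  simp_rw [this]
  rw [finprod_mul_distrib (finite_mulSupport_hilbert ha hc) (finite_mulSupport_hilbert hb hc),
    Rat.cast_mul, hilbertSymbol_mul_left (by exact_mod_cast ha) (by exact_mod_cast hb)
      (by exact_mod_cast hc)]
  exact mul_mul_mul_comm _ _ _ _

theorem globalHilbert_inv_left {a : ℚ} (ha : a ≠ 0) (b : ℚ) :
    globalHilbert a⁻¹ b = globalHilbert a b := by
  unfold globalHilbert
  have : ∀ p : Nat.Primes, hilbertSymbol ((a⁻¹ : ℚ) : ℚ_[p]) (b : ℚ_[p]) =
      hilbertSymbol (a : ℚ_[p]) (b : ℚ_[p]) := by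
    intro p
    rw [Rat.cast_inv, hilbertSymbol_inv_left]
    exact_mod_cast ha
  simp_rw [this]
  rw [Rat.cast_inv, hilbertSymbol_inv_left (by exact_mod_cast ha)]

theorem globalHilbert_self {a : ℚ} (ha : a ≠ 0) : globalHilbert a a = globalHilbert a (-1) := by
  unfold globalHilbert
  have : ∀ p : Nat.Primes, hilbertSymbol (a : ℚ_[p]) (a : ℚ_[p]) =
      hilbertSymbol (a : ℚ_[p]) ((-1 : ℚ) : ℚ_[p]) := by
    intro p
    rw [Rat.cast_neg, Rat.cast_one, hilbertSymbol_self]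
    exact_mod_cast ha
  simp_rw [this]
  rw [hilbertSymbol_self (by exact_mod_cast ha)]
  simp

/-- The group ℚˣ is generated by -1 and the primes, so the product formula only has to be verified
on these. -/
theorem rat_mul_induction {P : ℚ → Prop} (neg_one : P (-1)) (prime : ∀ p : ℕ, p.Prime → P p)
    (mul : ∀ a b, a ≠ 0 → b ≠ 0 → P a → P b → P (a * b))
    (inv : ∀ a, a ≠ 0 → P a → P a⁻¹) {a : ℚ} (ha : a ≠ 0) : P a := by
  have one : P 1 := by simpa using mul (-1) (-1) (by simp) (by simp) neg_one neg_one
  have nat : ∀ n : ℕ, n ≠ 0 → P n := by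
    intro n
    induction n using Nat.recOnMul with
    | zero => simp
    | one => intro _; simpa using one
    | prime p hp => exact fun _ => prime p hp
    | mul m n hm hn =>
      intro h
      have hm0 : m ≠ 0 := by rintro rfl; simp at h
      have hn0 : n ≠ 0 := by rintro rfl; simp at h
      rw [Nat.cast_mul]
      exact mul _ _ (by exact_mod_cast hm0) (by exact_mod_cast hn0) (hm hm0) (hn hn0)
  have int : ∀ n : ℤ, n ≠ 0 → P n := by
    intro n hn
    rcases Int.natAbs_eq n with h | h
    · rw [h, Int.cast_natCast]; exact nat _ (Int.natAbs_ne_zero.2 hn)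
    · rw [h, Int.cast_neg, Int.cast_natCast]
      have h0 : ((n.natAbs : ℚ)) ≠ 0 := by exact_mod_cast Int.natAbs_ne_zero.2 hn
      have := mul (-1) n.natAbs (by simp) h0 neg_one (nat _ (Int.natAbs_ne_zero.2 hn))
      rwa [neg_one_mul] at this
  rw [← Rat.num_div_den a, div_eq_mul_inv]
  have hd : ((a.den : ℚ)) ≠ 0 := by exact_mod_cast a.den_nz
  exact mul _ _ (by exact_mod_cast Rat.num_ne_zero.2 ha) (inv_ne_zero hd)
    (int _ (Rat.num_ne_zero.2 ha)) (inv _ hd (nat _ a.den_nz))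

theorem hilbertSymbol_int_of_not_dvd {p : ℕ} [Fact p.Prime] (h2 : p ≠ 2) {a b : ℤ}
    (ha : ¬ (p : ℤ) ∣ a) (hb : ¬ (p : ℤ) ∣ b) : hilbertSymbol (a : ℚ_[p]) (b : ℚ_[p]) = 1 := by
  apply hilbertSymbol_units_of_ne_two h2
  · exact le_antisymm (Padic.norm_int_le_one a) (not_lt.1 (Padic.norm_intCast_lt_one_iff.not.2 ha))
  · exact le_antisymm (Padic.norm_int_le_one b) (not_lt.1 (Padic.norm_intCast_lt_one_iff.not.2 hb))

theorem globalHilbert_eq_prod {a b : ℤ} (s : Finset Nat.Primes) (h2 : two ∈ s)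
    (h : ∀ p : Nat.Primes, p ∉ s → ¬ ((p : ℕ) : ℤ) ∣ a ∧ ¬ ((p : ℕ) : ℤ) ∣ b) :
    globalHilbert a b = hilbertSymbol (a : ℝ) (b : ℝ) *
      ∏ p ∈ s, hilbertSymbol (a : ℚ_[p]) (b : ℚ_[p]) := by
  unfold globalHilbert
  rw [finprod_eq_prod_of_mulSupport_subset (s := s)]
  · simp only [Rat.cast_intCast]
  · intro p hp
    by_contra hps
    apply hp
    have := h p hps
    simp only [Rat.cast_intCast]
    refine hilbertSymbol_int_of_not_dvd ?_ this.1 this.2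
    intro h0
    exact hps ((Subtype.ext h0 : p = two) ▸ h2)

theorem norm_int_sub_one_le_four {n : ℤ} (h : n % 4 = 1) :
    ‖(n : ℚ_[2]) - 1‖ ≤ ‖(4 : ℚ_[2])‖ := by
  have := (Padic.norm_int_le_pow_iff_dvd (p := 2) (n - 1) 2).2 (by norm_num; omega)
  rw [norm_four_eq]
  push_cast at this
  norm_num at this ⊢
  exact this

theorem isSquare_int_two {n : ℤ} (h : n % 8 = 1) : IsSquare (n : ℚ_[2]) := by
  apply isSquare_of_norm_sub_one_lt
  have := (Padic.norm_int_le_pow_iff_dvd (p := 2) (n - 1) 3).2 (by norm_num; omega)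
  rw [norm_four_eq]
  push_cast at this
  refine this.trans_lt ?_
  norm_num

theorem norm_int_two {n : ℤ} (h : n % 2 = 1) : ‖(n : ℚ_[2])‖ = 1 :=
  le_antisymm (Padic.norm_int_le_one n) (not_lt.1 (Padic.norm_intCast_lt_one_iff.not.2
    (by push_cast; omega)))

theorem hilbertSymbol_two_odd {m n : ℤ} (hm : m % 4 = 1) (hn : n % 2 = 1) :
    hilbertSymbol (m : ℚ_[2]) n = 1 :=
  hilbertSymbol_units_two (norm_int_sub_one_le_four hm) (norm_int_two hn)

theorem hilbertSymbol_two_odd_odd {m n : ℤ} (hm : m % 4 = 3) (hn : n % 4 = 3) :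
    hilbertSymbol (m : ℚ_[2]) n = -1 := by
  have hm0 : (m : ℚ_[2]) ≠ 0 := by exact_mod_cast (by omega : m ≠ 0)
  have hn0 : (n : ℚ_[2]) ≠ 0 := by exact_mod_cast (by omega : n ≠ 0)
  have h1 := hilbertSymbol_two_odd (m := -m) (n := n) (by omega) (by omega)
  have h2 := hilbertSymbol_two_odd (m := -n) (n := -1) (by omega) (by omega)
  push_cast at h1 h2
  rw [hilbertSymbol_neg_left hm0 hn0] at h1
  rw [hilbertSymbol_neg_left hn0 (by simp), hilbertSymbol_two_neg_one_neg_one,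
    hilbertSymbol_comm] at h2
  have h2 : hilbertSymbol (-1 : ℚ_[2]) n = -1 := by
    rcases Int.units_eq_one_or (hilbertSymbol (-1 : ℚ_[2]) n) with h | h
    · rw [h] at h2; exact absurd h2 (by decide)
    · exact h
  rw [h2] at h1
  rcases Int.units_eq_one_or (hilbertSymbol (m : ℚ_[2]) n) with h | h
  · rw [h] at h1; exact absurd h1 (by decide)
  · exact h

theorem hilbertSymbol_two_two {n : ℤ} (hn : n % 2 = 1) :
    hilbertSymbol (2 : ℚ_[2]) n = if n % 8 = 1 ∨ n % 8 = 7 then 1 else -1 := by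
  have hn0 : (n : ℚ_[2]) ≠ 0 := by exact_mod_cast (by omega : n ≠ 0)
  have hneg : hilbertSymbol (2 : ℚ_[2]) (-1) = 1 :=
    hilbertSymbol_eq_one_of_add_eq_sq (c := 1) (by norm_num)
  have h8 : n % 8 = 1 ∨ n % 8 = 3 ∨ n % 8 = 5 ∨ n % 8 = 7 := by omega
  have h5 : ∀ n : ℤ, n % 8 = 5 → hilbertSymbol (2 : ℚ_[2]) n = -1 := by
    intro n hn
    have hn0 : (n : ℚ_[2]) ≠ 0 := by exact_mod_cast (by omega : n ≠ 0)
    have hs := isSquare_int_two (n := 5 * n) (by omega)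
    have := hilbertSymbol_isSquare_right (2 : ℚ_[2]) hs
    push_cast at this
    rw [hilbertSymbol_mul_right (by norm_num) (by norm_num) hn0, hilbertSymbol_two_two_five] at this
    rcases Int.units_eq_one_or (hilbertSymbol (2 : ℚ_[2]) n) with h | h
    · rw [h] at this; exact absurd this (by decide)
    · exact h
  have hflip : hilbertSymbol (2 : ℚ_[2]) ((-n : ℤ) : ℚ_[2]) = hilbertSymbol (2 : ℚ_[2]) n := by
    push_cast
    rw [hilbertSymbol_neg_right (by norm_num) hn0, hneg, one_mul]
  rcases h8 with h | h | h | h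
  · rw [if_pos (Or.inl h), hilbertSymbol_isSquare_right _ (isSquare_int_two h)]
  · rw [if_neg (by omega), ← hflip, h5 _ (by omega)]
  · rw [if_neg (by omega), h5 _ (by omega)]
  · rw [if_pos (Or.inr h), ← hflip, hilbertSymbol_isSquare_right _ (isSquare_int_two (by omega))]

theorem hilbertSymbol_int_prime {p : ℕ} [hp : Fact p.Prime] (h2 : p ≠ 2) {n : ℤ}
    (hn : ¬ (p : ℤ) ∣ n) :
    ((hilbertSymbol (n : ℚ_[p]) p : ℤˣ) : ℤ) = legendreSym p n := by
  have hn' : (n : ZMod p) ≠ 0 := by rwa [Ne, ZMod.intCast_zmod_eq_zero_iff_dvd]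
  have hc : PadicInt.toZMod (n : ℤ_[p]) = (n : ZMod p) := map_intCast _ n
  by_cases h : IsSquare (n : ZMod p)
  · rw [(legendreSym.eq_one_iff p hn').2 h, hilbertSymbol_isSquare_left]
    · simp
    · have hu : ‖(n : ℤ_[p])‖ = 1 := by
        refine le_antisymm (PadicInt.norm_le_one _) (not_lt.1 ?_)
        rwa [PadicInt.norm_int_lt_one_iff_dvd]
      exact_mod_cast isSquare_of_toZMod h2 hu (by rwa [hc])
  · rw [(legendreSym.eq_neg_one_iff p).2 h]
    have := hilbertSymbol_unit_prime (p := p) (u := (n : ℤ_[p])) (by rwa [hc])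
    rw [PadicInt.coe_intCast] at this
    rw [this]; simp

theorem hilbertSymbol_real_pos_right (a : ℝ) {b : ℝ} (hb : 0 < b) : hilbertSymbol a b = 1 := by
  rw [hilbertSymbol_real a hb.ne', if_neg (by intro h; linarith [h.2])]

theorem globalHilbert_neg_one_neg_one : globalHilbert (-1) (-1) = 1 := by
  have := globalHilbert_eq_prod (a := -1) (b := -1) {two} (by simp) (by
    intro p hp
    have h : ¬ ((p : ℕ) : ℤ) ∣ -1 := by
      rw [dvd_neg]; exact_mod_cast p.2.prime.not_dvd_one
    exact ⟨h, h⟩)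
  simp only [Int.cast_neg, Int.cast_one, Finset.prod_singleton] at this
  rw [this, hilbertSymbol_real _ (by norm_num), if_pos (by norm_num)]
  have h2 : hilbertSymbol (-1 : ℚ_[two]) (-1) = -1 := hilbertSymbol_two_neg_one_neg_one
  rw [h2]; decide

theorem globalHilbert_neg_one_two : globalHilbert (-1) 2 = 1 := by
  unfold globalHilbert
  rw [hilbertSymbol_real_pos_right _ (by norm_num), one_mul]
  refine finprod_eq_one_of_forall_eq_one fun p => hilbertSymbol_eq_one_of_add_eq_sq (c := 1) ?_
  push_cast; norm_num

theorem not_dvd_of_ne {p q : Nat.Primes} (h : p ≠ q) : ¬ ((p : ℕ) : ℤ) ∣ ((q : ℕ) : ℤ) := by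
  rw [Int.natCast_dvd_natCast, Nat.prime_dvd_prime_iff_eq p.2 q.2]
  exact fun h' => h (Subtype.ext h')

theorem globalHilbert_int_prime {n : ℤ} {q : Nat.Primes} (hq : (q : ℕ) ≠ 2)
    (h : ∀ p : Nat.Primes, p ≠ two → p ≠ q → ¬ ((p : ℕ) : ℤ) ∣ n) (hn : ¬ ((q : ℕ) : ℤ) ∣ n) :
    ((globalHilbert n q : ℤˣ) : ℤ) =
      (hilbertSymbol (n : ℚ_[2]) (q : ℕ) : ℤˣ) * legendreSym q n := by
  have hne : two ≠ q := fun h' => hq (by rw [← h'])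
  have := globalHilbert_eq_prod (a := n) (b := (q : ℕ)) {two, q} (by simp) (by
    intro p hp
    simp only [Finset.mem_insert, Finset.mem_singleton, not_or] at hp
    exact ⟨h p hp.1 hp.2, not_dvd_of_ne hp.2⟩)
  rw [Finset.prod_pair hne, Int.cast_natCast, Int.cast_natCast, Int.cast_natCast,
    Int.cast_natCast, hilbertSymbol_real_pos_right _ (by exact_mod_cast q.2.pos), one_mul] at this
  rw [this, Units.val_mul, hilbertSymbol_int_prime hq hn]

theorem globalHilbert_neg_one_prime (q : Nat.Primes) : globalHilbert (-1) q = 1 := by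
  by_cases hq : (q : ℕ) = 2
  · rw [hq]; exact globalHilbert_neg_one_two
  have hodd := (q.2.eq_two_or_odd).resolve_left hq
  have h := globalHilbert_int_prime (n := -1) hq (fun p _ _ => by
    rw [dvd_neg]; exact_mod_cast p.2.prime.not_dvd_one) (by
    rw [dvd_neg]; exact_mod_cast q.2.prime.not_dvd_one)
  rw [legendreSym.at_neg_one hq] at h
  apply Units.ext
  push_cast at h
  rw [h]
  have hcases : (q : ℕ) % 4 = 1 ∨ (q : ℕ) % 4 = 3 := by omega
  rcases hcases with h4 | h4
  · have := hilbertSymbol_two_odd (m := (q : ℕ)) (n := -1) (by omega) (by norm_num)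
    push_cast at this
    rw [hilbertSymbol_comm, this, ZMod.χ₄_nat_one_mod_four h4]; simp
  · have := hilbertSymbol_two_odd_odd (m := (q : ℕ)) (n := -1) (by omega) (by norm_num)
    push_cast at this
    rw [hilbertSymbol_comm, this, ZMod.χ₄_nat_three_mod_four h4]; simp

theorem globalHilbert_two_prime (q : Nat.Primes) (hq : (q : ℕ) ≠ 2) : globalHilbert 2 q = 1 := by
  have hodd := (q.2.eq_two_or_odd).resolve_left hq
  have hne : q ≠ two := fun h' => hq (by rw [h'])
  have h := globalHilbert_int_prime (n := 2) hq (fun p hp _ => not_dvd_of_ne (q := two) hp)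
    (not_dvd_of_ne (q := two) hne)
  rw [legendreSym.at_two hq] at h
  apply Units.ext
  push_cast at h
  rw [h]
  have := hilbertSymbol_two_two (n := (q : ℕ)) (by omega)
  push_cast at this
  rw [this, ZMod.χ₈_nat_eq_if_mod_eight, if_neg (by omega : ¬ (q : ℕ) % 2 = 0)]
  by_cases h8 : (q : ℕ) % 8 = 1 ∨ (q : ℕ) % 8 = 7
  · rw [if_pos (by omega : ((q : ℕ) : ℤ) % 8 = 1 ∨ ((q : ℕ) : ℤ) % 8 = 7), if_pos h8]; simp
  · rw [if_neg (by omega : ¬ (((q : ℕ) : ℤ) % 8 = 1 ∨ ((q : ℕ) : ℤ) % 8 = 7)), if_neg h8]; simp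

/-- Only 2, p and q contribute. The symbols at p and q are Legendre symbols, the one at 2 is the
sign in quadratic reciprocity. -/
theorem globalHilbert_prime_prime (p q : Nat.Primes) (hp : (p : ℕ) ≠ 2) (hq : (q : ℕ) ≠ 2)
    (hpq : p ≠ q) : globalHilbert p q = 1 := by
  have hpodd := (p.2.eq_two_or_odd).resolve_left hp
  have hqodd := (q.2.eq_two_or_odd).resolve_left hq
  have hp2 : two ≠ p := fun h' => hp (by rw [← h'])
  have hq2 : two ≠ q := fun h' => hq (by rw [← h'])
  have key := globalHilbert_eq_prod (a := (p : ℕ)) (b := (q : ℕ)) {two, p, q} (by simp) (by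
    intro r hr
    simp only [Finset.mem_insert, Finset.mem_singleton, not_or] at hr
    exact ⟨not_dvd_of_ne hr.2.1, not_dvd_of_ne hr.2.2⟩)
  rw [Finset.prod_insert (by simp [hp2, hq2]), Finset.prod_pair hpq] at key
  simp only [Int.cast_natCast] at key
  rw [hilbertSymbol_real_pos_right _ (by exact_mod_cast q.2.pos), one_mul] at key
  have h1 := hilbertSymbol_int_prime (p := p) hp (n := (q : ℕ)) (not_dvd_of_ne hpq)
  have h2 := hilbertSymbol_int_prime (p := q) hq (n := (p : ℕ)) (not_dvd_of_ne hpq.symm)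
  rw [hilbertSymbol_comm] at h1
  rw [Int.cast_natCast] at h1 h2
  apply Units.ext
  rw [key, Units.val_mul, Units.val_mul, h1, h2]
  have hne : (p : ℕ) ≠ (q : ℕ) := fun h => hpq (Subtype.ext h)
  have hsq : legendreSym p (q : ℕ) * legendreSym p (q : ℕ) = 1 := by
    rw [← sq]
    exact legendreSym.sq_one p (by
      rw [Ne, ZMod.intCast_zmod_eq_zero_iff_dvd]; exact not_dvd_of_ne hpq)
  have hpc : (p : ℕ) % 4 = 1 ∨ (p : ℕ) % 4 = 3 := by omega
  have hqc : (q : ℕ) % 4 = 1 ∨ (q : ℕ) % 4 = 3 := by omega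
  rcases hpc with h4 | h4
  · have := hilbertSymbol_two_odd (m := (p : ℕ)) (n := (q : ℕ)) (by omega) (by omega)
    rw [Int.cast_natCast, Int.cast_natCast] at this
    rw [this, legendreSym.quadratic_reciprocity_one_mod_four h4 hq, hsq]; simp
  rcases hqc with h4' | h4'
  · have := hilbertSymbol_two_odd (m := (q : ℕ)) (n := (p : ℕ)) (by omega) (by omega)
    rw [Int.cast_natCast, Int.cast_natCast, hilbertSymbol_comm] at this
    rw [this, ← legendreSym.quadratic_reciprocity_one_mod_four h4' hp, hsq]; simp
  · have := hilbertSymbol_two_odd_odd (m := (p : ℕ)) (n := (q : ℕ)) (by omega) (by omega)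
    rw [Int.cast_natCast, Int.cast_natCast] at this
    rw [this, legendreSym.quadratic_reciprocity_three_mod_four h4 h4', mul_neg, hsq]; simp

/-- The product formula for the Hilbert symbols over `ℚ`. -/
theorem globalHilbert_eq_one {a b : ℚ} (ha : a ≠ 0) (hb : b ≠ 0) : globalHilbert a b = 1 := by
  have hmul : ∀ c : ℚ, c ≠ 0 → ∀ a b, a ≠ 0 → b ≠ 0 → globalHilbert a c = 1 →
      globalHilbert b c = 1 → globalHilbert (a * b) c = 1 := by
    intro c hc a b ha hb h h'
    rw [globalHilbert_mul_left ha hb hc, h, h', one_mul]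
  have hinv : ∀ c : ℚ, c ≠ 0 → ∀ a, a ≠ 0 → globalHilbert a c = 1 → globalHilbert a⁻¹ c = 1 := by
    intro c _ a ha h
    rw [globalHilbert_inv_left ha, h]
  have hneg : ∀ a : ℚ, a ≠ 0 → globalHilbert a (-1) = 1 := fun a ha =>
    rat_mul_induction (P := fun a => globalHilbert a (-1) = 1) globalHilbert_neg_one_neg_one
      (fun p hp => by rw [globalHilbert_comm]; exact globalHilbert_neg_one_prime ⟨p, hp⟩)
      (hmul _ (by norm_num)) (hinv _ (by norm_num)) ha
  have hprime : ∀ p q : Nat.Primes, globalHilbert p q = 1 := by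
    intro p q
    rcases eq_or_ne p q with rfl | hpq
    · have h0 : ((p : ℕ) : ℚ) ≠ 0 := by exact_mod_cast p.2.ne_zero
      rw [globalHilbert_self h0, hneg _ h0]
    by_cases hp : (p : ℕ) = 2
    · by_cases hq : (q : ℕ) = 2
      · exact absurd (Subtype.ext (hp.trans hq.symm)) hpq
      · rw [hp]; exact globalHilbert_two_prime q hq
    · by_cases hq : (q : ℕ) = 2
      · rw [globalHilbert_comm, hq]; exact globalHilbert_two_prime p hp
      · exact globalHilbert_prime_prime p q hp hq hpq
  refine rat_mul_induction (P := fun a => globalHilbert a b = 1) ?_ ?_ (hmul b hb) (hinv b hb) ha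
  · rw [globalHilbert_comm]; exact hneg b hb
  · intro p hp
    have hp0 : (p : ℚ) ≠ 0 := by exact_mod_cast hp.ne_zero
    rw [globalHilbert_comm]
    exact rat_mul_induction (P := fun b => globalHilbert b p = 1)
      (by rw [globalHilbert_comm]; exact hneg _ hp0)
      (fun q hq => hprime ⟨q, hq⟩ ⟨p, hp⟩) (hmul _ hp0) (hinv _ hp0) hb

/-! ### Kubota's cocycle -/

section Kubota

variable {K : Type*} [Field K]

theorem sign_mul_cancel_left (u v : ℤˣ) : u * (u * v) = v := by
  rw [← mul_assoc, Int.units_mul_self, one_mul]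

theorem SL2_det (g : SL(2, K)) : g 0 0 * g 1 1 - g 0 1 * g 1 0 = 1 := by
  have := g.det_coe
  rwa [Matrix.det_fin_two] at this

theorem SL2_mul_zero_zero (g h : SL(2, K)) : (g * h) 0 0 = g 0 0 * h 0 0 + g 0 1 * h 1 0 := by
  simp [Matrix.mul_apply, Fin.sum_univ_two]

theorem SL2_mul_zero_one (g h : SL(2, K)) : (g * h) 0 1 = g 0 0 * h 0 1 + g 0 1 * h 1 1 := by
  simp [Matrix.mul_apply, Fin.sum_univ_two]

theorem SL2_mul_one_zero (g h : SL(2, K)) : (g * h) 1 0 = g 1 0 * h 0 0 + g 1 1 * h 1 0 := by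
  simp [Matrix.mul_apply, Fin.sum_univ_two]

theorem SL2_mul_one_one (g h : SL(2, K)) : (g * h) 1 1 = g 1 0 * h 0 1 + g 1 1 * h 1 1 := by
  simp [Matrix.mul_apply, Fin.sum_univ_two]

theorem tau_of_ne_zero {g : SL(2, K)} (h : g 1 0 ≠ 0) : tau g = g 1 0 := if_pos h

theorem tau_of_eq_zero {g : SL(2, K)} (h : g 1 0 = 0) : tau g = g 1 1 := if_neg (by simpa using h)

theorem tau_ne_zero (g : SL(2, K)) : tau g ≠ 0 := by
  unfold tau
  split_ifs with h
  · exact h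
  · intro h'
    have := SL2_det g
    rw [not_not] at h
    simp [h, h'] at this

theorem tau_mul_of_left_upper {g : SL(2, K)} (hg : g 1 0 = 0) (h : SL(2, K)) :
    tau (g * h) = tau g * tau h := by
  have hg' := tau_ne_zero g
  rw [tau_of_eq_zero hg] at hg' ⊢
  by_cases hh : h 1 0 = 0
  · rw [tau_of_eq_zero hh, tau_of_eq_zero, SL2_mul_one_one, hg, zero_mul, zero_add]
    rw [SL2_mul_one_zero, hg, hh]; ring
  · have : (g * h) 1 0 = g 1 1 * h 1 0 := by rw [SL2_mul_one_zero, hg]; ring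
    rw [tau_of_ne_zero hh, tau_of_ne_zero (by rw [this]; exact mul_ne_zero hg' hh), this]

/-- Unlike for an upper triangular left factor, τ is multiplicative only up to a square, which
Hilbert symbols do not see. -/
theorem tau_mul_of_right_upper (g : SL(2, K)) {h : SL(2, K)} (hh : h 1 0 = 0) :
    ∃ s, s ≠ 0 ∧ tau (g * h) = tau g * tau h * (s * s) := by
  have hh' := tau_ne_zero h
  have hdet := SL2_det h
  rw [hh, mul_zero, sub_zero] at hdet
  rw [tau_of_eq_zero hh] at hh' ⊢
  by_cases hg : g 1 0 = 0
  · refine ⟨1, one_ne_zero, ?_⟩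
    rw [tau_mul_of_left_upper hg, tau_of_eq_zero hh]; ring
  · have h0 : h 0 0 ≠ 0 := left_ne_zero_of_mul_eq_one hdet
    have : (g * h) 1 0 = g 1 0 * h 0 0 := by rw [SL2_mul_one_zero, hh]; ring
    refine ⟨h 0 0, h0, ?_⟩
    rw [tau_of_ne_zero hg, tau_of_ne_zero (by rw [this]; exact mul_ne_zero hg h0), this]
    linear_combination -(g 1 0 * h 0 0) * hdet

/-- The part of Kubota's cocycle that does not involve `s`. -/
noncomputable def kubota (g h : SL(2, K)) : ℤˣ :=
  hilbertSymbol (tau (g * h) * tau g) (tau (g * h) * tau h)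

/-- With u = a_h/c_h + d_g/c_g the lower left entry of gh is c_g c_h u. When u = 0 the product is
upper triangular and the determinant of h gives its lower right entry -c_g/c_h. -/
theorem tau_mul_generic {g h : SL(2, K)} (hg : g 1 0 ≠ 0) (hh : h 1 0 ≠ 0) :
    tau (g * h) = g 1 0 * h 1 0 * (h 0 0 / h 1 0 + g 1 1 / g 1 0) ∧
      h 0 0 / h 1 0 + g 1 1 / g 1 0 ≠ 0 ∨
    tau (g * h) = -1 * g 1 0 * (h 1 0)⁻¹ ∧ h 0 0 / h 1 0 + g 1 1 / g 1 0 = 0 := by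
  have e : (g * h) 1 0 = g 1 0 * h 1 0 * (h 0 0 / h 1 0 + g 1 1 / g 1 0) := by
    rw [SL2_mul_one_zero]; field_simp
  by_cases hu : h 0 0 / h 1 0 + g 1 1 / g 1 0 = 0
  · refine Or.inr ⟨?_, hu⟩
    rw [hu, mul_zero] at e
    rw [tau_of_eq_zero e, SL2_mul_one_one]
    have hd := SL2_det h
    field_simp at hu ⊢
    linear_combination hu * h 1 1 - g 1 0 * hd
  · exact Or.inl ⟨by rw [tau_of_ne_zero (by rw [e]; exact mul_ne_zero (mul_ne_zero hg hh) hu), e],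
      hu⟩

variable [HilbertBimultiplicative K]

/-- After expansion by bimultiplicativity and (x, x) = (-1, x), the two sides differ exactly by (uv,
-w), which is 1 because uv - w is a square. -/
theorem kubota_generic {A B C u v w : K} (hA : A ≠ 0) (hB : B ≠ 0) (hC : C ≠ 0)
    (hu : u ≠ 0) (hv : v ≠ 0) (hw : w ≠ 0) (huv : u * v - w = B⁻¹ ^ 2) :
    hilbertSymbol (A * B * u * A) (A * B * u * B) *
      hilbertSymbol (A * B * C * w * (A * B * u)) (A * B * C * w * C) =
    hilbertSymbol (A * B * C * w * A) (A * B * C * w * (B * C * v)) *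
      hilbertSymbol (B * C * v * B) (B * C * v * C) := by
  -- The scalar -1 is kept as an opaque letter m, so that both sides become words in symbols of
  -- letters and can be compared in a group of exponent two.
  obtain ⟨m, hm⟩ : ∃ m : K, m = -1 := ⟨_, rfl⟩
  have hm0 : m ≠ 0 := by rw [hm]; simp
  have self : ∀ {x : K}, x ≠ 0 → hilbertSymbol x x = hilbertSymbol m x := by
    intro x hx; rw [hilbertSymbol_self hx, hm, hilbertSymbol_comm]
  have key : hilbertSymbol (u * v) (m * w) = 1 :=
    hilbertSymbol_eq_one_of_add_eq_sq (c := B⁻¹) (by rw [hm, ← huv]; ring)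
  rw [← mul_one (hilbertSymbol (B * C * v * B) (B * C * v * C)), ← key]
  simp only [hilbertSymbol_mul_left, hilbertSymbol_mul_right, ne_eq, mul_eq_zero, hA, hB, hC, hu,
    hv, hw, hm0, or_self, not_false_eq_true, self]
  simp only [hilbertSymbol_comm, mul_assoc, mul_comm, mul_left_comm, Int.units_mul_self,
    sign_mul_cancel_left, mul_one]

/-- If one of g, h, k is upper triangular, τ is multiplicative up to squares and expansion suffices.
Otherwise the three τ-values are products of c_g, c_h, c_k with u, v and uv - c_h⁻², and the only
relation needed beyond bimultiplicativity is the Steinberg relation of `kubota_generic`. The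
degenerate cases u = 0, v = 0 and uv = c_h⁻² are separate. -/
theorem kubota_cocycle (g h k : SL(2, K)) :
    kubota g h * kubota (g * h) k = kubota g (h * k) * kubota h k := by
  obtain ⟨m, hm⟩ : ∃ m : K, m = -1 := ⟨_, rfl⟩
  have hm0 : m ≠ 0 := by rw [hm]; simp
  have self : ∀ {x : K}, x ≠ 0 → hilbertSymbol x x = hilbertSymbol m x := by
    intro x hx; rw [hilbertSymbol_self hx, hm, hilbertSymbol_comm]
  have htg := tau_ne_zero g
  have hth := tau_ne_zero h
  have htk := tau_ne_zero k
  have htgh := tau_ne_zero (g * h)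
  have hthk := tau_ne_zero (h * k)
  have htghk := tau_ne_zero (g * h * k)
  unfold kubota
  rw [← mul_assoc g h k]
  by_cases hg : g 1 0 = 0
  · rw [mul_assoc g h k, tau_mul_of_left_upper hg, tau_mul_of_left_upper hg]
    simp only [hilbertSymbol_mul_left, hilbertSymbol_mul_right, ne_eq, mul_eq_zero, htg, hth, htk,
      hthk, or_self, not_false_eq_true, self]
    simp only [hilbertSymbol_comm, mul_assoc, mul_comm, mul_left_comm, Int.units_mul_self,
      sign_mul_cancel_left, mul_one]
  by_cases hk : k 1 0 = 0
  · obtain ⟨s, hs, h1⟩ := tau_mul_of_right_upper (g * h) hk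
    obtain ⟨t, ht, h2⟩ := tau_mul_of_right_upper h hk
    rw [h1, h2]
    simp only [hilbertSymbol_mul_left, hilbertSymbol_mul_right, ne_eq, mul_eq_zero, htg, hth, htk,
      htgh, hs, ht, or_self, not_false_eq_true, self]
    simp only [hilbertSymbol_comm, mul_assoc, mul_comm, mul_left_comm, Int.units_mul_self,
      sign_mul_cancel_left, mul_one]
  by_cases hh : h 1 0 = 0
  · obtain ⟨s, hs, h1⟩ := tau_mul_of_right_upper g hh
    rw [h1, tau_mul_of_left_upper hh k]
    simp only [hilbertSymbol_mul_left, hilbertSymbol_mul_right, ne_eq, mul_eq_zero, htg, hth, htk,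
      htghk, hs, or_self, not_false_eq_true, self]
    simp only [hilbertSymbol_comm, mul_assoc, mul_comm, mul_left_comm, Int.units_mul_self,
      sign_mul_cancel_left, mul_one]
  -- In these coordinates the lower left entry of ghk is c_g c_h c_k (uv - c_h⁻²).
  obtain ⟨u, hu⟩ : ∃ u, u = h 0 0 / h 1 0 + g 1 1 / g 1 0 := ⟨_, rfl⟩
  obtain ⟨v, hv⟩ : ∃ v, v = k 0 0 / k 1 0 + h 1 1 / h 1 0 := ⟨_, rfl⟩
  have e3 : (g * h * k) 1 0 = g 1 0 * h 1 0 * k 1 0 * (u * v - (h 1 0)⁻¹ ^ 2) := by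
    rw [SL2_mul_one_zero, SL2_mul_one_zero, SL2_mul_one_one, hu, hv]
    have hd := SL2_det h
    field_simp
    linear_combination -(k 1 0 * g 1 0) * hd
  have hgh := tau_mul_generic hg hh
  have hhk := tau_mul_generic hh hk
  rw [← hu, ← hm] at hgh
  rw [← hv, ← hm] at hhk
  have hneg : 0 - (h 1 0)⁻¹ ^ 2 = m * ((h 1 0)⁻¹ * (h 1 0)⁻¹) := by rw [hm]; ring
  rw [tau_of_ne_zero hg, tau_of_ne_zero hh, tau_of_ne_zero hk]
  generalize hA : g 1 0 = A at *
  generalize hB : h 1 0 = B at *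
  generalize hC : k 1 0 = C at *
  -- In this case ghk is upper triangular; then u and v are nonzero and v is u⁻¹ up to a square.
  by_cases hw : u * v - B⁻¹ ^ 2 = 0
  · have hB2 : B⁻¹ ≠ 0 := inv_ne_zero hh
    have huv : u * v ≠ 0 := by rw [sub_eq_zero.1 hw]; exact pow_ne_zero 2 hB2
    have hu0 := left_ne_zero_of_mul huv
    have hv0 := right_ne_zero_of_mul huv
    have e1 := (hgh.resolve_right fun h => hu0 h.2).1
    have e2 := (hhk.resolve_right fun h => hv0 h.2).1
    have e2' : (h * k) 1 0 ≠ 0 := by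
      rw [SL2_mul_one_zero, hB, hC]
      intro h0
      apply hv0
      rw [hv]
      field_simp
      linear_combination h0
    have e5 : (h * k) 1 0 = B * C * v := by rw [← e2, tau_of_ne_zero]; exact e2'
    have e4 : tau (g * h * k) = m * A * (B * C * v)⁻¹ := by
      rw [hw, mul_zero, mul_assoc g h k] at e3
      rcases tau_mul_generic (g := g) (h := h * k) (by rwa [hA]) e2' with ⟨-, h2⟩ | ⟨h1, -⟩
      · rw [SL2_mul_one_zero] at e3
        exfalso
        apply h2
        rw [← hA] at hg
        field_simp
        linear_combination e3
      · rw [mul_assoc, h1, hA, e5, hm]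
    rw [e1, e2, e4]
    have hvu : v = u⁻¹ * (B⁻¹ * B⁻¹) := by
      rw [eq_inv_mul_iff_mul_eq₀ hu0]; linear_combination hw
    rw [hvu]
    simp only [mul_inv, inv_inv]
    simp only [hilbertSymbol_mul_left, hilbertSymbol_mul_right, hilbertSymbol_inv_left,
        hilbertSymbol_inv_right, inv_eq_zero, ne_eq, mul_eq_zero, hg, hh, hk, hu0,
      hm0, or_self, not_false_eq_true, self]
    simp only [hilbertSymbol_comm, mul_assoc, mul_comm, mul_left_comm, Int.units_mul_self,
      sign_mul_cancel_left, mul_one]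
  have e4 : tau (g * h * k) = A * B * C * (u * v - B⁻¹ ^ 2) := by
    rw [tau_of_ne_zero, e3]
    rw [e3]
    exact mul_ne_zero (mul_ne_zero (mul_ne_zero hg hh) hk) hw
  rw [e4]
  rcases hgh with ⟨e1, hu0⟩ | ⟨e1, hu0⟩
  · rcases hhk with ⟨e2, hv0⟩ | ⟨e2, hv0⟩
    · rw [e1, e2]
      exact kubota_generic hg hh hk hu0 hv0 hw (by ring)
    · rw [e1, e2, hv0, mul_zero, hneg]
      simp only [hilbertSymbol_mul_left, hilbertSymbol_mul_right, hilbertSymbol_inv_left,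
        hilbertSymbol_inv_right, inv_eq_zero, ne_eq, mul_eq_zero, hg, hh, hk, hu0,
        hm0, or_self, not_false_eq_true, self]
      simp only [hilbertSymbol_comm, mul_assoc, mul_comm, mul_left_comm, Int.units_mul_self,
        sign_mul_cancel_left, mul_one]
  · rcases hhk with ⟨e2, hv0⟩ | ⟨e2, hv0⟩
    · rw [e1, e2, hu0, zero_mul, hneg]
      simp only [hilbertSymbol_mul_left, hilbertSymbol_mul_right, hilbertSymbol_inv_left,
        hilbertSymbol_inv_right, inv_eq_zero, ne_eq, mul_eq_zero, hg, hh, hk, hv0,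
        hm0, or_self, not_false_eq_true, self]
      simp only [hilbertSymbol_comm, mul_assoc, mul_comm, mul_left_comm, Int.units_mul_self,
        sign_mul_cancel_left, mul_one]
    · rw [e1, e2, hu0, zero_mul, hneg]
      simp only [hilbertSymbol_mul_left, hilbertSymbol_mul_right, hilbertSymbol_inv_left,
        hilbertSymbol_inv_right, inv_eq_zero, ne_eq, mul_eq_zero, hg, hh, hk,
        hm0, or_self, not_false_eq_true, self]
      simp only [hilbertSymbol_comm, mul_assoc, mul_comm, mul_left_comm, Int.units_mul_self,
        sign_mul_cancel_left, mul_one]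

end Kubota

/-! ### The cocycle corrected by s, and elementary matrices -/

section Cocycle

variable {K : Type*} [Field K]

theorem cocycle_eq (s : SL(2, K) → ℤˣ) (g h : SL(2, K)) :
    cocycle s g h = kubota g h * s g * s h * s (g * h) := rfl

/-- The factors s change Kubota's cocycle by a coboundary, each repeated sign cancelling itself. -/
theorem cocycle_assoc [HilbertBimultiplicative K] (s : SL(2, K) → ℤˣ) (g h k : SL(2, K)) :
    cocycle s g h * cocycle s (g * h) k = cocycle s g (h * k) * cocycle s h k := by
  have key := kubota_cocycle g h k
  simp only [cocycle_eq]
  calc _ = (kubota g h * kubota (g * h) k) * (s g * s h * s k * s (g * h * k)) *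
        (s (g * h) * s (g * h)) := by
        simp only [mul_assoc, mul_comm, mul_left_comm]
    _ = (kubota g (h * k) * kubota h k) * (s g * s h * s k * s (g * (h * k))) *
        (s (h * k) * s (h * k)) := by
        rw [key, Int.units_mul_self, Int.units_mul_self, mul_assoc g h k]
    _ = _ := by simp only [mul_assoc, mul_comm, mul_left_comm]

theorem kubota_one_right (g : SL(2, K)) : kubota g 1 = 1 := by
  unfold kubota
  rw [mul_one]
  exact hilbertSymbol_isSquare_left ⟨_, rfl⟩ _

theorem kubota_one_left (g : SL(2, K)) : kubota 1 g = 1 := by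
  unfold kubota
  rw [one_mul]
  exact hilbertSymbol_isSquare_right _ ⟨_, rfl⟩

theorem cocycle_one_right {s : SL(2, K) → ℤˣ} (hs : s 1 = 1) (g : SL(2, K)) :
    cocycle s g 1 = 1 := by
  rw [cocycle_eq, kubota_one_right, hs, mul_one, mul_one, one_mul, Int.units_mul_self]

theorem cocycle_one_left {s : SL(2, K) → ℤˣ} (hs : s 1 = 1) (g : SL(2, K)) :
    cocycle s 1 g = 1 := by
  rw [cocycle_eq, kubota_one_left, hs, mul_one, one_mul, one_mul, Int.units_mul_self]

/-- `(1, b; 0, 1)`. -/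
def upperU (b : K) : SL(2, K) := ⟨!![1, b; 0, 1], by simp [Matrix.det_fin_two]⟩

/-- `(1, 0; c, 1)`. -/
def lowerU (c : K) : SL(2, K) := ⟨!![1, 0; c, 1], by simp [Matrix.det_fin_two]⟩

/-- `(t, 0; 0, t⁻¹)`. -/
def diagU (t : Kˣ) : SL(2, K) :=
  ⟨!![(t : K), 0; 0, ((t⁻¹ : Kˣ) : K)], by simp [Matrix.det_fin_two]⟩

@[simp] theorem upperU_00 (b : K) : upperU b 0 0 = 1 := rfl
@[simp] theorem upperU_01 (b : K) : upperU b 0 1 = b := rfl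
@[simp] theorem upperU_10 (b : K) : upperU b 1 0 = 0 := rfl
@[simp] theorem upperU_11 (b : K) : upperU b 1 1 = 1 := rfl
@[simp] theorem lowerU_00 (b : K) : lowerU b 0 0 = 1 := rfl
@[simp] theorem lowerU_01 (b : K) : lowerU b 0 1 = 0 := rfl
@[simp] theorem lowerU_10 (b : K) : lowerU b 1 0 = b := rfl
@[simp] theorem lowerU_11 (b : K) : lowerU b 1 1 = 1 := rfl
@[simp] theorem diagU_00 (t : Kˣ) : diagU t 0 0 = t := rfl
@[simp] theorem diagU_01 (t : Kˣ) : diagU t 0 1 = 0 := rfl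
@[simp] theorem diagU_10 (t : Kˣ) : diagU t 1 0 = 0 := rfl
@[simp] theorem diagU_11 (t : Kˣ) : diagU t 1 1 = (t : K)⁻¹ := by
  simp [diagU]

theorem SL2_ext {g h : SL(2, K)} (h00 : g 0 0 = h 0 0) (h01 : g 0 1 = h 0 1)
    (h10 : g 1 0 = h 1 0) (h11 : g 1 1 = h 1 1) : g = h := by
  ext i j
  fin_cases i <;> fin_cases j <;> assumption

theorem iwahori (g : SL(2, K)) (t : Kˣ) (ht : (t : K) = g 0 0) :
    g = lowerU (g 1 0 / g 0 0) * (diagU t * upperU (g 0 1 / g 0 0)) := by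
  have hd := SL2_det g
  have h0 : g 0 0 ≠ 0 := by rw [← ht]; exact t.ne_zero
  apply SL2_ext <;> simp only [SL2_mul_zero_zero, SL2_mul_zero_one, SL2_mul_one_zero,
    SL2_mul_one_one, upperU_00, upperU_01, upperU_10, upperU_11, lowerU_00, lowerU_01, lowerU_10,
    lowerU_11, diagU_00, diagU_01, diagU_10, diagU_11, ht] <;> field_simp <;>
    first | ring1 | linear_combination hd

theorem SL2_inv_00 (g : SL(2, K)) : g⁻¹ 0 0 = g 1 1 := by
  rw [Matrix.SpecialLinearGroup.SL2_inv_expl]; rfl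
theorem SL2_inv_01 (g : SL(2, K)) : g⁻¹ 0 1 = -g 0 1 := by
  rw [Matrix.SpecialLinearGroup.SL2_inv_expl]; rfl
theorem SL2_inv_10 (g : SL(2, K)) : g⁻¹ 1 0 = -g 1 0 := by
  rw [Matrix.SpecialLinearGroup.SL2_inv_expl]; rfl
theorem SL2_inv_11 (g : SL(2, K)) : g⁻¹ 1 1 = g 0 0 := by
  rw [Matrix.SpecialLinearGroup.SL2_inv_expl]; rfl

end Cocycle

/-! ### Splitting of the cover over SL₂(ℤ_p) for odd p and over K₁(4) for p = 2 -/

section PadicSubgroups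

variable {p : Nat.Primes}

theorem norm_add_le_of_le {x y : ℚ_[p]} {r : ℝ} (hx : ‖x‖ ≤ r) (hy : ‖y‖ ≤ r) : ‖x + y‖ ≤ r :=
  (Padic.nonarchimedean x y).trans (max_le hx hy)

theorem norm_sub_le_of_le {x y : ℚ_[p]} {r : ℝ} (hx : ‖x‖ ≤ r) (hy : ‖y‖ ≤ r) : ‖x - y‖ ≤ r := by
  rw [sub_eq_add_neg]; exact norm_add_le_of_le hx (by rwa [norm_neg])

theorem norm_mul_le_of_le_one_left {x y : ℚ_[p]} {r : ℝ} (hx : ‖x‖ ≤ 1) (hy : ‖y‖ ≤ r) :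
    ‖x * y‖ ≤ r := by
  rw [norm_mul]
  exact (mul_le_of_le_one_left (norm_nonneg y) hx).trans hy

theorem norm_mul_le_of_le_one_right {x y : ℚ_[p]} {r : ℝ} (hx : ‖x‖ ≤ r) (hy : ‖y‖ ≤ 1) :
    ‖x * y‖ ≤ r := by
  rw [mul_comm]; exact norm_mul_le_of_le_one_left hy hx

/-- The elements of `SL₂(ℤ_p)` with lower left entry divisible by `x`. -/
def gammaZeroPadic (p : Nat.Primes) (x : ℚ_[p]) : Subgroup SL(2, ℚ_[p]) where
  carrier := {g | g ∈ SL2Zp p ∧ ‖g 1 0‖ ≤ ‖x‖}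
  one_mem' := ⟨one_mem _, by simp⟩
  mul_mem' := by
    rintro g h ⟨hg, hgc⟩ ⟨hh, hhc⟩
    refine ⟨mul_mem hg hh, ?_⟩
    rw [mem_SL2Zp] at hg hh
    rw [SL2_mul_one_zero]
    exact norm_add_le_of_le (norm_mul_le_of_le_one_right hgc (hh 0 0))
      (norm_mul_le_of_le_one_left (hg 1 1) hhc)
  inv_mem' := by
    rintro g ⟨hg, hgc⟩
    refine ⟨inv_mem hg, ?_⟩
    rwa [SL2_inv_10, norm_neg]

/-- The elements of `SL₂(ℤ_p)` with `c ≡ 0` and `a ≡ d ≡ 1` modulo `4`. -/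
def gammaOneFour (p : Nat.Primes) : Subgroup SL(2, ℚ_[p]) where
  carrier := {g | g ∈ gammaZeroPadic p 4 ∧ ‖g 0 0 - 1‖ ≤ ‖(4 : ℚ_[p])‖ ∧
    ‖g 1 1 - 1‖ ≤ ‖(4 : ℚ_[p])‖}
  one_mem' := ⟨one_mem _, by simp, by simp⟩
  mul_mem' := by
    rintro g h ⟨hg, hga, hgd⟩ ⟨hh, hha, hhd⟩
    refine ⟨mul_mem hg hh, ?_, ?_⟩
    · have h1 := mem_SL2Zp.1 hg.1
      have h2 := mem_SL2Zp.1 hh.1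
      rw [SL2_mul_zero_zero, show g 0 0 * h 0 0 + g 0 1 * h 1 0 - 1 =
        g 0 0 * (h 0 0 - 1) + (g 0 0 - 1) + g 0 1 * h 1 0 by ring]
      exact norm_add_le_of_le (norm_add_le_of_le (norm_mul_le_of_le_one_left (h1 0 0) hha) hga)
        (norm_mul_le_of_le_one_left (h1 0 1) hh.2)
    · have h1 := mem_SL2Zp.1 hg.1
      have h2 := mem_SL2Zp.1 hh.1
      rw [SL2_mul_one_one, show g 1 0 * h 0 1 + g 1 1 * h 1 1 - 1 =
        g 1 0 * h 0 1 + (g 1 1 * (h 1 1 - 1) + (g 1 1 - 1)) by ring]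
      exact norm_add_le_of_le (norm_mul_le_of_le_one_right hg.2 (h2 0 1))
        (norm_add_le_of_le (norm_mul_le_of_le_one_left (h1 1 1) hhd) hgd)
  inv_mem' := by
    rintro g ⟨hg, hga, hgd⟩
    exact ⟨inv_mem hg, by rwa [SL2_inv_00], by rwa [SL2_inv_11]⟩

theorem gammaOneFour_of_ne_two (h2 : (p : ℕ) ≠ 2) : gammaOneFour p = SL2Zp p := by
  have h4 : ‖(4 : ℚ_[p])‖ = 1 := norm_four_of_ne_two h2
  apply le_antisymm
  · exact fun g hg => hg.1.1
  · intro g hg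
    have h1 := mem_SL2Zp.1 hg
    refine ⟨⟨hg, by rw [h4]; exact h1 1 0⟩, ?_, ?_⟩ <;> rw [h4]
    · exact norm_sub_le_of_le (h1 0 0) (by simp)
    · exact norm_sub_le_of_le (h1 1 1) (by simp)

theorem upperU_mem {b : ℚ_[p]} (hb : ‖b‖ ≤ 1) : upperU b ∈ gammaOneFour p := by
  refine ⟨⟨mem_SL2Zp.2 fun i j => ?_, by simp⟩, by simp, by simp⟩
  fin_cases i <;> fin_cases j <;> simp [hb]

theorem lowerU_mem {c : ℚ_[p]} (hc : ‖c‖ ≤ ‖(4 : ℚ_[p])‖) : lowerU c ∈ gammaOneFour p := by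
  refine ⟨⟨mem_SL2Zp.2 fun i j => ?_, by simpa⟩, by simp, by simp⟩
  fin_cases i <;> fin_cases j <;> simp [hc.trans norm_four_le_one]

theorem norm_inv_sub_one {t : ℚ_[p]} (ht : ‖t‖ = 1) : ‖t⁻¹ - 1‖ = ‖t - 1‖ := by
  have h0 := ne_zero_of_norm_eq_one ht
  rw [show t⁻¹ - 1 = -((t - 1) * t⁻¹) by field_simp; ring, norm_neg, norm_mul, norm_inv, ht]
  simp

theorem diagU_mem {t : (ℚ_[p])ˣ} (ht : ‖(t : ℚ_[p])‖ = 1)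
    (ht4 : ‖(t : ℚ_[p]) - 1‖ ≤ ‖(4 : ℚ_[p])‖) : diagU t ∈ gammaOneFour p := by
  refine ⟨⟨mem_SL2Zp.2 fun i j => ?_, by simp⟩, by simpa, by
    rw [diagU_11, norm_inv_sub_one ht]; exact ht4⟩
  fin_cases i <;> fin_cases j <;> simp [ht, diagU]

theorem sPadic_of_eq_zero {g : SL(2, ℚ_[p])} (h : g 1 0 = 0) : sPadic p g = 1 :=
  if_neg (by simp [h])

theorem sPadic_of_even {g : SL(2, ℚ_[p])} (h : Even (g 1 0).valuation) : sPadic p g = 1 :=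
  if_neg (by simp [h])

theorem sPadic_lowerU (c : ℚ_[p]) : sPadic p (lowerU c) = 1 := by
  unfold sPadic
  split_ifs with h
  · simp
  · rfl

/-- On `K₁(4)` the function `s_p` is `(c, d)_p` when `d` is a unit. -/
theorem sPadic_of_unit {g : SL(2, ℚ_[p])} (hc : g 1 0 ≠ 0) (hd : ‖g 1 1‖ = 1)
    (hd4 : ‖g 1 1 - 1‖ ≤ ‖(4 : ℚ_[p])‖) : sPadic p g = hilbertSymbol (g 1 0) (g 1 1) := by
  unfold sPadic
  split_ifs with h
  · rfl
  · have he : Even (g 1 0).valuation := by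
      rw [← Int.not_odd_iff_even]
      exact fun h' => h ⟨mul_ne_zero hc (ne_zero_of_norm_eq_one hd), h'⟩
    rw [hilbertSymbol_comm, hilbertSymbol_eq_one_of_even hd hd4 hc he]

theorem norm_one_zero_of_norm_one_one {g : SL(2, ℚ_[p])} (hg : g ∈ SL2Zp p) (hd : ‖g 1 1‖ ≠ 1) :
    ‖g 1 0‖ = 1 := by
  rw [mem_SL2Zp] at hg
  by_contra hc
  have h1 : ‖g 0 0 * g 1 1 - g 0 1 * g 1 0‖ < 1 := by
    rw [sub_eq_add_neg]
    refine (Padic.nonarchimedean _ _).trans_lt (max_lt ?_ ?_)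
    · rw [norm_mul]
      exact mul_lt_one_of_nonneg_of_lt_one_right (hg 0 0) (norm_nonneg _)
        (lt_of_le_of_ne (hg 1 1) hd)
    · rw [norm_neg, norm_mul]
      exact mul_lt_one_of_nonneg_of_lt_one_right (hg 0 1) (norm_nonneg _)
        (lt_of_le_of_ne (hg 1 0) hc)
  rw [SL2_det] at h1
  simp at h1

theorem sPadic_of_nonunit {g : SL(2, ℚ_[p])} (hg : g ∈ SL2Zp p) (hd : ‖g 1 1‖ ≠ 1) :
    sPadic p g = 1 := by
  apply sPadic_of_even
  rw [valuation_eq_zero_of_norm_eq_one (norm_one_zero_of_norm_one_one hg hd)]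
  exact Even.zero

theorem norm_four_of_nonunit {g : SL(2, ℚ_[p])} (hg : g ∈ gammaOneFour p) (hd : ‖g 1 1‖ ≠ 1) :
    ‖(4 : ℚ_[p])‖ = 1 := by
  have := hg.1.2
  rw [norm_one_zero_of_norm_one_one hg.1.1 hd] at this
  exact le_antisymm norm_four_le_one this

theorem cocyclePadic_eq (g h : SL(2, ℚ_[p])) :
    cocyclePadic p g h = kubota g h * sPadic p g * sPadic p h * sPadic p (g * h) := rfl

theorem tau_upperU {K : Type*} [Field K] (b : K) : tau (upperU b) = 1 := by
  rw [tau_of_eq_zero] <;> simp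

theorem tau_diagU {K : Type*} [Field K] (t : Kˣ) : tau (diagU t) = (t : K)⁻¹ := by
  rw [tau_of_eq_zero] <;> simp

theorem tau_lowerU {K : Type*} [Field K] {c : K} (hc : c ≠ 0) : tau (lowerU c) = c := by
  rw [tau_of_ne_zero] <;> simp [hc]

theorem kubota_upperU_right {K : Type*} [Field K] (g : SL(2, K)) (b : K) :
    kubota g (upperU b) = 1 := by
  unfold kubota
  obtain ⟨s, -, hs⟩ := tau_mul_of_right_upper g (upperU_10 b)
  rw [hs, tau_upperU]
  exact hilbertSymbol_isSquare_left ⟨tau g * s, by ring⟩ _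

theorem kubota_upperU_left {K : Type*} [Field K] (g : SL(2, K)) (b : K) :
    kubota (upperU b) g = 1 := by
  unfold kubota
  rw [tau_mul_of_left_upper (upperU_10 b), tau_upperU]
  exact hilbertSymbol_isSquare_right _ ⟨tau g, by ring⟩

theorem kubota_diagU_right {K : Type*} [Field K] [HilbertBimultiplicative K] (g : SL(2, K))
    (t : Kˣ) : kubota g (diagU t) = hilbertSymbol (t : K) (tau g) := by
  unfold kubota
  obtain ⟨s, hs, h⟩ := tau_mul_of_right_upper g (diagU_10 t)
  have hg := tau_ne_zero g
  rw [h, tau_diagU]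
  have e1 : tau g * (t : K)⁻¹ * (s * s) * tau g = t * (tau g * s * (t : K)⁻¹) ^ 2 := by
    field_simp
  have e2 : tau g * (t : K)⁻¹ * (s * s) * (t : K)⁻¹ = tau g * (s * (t : K)⁻¹) ^ 2 := by
    field_simp
  rw [e1, e2, hilbertSymbol_mul_sq_left, hilbertSymbol_mul_sq_right]
  · simp [hs]
  · simp [hs, hg]

/-- The valuation of 4 is even at every prime, so it cannot equal that of c. -/
theorem norm_lt_four_of_odd {c : ℚ_[p]} (hc : ‖c‖ ≤ ‖(4 : ℚ_[p])‖) (hodd : Odd c.valuation) :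
    ‖c‖ < ‖(4 : ℚ_[p])‖ := by
  refine lt_of_le_of_ne hc fun h => ?_
  have h4 : (4 : ℚ_[p]) ≠ 0 := by norm_num
  have h0 : c ≠ 0 := by
    rintro rfl
    simp at hodd
  rw [Padic.norm_eq_zpow_neg_valuation h0, Padic.norm_eq_zpow_neg_valuation h4] at h
  have hp1 : (1 : ℝ) < (p : ℕ) := by exact_mod_cast p.2.one_lt
  have := zpow_right_injective₀ (by positivity) hp1.ne' h
  have h2 : (4 : ℚ_[p]).valuation = 2 * (2 : ℚ_[p]).valuation := by
    rw [show (4 : ℚ_[p]) = 2 * 2 by norm_num, Padic.valuation_mul two_ne_zero two_ne_zero]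
    ring
  rw [h2] at this
  obtain ⟨m, hm⟩ := hodd
  omega

theorem norm_one_one_of_odd {g : SL(2, ℚ_[p])} (hg : g ∈ gammaOneFour p)
    (hodd : Odd (g 1 0).valuation) : ‖g 1 1‖ = 1 := by
  by_contra hd
  have := norm_one_zero_of_norm_one_one hg.1.1 hd
  rw [valuation_eq_zero_of_norm_eq_one this] at hodd
  exact absurd hodd (by decide)

/-- The entry c is unchanged and d is multiplied by 1 + cb/d. Only odd ord(c) matters; then |c| <
|4| and this factor is a square. -/
theorem cocyclePadic_upperU {g : SL(2, ℚ_[p])} (hg : g ∈ gammaOneFour p) {b : ℚ_[p]}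
    (hb : ‖b‖ ≤ 1) : cocyclePadic p g (upperU b) = 1 := by
  have hgb := mul_mem hg (upperU_mem hb)
  have e10 : (g * upperU b) 1 0 = g 1 0 := by rw [SL2_mul_one_zero]; simp
  have e11 : (g * upperU b) 1 1 = g 1 0 * b + g 1 1 := by rw [SL2_mul_one_one]; simp
  rw [cocyclePadic_eq, kubota_upperU_right, sPadic_of_eq_zero (upperU_10 b), one_mul, mul_one]
  rcases Int.even_or_odd (g 1 0).valuation with h | h
  · rw [sPadic_of_even h, sPadic_of_even (by rwa [e10]), one_mul]
  have hc : g 1 0 ≠ 0 := by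
    intro h0; rw [h0] at h; simp at h
  have hd := norm_one_one_of_odd hg h
  have hd' := norm_one_one_of_odd hgb (by rwa [e10])
  have h0 := ne_zero_of_norm_eq_one hd
  have h0' := ne_zero_of_norm_eq_one hd'
  rw [sPadic_of_unit hc hd hg.2.2, sPadic_of_unit (by rwa [e10]) hd' hgb.2.2, e10,
    ← hilbertSymbol_mul_right hc h0 h0', e11]
  have : g 1 1 * (g 1 0 * b + g 1 1) = (1 + g 1 0 * b / g 1 1) * g 1 1 ^ 2 := by
    field_simp; ring
  rw [this, hilbertSymbol_mul_sq_right _ _ h0]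
  apply hilbertSymbol_isSquare_right
  apply isSquare_of_norm_sub_one_lt
  rw [add_sub_cancel_left, norm_div, hd, div_one, norm_mul]
  exact (mul_le_of_le_one_right (norm_nonneg _) hb).trans_lt (norm_lt_four_of_odd hg.1.2 h)

/-- A unit t ≡ 1 modulo 4 has trivial symbol with every unit, and the remaining symbols (t, c)
cancel between the cocycle and s. -/
theorem cocyclePadic_diagU {g : SL(2, ℚ_[p])} (hg : g ∈ gammaOneFour p) {t : (ℚ_[p])ˣ}
    (ht : ‖(t : ℚ_[p])‖ = 1) (ht4 : ‖(t : ℚ_[p]) - 1‖ ≤ ‖(4 : ℚ_[p])‖) :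
    cocyclePadic p g (diagU t) = 1 := by
  have hgt := mul_mem hg (diagU_mem ht ht4)
  have e10 : (g * diagU t) 1 0 = g 1 0 * t := by rw [SL2_mul_one_zero]; simp
  have e11 : (g * diagU t) 1 1 = g 1 1 * (t : ℚ_[p])⁻¹ := by rw [SL2_mul_one_one]; simp
  have ht0 := ne_zero_of_norm_eq_one ht
  have hd' : ‖(g * diagU t) 1 1‖ = ‖g 1 1‖ := by
    rw [e11, norm_mul, norm_inv, ht, inv_one, mul_one]
  rw [cocyclePadic_eq, kubota_diagU_right, sPadic_of_eq_zero (diagU_10 t), mul_one]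
  by_cases hd : ‖g 1 1‖ = 1
  · have h0 := ne_zero_of_norm_eq_one hd
    by_cases hc : g 1 0 = 0
    · rw [tau_of_eq_zero hc, sPadic_of_eq_zero hc, sPadic_of_eq_zero (by rw [e10, hc, zero_mul]),
        hilbertSymbol_units ht ht4 hd, one_mul, one_mul]
    · rw [tau_of_ne_zero hc, sPadic_of_unit hc hd hg.2.2,
        sPadic_of_unit (by rw [e10]; exact mul_ne_zero hc ht0) (hd'.trans hd) hgt.2.2, e10, e11]
      have h1 : hilbertSymbol (t : ℚ_[p]) (t : ℚ_[p]) = 1 := hilbertSymbol_units ht ht4 ht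
      have h2 : hilbertSymbol (t : ℚ_[p]) (g 1 1) = 1 := hilbertSymbol_units ht ht4 hd
      rw [hilbertSymbol_comm] at h2
      simp only [hilbertSymbol_mul_left, hilbertSymbol_mul_right, hilbertSymbol_inv_right, ne_eq,
        mul_eq_zero, inv_eq_zero, hc, ht0, h0, or_self, not_false_eq_true, h1,
        hilbertSymbol_comm (t : ℚ_[p]) (g 1 1), h2, hilbertSymbol_comm (t : ℚ_[p]) (g 1 0)]
      simp only [mul_assoc, mul_comm, mul_left_comm, Int.units_mul_self, sign_mul_cancel_left,
        mul_one]
  · have hc := norm_one_zero_of_norm_one_one hg.1.1 hd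
    rw [tau_of_ne_zero (ne_zero_of_norm_eq_one hc), sPadic_of_nonunit hg.1.1 hd,
      sPadic_of_nonunit hgt.1.1 (by rwa [hd']), hilbertSymbol_units ht ht4 hc, one_mul, one_mul]

/-- With c' = c + dy the new lower left entry, the generic case is (c/c', dy/c') = 1, true because
the two arguments add up to 1. If d is not a unit, then |4| = 1 and c'/c = 1 + dy/c is a square. -/
theorem cocyclePadic_lowerU {g : SL(2, ℚ_[p])} (hg : g ∈ gammaOneFour p) {y : ℚ_[p]}
    (hy : ‖y‖ ≤ ‖(4 : ℚ_[p])‖) : cocyclePadic p g (lowerU y) = 1 := by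
  have hgy := mul_mem hg (lowerU_mem hy)
  have e10 : (g * lowerU y) 1 0 = g 1 0 + g 1 1 * y := by rw [SL2_mul_one_zero]; simp
  have e11 : (g * lowerU y) 1 1 = g 1 1 := by rw [SL2_mul_one_one]; simp
  rcases eq_or_ne y 0 with rfl | hy0
  · have : lowerU (0 : ℚ_[p]) = 1 := by apply SL2_ext <;> simp
    rw [this]
    exact cocycle_one_right (sPadic_of_eq_zero (by simp)) g
  rw [cocyclePadic_eq, sPadic_lowerU, mul_one, kubota, tau_lowerU hy0]
  by_cases hd : ‖g 1 1‖ = 1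
  · have hd0 := ne_zero_of_norm_eq_one hd
    have hdd : hilbertSymbol (g 1 1) (g 1 1) = 1 := hilbertSymbol_units hd hg.2.2 hd
    by_cases hc : g 1 0 = 0
    · have hc' : (g * lowerU y) 1 0 ≠ 0 := by rw [e10, hc, zero_add]; exact mul_ne_zero hd0 hy0
      rw [tau_of_ne_zero hc', tau_of_eq_zero hc, sPadic_of_eq_zero hc,
        sPadic_of_unit hc' (by rwa [e11]) hgy.2.2, e10, e11, hc, zero_add]
      simp only [hilbertSymbol_mul_left, hilbertSymbol_mul_right, ne_eq, mul_eq_zero, hy0, hd0,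
        or_self, not_false_eq_true, hdd, hilbertSymbol_comm (g 1 1) y]
      simp only [mul_comm, mul_left_comm, Int.units_mul_self, sign_mul_cancel_left,
        mul_one]
    by_cases hc' : (g * lowerU y) 1 0 = 0
    · rw [tau_of_ne_zero hc, tau_of_eq_zero hc', sPadic_of_eq_zero hc',
        sPadic_of_unit hc hd hg.2.2, e11]
      rw [e10] at hc'
      have : g 1 0 = g 1 1 * -y := by linear_combination hc'
      have hny0 : -y ≠ 0 := neg_ne_zero.2 hy0
      have hyy : hilbertSymbol (-y) y = 1 := by
        rw [hilbertSymbol_comm]; exact hilbertSymbol_self_neg y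
      rw [this]
      simp only [hilbertSymbol_mul_left, hilbertSymbol_mul_right, mul_eq_zero, hd0, hny0,
        or_self, not_false_eq_true, hdd, hyy, hy0, ne_eq]
      simp only [hilbertSymbol_comm, mul_comm, mul_left_comm, Int.units_mul_self,
        sign_mul_cancel_left, mul_one]
    · rw [tau_of_ne_zero hc, tau_of_ne_zero hc', sPadic_of_unit hc hd hg.2.2,
        sPadic_of_unit hc' (by rwa [e11]) hgy.2.2, e11]
      generalize hcc : (g * lowerU y) 1 0 = c' at *
      -- This single Steinberg relation accounts for all symbols of the generic case.
      have key : hilbertSymbol (g 1 0 * c'⁻¹) (g 1 1 * y * c'⁻¹) = 1 :=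
        hilbertSymbol_eq_one_of_add_eq_sq (c := 1) (by
          rw [← add_mul, ← e10, mul_inv_cancel₀ hc']; simp)
      have hself : ∀ {x : ℚ_[p]}, x ≠ 0 → hilbertSymbol x x = hilbertSymbol (-1) x := by
        intro x hx; rw [hilbertSymbol_self hx, hilbertSymbol_comm]
      rw [← key]
      simp only [hilbertSymbol_mul_left, hilbertSymbol_mul_right, mul_eq_zero, hd0, inv_eq_zero,
        hilbertSymbol_inv_left, hilbertSymbol_inv_right, hself,
        or_self, not_false_eq_true, hy0, hc', hc, ne_eq]
      simp only [hilbertSymbol_comm, mul_assoc, mul_comm, mul_left_comm]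
  · have h4 := norm_four_of_nonunit hg hd
    have hc := norm_one_zero_of_norm_one_one hg.1.1 hd
    have hc' := norm_one_zero_of_norm_one_one hgy.1.1 (by rwa [e11])
    have hc0 := ne_zero_of_norm_eq_one hc
    rw [tau_of_ne_zero hc0, tau_of_ne_zero (ne_zero_of_norm_eq_one hc'),
      sPadic_of_nonunit hg.1.1 hd, sPadic_of_nonunit hgy.1.1 (by rwa [e11]), mul_one, mul_one, e10]
    have : (g 1 0 + g 1 1 * y) * g 1 0 = (1 + g 1 1 * y / g 1 0) * g 1 0 ^ 2 := by
      field_simp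
    rw [this, hilbertSymbol_mul_sq_left _ _ hc0]
    apply hilbertSymbol_isSquare_left
    apply isSquare_of_norm_sub_one_lt
    rw [add_sub_cancel_left, norm_div, hc, div_one, norm_mul, h4]
    rw [h4] at hy
    exact mul_lt_one_of_nonneg_of_lt_one_left (norm_nonneg _)
      (lt_of_le_of_ne (mem_SL2Zp.1 hg.1.1 1 1) hd) hy

theorem cocyclePadic_assoc (g h k : SL(2, ℚ_[p])) :
    cocyclePadic p g h * cocyclePadic p (g * h) k =
      cocyclePadic p g (h * k) * cocyclePadic p h k := cocycle_assoc _ g h k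

/-- By the cocycle relation, the second arguments with trivial cocycle against the whole group are
closed under products, so the factors of an Iwahori decomposition may be treated one at a time. -/
theorem cocyclePadic_right_mul {x y : SL(2, ℚ_[p])} (hx : x ∈ gammaOneFour p)
    (h : ∀ g ∈ gammaOneFour p, cocyclePadic p g x = 1)
    (h' : ∀ g ∈ gammaOneFour p, cocyclePadic p g y = 1) :
    ∀ g ∈ gammaOneFour p, cocyclePadic p g (x * y) = 1 := by
  intro g hg
  have := cocyclePadic_assoc g x y
  rwa [h g hg, h' _ (mul_mem hg hx), h' x hx, mul_one, mul_one, eq_comm] at this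

/-- Kubota's cocycle is trivial on `SL₂(ℤ_p)` for odd `p` and on `K₁(4)` for `p = 2`. -/
theorem cocyclePadic_eq_one {g h : SL(2, ℚ_[p])} (hg : g ∈ gammaOneFour p)
    (hh : h ∈ gammaOneFour p) : cocyclePadic p g h = 1 := by
  have unit : ∀ h ∈ gammaOneFour p, ‖h 0 0‖ = 1 → ∀ g ∈ gammaOneFour p,
      cocyclePadic p g h = 1 := by
    intro h hh ha
    have ha0 := ne_zero_of_norm_eq_one ha
    have hm := mem_SL2Zp.1 hh.1.1
    have hl : ‖h 1 0 / h 0 0‖ ≤ ‖(4 : ℚ_[p])‖ := by rw [norm_div, ha, div_one]; exact hh.1.2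
    have hu : ‖h 0 1 / h 0 0‖ ≤ 1 := by rw [norm_div, ha, div_one]; exact hm 0 1
    rw [iwahori h (Units.mk0 _ ha0) rfl]
    refine cocyclePadic_right_mul (lowerU_mem hl) (fun g hg => cocyclePadic_lowerU hg hl) ?_
    exact cocyclePadic_right_mul (diagU_mem (by simpa using ha) (by simpa using hh.2.1))
      (fun g hg => cocyclePadic_diagU hg (by simpa using ha) (by simpa using hh.2.1))
      (fun g hg => cocyclePadic_upperU hg hu)
  by_cases ha : ‖h 0 0‖ = 1
  · exact unit h hh ha g hg
  have hm := mem_SL2Zp.1 hh.1.1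
  have hc : ‖h 1 0‖ = 1 := by
    have := norm_one_zero_of_norm_one_one (g := h⁻¹) (inv_mem hh.1.1) (by rwa [SL2_inv_11])
    rwa [SL2_inv_10, norm_neg] at this
  have h1 : upperU (1 : ℚ_[p]) ∈ gammaOneFour p := upperU_mem (by simp)
  have h2 : upperU (-1 : ℚ_[p]) ∈ gammaOneFour p := upperU_mem (by simp)
  -- If a is not a unit then c is, and n(1)h has the unit a + c in its upper left corner.
  have e : h = upperU (-1 : ℚ_[p]) * (upperU 1 * h) := by
    rw [← mul_assoc]
    have : upperU (-1 : ℚ_[p]) * upperU 1 = 1 := by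
      apply SL2_ext <;> simp [SL2_mul_zero_zero, SL2_mul_zero_one, SL2_mul_one_zero,
        SL2_mul_one_one]
    rw [this, one_mul]
  rw [e]
  refine cocyclePadic_right_mul h2 (fun g hg => cocyclePadic_upperU hg (by simp))
    (unit _ (mul_mem h1 hh) ?_) g hg
  rw [SL2_mul_zero_zero, upperU_00, upperU_01, one_mul, one_mul, add_comm]
  rw [Padic.add_eq_max_of_ne (by rw [hc]; exact fun h => ha h.symm), hc]
  exact max_eq_left (hm 0 0)

end PadicSubgroups

/-! ### Group structure of the covers -/

section PadicCover

variable {p : Nat.Primes}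

theorem sPadic_one : sPadic p 1 = 1 := sPadic_of_eq_zero (by simp)

@[simp] theorem cocyclePadic_one_right (g : SL(2, ℚ_[p])) : cocyclePadic p g 1 = 1 :=
  cocycle_one_right sPadic_one g

@[simp] theorem cocyclePadic_one_left (g : SL(2, ℚ_[p])) : cocyclePadic p 1 g = 1 :=
  cocycle_one_left sPadic_one g

namespace PadicCover

theorem mul_mat (x y : PadicCover p) : (x * y).mat = x.mat * y.mat := rfl

theorem mul_sgn (x y : PadicCover p) :
    (x * y).sgn = x.sgn * y.sgn * cocyclePadic p x.mat y.mat := rfl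

theorem mk_mul_mk (g h : SL(2, ℚ_[p])) (ε δ : ℤˣ) :
    (⟨g, ε⟩ * ⟨h, δ⟩ : PadicCover p) = ⟨g * h, ε * δ * cocyclePadic p g h⟩ := rfl

noncomputable instance : One (PadicCover p) := ⟨⟨1, 1⟩⟩

theorem one_def : (1 : PadicCover p) = ⟨1, 1⟩ := rfl

noncomputable instance : Inv (PadicCover p) := ⟨fun x => ⟨x.mat⁻¹, x.sgn * cocyclePadic p x.mat⁻¹ x.mat⟩⟩

noncomputable instance : Group (PadicCover p) :=
  Group.ofLeftAxioms
    (by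
      intro x y z
      apply PadicCover.ext
      · simp only [mul_mat, mul_assoc]
      · simp only [mul_mat, mul_sgn]
        calc _ = x.sgn * y.sgn * z.sgn *
              (cocyclePadic p x.mat y.mat * cocyclePadic p (x.mat * y.mat) z.mat) := by
              simp only [mul_assoc, mul_comm, mul_left_comm]
          _ = _ := by
              rw [cocyclePadic_assoc]
              simp only [mul_assoc, mul_comm, mul_left_comm])
    (by
      intro x
      apply PadicCover.ext
      · exact one_mul _
      · rw [mul_sgn, one_def, cocyclePadic_one_left, one_mul, mul_one])
    (by
      intro x
      apply PadicCover.ext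
      · exact inv_mul_cancel _
      · rw [mul_sgn, one_def]
        change x.sgn * cocyclePadic p x.mat⁻¹ x.mat * x.sgn * cocyclePadic p x.mat⁻¹ x.mat = 1
        rw [mul_assoc, mul_assoc, mul_left_comm, sign_mul_cancel_left, Int.units_mul_self])

theorem sign_mul_comm (x : PadicCover p) (ε : ℤˣ) :
    x * ⟨1, ε⟩ = (⟨1, ε⟩ : PadicCover p) * x := by
  apply PadicCover.ext
  · simp [mul_mat]
  · simp [mul_sgn, mul_comm]

end PadicCover

end PadicCover

/-! ### The adelic cover as a monoid, and commutation between places -/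

section AdelicCover

theorem cocycleReal_one_right (g : SL(2, ℝ)) : cocycleReal g 1 = 1 := cocycle_one_right rfl g

theorem cocycleReal_one_left (g : SL(2, ℝ)) : cocycleReal 1 g = 1 := cocycle_one_left rfl g

theorem cocycleReal_eq (g h : SL(2, ℝ)) : cocycleReal g h = kubota g h := by
  unfold cocycleReal
  rw [cocycle_eq]; simp

/-- The cocycle of the finite adeles. -/
noncomputable def cocycleFinite (g h : SL2FiniteAdele) : ℤˣ :=
  ∏ᶠ p : Nat.Primes, cocyclePadic p (g p) (h p)

theorem finite_mulSupport_cocycle (g h : SL2FiniteAdele) :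
    (Function.mulSupport fun p : Nat.Primes => cocyclePadic p (g p) (h p)).Finite := by
  have : ∀ᶠ p : Nat.Primes in cofinite, cocyclePadic p (g p) (h p) = 1 := by
    filter_upwards [g.2, h.2, eventually_ne_two] with p hg hh h2
    apply cocyclePadic_eq_one <;> rw [gammaOneFour_of_ne_two h2]
    · exact hg
    · exact hh
  exact Filter.eventually_cofinite.1 this

theorem cocycleFinite_assoc (g h k : SL2FiniteAdele) :
    cocycleFinite g h * cocycleFinite (g * h) k =
      cocycleFinite g (h * k) * cocycleFinite h k := by
  unfold cocycleFinite
  rw [← finprod_mul_distrib (finite_mulSupport_cocycle _ _) (finite_mulSupport_cocycle _ _),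
    ← finprod_mul_distrib (finite_mulSupport_cocycle _ _) (finite_mulSupport_cocycle _ _)]
  congr 1
  ext p : 1
  exact cocyclePadic_assoc _ _ _

theorem cocycleFinite_eq_one {g h : SL2FiniteAdele}
    (H : ∀ p, cocyclePadic p (g p) (h p) = 1) : cocycleFinite g h = 1 :=
  finprod_eq_one_of_forall_eq_one H

theorem cocycleFinite_one_left (g : SL2FiniteAdele) : cocycleFinite 1 g = 1 :=
  cocycleFinite_eq_one fun p => by
    rw [RestrictedProduct.one_apply]
    exact cocyclePadic_one_left _

theorem cocycleFinite_one_right (g : SL2FiniteAdele) : cocycleFinite g 1 = 1 :=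
  cocycleFinite_eq_one fun p => by
    rw [RestrictedProduct.one_apply]
    exact cocyclePadic_one_right _

theorem cocycleFinite_eq_single (q : Nat.Primes) {g h : SL2FiniteAdele}
    (H : ∀ p, p ≠ q → cocyclePadic p (g p) (h p) = 1) :
    cocycleFinite g h = cocyclePadic q (g q) (h q) :=
  finprod_eq_single _ q H

namespace AdelicCover

theorem mul_inf (x y : AdelicCover) : (x * y).inf = x.inf * y.inf := rfl

theorem mul_fin (x y : AdelicCover) : (x * y).fin = x.fin * y.fin := rfl

theorem mul_sgn (x y : AdelicCover) : (x * y).sgn = x.sgn * y.sgn *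
    (cocycleReal x.inf y.inf * cocycleFinite x.fin y.fin) := rfl

noncomputable instance : One AdelicCover := ⟨⟨1, 1, 1⟩⟩

theorem one_def : (1 : AdelicCover) = ⟨1, 1, 1⟩ := rfl

noncomputable instance : Monoid AdelicCover where
  mul_assoc x y z := by
    apply AdelicCover.ext
    · simp only [mul_inf, mul_assoc]
    · simp only [mul_fin, mul_assoc]
    · simp only [mul_inf, mul_fin, mul_sgn]
      have h1 : cocycleReal x.inf y.inf * cocycleReal (x.inf * y.inf) z.inf =
          cocycleReal x.inf (y.inf * z.inf) * cocycleReal y.inf z.inf := cocycle_assoc _ _ _ _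
      have h2 := cocycleFinite_assoc x.fin y.fin z.fin
      calc _ = x.sgn * y.sgn * z.sgn *
            (cocycleReal x.inf y.inf * cocycleReal (x.inf * y.inf) z.inf) *
            (cocycleFinite x.fin y.fin * cocycleFinite (x.fin * y.fin) z.fin) := by
            simp only [mul_assoc, mul_comm, mul_left_comm]
        _ = _ := by
            rw [h1, h2]
            simp only [mul_assoc, mul_comm, mul_left_comm]
  one_mul x := by
    apply AdelicCover.ext
    · exact one_mul _
    · exact one_mul _
    · rw [mul_sgn, one_def, cocycleReal_one_left, cocycleFinite_one_left, one_mul, mul_one, mul_one]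
  mul_one x := by
    apply AdelicCover.ext
    · exact mul_one _
    · exact mul_one _
    · rw [mul_sgn, one_def, cocycleReal_one_right, cocycleFinite_one_right, mul_one, mul_one, mul_one]

end AdelicCover

theorem ofReal_mul_ofReal (g h : SL(2, ℝ)) (ε δ : ℤˣ) :
    ofReal g ε * ofReal h δ = ofReal (g * h) (ε * δ * cocycleReal g h) := by
  apply AdelicCover.ext
  · rfl
  · exact one_mul _
  · rw [AdelicCover.mul_sgn]
    change ε * δ * (cocycleReal g h * cocycleFinite 1 1) = _
    rw [cocycleFinite_one_left, mul_one]
    rfl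

theorem ofReal_mul_ofPadic {p : Nat.Primes} (g : SL(2, ℝ)) (ε : ℤˣ) (x : PadicCover p) :
    ofReal g ε * ofPadic x = ⟨g, RestrictedProduct.mulSingle SL2Zp p x.mat, ε * x.sgn⟩ := by
  apply AdelicCover.ext
  · exact mul_one _
  · exact one_mul _
  · rw [AdelicCover.mul_sgn]
    change ε * x.sgn * (cocycleReal g 1 * cocycleFinite 1 _) = _
    rw [cocycleFinite_one_left, mul_one, cocycleReal_one_right,
      mul_one]

theorem ofPadic_mul_ofReal {p : Nat.Primes} (g : SL(2, ℝ)) (ε : ℤˣ) (x : PadicCover p) :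
    ofPadic x * ofReal g ε = ofReal g ε * ofPadic x := by
  rw [ofReal_mul_ofPadic]
  apply AdelicCover.ext
  · exact one_mul _
  · exact mul_one _
  · rw [AdelicCover.mul_sgn]
    change x.sgn * ε * (cocycleReal 1 g * cocycleFinite _ 1) = _
    rw [cocycleFinite_one_right, mul_one, cocycleReal_one_left,
      mul_one, mul_comm]

theorem ofReal_mul_ofFinite (g : SL(2, ℝ)) (ε : ℤˣ) (κ : SL2FiniteAdele) :
    ofReal g ε * ofFinite κ = ⟨g, κ, ε⟩ := by
  apply AdelicCover.ext
  · exact mul_one _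
  · exact one_mul _
  · rw [AdelicCover.mul_sgn]
    change ε * 1 * (cocycleReal g 1 * cocycleFinite 1 κ) = _
    rw [cocycleFinite_one_left, mul_one, cocycleReal_one_right,
      mul_one, mul_one]

theorem ofFinite_mul_ofReal (g : SL(2, ℝ)) (ε : ℤˣ) (κ : SL2FiniteAdele) :
    ofFinite κ * ofReal g ε = ofReal g ε * ofFinite κ := by
  rw [ofReal_mul_ofFinite]
  apply AdelicCover.ext
  · exact one_mul _
  · exact mul_one _
  · rw [AdelicCover.mul_sgn]
    change 1 * ε * (cocycleReal 1 g * cocycleFinite κ 1) = _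
    rw [cocycleFinite_one_right, mul_one, cocycleReal_one_left,
      mul_one, one_mul]

theorem ofFinite_mul_ofFinite {κ κ' : SL2FiniteAdele} (h : ∀ p, κ p ∈ gammaOneFour p)
    (h' : ∀ p, κ' p ∈ gammaOneFour p) : ofFinite κ * ofFinite κ' = ofFinite (κ * κ') := by
  apply AdelicCover.ext
  · exact mul_one _
  · rfl
  · rw [AdelicCover.mul_sgn]
    change 1 * 1 * (cocycleReal 1 1 * cocycleFinite κ κ') = 1
    rw [cocycleFinite_eq_one fun p => cocyclePadic_eq_one (h p) (h' p), cocycleReal_one_right,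
      mul_one, mul_one]

theorem ofPadic_mul_ofPadic {p : Nat.Primes} (x y : PadicCover p) :
    ofPadic x * ofPadic y = ofPadic (x * y) := by
  apply AdelicCover.ext
  · exact mul_one _
  · exact (RestrictedProduct.mulSingle_mul SL2Zp p x.mat y.mat).symm
  · rw [AdelicCover.mul_sgn]
    change x.sgn * y.sgn * (cocycleReal 1 1 * cocycleFinite (RestrictedProduct.mulSingle SL2Zp p
      x.mat) (RestrictedProduct.mulSingle SL2Zp p y.mat)) = x.sgn * y.sgn * _
    rw [cocycleReal_one_left, one_mul, cocycleFinite_eq_single p]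
    · rw [RestrictedProduct.mulSingle_eq_same, RestrictedProduct.mulSingle_eq_same]
    · intro q hq
      rw [RestrictedProduct.mulSingle_eq_of_ne _ _ hq, cocyclePadic_one_left]

/-- Moving the component at `p` of a finite adele past an element at the place `p`. -/
theorem ofFinite_mul_ofPadic {p : Nat.Primes} (κ : SL2FiniteAdele) (x : PadicCover p) :
    ofFinite κ * ofPadic x = ofPadic (⟨κ p, 1⟩ * x) *
      ofFinite (RestrictedProduct.mulSingle SL2Zp p (κ p)⁻¹ * κ) := by
  have hp : ∀ q, q ≠ p → (RestrictedProduct.mulSingle SL2Zp p (κ p)⁻¹ * κ) q = κ q := by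
    intro q hq
    rw [RestrictedProduct.mul_apply, RestrictedProduct.mulSingle_eq_of_ne _ _ hq, one_mul]
  have hp' : (RestrictedProduct.mulSingle SL2Zp p (κ p)⁻¹ * κ) p = 1 := by
    rw [RestrictedProduct.mul_apply, RestrictedProduct.mulSingle_eq_same, inv_mul_cancel]
  generalize RestrictedProduct.mulSingle SL2Zp p (κ p)⁻¹ * κ = κ' at hp hp' ⊢
  apply AdelicCover.ext
  · rfl
  · rw [AdelicCover.mul_fin, AdelicCover.mul_fin]
    change κ * RestrictedProduct.mulSingle SL2Zp p x.mat =
      RestrictedProduct.mulSingle SL2Zp p (κ p * x.mat) * κ'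
    ext1 q
    rcases eq_or_ne q p with rfl | hq
    · rw [RestrictedProduct.mul_apply, RestrictedProduct.mul_apply, hp',
        RestrictedProduct.mulSingle_eq_same, RestrictedProduct.mulSingle_eq_same, mul_one]
    · rw [RestrictedProduct.mul_apply, RestrictedProduct.mul_apply, hp q hq,
        RestrictedProduct.mulSingle_eq_of_ne _ _ hq, RestrictedProduct.mulSingle_eq_of_ne _ _ hq,
        mul_one, one_mul]
  · rw [AdelicCover.mul_sgn, AdelicCover.mul_sgn]
    change 1 * x.sgn * (cocycleReal 1 1 * cocycleFinite κ (RestrictedProduct.mulSingle SL2Zp p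
      x.mat)) = (1 * x.sgn * cocyclePadic p (κ p) x.mat) * 1 * (cocycleReal 1 1 *
      cocycleFinite (RestrictedProduct.mulSingle SL2Zp p (κ p * x.mat)) κ')
    rw [cocycleFinite_eq_single p, cocycleFinite_eq_one]
    · rw [RestrictedProduct.mulSingle_eq_same, cocycleReal_one_left]; simp
    · intro q
      rcases eq_or_ne q p with rfl | hq
      · rw [hp', cocyclePadic_one_right]
      · rw [RestrictedProduct.mulSingle_eq_of_ne _ _ hq, cocyclePadic_one_left]
    · intro q hq
      rw [RestrictedProduct.mulSingle_eq_of_ne _ _ hq, cocyclePadic_one_right]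

/-! ### The splitting over `SL₂(ℚ)` -/

theorem map_apply {R S : Type*} [CommRing R] [CommRing S] (f : R →+* S) (g : SL(2, R))
    (i j : Fin 2) : Matrix.SpecialLinearGroup.map f g i j = f (g i j) := rfl

theorem ratToPadic_apply (p : Nat.Primes) (α : SL(2, ℚ)) (i j : Fin 2) :
    ratToPadic p α i j = ((α i j : ℚ) : ℚ_[p]) := rfl

theorem tau_map {K L : Type*} [Field K] [Field L] (f : K →+* L) (g : SL(2, K)) :
    tau (Matrix.SpecialLinearGroup.map f g) = f (tau g) := by
  by_cases h : g 1 0 = 0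
  · rw [tau_of_eq_zero h, tau_of_eq_zero]
    · rfl
    · rw [map_apply, h, map_zero]
  · rw [tau_of_ne_zero h, tau_of_ne_zero]
    · rfl
    · rw [map_apply]; exact (map_ne_zero f).2 h

/-- The embedding `SL₂(ℚ) → SL₂(ℝ)`. -/
noncomputable def ratToReal : SL(2, ℚ) →* SL(2, ℝ) :=
  Matrix.SpecialLinearGroup.map (Rat.castHom ℝ)

theorem ratToReal_apply (α : SL(2, ℚ)) (i j : Fin 2) : ratToReal α i j = ((α i j : ℚ) : ℝ) := rfl

/-- The sign `∏ s_p(α)` of the splitting. -/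
noncomputable def splitSign (α : SL(2, ℚ)) : ℤˣ := ∏ᶠ p : Nat.Primes, sPadic p (ratToPadic p α)

theorem finite_mulSupport_sPadic (α : SL(2, ℚ)) :
    (Function.mulSupport fun p : Nat.Primes => sPadic p (ratToPadic p α)).Finite := by
  have : ∀ᶠ p : Nat.Primes in cofinite, sPadic p (ratToPadic p α) = 1 := by
    by_cases hc : α 1 0 = 0
    · refine Eventually.of_forall fun p => sPadic_of_eq_zero ?_
      rw [ratToPadic_apply, hc, Rat.cast_zero]
    · filter_upwards [eventually_norm_rat_eq_one hc] with p h1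
      apply sPadic_of_even
      rw [ratToPadic_apply, valuation_eq_zero_of_norm_eq_one h1]
      exact Even.zero
  exact Filter.eventually_cofinite.1 this

/-- At each place the cocycle is a Hilbert symbol of rational numbers times local signs s. The
symbols multiply to 1 by the product formula, and the local signs are a coboundary. -/
theorem splitSign_mul (α β : SL(2, ℚ)) : splitSign (α * β) = splitSign α * splitSign β *
    (cocycleReal (ratToReal α) (ratToReal β) *
      cocycleFinite (ratDiagonal α) (ratDiagonal β)) := by
  have h1 : ∀ p : Nat.Primes, cocyclePadic p (ratDiagonal α p) (ratDiagonal β p) =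
      hilbertSymbol ((tau (α * β) * tau α : ℚ) : ℚ_[p]) ((tau (α * β) * tau β : ℚ) : ℚ_[p]) *
        (sPadic p (ratToPadic p α) * sPadic p (ratToPadic p β) *
          sPadic p (ratToPadic p (α * β))) := by
    intro p
    change cocyclePadic p (ratToPadic p α) (ratToPadic p β) = _
    rw [cocyclePadic_eq, kubota, ← map_mul]
    unfold ratToPadic
    simp only [tau_map, eq_ratCast, Rat.cast_mul, mul_assoc]
  have hA : tau (α * β) * tau α ≠ 0 := mul_ne_zero (tau_ne_zero _) (tau_ne_zero _)
  have hB : tau (α * β) * tau β ≠ 0 := mul_ne_zero (tau_ne_zero _) (tau_ne_zero _)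
  have f1 := finite_mulSupport_hilbert hA hB
  have f2 := finite_mulSupport_sPadic α
  have f3 := finite_mulSupport_sPadic β
  have f4 := finite_mulSupport_sPadic (α * β)
  have h2 : cocycleFinite (ratDiagonal α) (ratDiagonal β) =
      (∏ᶠ p : Nat.Primes, hilbertSymbol ((tau (α * β) * tau α : ℚ) : ℚ_[p])
        ((tau (α * β) * tau β : ℚ) : ℚ_[p])) *
      (splitSign α * splitSign β * splitSign (α * β)) := by
    unfold cocycleFinite splitSign
    simp_rw [h1]
    rw [finprod_mul_distrib f1, finprod_mul_distrib _ f4, finprod_mul_distrib f2 f3]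
    · exact (f2.union f3).subset (Function.mulSupport_mul _ _)
    · refine ((f2.union f3).union f4).subset ((Function.mulSupport_mul _ _).trans ?_)
      exact Set.union_subset_union_left _ (Function.mulSupport_mul _ _)
  have h3 : cocycleReal (ratToReal α) (ratToReal β) =
      hilbertSymbol ((tau (α * β) * tau α : ℚ) : ℝ) ((tau (α * β) * tau β : ℚ) : ℝ) := by
    rw [cocycleReal_eq, kubota, ← map_mul]
    unfold ratToReal
    simp only [tau_map, eq_ratCast, Rat.cast_mul]
  have h4 := globalHilbert_eq_one hA hB
  unfold globalHilbert at h4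
  rw [h2, h3, ← mul_assoc (hilbertSymbol _ _), h4, one_mul, sign_mul_cancel_left]

theorem rationalSplitting_mul (α β : SL(2, ℚ)) :
    rationalSplitting (α * β) = rationalSplitting α * rationalSplitting β := by
  apply AdelicCover.ext
  · exact map_mul ratToReal α β
  · ext1 p
    exact map_mul (ratToPadic p) α β
  · exact splitSign_mul α β

theorem rationalSplitting_one : rationalSplitting 1 = 1 := by
  apply AdelicCover.ext
  · exact map_one ratToReal
  · ext1 p
    exact map_one (ratToPadic p)
  · change splitSign 1 = 1
    refine finprod_eq_one_of_forall_eq_one fun p => ?_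
    rw [map_one, sPadic_one]

end AdelicCover

/-! ### The automorphy factor over the reals -/

section AutJ

/-- The half plane containing exactly one of each pair `w, -w` of nonzero complex numbers. -/
def InHalfPlane (w : ℂ) : Prop := 0 < w.re ∨ (w.re = 0 ∧ w.im < 0)

/-- A nonzero square has one root in this half plane. All identities for `autJ` are thus proved by
comparing squares. -/
theorem InHalfPlane.eq_of_sq_eq {v w : ℂ} (hv : InHalfPlane v) (hw : InHalfPlane w)
    (h : v ^ 2 = w ^ 2) : v = w := by
  rcases sq_eq_sq_iff_eq_or_eq_neg.1 h with h | h
  · exact h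
  · subst h
    simp only [InHalfPlane, Complex.neg_re, Complex.neg_im] at hv hw
    rcases hv with hv | ⟨hv, hv'⟩ <;> rcases hw with hw | ⟨hw, hw'⟩ <;> linarith

theorem cpow_half_sq (w : ℂ) : (w ^ (1 / 2 : ℂ)) ^ 2 = w := by
  rw [← Complex.cpow_nat_mul]; norm_num

theorem cpow_half_re_im {w : ℂ} (hw : w ≠ 0) :
    (w ^ (1 / 2 : ℂ)).re = Real.exp (Real.log ‖w‖ / 2) * Real.cos (w.arg / 2) ∧
      (w ^ (1 / 2 : ℂ)).im = Real.exp (Real.log ‖w‖ / 2) * Real.sin (w.arg / 2) := by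
  rw [Complex.cpow_def_of_ne_zero hw]
  have h1 : (Complex.log w * (1 / 2)).re = Real.log ‖w‖ / 2 := by
    rw [show Complex.log w * (1 / 2) = Complex.log w / (2 : ℝ) by push_cast; ring,
      Complex.div_ofReal_re, Complex.log_re]
  have h2 : (Complex.log w * (1 / 2)).im = w.arg / 2 := by
    rw [show Complex.log w * (1 / 2) = Complex.log w / (2 : ℝ) by push_cast; ring,
      Complex.div_ofReal_im, Complex.log_im]
  rw [Complex.exp_re, Complex.exp_im, h1, h2]
  exact ⟨rfl, rfl⟩

theorem cpow_half_region {w : ℂ} (hw : w ≠ 0) : 0 < (w ^ (1 / 2 : ℂ)).re ∨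
    ((w ^ (1 / 2 : ℂ)).re = 0 ∧ 0 < (w ^ (1 / 2 : ℂ)).im ∧ w.arg = Real.pi) := by
  obtain ⟨h1, h2⟩ := cpow_half_re_im hw
  rw [h1, h2]
  have h3 := Complex.arg_le_pi w
  have h4 := Complex.neg_pi_lt_arg w
  rcases h3.lt_or_eq with h3 | h3
  · exact Or.inl (mul_pos (Real.exp_pos _) (Real.cos_pos_of_mem_Ioo ⟨by linarith, by linarith⟩))
  · refine Or.inr ⟨?_, ?_, h3⟩
    · rw [h3, Real.cos_pi_div_two, mul_zero]
    · rw [h3, Real.sin_pi_div_two, mul_one]; exact Real.exp_pos _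

/-- The linear factor `cz + d`. -/
noncomputable def linDenom (g : SL(2, ℝ)) (z : ℍ) : ℂ := (g 1 0 : ℂ) * (z : ℂ) + (g 1 1 : ℂ)

theorem linDenom_eq (g : SL(2, ℝ)) (z : ℍ) :
    linDenom g z = denom (Matrix.SpecialLinearGroup.toGL g) z := rfl

theorem linDenom_ne_zero (g : SL(2, ℝ)) (z : ℍ) : linDenom g z ≠ 0 := by
  rw [linDenom_eq]; exact denom_ne_zero _ z

theorem coe_smul_SL2 (g : SL(2, ℝ)) (z : ℍ) :
    ((g • z : ℍ) : ℂ) = ((g 0 0 : ℂ) * z + g 0 1) / linDenom g z := by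
  rw [coe_specialLinearGroup_apply]; rfl

theorem linDenom_mul (g h : SL(2, ℝ)) (z : ℍ) :
    linDenom (g * h) z = linDenom g (h • z) * linDenom h z := by
  have h0 := linDenom_ne_zero h z
  have h1 : linDenom g (h • z) * linDenom h z = (g 1 0 : ℂ) * ((h 0 0 : ℂ) * z + h 0 1) +
      (g 1 1 : ℂ) * linDenom h z := by
    rw [linDenom, coe_smul_SL2, add_mul, mul_assoc, div_mul_cancel₀ _ h0]
  rw [h1, linDenom, linDenom, SL2_mul_one_zero, SL2_mul_one_one]
  push_cast
  ring

theorem linDenom_im (g : SL(2, ℝ)) (z : ℍ) : (linDenom g z).im = g 1 0 * z.im := by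
  simp [linDenom]

theorem linDenom_of_eq_zero {g : SL(2, ℝ)} (hg : g 1 0 = 0) (z : ℍ) :
    linDenom g z = (g 1 1 : ℂ) := by
  simp [linDenom, hg]

theorem autJ_eq (g : SL(2, ℝ)) (ε : ℤˣ) (z : ℍ) : autJ g ε z = ((ε : ℤ) : ℂ) * autJ g 1 z := by
  unfold autJ; simp

theorem autJ_one_def (g : SL(2, ℝ)) (z : ℍ) :
    autJ g 1 z = starRingEnd ℂ ((starRingEnd ℂ (linDenom g z)) ^ (1 / 2 : ℂ)) := by
  unfold autJ linDenom; simp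

theorem autJ_sq (g : SL(2, ℝ)) (z : ℍ) : autJ g 1 z ^ 2 = linDenom g z := by
  rw [autJ_one_def, ← map_pow, cpow_half_sq, Complex.conj_conj]

theorem autJ_ne_zero (g : SL(2, ℝ)) (z : ℍ) : autJ g 1 z ≠ 0 := by
  intro h
  have := autJ_sq g z
  rw [h] at this
  exact linDenom_ne_zero g z (by rw [← this]; simp)

theorem autJ_mem (g : SL(2, ℝ)) (z : ℍ) : InHalfPlane (autJ g 1 z) := by
  have h0 : starRingEnd ℂ (linDenom g z) ≠ 0 := (map_ne_zero _).2 (linDenom_ne_zero g z)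
  rw [autJ_one_def]
  rcases cpow_half_region h0 with h | ⟨h, h', -⟩
  · exact Or.inl (by rwa [Complex.conj_re])
  · exact Or.inr ⟨by rwa [Complex.conj_re], by rw [Complex.conj_im]; linarith⟩

theorem autJ_eq_of_sq {g : SL(2, ℝ)} {z : ℍ} {w : ℂ} (hw : InHalfPlane w)
    (h : w ^ 2 = linDenom g z) : autJ g 1 z = w :=
  (autJ_mem g z).eq_of_sq_eq hw (by rw [autJ_sq, h])

theorem autJ_eq_cpow {g : SL(2, ℝ)} (hg : g 1 0 ≠ 0 ∨ 0 < g 1 1) (z : ℍ) :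
    autJ g 1 z = linDenom g z ^ (1 / 2 : ℂ) := by
  refine autJ_eq_of_sq ?_ (cpow_half_sq _)
  refine Or.inl ((cpow_half_region (linDenom_ne_zero g z)).resolve_right fun h => ?_)
  have h1 := Complex.arg_eq_pi_iff.1 h.2.2
  rw [linDenom_im] at h1
  have hc : g 1 0 = 0 := (mul_eq_zero.1 h1.2).resolve_right z.im_pos.ne'
  have hd := hg.resolve_left (by simpa using hc)
  rw [linDenom_of_eq_zero hc, Complex.ofReal_re] at h1
  linarith [h1.1]

/-- Since J² = cz + d, one has 2 Re J · Im J = c Im z, so the quadrant of J reveals the sign of c;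
for c = 0 the choice of branch makes it reveal the sign of d. This is the link between J and the
real cocycle. -/
theorem tau_sign (g : SL(2, ℝ)) (z : ℍ) :
    (0 < tau g ∧ 0 < (autJ g 1 z).re ∧ 0 ≤ (autJ g 1 z).im) ∨
      (tau g < 0 ∧ 0 ≤ (autJ g 1 z).re ∧ (autJ g 1 z).im < 0) := by
  have hsq := autJ_sq g z
  have hmem := autJ_mem g z
  set A := autJ g 1 z
  have him : 2 * (A.re * A.im) = g 1 0 * z.im := by
    rw [← linDenom_im, ← hsq, sq, Complex.mul_im]; ring
  have hz := z.im_pos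
  rcases lt_trichotomy (g 1 0) 0 with hc | hc | hc
  · have h1 : A.re * A.im < 0 := by nlinarith
    right
    rw [tau_of_ne_zero hc.ne]
    rcases hmem with h | ⟨h, h'⟩
    · exact ⟨hc, h.le, by nlinarith⟩
    · rw [h] at h1; simp at h1
  · have h1 : A.re * A.im = 0 := by rw [hc] at him; linarith
    have h2 : A.re * A.re - A.im * A.im = g 1 1 := by
      have := congrArg Complex.re hsq
      rwa [linDenom_of_eq_zero hc, Complex.ofReal_re, sq, Complex.mul_re] at this
    rw [tau_of_eq_zero hc]
    rcases hmem with h | ⟨h, h'⟩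
    · have h3 : A.im = 0 := (mul_eq_zero.1 h1).resolve_left h.ne'
      exact Or.inl ⟨by rw [← h2, h3]; nlinarith, h, h3.ge⟩
    · exact Or.inr ⟨by rw [← h2, h]; nlinarith, h.ge, h'⟩
  · have h1 : 0 < A.re * A.im := by nlinarith [mul_pos hc hz]
    left
    rw [tau_of_ne_zero hc.ne']
    rcases hmem with h | ⟨h, h'⟩
    · exact ⟨hc, h, by nlinarith⟩
    · rw [h] at h1; simp at h1

theorem cocycleReal_eq_ite (g h : SL(2, ℝ)) : cocycleReal g h =
    if tau (g * h) * tau g < 0 ∧ tau (g * h) * tau h < 0 then -1 else 1 := by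
  rw [cocycleReal_eq, kubota, hilbertSymbol_real _ (mul_ne_zero (tau_ne_zero _) (tau_ne_zero _))]

/-- Quadrant arithmetic for (a + bi)(c + di), on the quadrants that occur in `tau_sign`; it fixes
the sign in `autJ_mul`. -/
theorem mul_region_pos_pos {a b c d : ℝ} (ha : 0 < a) (hb : 0 ≤ b) (hc : 0 < c) (hd : 0 ≤ d) :
    0 < a * d + b * c ∨ (a * d + b * c = 0 ∧ 0 < a * c - b * d) := by
  have hac := mul_pos ha hc
  rcases hb.eq_or_lt with rfl | hb
  · rcases hd.eq_or_lt with rfl | hd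
    · right; simpa using hac
    · left; nlinarith [mul_pos ha hd]
  · left; nlinarith [mul_pos hb hc, mul_nonneg ha.le hd]

theorem mul_region_neg_neg {a b c d : ℝ} (ha : 0 ≤ a) (hb : b < 0) (hc : 0 ≤ c) (hd : d < 0) :
    a * d + b * c < 0 ∨ (a * d + b * c = 0 ∧ a * c - b * d < 0) := by
  have hbd := mul_pos_of_neg_of_neg hb hd
  rcases ha.eq_or_lt with rfl | ha
  · rcases hc.eq_or_lt with rfl | hc
    · right; constructor <;> simp [hbd]
    · left; nlinarith [mul_neg_of_neg_of_pos hb hc]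
  · left; nlinarith [mul_neg_of_pos_of_neg ha hd, mul_nonpos_of_nonpos_of_nonneg hb.le hc]

theorem mul_region_pos_neg {a b c d : ℝ} (ha : 0 < a) (hb : 0 ≤ b) (hc : 0 ≤ c) (hd : d < 0) :
    0 < a * c - b * d ∨ (a * c - b * d = 0 ∧ a * d + b * c < 0) := by
  have had := mul_neg_of_pos_of_neg ha hd
  rcases hb.eq_or_lt with rfl | hb
  · rcases hc.eq_or_lt with rfl | hc
    · right; simpa using had
    · left; nlinarith [mul_pos ha hc]
  · left; nlinarith [mul_neg_of_pos_of_neg hb hd, mul_nonneg ha.le hc]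

/-- `J` is an automorphy factor for the double cover of `SL₂(ℝ)`. -/
theorem autJ_mul (g h : SL(2, ℝ)) (z : ℍ) :
    autJ g 1 (h • z) * autJ h 1 z = ((cocycleReal g h : ℤ) : ℂ) * autJ (g * h) 1 z := by
  have hsq : (autJ g 1 (h • z) * autJ h 1 z) ^ 2 = autJ (g * h) 1 z ^ 2 := by
    rw [mul_pow, autJ_sq, autJ_sq, autJ_sq, linDenom_mul]
  have hX := tau_sign g (h • z)
  have hY := tau_sign h z
  have hZ := tau_sign (g * h) z
  have hZm := autJ_mem (g * h) z
  rw [cocycleReal_eq_ite]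
  set X := autJ g 1 (h • z)
  set Y := autJ h 1 z
  set Z := autJ (g * h) 1 z
  have hre : (X * Y).re = X.re * Y.re - X.im * Y.im := Complex.mul_re _ _
  have him : (X * Y).im = X.re * Y.im + X.im * Y.re := Complex.mul_im _ _
  -- Both sides have the same square; which sign occurs is forced by the quadrants, and these record
  -- the signs of the three τ-values entering the cocycle.
  rcases sq_eq_sq_iff_eq_or_eq_neg.1 hsq with h1 | h1
  · rw [if_neg]
    · simp [h1]
    · rintro ⟨h2, h3⟩
      rw [h1] at hre him
      rcases hX with ⟨x1, x2, x3⟩ | ⟨x1, x2, x3⟩ <;> rcases hY with ⟨y1, y2, y3⟩ | ⟨y1, y2, y3⟩ <;>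
        rcases hZ with ⟨z1, z2, z3⟩ | ⟨z1, z2, z3⟩ <;> try nlinarith
      · rcases mul_region_neg_neg x2 x3 y2 y3 with h | ⟨h, h'⟩ <;> linarith
  · rw [if_pos]
    · simp [h1]
    · rw [h1, Complex.neg_re] at hre
      rw [h1, Complex.neg_im] at him
      rcases hX with ⟨x1, x2, x3⟩ | ⟨x1, x2, x3⟩ <;> rcases hY with ⟨y1, y2, y3⟩ | ⟨y1, y2, y3⟩
      · rcases hZ with ⟨z1, z2, z3⟩ | ⟨z1, z2, z3⟩
        · exfalso
          rcases mul_region_pos_pos x2 x3 y2 y3 with h | ⟨h, h'⟩ <;> linarith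
        · exact ⟨mul_neg_of_neg_of_pos z1 x1, mul_neg_of_neg_of_pos z1 y1⟩
      · exfalso
        rcases mul_region_pos_neg x2 x3 y2 y3 with h | ⟨h, h'⟩ <;>
          rcases hZm with h4 | ⟨h4, h5⟩ <;> linarith
      · exfalso
        rcases mul_region_pos_neg y2 y3 x2 x3 with h | ⟨h, h'⟩ <;>
          rcases hZm with h4 | ⟨h4, h5⟩ <;> linarith
      · rcases hZ with ⟨z1, z2, z3⟩ | ⟨z1, z2, z3⟩
        · exact ⟨mul_neg_of_pos_of_neg z1 x1, mul_neg_of_pos_of_neg z1 y1⟩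
        · exfalso
          rcases mul_region_neg_neg x2 x3 y2 y3 with h | ⟨h, h'⟩ <;> linarith

theorem norm_autJ_sq (g : SL(2, ℝ)) (z : ℍ) : ‖autJ g 1 z‖ ^ 2 = ‖linDenom g z‖ := by
  rw [← norm_pow, autJ_sq]

theorem autJ_one (z : ℍ) : autJ 1 1 z = 1 :=
  autJ_eq_of_sq (Or.inl (by simp)) (by rw [linDenom]; simp)

theorem mdifferentiable_autJ (g : SL(2, ℝ)) :
    MDifferentiable 𝓘(ℂ) 𝓘(ℂ) (fun z : ℍ => autJ g 1 z) := by
  by_cases hc : g 1 0 = 0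
  · have : (fun z : ℍ => autJ g 1 z) = fun _ => autJ g 1 UpperHalfPlane.I := by
      ext z
      rw [autJ_one_def, autJ_one_def, linDenom_of_eq_zero hc, linDenom_of_eq_zero hc]
    rw [this]
    exact mdifferentiable_const
  · have h1 : (fun z : ℍ => autJ g 1 z) = fun z => linDenom g z ^ (1 / 2 : ℂ) := by
      ext z; exact autJ_eq_cpow (Or.inl hc) z
    rw [h1, UpperHalfPlane.mdifferentiable_iff]
    intro w hw
    apply DifferentiableAt.differentiableWithinAt
    have h2 : ((fun z : ℍ => linDenom g z ^ (1 / 2 : ℂ)) ∘ ofComplex) =ᶠ[𝓝 w]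
        fun w => ((g 1 0 : ℂ) * w + g 1 1) ^ (1 / 2 : ℂ) := by
      filter_upwards [isOpen_upperHalfPlaneSet.mem_nhds hw] with v hv
      simp only [Function.comp_apply, linDenom, ofComplex_apply_of_im_pos hv]
    refine DifferentiableAt.congr_of_eventuallyEq ?_ h2
    refine DifferentiableAt.cpow (by fun_prop) (by fun_prop) ?_
    refine Complex.mem_slitPlane_iff.2 (Or.inr ?_)
    have : ((g 1 0 : ℂ) * w + g 1 1).im = g 1 0 * w.im := by simp
    rw [this]
    exact mul_ne_zero hc (ne_of_gt hw)

end AutJ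

/-! ### The slash operator of the real group -/

section SlashReal

/-- The weight `k + 1/2` slash operator of `SL₂(ℝ)`, a projective action. -/
noncomputable def slashReal (k : ℕ) (f : ℍ → ℂ) (g : SL(2, ℝ)) (z : ℍ) : ℂ :=
  f (g • z) * (autJ g 1 z ^ (2 * k + 1))⁻¹

theorem sign_pow_odd (ε : ℤˣ) (k : ℕ) : (((ε : ℤ) : ℂ)) ^ (2 * k + 1) = ((ε : ℤ) : ℂ) := by
  rcases Int.units_eq_one_or ε with rfl | rfl
  · simp
  · simp [pow_succ, pow_mul]

theorem sign_inv (ε : ℤˣ) : (((ε : ℤ) : ℂ))⁻¹ = ((ε : ℤ) : ℂ) := by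
  rcases Int.units_eq_one_or ε with rfl | rfl <;> simp

theorem sign_mul_self_complex (ε : ℤˣ) : ((ε : ℤ) : ℂ) * ((ε : ℤ) : ℂ) = 1 := by
  rcases Int.units_eq_one_or ε with rfl | rfl <;> simp

theorem slashReal_slashReal (k : ℕ) (f : ℍ → ℂ) (g h : SL(2, ℝ)) :
    slashReal k (slashReal k f g) h = ((cocycleReal g h : ℤ) : ℂ) • slashReal k f (g * h) := by
  ext z
  simp only [slashReal, Pi.smul_apply, smul_eq_mul]
  rw [mul_assoc, ← mul_inv, ← mul_pow, autJ_mul, mul_pow, mul_inv, sign_pow_odd, sign_inv,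
    mul_smul]
  ring

theorem slashReal_smul (k : ℕ) (c : ℂ) (f : ℍ → ℂ) (g : SL(2, ℝ)) :
    slashReal k (c • f) g = c • slashReal k f g := by
  ext z; simp [slashReal, mul_assoc]

theorem slashReal_add (k : ℕ) (f f' : ℍ → ℂ) (g : SL(2, ℝ)) :
    slashReal k (f + f') g = slashReal k f g + slashReal k f' g := by
  ext z; simp [slashReal, add_mul]

theorem slashReal_sum (k : ℕ) {ι : Type*} (s : Finset ι) (f : ι → ℍ → ℂ) (g : SL(2, ℝ)) :
    slashReal k (∑ i ∈ s, f i) g = ∑ i ∈ s, slashReal k (f i) g := by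
  ext z; simp [slashReal, Finset.sum_mul]

theorem slashReal_one (k : ℕ) (f : ℍ → ℂ) : slashReal k f 1 = f := by
  ext z; simp [slashReal, autJ_one]

theorem mdifferentiable_slashReal {k : ℕ} {f : ℍ → ℂ} (hf : MDifferentiable 𝓘(ℂ) 𝓘(ℂ) f)
    (g : SL(2, ℝ)) : MDifferentiable 𝓘(ℂ) 𝓘(ℂ) (slashReal k f g) := by
  have h1 : MDifferentiable 𝓘(ℂ) 𝓘(ℂ) fun z : ℍ => f (g • z) :=
    hf.comp (mdifferentiable_smul (g := (g : GL (Fin 2) ℝ)) (by simp))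
  have h2 : Differentiable ℂ fun w : ℂ => w ^ (2 * k + 1) := by fun_prop
  intro z
  have h3 : MDifferentiableAt 𝓘(ℂ) 𝓘(ℂ) (fun z : ℍ => (autJ g 1 z ^ (2 * k + 1))⁻¹) z := by
    have h4 : DifferentiableAt ℂ (fun w : ℂ => (w ^ (2 * k + 1))⁻¹) (autJ g 1 z) :=
      (h2 _).inv (pow_ne_zero _ (autJ_ne_zero g z))
    exact h4.mdifferentiableAt.comp z (mdifferentiable_autJ g z)
  exact (h1 z).mul h3

end SlashReal

/-! ### The splitting sign and the theta multiplier -/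

section Theta

/-- The embedding `SL₂(ℤ) → SL₂(ℚ)`. -/
def intToRat : SL(2, ℤ) →* SL(2, ℚ) := Matrix.SpecialLinearGroup.map (Int.castRingHom ℚ)

theorem intToRat_apply (δ : SL(2, ℤ)) (i j : Fin 2) : intToRat δ i j = ((δ i j : ℤ) : ℚ) := rfl

theorem SL2_det_int (g : SL(2, ℤ)) : g 0 0 * g 1 1 - g 0 1 * g 1 0 = 1 := by
  have := g.det_coe
  rwa [Matrix.det_fin_two] at this

/-- The contribution of the primes not dividing `c` to the reciprocity law. -/
theorem finprod_hilbert_eq_jacobi {c : ℤ} (hc2 : 2 ∣ c) (hc : c ≠ 0) (n : ℕ) (hn : n ≠ 0)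
    (hcop : IsCoprime c n) :
    ((∏ᶠ p : Nat.Primes, (if ((p : ℕ) : ℤ) ∣ c then 1 else hilbertSymbol (c : ℚ_[p]) (n : ℚ_[p])) :
      ℤˣ) : ℤ) = jacobiSym c n := by
  have odd_of : ∀ p : Nat.Primes, ¬ ((p : ℕ) : ℤ) ∣ c → (p : ℕ) ≠ 2 := by
    rintro p hp h; rw [h] at hp; exact hp hc2
  induction n using induction_on_primes with
  | zero => exact absurd rfl hn
  | one => simp
  | prime_mul q a hq ih =>
    have ha : a ≠ 0 := by rintro rfl; simp at hn
    rw [Nat.cast_mul] at hcop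
    have ih := ih ha hcop.of_mul_right_right
    have hqc : ¬ ((q : ℕ) : ℤ) ∣ c := by
      intro h
      have := hcop.of_mul_right_left.symm
      rw [(Nat.prime_iff_prime_int.1 hq).coprime_iff_not_dvd] at this
      exact this h
    have : Fact q.Prime := ⟨hq⟩
    rw [jacobiSym.mul_right' c hq.ne_zero ha, ← ih, ← jacobiSym.legendreSym.to_jacobiSym,
      ← hilbertSymbol_int_prime (odd_of ⟨q, hq⟩ hqc) hqc]
    have h1 : ∀ p : Nat.Primes, (if ((p : ℕ) : ℤ) ∣ c then 1 else
        hilbertSymbol (c : ℚ_[p]) ((q * a : ℕ) : ℚ_[p])) =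
        (if ((p : ℕ) : ℤ) ∣ c then 1 else hilbertSymbol (c : ℚ_[p]) (q : ℚ_[p])) *
        (if ((p : ℕ) : ℤ) ∣ c then 1 else hilbertSymbol (c : ℚ_[p]) (a : ℚ_[p])) := by
      intro p
      split_ifs with h
      · simp
      · rw [Nat.cast_mul, hilbertSymbol_mul_right] <;>
          simp [hc, ha, hq.ne_zero]
    have fin : ∀ m : ℕ, m ≠ 0 → (Function.mulSupport fun p : Nat.Primes =>
        (if ((p : ℕ) : ℤ) ∣ c then 1 else hilbertSymbol (c : ℚ_[p]) (m : ℚ_[p]))).Finite := by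
      intro m hm
      have := finite_mulSupport_hilbert (a := (c : ℚ)) (b := (m : ℚ)) (by exact_mod_cast hc)
        (by exact_mod_cast hm)
      refine this.subset fun p hp => ?_
      rw [Function.mem_mulSupport] at hp ⊢
      split_ifs at hp with h
      · exact absurd rfl hp
      · simpa using hp
    simp_rw [h1]
    rw [finprod_mul_distrib (fin q hq.ne_zero) (fin a ha), Units.val_mul]
    congr 2
    refine (finprod_eq_single (α := Nat.Primes) _ ⟨q, hq⟩ ?_).trans ?_
    · intro p hp
      split_ifs with h
      · rfl
      · have h2 := hilbertSymbol_int_of_not_dvd (odd_of p h) h (not_dvd_of_ne (q := ⟨q, hq⟩) hp)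
        simpa using h2
    · exact if_neg hqc

theorem one_one_eq_one_of_one_zero {δ : SL(2, ℤ)} (hc : δ 1 0 = 0) (hd : δ 1 1 % 4 = 1) :
    δ 1 1 = 1 := by
  have hdet := SL2_det_int δ
  rw [hc, mul_zero, sub_zero] at hdet
  rcases Int.eq_one_or_neg_one_of_mul_eq_one' hdet with h | h
  · exact h.2
  · rw [h.2] at hd; norm_num at hd

theorem norm_int_eq_one {p : ℕ} [Fact p.Prime] {n : ℤ} (h : ¬ (p : ℤ) ∣ n) : ‖(n : ℚ_[p])‖ = 1 :=
  le_antisymm (Padic.norm_int_le_one n) (not_lt.1 (Padic.norm_intCast_lt_one_iff.not.2 h))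

theorem norm_int_sub_one_le {p : Nat.Primes} {n : ℤ} (h : n % 4 = 1) :
    ‖(n : ℚ_[p]) - 1‖ ≤ ‖(4 : ℚ_[p])‖ := by
  obtain ⟨m, hm⟩ : ∃ m, n = 4 * m + 1 := ⟨n / 4, by omega⟩
  rw [hm]; push_cast
  rw [add_sub_cancel_right, norm_mul]
  exact mul_le_of_le_one_right (norm_nonneg _) (Padic.norm_int_le_one m)

theorem norm_int_le_of_dvd {p : Nat.Primes} {n m : ℤ} (h : n ∣ m) :
    ‖(m : ℚ_[p])‖ ≤ ‖(n : ℚ_[p])‖ := by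
  obtain ⟨l, rfl⟩ := h
  push_cast
  rw [norm_mul]
  exact mul_le_of_le_one_right (norm_nonneg _) (Padic.norm_int_le_one l)

/-- Writing s_p as (c, d)_p times a correction at the primes not dividing c prepares for the product
formula, which evaluates the uncorrected product. -/
theorem sPadic_int {p : Nat.Primes} {δ : SL(2, ℤ)} (hc : δ 1 0 ≠ 0) (hd : δ 1 1 % 4 = 1) :
    sPadic p (ratToPadic p (intToRat δ)) = hilbertSymbol ((δ 1 0 : ℤ) : ℚ_[p]) ((δ 1 1 : ℤ) : ℚ_[p])
      * (if ((p : ℕ) : ℤ) ∣ δ 1 0 then 1 else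
        hilbertSymbol ((δ 1 0 : ℤ) : ℚ_[p]) ((δ 1 1 : ℤ) : ℚ_[p])) := by
  have e10 : ratToPadic p (intToRat δ) 1 0 = ((δ 1 0 : ℤ) : ℚ_[p]) := by
    rw [ratToPadic_apply, intToRat_apply, Rat.cast_intCast]
  have e11 : ratToPadic p (intToRat δ) 1 1 = ((δ 1 1 : ℤ) : ℚ_[p]) := by
    rw [ratToPadic_apply, intToRat_apply, Rat.cast_intCast]
  split_ifs with h
  · have hcop : ¬ ((p : ℕ) : ℤ) ∣ δ 1 1 := by
      intro h'
      have h1 : ((p : ℕ) : ℤ) ∣ 1 := by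
        rw [← SL2_det_int δ]
        exact dvd_sub (h'.mul_left _) (h.mul_left _)
      exact (Nat.prime_iff_prime_int.1 p.2).not_isUnit (isUnit_of_dvd_one h1)
    rw [sPadic_of_unit, e10, e11, mul_one]
    · rw [e10]; exact_mod_cast hc
    · rw [e11]; exact norm_int_eq_one hcop
    · rw [e11]; exact norm_int_sub_one_le hd
  · rw [sPadic_of_even, Int.units_mul_self]
    rw [e10, valuation_eq_zero_of_norm_eq_one (norm_int_eq_one h)]
    exact Even.zero

/-- The splitting sign at an element of `Γ₁(4)` is Shimura's quadratic residue symbol. -/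
theorem splitSign_eq_shimuraSymbol {δ : SL(2, ℤ)} (hc4 : 4 ∣ δ 1 0) (hd : δ 1 1 % 4 = 1) :
    ((splitSign (intToRat δ) : ℤˣ) : ℤ) = shimuraSymbol (δ 1 0) (δ 1 1) := by
  have hdet := SL2_det_int δ
  by_cases hc : δ 1 0 = 0
  · have h1 : splitSign (intToRat δ) = 1 := by
      refine finprod_eq_one_of_forall_eq_one fun p => sPadic_of_eq_zero ?_
      rw [ratToPadic_apply, intToRat_apply, hc]; simp
    have h2 := one_one_eq_one_of_one_zero hc hd
    rw [h1, hc, h2]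
    simp [shimuraSymbol]
  · have hd0 : δ 1 1 ≠ 0 := by rintro h; rw [h] at hd; norm_num at hd
    have hcQ : ((δ 1 0 : ℤ) : ℚ) ≠ 0 := by exact_mod_cast hc
    have hdQ : ((δ 1 1 : ℤ) : ℚ) ≠ 0 := by exact_mod_cast hd0
    have hcop : IsCoprime (δ 1 0) ((δ 1 1).natAbs : ℤ) := by
      have : IsCoprime (δ 1 0) (δ 1 1) := ⟨-δ 0 1, δ 0 0, by linarith⟩
      rcases Int.natAbs_eq (δ 1 1) with h | h <;> rw [h] at this
      · exact this
      · exact (IsCoprime.neg_right_iff _ _).1 this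
    have hnat : (δ 1 1).natAbs ≠ 0 := by simpa using hd0
    have h1 := finprod_hilbert_eq_jacobi ((show (2 : ℤ) ∣ 4 by norm_num).trans hc4) hc
      (δ 1 1).natAbs hnat hcop
    have h2 : ∀ p : Nat.Primes, (if ((p : ℕ) : ℤ) ∣ δ 1 0 then 1 else
        hilbertSymbol ((δ 1 0 : ℤ) : ℚ_[p]) (((δ 1 1).natAbs : ℕ) : ℚ_[p])) =
        (if ((p : ℕ) : ℤ) ∣ δ 1 0 then 1 else
        hilbertSymbol ((δ 1 0 : ℤ) : ℚ_[p]) ((δ 1 1 : ℤ) : ℚ_[p])) := by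
      intro p
      split_ifs with h
      · rfl
      · have hp : (p : ℕ) ≠ 2 := by
          intro h2
          rw [h2] at h
          exact h ((show (2 : ℤ) ∣ 4 by norm_num).trans hc4)
        have h3 : (((δ 1 1).natAbs : ℕ) : ℚ_[p]) = (((δ 1 1).natAbs : ℤ) : ℚ_[p]) := by
          rw [Int.cast_natCast]
        rw [h3]
        rcases Int.natAbs_eq (δ 1 1) with h4 | h4
        · rw [← h4]
        · conv_rhs => rw [h4, Int.cast_neg]
          rw [hilbertSymbol_neg_right]
          · have h5 : hilbertSymbol ((δ 1 0 : ℤ) : ℚ_[p]) (-1) = 1 :=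
              hilbertSymbol_units_of_ne_two hp (norm_int_eq_one h) (by simp)
            rw [h5, one_mul]
          · exact_mod_cast hc
          · exact_mod_cast hnat
    simp_rw [h2] at h1
    have hfin1 : (Function.mulSupport fun p : Nat.Primes =>
        hilbertSymbol ((δ 1 0 : ℤ) : ℚ_[p]) ((δ 1 1 : ℤ) : ℚ_[p])).Finite := by
      simpa using finite_mulSupport_hilbert hcQ hdQ
    have h3 := globalHilbert_eq_one hcQ hdQ
    unfold globalHilbert at h3
    simp only [Rat.cast_intCast] at h3
    -- The full product of (c, d)_p is (c, d)_∞ by reciprocity, and the corrections form a Jacobi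
    -- symbol. The real symbol is the extra sign in Shimura's definition when c and d are both
    -- negative.
    have h4 : splitSign (intToRat δ) = hilbertSymbol ((δ 1 0 : ℤ) : ℝ) ((δ 1 1 : ℤ) : ℝ) *
        ∏ᶠ p : Nat.Primes, (if ((p : ℕ) : ℤ) ∣ δ 1 0 then 1 else
          hilbertSymbol ((δ 1 0 : ℤ) : ℚ_[p]) ((δ 1 1 : ℤ) : ℚ_[p])) := by
      unfold splitSign
      simp_rw [sPadic_int hc hd]
      rw [finprod_mul_distrib hfin1]
      · congr 1
        exact (mul_eq_one_iff_eq_inv.1 ((mul_comm _ _).trans h3)).trans (by simp)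
      · refine hfin1.subset fun p hp => ?_
        rw [Function.mem_mulSupport] at hp ⊢
        split_ifs at hp with h
        · exact absurd rfl hp
        · exact hp
    rw [h4, Units.val_mul, h1, hilbertSymbol_real _ (by exact_mod_cast hd0)]
    unfold shimuraSymbol
    simp only [Int.cast_lt_zero]
    split_ifs <;> simp

/-- For w in the upper half plane the principal argument of -w is arg w - π, and half of π gives the
factor -i. -/
theorem neg_zero_iff_conj {w : ℂ} (hw : 0 < w.im) :
    (-w) ^ (1 / 2 : ℂ) = -Complex.I * w ^ (1 / 2 : ℂ) := by
  have hw0 : w ≠ 0 := by rintro rfl; simp at hw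
  have him : (-w).im < 0 := by simpa using hw
  have h1 : Complex.log (-w) = Complex.log w - Real.pi * Complex.I := by
    apply Complex.ext
    · simp [Complex.log_re]
    · have := Complex.arg_neg_eq_arg_sub_pi_of_im_pos hw
      simp [Complex.log_im, this]
  rw [Complex.cpow_def_of_ne_zero (neg_ne_zero.2 hw0), Complex.cpow_def_of_ne_zero hw0, h1,
    show (Complex.log w - Real.pi * Complex.I) * (1 / 2) =
      -(Real.pi / 2 * Complex.I) + Complex.log w * (1 / 2) by ring, Complex.exp_add,
    Complex.exp_neg, Complex.exp_pi_div_two_mul_I, Complex.inv_I]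

theorem epsilonFactor_neg {d : ℤ} (hd : d % 4 = 1) : epsilonFactor (-d) = Complex.I :=
  if_neg (by omega)

theorem shimuraSymbol_neg_neg {c d : ℤ} (hd : d % 4 = 1) :
    shimuraSymbol (-c) (-d) = if c ≤ 0 then shimuraSymbol c d else -shimuraSymbol c d := by
  have hJ := jacobiSym.neg c (b := d.natAbs) (by rw [Nat.odd_iff]; omega)
  unfold shimuraSymbol
  rw [Int.natAbs_neg, hJ]
  rcases lt_trichotomy d 0 with h | h | h
  · have : d.natAbs % 4 = 3 := by omega
    rw [ZMod.χ₄_nat_three_mod_four this]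
    rcases lt_trichotomy c 0 with h' | h' | h'
    · simp [h, h', h'.le, h'.not_gt, h.not_gt]
    · subst h'
      rcases eq_or_ne d.natAbs 1 with h1 | h1
      · omega
      · have h2 : 1 < d.natAbs := by omega
        simp [jacobiSym.zero_left h2]
    · simp [h, h', h'.not_ge, h'.not_gt, h.not_gt]
  · omega
  · have : d.natAbs % 4 = 1 := by omega
    rw [ZMod.χ₄_nat_one_mod_four this]
    rcases lt_trichotomy c 0 with h' | h' | h'
    · simp [h, h', h'.le, h'.not_gt, h.not_gt]
    · subst h'; simp
    · simp [h, h', h'.not_ge, h'.not_gt, h.not_gt]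

/-- The changes of ε_d, of the quadratic symbol and of the branch of the root compensate. Hence only
the elements with d ≡ 1 modulo 4 need to be studied, where ε_d = 1. -/
theorem thetaFactor_neg {δ : SL(2, ℤ)} (hd : δ 1 1 % 4 = 1) (z : ℍ) :
    thetaFactor (-δ) z = thetaFactor δ z := by
  have e10 : (-δ) 1 0 = -δ 1 0 := rfl
  have e11 : (-δ) 1 1 = -δ 1 1 := rfl
  have him : ((δ 1 0 : ℂ) * (z : ℂ) + (δ 1 1 : ℂ)).im = δ 1 0 * z.im := by simp
  have hz := z.im_pos
  unfold thetaFactor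
  rw [e10, e11, epsilonFactor_neg hd, shimuraSymbol_neg_neg hd, epsilonFactor, if_pos hd]
  push_cast
  rw [show -(δ 1 0 : ℂ) * (z : ℂ) + -(δ 1 1 : ℂ) = -((δ 1 0 : ℂ) * (z : ℂ) + (δ 1 1 : ℂ)) by ring]
  set w := (δ 1 0 : ℂ) * (z : ℂ) + (δ 1 1 : ℂ) with hw
  rcases lt_trichotomy (δ 1 0) 0 with h | h | h
  · rw [if_pos h.le]
    have h1 : 0 < (-w).im := by
      rw [Complex.neg_im, him]
      have : ((δ 1 0 : ℤ) : ℝ) < 0 := by exact_mod_cast h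
      nlinarith
    have h2 := neg_zero_iff_conj h1
    rw [neg_neg] at h2
    rw [h2, Complex.inv_I]
    ring
  · rw [if_pos h.le]
    have h2 := one_one_eq_one_of_one_zero h hd
    have hw1 : w = 1 := by rw [hw, h, h2]; simp
    rw [hw1, Complex.one_cpow]
    have : (-1 : ℂ) ^ (1 / 2 : ℂ) = Complex.I := by
      rw [Complex.cpow_def_of_ne_zero (by simp), Complex.log_neg_one,
        show (Real.pi : ℂ) * Complex.I * (1 / 2) = Real.pi / 2 * Complex.I by ring,
        Complex.exp_pi_div_two_mul_I]
    rw [this]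
    have hI := Complex.I_ne_zero
    field_simp
  · rw [if_neg h.not_ge]
    have h1 : 0 < w.im := by
      rw [him]
      have : (0 : ℝ) < ((δ 1 0 : ℤ) : ℝ) := by exact_mod_cast h
      exact mul_pos this hz
    rw [neg_zero_iff_conj h1, Complex.inv_I]
    linear_combination (-(shimuraSymbol (δ 1 0) (δ 1 1) : ℂ) * w ^ (1 / 2 : ℂ)) * Complex.I_mul_I

/-- For d ≡ 1 modulo 4 the case c = 0 > d, where the two branches of the square root disagree, does
not occur. So the theta multiplier is the splitting sign of s_ℚ. -/
theorem thetaFactor_eq {δ : SL(2, ℤ)} (hc4 : 4 ∣ δ 1 0) (hd : δ 1 1 % 4 = 1) (z : ℍ) :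
    thetaFactor δ z =
      ((splitSign (intToRat δ) : ℤ) : ℂ) * autJ (ratToReal (intToRat δ)) 1 z := by
  have e10 : ratToReal (intToRat δ) 1 0 = ((δ 1 0 : ℤ) : ℝ) := by
    rw [ratToReal_apply, intToRat_apply, Rat.cast_intCast]
  have e11 : ratToReal (intToRat δ) 1 1 = ((δ 1 1 : ℤ) : ℝ) := by
    rw [ratToReal_apply, intToRat_apply, Rat.cast_intCast]
  have h : ratToReal (intToRat δ) 1 0 ≠ 0 ∨ 0 < ratToReal (intToRat δ) 1 1 := by
    rw [e10, e11]
    by_cases hc : δ 1 0 = 0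
    · right
      rw [one_one_eq_one_of_one_zero hc hd]; norm_num
    · left; exact_mod_cast hc
  rw [autJ_eq_cpow h, splitSign_eq_shimuraSymbol hc4 hd, thetaFactor, epsilonFactor, if_pos hd,
    linDenom, e10, e11]
  simp

end Theta

/-! ### The group `Γ₀(N) ∩ Γ₁(4)` -/

section Level

/-- The group `Γ₀(N) ∩ Γ₁(4)`. -/
def levelInt (N : ℕ) : Subgroup SL(2, ℤ) :=
  CongruenceSubgroup.Gamma0 N ⊓ CongruenceSubgroup.Gamma1 4

variable {N : ℕ}

theorem mem_Gamma0_iff {δ : SL(2, ℤ)} : δ ∈ CongruenceSubgroup.Gamma0 N ↔ (N : ℤ) ∣ δ 1 0 := by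
  rw [CongruenceSubgroup.Gamma0_mem, ZMod.intCast_zmod_eq_zero_iff_dvd]

theorem mem_levelInt_iff (hN : 4 ∣ N) {δ : SL(2, ℤ)} :
    δ ∈ levelInt N ↔ (N : ℤ) ∣ δ 1 0 ∧ δ 1 1 % 4 = 1 := by
  have h1 : ∀ n : ℤ, (n : ZMod 4) = 1 ↔ n % 4 = 1 := by
    intro n
    have : (1 : ZMod 4) = ((1 : ℤ) : ZMod 4) := by simp
    rw [this, ZMod.intCast_eq_intCast_iff']
    norm_num
  have h2 := SL2_det_int δ
  rw [levelInt, Subgroup.mem_inf, mem_Gamma0_iff, CongruenceSubgroup.Gamma1_mem, h1, h1]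
  refine and_congr_right fun h => ⟨fun h' => h'.2.1, fun h' => ?_⟩
  have h4 : (4 : ℤ) ∣ δ 1 0 := (by exact_mod_cast hN : (4 : ℤ) ∣ N).trans h
  refine ⟨?_, h', ?_⟩
  · obtain ⟨m, hm⟩ := h4
    rw [hm] at h2
    obtain ⟨n, hn⟩ : ∃ n, δ 1 1 = 4 * n + 1 := ⟨δ 1 1 / 4, by omega⟩
    rw [hn] at h2
    have : δ 0 0 = 1 + 4 * (δ 0 1 * m - δ 0 0 * n) := by linear_combination h2
    omega
  · exact_mod_cast (ZMod.intCast_zmod_eq_zero_iff_dvd _ 4).2 h4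

theorem four_dvd_of_mem (hN : 4 ∣ N) {δ : SL(2, ℤ)} (h : δ ∈ levelInt N) : 4 ∣ δ 1 0 :=
  (by exact_mod_cast hN : (4 : ℤ) ∣ N).trans ((mem_levelInt_iff hN).1 h).1

theorem zero_zero_of_mem (hN : 4 ∣ N) {δ : SL(2, ℤ)} (h : δ ∈ levelInt N) : δ 0 0 % 4 = 1 := by
  have := ((mem_levelInt_iff hN).1 (inv_mem h)).2
  rwa [Matrix.SpecialLinearGroup.SL2_inv_expl] at this

/-- Every element of `Γ₀(N)` is, up to sign, in `Γ₀(N) ∩ Γ₁(4)`. -/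
theorem mem_or_neg_mem (hN : 4 ∣ N) {δ : SL(2, ℤ)} (h : δ ∈ CongruenceSubgroup.Gamma0 N) :
    δ ∈ levelInt N ∨ -δ ∈ levelInt N := by
  rw [mem_levelInt_iff hN, mem_levelInt_iff hN]
  rw [mem_Gamma0_iff] at h
  have e10 : (-δ) 1 0 = -δ 1 0 := rfl
  have e11 : (-δ) 1 1 = -δ 1 1 := rfl
  rw [e10, e11]
  have h4 : (4 : ℤ) ∣ δ 1 0 := (by exact_mod_cast hN : (4 : ℤ) ∣ N).trans h
  have h2 := SL2_det_int δ
  obtain ⟨m, hm⟩ := h4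
  have hodd : δ 1 1 % 2 ≠ 0 := by
    intro h'
    obtain ⟨n, hn⟩ : ∃ n, δ 1 1 = 2 * n := ⟨δ 1 1 / 2, by omega⟩
    rw [hm, hn] at h2
    have : 2 * (δ 0 0 * n - 2 * (δ 0 1 * m)) = 1 := by linear_combination h2
    omega
  have : δ 1 1 % 4 = 1 ∨ δ 1 1 % 4 = 3 := by omega
  rcases this with h' | h'
  · exact Or.inl ⟨h, h'⟩
  · exact Or.inr ⟨(dvd_neg).2 h, by omega⟩

theorem norm_natCast_le_four (hN : 4 ∣ N) (p : Nat.Primes) :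
    ‖(N : ℚ_[p])‖ ≤ ‖(4 : ℚ_[p])‖ := by
  have := norm_int_le_of_dvd (p := p) (n := 4) (m := N) (by exact_mod_cast hN)
  simpa using this

/-- The open subgroup of `SL₂` of the finite adeles given by `c ≡ 0 (mod N)`,
`a ≡ d ≡ 1 (mod 4)`. -/
def levelFin (N : ℕ) : Subgroup SL2FiniteAdele where
  carrier := {κ | ∀ q : Nat.Primes, κ q ∈ gammaZeroPadic q (N : ℚ_[q]) ⊓ gammaOneFour q}
  one_mem' := fun q => by rw [RestrictedProduct.one_apply]; exact one_mem _
  mul_mem' := fun ha hb q => by rw [RestrictedProduct.mul_apply]; exact mul_mem (ha q) (hb q)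
  inv_mem' := fun ha q => by rw [RestrictedProduct.inv_apply]; exact inv_mem (ha q)

theorem K1Adelic_subset (hN : 4 ∣ N) {κ : SL2FiniteAdele} (h : κ ∈ K1Adelic N) :
    κ ∈ levelFin N := by
  intro q
  obtain ⟨h1, h2, h3, h4⟩ := h q
  have := norm_natCast_le_four hN q
  exact ⟨⟨h1, h2⟩, ⟨h1, h2.trans this⟩, h3.trans this, h4.trans this⟩

theorem ratDiagonal_apply (α : SL(2, ℚ)) (q : Nat.Primes) : ratDiagonal α q = ratToPadic q α := rfl

theorem ratDiagonal_mem (hN : 4 ∣ N) {δ : SL(2, ℤ)} (h : δ ∈ levelInt N) :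
    ratDiagonal (intToRat δ) ∈ levelFin N := by
  intro q
  have e : ∀ i j, ratToPadic q (intToRat δ) i j = ((δ i j : ℤ) : ℚ_[q]) := by
    intro i j
    rw [ratToPadic_apply, intToRat_apply, Rat.cast_intCast]
  rw [ratDiagonal_apply]
  have h1 : ratToPadic q (intToRat δ) ∈ SL2Zp q := by
    rw [mem_SL2Zp]; intro i j; rw [e]; exact Padic.norm_int_le_one _
  have h2 := (mem_levelInt_iff hN).1 h
  refine ⟨⟨h1, ?_⟩, ⟨h1, ?_⟩, ?_, ?_⟩
  · rw [e]; simpa using norm_int_le_of_dvd (p := q) h2.1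
  · rw [e]; simpa using norm_int_le_of_dvd (p := q) (four_dvd_of_mem hN h)
  · rw [e]; exact norm_int_sub_one_le (zero_zero_of_mem hN h)
  · rw [e]; exact norm_int_sub_one_le h2.2

theorem exists_int_of_norm_le_one {x : ℚ} (h : ∀ p : Nat.Primes, ‖(x : ℚ_[p])‖ ≤ 1) :
    ∃ n : ℤ, x = n := by
  have h1 : x.den = 1 := by
    by_contra hne
    obtain ⟨p, hp, hpd⟩ := Nat.exists_prime_and_dvd hne
    have : Fact p.Prime := ⟨hp⟩
    have h2 := h ⟨p, hp⟩
    have hden : ‖((x.den : ℤ) : ℚ_[p])‖ < 1 :=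
      Padic.norm_intCast_lt_one_iff.2 (by exact_mod_cast hpd)
    have hnum : ‖((x.num : ℤ) : ℚ_[p])‖ = 1 := by
      apply norm_int_eq_one
      intro hn
      have := x.reduced
      have h4 : p ∣ Nat.gcd x.num.natAbs x.den :=
        Nat.dvd_gcd (Int.natCast_dvd.1 hn) hpd
      rw [this] at h4
      exact hp.one_lt.ne' (Nat.dvd_one.1 h4)
    have h5 : (x : ℚ_[p]) * ((x.den : ℤ) : ℚ_[p]) = ((x.num : ℤ) : ℚ_[p]) := by
      have : x * x.den = x.num := Rat.mul_den_eq_num x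
      exact_mod_cast congrArg (fun q : ℚ => (q : ℚ_[p])) this
    have h6 := congrArg norm h5
    rw [norm_mul, hnum] at h6
    have : ‖(x : ℚ_[p])‖ * ‖((x.den : ℤ) : ℚ_[p])‖ < 1 :=
      mul_lt_one_of_nonneg_of_lt_one_right h2 (norm_nonneg _) hden
    linarith
  exact ⟨x.num, by rw [← Rat.num_div_den x]; simp [h1]⟩

theorem int_dvd_of_norm_le {n m : ℤ} (hn : n ≠ 0) (h : ∀ p : Nat.Primes, ‖(m : ℚ_[p])‖ ≤ ‖(n : ℚ_[p])‖) :
    n ∣ m := by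
  obtain ⟨l, hl⟩ := exists_int_of_norm_le_one (x := (m : ℚ) / n) (by
    intro p
    push_cast
    rw [norm_div]
    have : 0 < ‖(n : ℚ_[p])‖ := norm_pos_iff.2 (by exact_mod_cast hn)
    rw [div_le_one this]
    exact h p)
  refine ⟨l, ?_⟩
  have hn' : (n : ℚ) ≠ 0 := by exact_mod_cast hn
  rw [div_eq_iff hn'] at hl
  have : m = l * n := by exact_mod_cast hl
  rw [this, mul_comm]

/-- A rational matrix whose finite components lie in the level group is integral. -/
theorem exists_levelInt (hN : 4 ∣ N) (hN0 : N ≠ 0) {β : SL(2, ℚ)} (h : ratDiagonal β ∈ levelFin N) :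
    -- The conclusion places δ in Γ₀(N) ∩ Γ₁(4), where the multiplier is known.
    ∃ δ ∈ levelInt N, β = intToRat δ := by
  have h1 : ∀ i j, ∃ n : ℤ, β i j = n := fun i j =>
    exists_int_of_norm_le_one fun p => mem_SL2Zp.1 (h p).1.1 i j
  choose m hm using h1
  let δ : SL(2, ℤ) := ⟨Matrix.of m, by
    have := SL2_det β
    rw [hm, hm, hm, hm] at this
    rw [Matrix.det_fin_two]
    exact_mod_cast this⟩
  have e : β = intToRat δ := by
    ext i j
    exact hm i j
  refine ⟨δ, (mem_levelInt_iff hN).2 ⟨?_, ?_⟩, e⟩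
  · apply int_dvd_of_norm_le (by exact_mod_cast hN0)
    intro p
    have := (h p).1.2
    rw [ratDiagonal_apply, ratToPadic_apply, e, intToRat_apply, Rat.cast_intCast] at this
    simpa using this
  · have : (4 : ℤ) ∣ δ 1 1 - 1 := by
      apply int_dvd_of_norm_le (by norm_num)
      intro p
      have := (h p).2.2.2
      rw [ratDiagonal_apply, ratToPadic_apply, e, intToRat_apply, Rat.cast_intCast] at this
      simpa using this
    omega

theorem cocycleFinite_eq_one_of_mem {κ κ' : SL2FiniteAdele} (h : κ ∈ levelFin N)
    (h' : κ' ∈ levelFin N) : cocycleFinite κ κ' = 1 :=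
  cocycleFinite_eq_one fun p => cocyclePadic_eq_one (h p).2 (h' p).2

theorem splitSign_mul_of_mem (hN : 4 ∣ N) {δ δ' : SL(2, ℤ)} (h : δ ∈ levelInt N)
    (h' : δ' ∈ levelInt N) : splitSign (intToRat (δ * δ')) = splitSign (intToRat δ) *
      splitSign (intToRat δ') * cocycleReal (ratToReal (intToRat δ)) (ratToReal (intToRat δ')) := by
  rw [map_mul, splitSign_mul, cocycleFinite_eq_one_of_mem (ratDiagonal_mem hN h)
    (ratDiagonal_mem hN h'), mul_one]

end Level

/-! ### Cusp forms in terms of the slash operator -/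

section Cusp

/-- The embedding `SL₂(ℤ) → SL₂(ℝ)`. -/
noncomputable def intToReal : SL(2, ℤ) →* SL(2, ℝ) := ratToReal.comp intToRat

theorem intToReal_eq (δ : SL(2, ℤ)) : intToReal δ = ratToReal (intToRat δ) := rfl

theorem intToReal_apply (δ : SL(2, ℤ)) (i j : Fin 2) : intToReal δ i j = ((δ i j : ℤ) : ℝ) := by
  rw [intToReal_eq, ratToReal_apply, intToRat_apply, Rat.cast_intCast]

theorem toGL_intToReal (δ : SL(2, ℤ)) :
    Matrix.SpecialLinearGroup.toGL (intToReal δ) = Matrix.SpecialLinearGroup.mapGL ℝ δ := by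
  ext i j
  simp [intToReal_apply]

theorem toGL_smul (g : SL(2, ℝ)) (z : ℍ) :
    (Matrix.SpecialLinearGroup.toGL g : GL (Fin 2) ℝ) • z = g • z := by
  have : Matrix.SpecialLinearGroup.mapGL ℝ g = Matrix.SpecialLinearGroup.toGL g := by
    ext i j; simp
  rw [← this]
  rfl

theorem neg_smul_SL2 (g : SL(2, ℝ)) (z : ℍ) : (-g) • z = g • z := by
  rw [← toGL_smul, ← toGL_smul, ← UpperHalfPlane.neg_smul]
  congr 1
  ext i j; simp

/-- The element `(g, t J(g, z))` of Shimura's group. -/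
noncomputable def shimuraElt (g : SL(2, ℝ)) (t : ℂ) (ht : ‖t‖ = 1) : ShimuraGroup where
  mat := Matrix.SpecialLinearGroup.toGL g
  aut := fun z => t * autJ g 1 z
  det_pos := by simp
  holo := mdifferentiable_const.mul (mdifferentiable_autJ g)
  sq := ⟨t ^ 2, by rw [norm_pow, ht, one_pow], fun z => by
    rw [mul_pow, autJ_sq, linDenom_eq]; simp⟩

theorem norm_sign (ε : ℤˣ) : ‖((ε : ℤ) : ℂ)‖ = 1 := by
  rcases Int.units_eq_one_or ε with rfl | rfl <;> simp

variable {k N : ℕ}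

theorem slash_eq_of_aut {f : ℍ → ℂ} {ξ : ShimuraGroup} {g : SL(2, ℝ)} {t : ℂ}
    (hmat : ∀ z : ℍ, ξ.mat • z = g • z) (haut : ∀ z, ξ.aut z = t * autJ g 1 z) :
    slash k f ξ = (t ^ (2 * k + 1))⁻¹ • slashReal k f g := by
  ext z
  simp only [slash, slashReal, Pi.smul_apply, smul_eq_mul, hmat, haut, mul_pow, mul_inv]
  ring

/-- Membership in `Δ₀(N)` in terms of `Γ₀(N) ∩ Γ₁(4)`. -/
theorem mem_Delta0_iff (hN : 4 ∣ N) {ξ : ShimuraGroup} : ξ ∈ Delta0 N ↔ ∃ δ ∈ levelInt N,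
    (ξ.mat = Matrix.SpecialLinearGroup.mapGL ℝ δ ∨
      ξ.mat = Matrix.SpecialLinearGroup.mapGL ℝ (-δ)) ∧
    ∀ z, ξ.aut z = ((splitSign (intToRat δ) : ℤ) : ℂ) * autJ (intToReal δ) 1 z := by
  constructor
  · rintro ⟨α, hα, hmat, haut⟩
    rcases mem_or_neg_mem hN hα with h | h
    · refine ⟨α, h, Or.inl hmat, fun z => ?_⟩
      rw [haut, thetaFactor_eq (four_dvd_of_mem hN h) ((mem_levelInt_iff hN).1 h).2, intToReal_eq]
    · refine ⟨-α, h, Or.inr (by rw [hmat, neg_neg]), fun z => ?_⟩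
      have h2 := ((mem_levelInt_iff hN).1 h).2
      have h3 := thetaFactor_neg h2 z
      rw [neg_neg] at h3
      rw [haut, h3, thetaFactor_eq (four_dvd_of_mem hN h) h2, intToReal_eq]
  · rintro ⟨δ, hδ, hmat, haut⟩
    have h2 := ((mem_levelInt_iff hN).1 hδ).2
    have h4 := four_dvd_of_mem hN hδ
    rcases hmat with hmat | hmat
    · exact ⟨δ, hδ.1, hmat, fun z => by rw [haut, thetaFactor_eq h4 h2, intToReal_eq]⟩
    · refine ⟨-δ, ?_, hmat, fun z => by rw [haut, thetaFactor_neg h2, thetaFactor_eq h4 h2,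
        intToReal_eq]⟩
      rw [mem_Gamma0_iff]
      exact dvd_neg.2 (mem_Gamma0_iff.1 hδ.1)

theorem intToReal_neg (δ : SL(2, ℤ)) : intToReal (-δ) = -intToReal δ := by
  ext i j
  have : (-intToReal δ) i j = -(intToReal δ i j) := rfl
  rw [this, intToReal_apply, intToReal_apply]
  have : (-δ) i j = -(δ i j) := rfl
  rw [this]; push_cast; rfl

theorem slash_of_mem_Delta0 {f : ℍ → ℂ} {ξ : ShimuraGroup} {δ : SL(2, ℤ)}
    (hmat : ξ.mat = Matrix.SpecialLinearGroup.mapGL ℝ δ ∨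
      ξ.mat = Matrix.SpecialLinearGroup.mapGL ℝ (-δ))
    (haut : ∀ z, ξ.aut z = ((splitSign (intToRat δ) : ℤ) : ℂ) * autJ (intToReal δ) 1 z) :
    slash k f ξ = ((splitSign (intToRat δ) : ℤ) : ℂ) • slashReal k f (intToReal δ) := by
  rw [slash_eq_of_aut (g := intToReal δ) _ haut, sign_pow_odd, sign_inv]
  intro z
  rcases hmat with h | h
  · rw [h, ← toGL_intToReal, toGL_smul]
  · rw [h, ← toGL_intToReal, toGL_smul, intToReal_neg, neg_smul_SL2]

/-- Invariance under `Γ₀(N) ∩ Γ₁(4)` for the theta multiplier. -/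
def ThetaInvariant (k N : ℕ) (f : ℍ → ℂ) : Prop :=
  ∀ δ ∈ levelInt N, slashReal k f (intToReal δ) = ((splitSign (intToRat δ) : ℤ) : ℂ) • f

theorem invariant_iff (hN : 4 ∣ N) {f : ℍ → ℂ} :
    (∀ ξ ∈ Delta0 N, slash k f ξ = f) ↔ ThetaInvariant k N f := by
  constructor
  · intro h δ hδ
    have hm : shimuraElt (intToReal δ) ((splitSign (intToRat δ) : ℤ) : ℂ) (norm_sign _) ∈
        Delta0 N :=
      (mem_Delta0_iff hN).2 ⟨δ, hδ, Or.inl (toGL_intToReal δ), fun z => rfl⟩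
    have h1 := h _ hm
    rw [slash_of_mem_Delta0 (δ := δ) (Or.inl (toGL_intToReal δ)) fun z => rfl] at h1
    conv_rhs => rw [← h1]
    rw [smul_smul, sign_mul_self_complex, one_smul]
  · intro h ξ hξ
    obtain ⟨δ, hδ, hmat, haut⟩ := (mem_Delta0_iff hN).1 hξ
    rw [slash_of_mem_Delta0 hmat haut, h δ hδ, smul_smul, sign_mul_self_complex, one_smul]

theorem isZeroAtImInfty_congr_norm {f g : ℍ → ℂ} (h : ∀ z, ‖f z‖ = ‖g z‖)
    (hf : IsZeroAtImInfty f) : IsZeroAtImInfty g := by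
  unfold IsZeroAtImInfty ZeroAtFilter at *
  rw [tendsto_zero_iff_norm_tendsto_zero] at hf ⊢
  exact hf.congr h

theorem norm_aut_of_mat {ξ : ShimuraGroup} {g : SL(2, ℝ)}
    (hmat : ξ.mat = Matrix.SpecialLinearGroup.toGL g) (z : ℍ) : ‖ξ.aut z‖ = ‖autJ g 1 z‖ := by
  obtain ⟨t, ht, h⟩ := ξ.sq
  have h1 := congrArg norm (h z)
  have h2 : ξ.mat.det.val = 1 := by rw [hmat]; simp
  rw [h2, norm_pow, norm_mul, norm_mul, ht, hmat, ← linDenom_eq, ← norm_autJ_sq] at h1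
  simp only [Real.one_rpow, Complex.ofReal_one, norm_one, one_mul] at h1
  exact (sq_eq_sq₀ (norm_nonneg _) (norm_nonneg _)).1 h1

/-- Vanishing at a cusp concerns absolute values only, and the absolute value of an automorphy
factor is determined by its matrix; one lift per matrix suffices. -/
theorem isCuspForm_iff (hN : 4 ∣ N) {f : ℍ → ℂ} : f ∈ cuspForms k N ↔
    MDifferentiable 𝓘(ℂ) 𝓘(ℂ) f ∧ ThetaInvariant k N f ∧
      ∀ α : SL(2, ℤ), IsZeroAtImInfty (slashReal k f (intToReal α)) := by
  constructor
  · intro h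
    refine ⟨h.holo, (invariant_iff hN).1 h.invariant, fun α => ?_⟩
    have := h.zero_at_cusps (shimuraElt (intToReal α) 1 (by simp)) ⟨α, toGL_intToReal α⟩
    refine isZeroAtImInfty_congr_norm (fun z => ?_) this
    simp only [slash, slashReal, shimuraElt, toGL_smul, one_mul]
  · rintro ⟨h1, h2, h3⟩
    refine ⟨h1, (invariant_iff hN).2 h2, ?_⟩
    rintro ξ ⟨α, hα⟩
    refine isZeroAtImInfty_congr_norm (fun z => ?_) (h3 α)
    rw [← toGL_intToReal] at hα
    rw [slash, slashReal, norm_mul, norm_mul, norm_inv, norm_inv, norm_pow, norm_pow,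
      norm_aut_of_mat hα, hα, toGL_smul]

theorem norm_slashReal_slashReal (f : ℍ → ℂ) (g h : SL(2, ℝ)) (z : ℍ) :
    ‖slashReal k (slashReal k f g) h z‖ = ‖slashReal k f (g * h) z‖ := by
  rw [slashReal_slashReal, Pi.smul_apply, norm_smul, norm_sign, one_mul]

theorem isZeroAtImInfty_slashReal_upper {f : ℍ → ℂ} (hf : IsZeroAtImInfty f) {g : SL(2, ℝ)}
    (hg : g 1 0 = 0) : IsZeroAtImInfty (slashReal k f g) := by
  have h1 : Tendsto (fun z : ℍ => g • z) atImInfty atImInfty := by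
    have := tendsto_smul_atImInfty (g := Matrix.SpecialLinearGroup.toGL g) hg
    simpa only [toGL_smul] using this
  have h2 : (slashReal k f g) = fun z : ℍ => f (g • z) * (autJ g 1 UpperHalfPlane.I ^ (2 * k + 1))⁻¹ := by
    ext z
    rw [slashReal, autJ_one_def, autJ_one_def, linDenom_of_eq_zero hg, linDenom_of_eq_zero hg]
  rw [h2]
  have h3 := (Tendsto.comp hf h1).mul_const (autJ g 1 UpperHalfPlane.I ^ (2 * k + 1))⁻¹
  rwa [zero_mul] at h3

/-- A rational matrix is the product of an integral one and an upper triangular one. -/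
theorem exists_int_mul_upper (α : SL(2, ℚ)) : ∃ γ : SL(2, ℤ), ((intToRat γ)⁻¹ * α) 1 0 = 0 := by
  obtain ⟨x, y, r, hcop, hx, hy⟩ : ∃ (x y : ℤ) (r : ℚ), IsCoprime x y ∧ α 0 0 = r * x ∧
      α 1 0 = r * y := by
    by_cases hc : α 1 0 = 0
    · exact ⟨1, 0, α 0 0, isCoprime_one_left, by simp, by simp [hc]⟩
    · set s := α 0 0 / α 1 0
      refine ⟨s.num, s.den, α 1 0 / s.den, s.isCoprime_num_den, ?_, ?_⟩
      · have h1 : (s.num : ℚ) / s.den = α 0 0 / α 1 0 := Rat.num_div_den s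
        have h2 : (s.den : ℚ) ≠ 0 := by exact_mod_cast s.den_ne_zero
        field_simp at h1 ⊢
        linarith
      · have h2 : (s.den : ℚ) ≠ 0 := by exact_mod_cast s.den_ne_zero
        push_cast
        field_simp
  obtain ⟨u, v, huv⟩ := hcop
  obtain ⟨γ, h00, h10⟩ : ∃ γ : SL(2, ℤ), γ 0 0 = x ∧ γ 1 0 = y :=
    ⟨⟨!![x, -v; y, u], by rw [Matrix.det_fin_two_of]; linarith⟩, rfl, rfl⟩
  refine ⟨γ, ?_⟩
  rw [SL2_mul_one_zero, SL2_inv_10, SL2_inv_11, hx, hy, intToRat_apply, intToRat_apply, h00, h10]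
  ring

/-- A rational matrix is integral times upper triangular, and an upper triangular matrix preserves
the filter at i∞ while having a constant automorphy factor. -/
theorem isZeroAtImInfty_slashReal_rat {f : ℍ → ℂ}
    (hf : ∀ α : SL(2, ℤ), IsZeroAtImInfty (slashReal k f (intToReal α))) (α : SL(2, ℚ)) :
    IsZeroAtImInfty (slashReal k f (ratToReal α)) := by
  obtain ⟨γ, hγ⟩ := exists_int_mul_upper α
  have h1 : ratToReal α = intToReal γ * ratToReal ((intToRat γ)⁻¹ * α) := by
    rw [intToReal_eq, ← map_mul, mul_inv_cancel_left]
  refine isZeroAtImInfty_congr_norm (fun z => ?_) (isZeroAtImInfty_slashReal_upper (k := k) (hf γ)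
    (g := ratToReal ((intToRat γ)⁻¹ * α)) (by rw [ratToReal_apply, hγ, Rat.cast_zero]))
  rw [norm_slashReal_slashReal, h1]

end Cusp

/-! ### Automorphic functions on the adelic double cover -/

section Approximation

variable {N : ℕ}

theorem exists_nat_approx {p : ℕ} [Fact p.Prime] {x : ℚ_[p]} (hx : ‖x‖ ≤ 1) {r : ℝ} (hr : 0 < r) :
    ∃ n : ℕ, ‖(n : ℚ_[p]) - x‖ ≤ r := by
  obtain ⟨x, rfl⟩ : ∃ y : ℤ_[p], (y : ℚ_[p]) = x := ⟨⟨x, hx⟩, rfl⟩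
  obtain ⟨n, hn⟩ := (PadicInt.denseRange_natCast (p := p)).exists_dist_lt x hr
  refine ⟨n, ?_⟩
  rw [dist_comm, dist_eq_norm, PadicInt.norm_def] at hn
  push_cast at hn
  exact hn.le

theorem four_dvd_of_norm_le {n : ℤ} (h : ‖(n : ℚ_[two])‖ ≤ ‖(4 : ℚ_[two])‖) : 4 ∣ n := by
  have h5 : ‖(4 : ℚ_[2])‖ = (2 : ℝ) ^ (-(2 : ℕ) : ℤ) := by rw [norm_four_eq]; norm_num
  have h6 : ‖(n : ℚ_[2])‖ ≤ ‖(4 : ℚ_[2])‖ := h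
  rw [h5] at h6
  have h7 := (Padic.norm_int_le_pow_iff_dvd (p := 2) n 2).1 (by exact_mod_cast h6)
  norm_num at h7
  exact h7

/-- The Chinese remainder theorem at the primes dividing N; elsewhere |N| = 1 and the condition is
integrality. -/
theorem exists_int_approx (hN0 : N ≠ 0) (a : ∀ q : Nat.Primes, ℚ_[q]) (ha : ∀ q, ‖a q‖ ≤ 1) :
    ∃ d : ℤ, ∀ q : Nat.Primes, ‖(d : ℚ_[q]) - a q‖ ≤ ‖(N : ℚ_[q])‖ := by
  have h1 : ∀ q : Nat.Primes, ∃ n : ℕ, ‖(n : ℚ_[q]) - a q‖ ≤ ‖(N : ℚ_[q])‖ := by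
    intro q
    exact exists_nat_approx (ha q) (norm_pos_iff.2 (by exact_mod_cast hN0))
  choose n hn using h1
  let s : Nat.Primes → ℕ := fun q => (q : ℕ) ^ N.factorization q
  let t : Finset Nat.Primes := Finset.subtype Nat.Prime N.primeFactors
  have hs : ∀ i ∈ t, s i ≠ 0 :=
    fun i _ => pow_ne_zero _ i.2.ne_zero
  have pp : Set.Pairwise (t : Set Nat.Primes)
      (Function.onFun Nat.Coprime s) := by
    intro i _ j _ hij
    exact Nat.Coprime.pow _ _ ((Nat.coprime_primes i.2 j.2).2 fun h => hij (Subtype.ext h))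
  obtain ⟨d, hd⟩ := Nat.chineseRemainderOfFinset n s _ hs pp
  refine ⟨d, fun q => ?_⟩
  by_cases hq : (q : ℕ) ∣ N
  · have h2 := hd q (Finset.mem_subtype.2 (Nat.mem_primeFactors.2 ⟨q.2, hq, hN0⟩))
    have h3 : ((s q : ℕ) : ℤ) ∣ (d : ℤ) - n q := (Nat.modEq_iff_dvd.1 h2.symm)
    have h4 := norm_int_le_of_dvd (p := q) h3
    have h5 : ‖(N : ℚ_[q])‖ = ‖((s q : ℕ) : ℚ_[q])‖ := by
      conv_lhs => rw [← Nat.ordProj_mul_ordCompl_eq_self N q, Nat.cast_mul, norm_mul]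
      have : ‖(((N / (q : ℕ) ^ N.factorization q : ℕ) : ℤ) : ℚ_[q])‖ = 1 := by
        apply norm_int_eq_one
        rw [Int.natCast_dvd_natCast]
        exact Nat.not_dvd_ordCompl q.2 hN0
      rw [Int.cast_natCast] at this
      rw [this, mul_one]
    rw [h5, show ((d : ℤ) : ℚ_[q]) - a q = (((d : ℤ) - n q : ℤ) : ℚ_[q]) + ((n q : ℚ_[q]) - a q) by
      push_cast; ring]
    apply norm_add_le_of_le
    · rw [Int.cast_natCast] at h4; exact h4
    · rw [← h5]; exact hn q
  · have : ‖((N : ℤ) : ℚ_[q])‖ = 1 := norm_int_eq_one (by rwa [Int.natCast_dvd_natCast])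
    rw [Int.cast_natCast] at this
    rw [this]
    exact norm_sub_le_of_le (Padic.norm_int_le_one _) (ha q)

/-- Φ_f is defined through `K1Adelic`, but is wanted on the larger group with a ≡ d ≡ 1 only modulo
4. An integral matrix with lower row (N, d) and d approximating the upper left entries of κ corrects
the difference. -/
theorem exists_levelInt_mul_mem (hN : 4 ∣ N) (hN0 : N ≠ 0) {κ : SL2FiniteAdele}
    (hκ : κ ∈ levelFin N) : ∃ δ ∈ levelInt N, ratDiagonal (intToRat δ) * κ ∈ K1Adelic N := by
  have hint : ∀ q i j, ‖κ q i j‖ ≤ 1 := fun q => mem_SL2Zp.1 (hκ q).1.1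
  have hN1 : ∀ q : Nat.Primes, ‖(N : ℚ_[q])‖ ≤ 1 := fun q => by
    simpa using Padic.norm_int_le_one (p := q) N
  obtain ⟨d, hd⟩ := exists_int_approx hN0 (fun q => κ q 0 0) fun q => hint q 0 0
  have hdκ : ∀ q : Nat.Primes, ‖(d : ℚ_[q]) * κ q 1 1 - 1‖ ≤ ‖(N : ℚ_[q])‖ := by
    intro q
    have h1 := SL2_det (κ q)
    rw [show (d : ℚ_[q]) * κ q 1 1 - 1 = (d - κ q 0 0) * κ q 1 1 + κ q 0 1 * κ q 1 0 by
      linear_combination h1]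
    exact norm_add_le_of_le (norm_mul_le_of_le_one_right (hd q) (hint q 1 1))
      (norm_mul_le_of_le_one_left (hint q 0 1) (hκ q).1.2)
  -- At a common prime divisor d κ₁₁ would be both a nonunit and congruent to 1.
  have hcop : IsCoprime (N : ℤ) d := by
    rw [Int.isCoprime_iff_gcd_eq_one]
    by_contra hne
    obtain ⟨p, hp, hpd⟩ := Nat.exists_prime_and_dvd hne
    have : Fact p.Prime := ⟨hp⟩
    have hpN : (p : ℤ) ∣ N := (Int.natCast_dvd_natCast.2 hpd).trans (Int.gcd_dvd_left _ _)
    have hpd' : (p : ℤ) ∣ d := (Int.natCast_dvd_natCast.2 hpd).trans (Int.gcd_dvd_right _ _)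
    have h1 : ‖((N : ℤ) : ℚ_[p])‖ < 1 := Padic.norm_intCast_lt_one_iff.2 hpN
    have h2 : ‖(d : ℚ_[p])‖ < 1 := Padic.norm_intCast_lt_one_iff.2 hpd'
    rw [Int.cast_natCast] at h1
    have h3 := norm_eq_one_of_norm_sub_one_lt ((hdκ ⟨p, hp⟩).trans_lt h1)
    have h4 : ‖(d : ℚ_[p]) * κ ⟨p, hp⟩ 1 1‖ < 1 := by
      rw [norm_mul]
      exact mul_lt_one_of_nonneg_of_lt_one_left (norm_nonneg _) h2 (hint ⟨p, hp⟩ 1 1)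
    exact absurd h3 h4.ne
  obtain ⟨u, v, huv⟩ := hcop
  obtain ⟨δ, h10, h11⟩ : ∃ δ : SL(2, ℤ), δ 1 0 = N ∧ δ 1 1 = d :=
    ⟨⟨!![v, -u; N, d], by rw [Matrix.det_fin_two_of]; linarith⟩, rfl, rfl⟩
  have e : ∀ q i j, ratToPadic q (intToRat δ) i j = ((δ i j : ℤ) : ℚ_[q]) := by
    intro q i j
    rw [ratToPadic_apply, intToRat_apply, Rat.cast_intCast]
  have hδ : δ ∈ levelInt N := by
    rw [mem_levelInt_iff hN]
    refine ⟨by rw [h10], ?_⟩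
    have h6 : 4 ∣ d - 1 := by
      apply four_dvd_of_norm_le
      rw [show ((d - 1 : ℤ) : ℚ_[two]) = (d - κ two 0 0) + (κ two 0 0 - 1) by push_cast; ring]
      exact norm_add_le_of_le ((hd two).trans (norm_natCast_le_four hN two)) (hκ two).2.2.1
    rw [h11]
    omega
  refine ⟨δ, hδ, fun q => ?_⟩
  have hmem := mul_mem (ratDiagonal_mem hN hδ) hκ q
  obtain ⟨⟨m1, m2⟩, -, -, -⟩ := hmem
  have m4 : ‖(ratDiagonal (intToRat δ) * κ) q 1 1 - 1‖ ≤ ‖(N : ℚ_[q])‖ := by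
    rw [RestrictedProduct.mul_apply, ratDiagonal_apply, SL2_mul_one_one, e, e, h10, h11, add_sub_assoc]
    refine norm_add_le_of_le (norm_mul_le_of_le_one_right ?_ (hint q 0 1)) (hdκ q)
    rw [Int.cast_natCast]
  refine ⟨m1, m2, ?_, m4⟩
  set g := (ratDiagonal (intToRat δ) * κ) q
  have hg := mem_SL2Zp.1 m1
  have hdet := SL2_det g
  rw [show g 0 0 - 1 = -(g 0 0 * (g 1 1 - 1)) + g 0 1 * g 1 0 by linear_combination hdet]
  refine norm_add_le_of_le ?_ (norm_mul_le_of_le_one_left (hg 0 1) m2)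
  rw [norm_neg]
  exact norm_mul_le_of_le_one_left (hg 0 0) m4

end Approximation

/-! ### Automorphy of Φ_f and the passage back to functions on the upper half plane -/

section Automorphic

variable {k N : ℕ}

theorem rationalSplitting_mul_mk (α : SL(2, ℚ)) (x : SL(2, ℝ)) (κ : SL2FiniteAdele) (ε : ℤˣ) :
    rationalSplitting α * ⟨x, κ, ε⟩ = ⟨ratToReal α * x, ratDiagonal α * κ,
      splitSign α * ε * (cocycleReal (ratToReal α) x * cocycleFinite (ratDiagonal α) κ)⟩ := rfl

theorem rationalSplitting_mul_of_mem (hN : 4 ∣ N) {δ : SL(2, ℤ)} (hδ : δ ∈ levelInt N)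
    (x : SL(2, ℝ)) (ε : ℤˣ) {κ : SL2FiniteAdele} (hκ : κ ∈ levelFin N) :
    rationalSplitting (intToRat δ) * (ofReal x ε * ofFinite κ) =
      ofReal (intToReal δ * x)
        (splitSign (intToRat δ) * ε * cocycleReal (intToReal δ) x) *
      ofFinite (ratDiagonal (intToRat δ) * κ) := by
  rw [ofReal_mul_ofFinite, ofReal_mul_ofFinite, rationalSplitting_mul_mk,
    cocycleFinite_eq_one_of_mem (ratDiagonal_mem hN hδ) hκ, mul_one]
  rfl

theorem rationalSplitting_inv_mul (α : SL(2, ℚ)) (g : AdelicCover) :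
    rationalSplitting α⁻¹ * (rationalSplitting α * g) = g := by
  rw [← mul_assoc, ← rationalSplitting_mul, inv_mul_cancel, rationalSplitting_one, one_mul]

theorem ThetaInvariant.slashReal_mul {f : ℍ → ℂ} (hf : ThetaInvariant k N f) {δ : SL(2, ℤ)}
    (hδ : δ ∈ levelInt N) (x : SL(2, ℝ)) :
    slashReal k f (intToReal δ * x) =
      (((splitSign (intToRat δ) * cocycleReal (intToReal δ) x : ℤˣ) : ℤ) : ℂ) • slashReal k f x := by
  have h1 := slashReal_slashReal k f (intToReal δ) x
  rw [hf δ hδ, slashReal_smul] at h1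
  rw [Units.val_mul, Int.cast_mul, mul_comm, mul_smul, h1, smul_smul, sign_mul_self_complex,
    one_smul]

/-- The values on two decompositions of the same element agree. -/
theorem decomposition_unique (hN : 4 ∣ N) (hN0 : N ≠ 0) {f : ℍ → ℂ} (hf : ThetaInvariant k N f)
    {α α' : SL(2, ℚ)} {x x' : SL(2, ℝ)} {ε ε' : ℤˣ} {κ κ' : SL2FiniteAdele}
    (hκ : κ ∈ levelFin N) (hκ' : κ' ∈ levelFin N)
    (h : rationalSplitting α * ofReal x ε * ofFinite κ =
      rationalSplitting α' * ofReal x' ε' * ofFinite κ') :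
    ((ε : ℤ) : ℂ) * slashReal k f x UpperHalfPlane.I =
      ((ε' : ℤ) : ℂ) * slashReal k f x' UpperHalfPlane.I := by
  have h1 : rationalSplitting (α'⁻¹ * α) * (ofReal x ε * ofFinite κ) = ofReal x' ε' * ofFinite κ' := by
    rw [mul_assoc, mul_assoc] at h
    rw [rationalSplitting_mul, mul_assoc, h, rationalSplitting_inv_mul]
  -- The two rational parts differ by a matrix whose finite components lie in the level group, hence
  -- by some δ in Γ₀(N) ∩ Γ₁(4); theta invariance of f then matches the real parts.
  have h2 : ratDiagonal (α'⁻¹ * α) ∈ levelFin N := by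
    have : ratDiagonal (α'⁻¹ * α) * κ = κ' := by
      rw [ofReal_mul_ofFinite, ofReal_mul_ofFinite] at h1
      exact congrArg AdelicCover.fin h1
    rw [eq_mul_inv_of_mul_eq this]
    exact mul_mem hκ' (inv_mem hκ)
  obtain ⟨δ, hδ, hβ⟩ := exists_levelInt hN hN0 h2
  rw [hβ, rationalSplitting_mul_of_mem hN hδ x ε hκ, ofReal_mul_ofFinite, ofReal_mul_ofFinite,
    AdelicCover.mk.injEq] at h1
  obtain ⟨hx, -, hε⟩ := h1
  rw [← hx, ← hε, hf.slashReal_mul hδ, Pi.smul_apply, smul_eq_mul, ← mul_assoc, ← Int.cast_mul,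
    ← Units.val_mul]
  congr 3
  calc ε = ε * (splitSign (intToRat δ) * splitSign (intToRat δ)) *
        (cocycleReal (intToReal δ) x * cocycleReal (intToReal δ) x) := by
        rw [Int.units_mul_self, Int.units_mul_self, mul_one, mul_one]
    _ = _ := by simp only [mul_assoc, mul_comm, mul_left_comm]

/-- The choice in `adelicLift` is harmless, and the finite part may be any element of `levelFin`, a
group, rather than of `K1Adelic`. -/
theorem adelicLift_eq (hN : 4 ∣ N) (hN0 : N ≠ 0) {f : ℍ → ℂ} (hf : ThetaInvariant k N f)
    (α : SL(2, ℚ)) (x : SL(2, ℝ)) (ε : ℤˣ) {κ : SL2FiniteAdele} (hκ : κ ∈ levelFin N) :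
    adelicLift k N f (rationalSplitting α * ofReal x ε * ofFinite κ) =
      ((ε : ℤ) : ℂ) * slashReal k f x UpperHalfPlane.I := by
  have H : ∃ y : SL(2, ℝ) × ℤˣ, ∃ β : SL(2, ℚ), ∃ κ' ∈ K1Adelic N,
      rationalSplitting α * ofReal x ε * ofFinite κ =
        rationalSplitting β * ofReal y.1 y.2 * ofFinite κ' := by
    obtain ⟨δ, hδ, hκ'⟩ := exists_levelInt_mul_mem hN hN0 hκ
    refine ⟨⟨intToReal δ * x, splitSign (intToRat δ) * ε * cocycleReal (intToReal δ) x⟩,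
      α * (intToRat δ)⁻¹, _, hκ', ?_⟩
    rw [mul_assoc, mul_assoc, ← rationalSplitting_mul_of_mem hN hδ x ε hκ,
      rationalSplitting_mul, mul_assoc, rationalSplitting_inv_mul]
  unfold adelicLift
  rw [dif_pos H]
  obtain ⟨β, κ', hκ', h⟩ := H.choose_spec
  rw [decomposition_unique hN hN0 hf hκ (K1Adelic_subset hN hκ') h, autJ_eq, mul_pow, mul_inv,
    sign_pow_odd, sign_inv, slashReal]
  ring

/-- The elements of the adelic cover that decompose as `s_ℚ(α) g_∞ κ`. -/
def IsDecomposable (N : ℕ) (g : AdelicCover) : Prop :=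
  ∃ (α : SL(2, ℚ)) (x : SL(2, ℝ)) (ε : ℤˣ), ∃ κ ∈ levelFin N,
    g = rationalSplitting α * ofReal x ε * ofFinite κ

/-- Decomposability is preserved by all the actions considered, so the extension by zero is
automorphic without knowing that every element decomposes. -/
theorem adelicLift_eq_zero (hN : 4 ∣ N) {f : ℍ → ℂ} {g : AdelicCover} (hg : ¬ IsDecomposable N g) :
    adelicLift k N f g = 0 :=
  dif_neg fun ⟨x, α, κ, hκ, h⟩ => hg ⟨α, x.1, x.2, κ, K1Adelic_subset hN hκ, h⟩

theorem IsDecomposable.left {g : AdelicCover} (h : IsDecomposable N g) (β : SL(2, ℚ)) :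
    IsDecomposable N (rationalSplitting β * g) := by
  obtain ⟨α, x, ε, κ, hκ, rfl⟩ := h
  exact ⟨β * α, x, ε, κ, hκ, by rw [rationalSplitting_mul]; simp only [mul_assoc]⟩

theorem IsDecomposable.right {g : AdelicCover} (h : IsDecomposable N g) {κ' : SL2FiniteAdele}
    (hκ' : κ' ∈ levelFin N) : IsDecomposable N (g * ofFinite κ') := by
  obtain ⟨α, x, ε, κ, hκ, rfl⟩ := h
  exact ⟨α, x, ε, κ * κ', mul_mem hκ hκ', by
    rw [mul_assoc, ofFinite_mul_ofFinite (fun p => (hκ p).2) fun p => (hκ' p).2]⟩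

theorem decomposition_mul_ofReal (α : SL(2, ℚ)) (x y : SL(2, ℝ)) (ε δ : ℤˣ) (κ : SL2FiniteAdele) :
    rationalSplitting α * ofReal x ε * ofFinite κ * ofReal y δ =
      rationalSplitting α * ofReal (x * y) (ε * δ * cocycleReal x y) * ofFinite κ := by
  rw [mul_assoc, ofFinite_mul_ofReal, ← mul_assoc, mul_assoc (rationalSplitting α),
    ofReal_mul_ofReal]

theorem IsDecomposable.ofReal {g : AdelicCover} (h : IsDecomposable N g) (y : SL(2, ℝ)) (δ : ℤˣ) :
    IsDecomposable N (g * KohnenPlus.ofReal y δ) := by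
  obtain ⟨α, x, ε, κ, hκ, rfl⟩ := h
  exact ⟨α, _, _, κ, hκ, decomposition_mul_ofReal α x y ε δ κ⟩

theorem ofReal_one_one : ofReal 1 1 = 1 := rfl

theorem ofFinite_one : ofFinite 1 = 1 := rfl

theorem ofReal_mul_inv (y : SL(2, ℝ)) (δ : ℤˣ) :
    ofReal y δ * ofReal y⁻¹ (δ * cocycleReal y y⁻¹) = 1 := by
  rw [ofReal_mul_ofReal, mul_inv_cancel, sign_mul_cancel_left, Int.units_mul_self, ofReal_one_one]

theorem ofFinite_mul_inv {κ : SL2FiniteAdele} (hκ : κ ∈ levelFin N) :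
    ofFinite κ * ofFinite κ⁻¹ = 1 := by
  rw [ofFinite_mul_ofFinite (fun p => (hκ p).2) fun p => (inv_mem hκ p).2, mul_inv_cancel,
    ofFinite_one]

/-- Genuine functions on the adelic double cover that are left invariant under `SL₂(ℚ)`, right
invariant under the level group, and of weight `k + 1/2` at the infinite place. -/
structure IsAutomorphic (k N : ℕ) (Φ : AdelicCover → ℂ) : Prop where
  left : ∀ α g, Φ (rationalSplitting α * g) = Φ g
  right : ∀ κ ∈ levelFin N, ∀ g, Φ (g * ofFinite κ) = Φ g
  weight : ∀ r : SL(2, ℝ), r • UpperHalfPlane.I = UpperHalfPlane.I → ∀ ε g,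
    Φ (g * ofReal r ε) = ((ε : ℤ) : ℂ) * (autJ r 1 UpperHalfPlane.I ^ (2 * k + 1))⁻¹ * Φ g

theorem isAutomorphic_adelicLift (hN : 4 ∣ N) (hN0 : N ≠ 0) {f : ℍ → ℂ}
    (hf : ThetaInvariant k N f) : IsAutomorphic k N (adelicLift k N f) where
  left β g := by
    by_cases h : IsDecomposable N g
    · obtain ⟨α, x, ε, κ, hκ, rfl⟩ := h
      rw [adelicLift_eq hN hN0 hf _ _ _ hκ, ← mul_assoc, ← mul_assoc, ← rationalSplitting_mul,
        adelicLift_eq hN hN0 hf _ _ _ hκ]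
    · rw [adelicLift_eq_zero hN h, adelicLift_eq_zero hN]
      intro h'
      have := h'.left β⁻¹
      rw [rationalSplitting_inv_mul] at this
      exact h this
  right κ' hκ' g := by
    by_cases h : IsDecomposable N g
    · obtain ⟨α, x, ε, κ, hκ, rfl⟩ := h
      rw [adelicLift_eq hN hN0 hf _ _ _ hκ, mul_assoc,
        ofFinite_mul_ofFinite (fun p => (hκ p).2) fun p => (hκ' p).2,
        adelicLift_eq hN hN0 hf _ _ _ (mul_mem hκ hκ')]
    · rw [adelicLift_eq_zero hN h, adelicLift_eq_zero hN]
      intro h'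
      have := h'.right (inv_mem hκ')
      rw [mul_assoc, ofFinite_mul_inv hκ', mul_one] at this
      exact h this
  weight r hr δ g := by
    by_cases h : IsDecomposable N g
    · obtain ⟨α, x, ε, κ, hκ, rfl⟩ := h
      rw [decomposition_mul_ofReal, adelicLift_eq hN hN0 hf _ _ _ hκ,
        adelicLift_eq hN hN0 hf _ _ _ hκ]
      have h1 := congrFun (slashReal_slashReal k f x r) UpperHalfPlane.I
      rw [Pi.smul_apply, smul_eq_mul, slashReal, hr] at h1
      rw [Units.val_mul, Units.val_mul, Int.cast_mul, Int.cast_mul, mul_assoc, ← h1]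
      ring
    · rw [adelicLift_eq_zero hN h, adelicLift_eq_zero hN, mul_zero]
      intro h'
      have := h'.ofReal r⁻¹ (δ * cocycleReal r r⁻¹)
      rw [mul_assoc, ofReal_mul_inv, mul_one] at this
      exact h this

variable {Φ : AdelicCover → ℂ}

/-- An arbitrary x and the chosen matrix sending i to x·i differ by the stabilizer of i, on which
the weight condition prescribes Φ. -/
theorem IsAutomorphic.ofReal_eq (hΦ : IsAutomorphic k N Φ) (x : SL(2, ℝ)) (ε : ℤˣ) :
    Φ (ofReal x ε) = ((ε : ℤ) : ℂ) * slashReal k (classicalForm k Φ) x UpperHalfPlane.I := by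
  set z : ℍ := x • UpperHalfPlane.I with hz
  set g := z.toSL2R with hg
  set r := g⁻¹ * x with hr
  have hx : g * r = x := by rw [hr, mul_inv_cancel_left]
  have hrI : r • UpperHalfPlane.I = UpperHalfPlane.I := by
    rw [hr, mul_smul, ← hz, inv_smul_eq_iff, hg, toSL2R_smul_I]
  have h1 : ofReal x ε = ofReal g 1 * ofReal r (ε * cocycleReal g r) := by
    rw [ofReal_mul_ofReal, one_mul, mul_assoc, Int.units_mul_self, mul_one, hx]
  have h2 := autJ_mul g r UpperHalfPlane.I
  rw [hrI, hx] at h2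
  have h3 : (autJ x 1 UpperHalfPlane.I ^ (2 * k + 1))⁻¹ = ((cocycleReal g r : ℤ) : ℂ) *
      ((autJ g 1 UpperHalfPlane.I ^ (2 * k + 1))⁻¹ * (autJ r 1 UpperHalfPlane.I ^ (2 * k + 1))⁻¹) := by
    rw [← mul_inv, ← mul_pow, h2, mul_pow, mul_inv, sign_pow_odd, sign_inv, ← mul_assoc,
      sign_mul_self_complex, one_mul]
  have h4 : autJ g 1 UpperHalfPlane.I ^ (2 * k + 1) ≠ 0 := pow_ne_zero _ (autJ_ne_zero _ _)
  rw [h1, hΦ.weight r hrI, slashReal, ← hz, classicalForm, ← hg, h3, Units.val_mul, Int.cast_mul]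
  field_simp

/-- In Φ(s_ℚ(δ)g) = Φ(g) the finite components of δ are absorbed by the level group; the splitting
sign and the real cocycle remain, and these form the theta multiplier. -/
theorem IsAutomorphic.thetaInvariant (hN : 4 ∣ N) (hΦ : IsAutomorphic k N Φ) :
    ThetaInvariant k N (classicalForm k Φ) := by
  intro δ hδ
  ext z
  set g := z.toSL2R with hg
  have h1 := hΦ.left (intToRat δ) (ofReal g 1 * ofFinite 1)
  rw [rationalSplitting_mul_of_mem hN hδ g 1 (one_mem _), hΦ.right _ (one_mem _),
    hΦ.right _ (mul_mem (ratDiagonal_mem hN hδ) (one_mem _)), hΦ.ofReal_eq, hΦ.ofReal_eq] at h1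
  have h2 := congrFun (slashReal_slashReal k (classicalForm k Φ) (intToReal δ) g) UpperHalfPlane.I
  have h3 : autJ g 1 UpperHalfPlane.I ^ (2 * k + 1) ≠ 0 := pow_ne_zero _ (autJ_ne_zero _ _)
  have h4 : ∀ F : ℍ → ℂ, slashReal k F g UpperHalfPlane.I =
      F z * (autJ g 1 UpperHalfPlane.I ^ (2 * k + 1))⁻¹ := fun F => by
    rw [slashReal, hg, toSL2R_smul_I]
  rw [Pi.smul_apply, smul_eq_mul] at h2
  rw [mul_one, Units.val_mul, Int.cast_mul, mul_assoc, ← h2, h4, h4, Units.val_one, Int.cast_one, one_mul, ← mul_assoc] at h1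
  have h5 := mul_right_cancel₀ (inv_ne_zero h3) h1
  rw [Pi.smul_apply, smul_eq_mul, ← h5, ← mul_assoc, sign_mul_self_complex, one_mul]

theorem classicalForm_adelicLift (hN : 4 ∣ N) (hN0 : N ≠ 0) {f : ℍ → ℂ}
    (hf : ThetaInvariant k N f) : classicalForm k (adelicLift k N f) = f := by
  ext z
  have h1 := adelicLift_eq hN hN0 hf 1 z.toSL2R 1 (one_mem (levelFin N))
  rw [rationalSplitting_one, one_mul, ofFinite_one, mul_one] at h1
  have h3 : autJ z.toSL2R 1 UpperHalfPlane.I ^ (2 * k + 1) ≠ 0 :=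
    pow_ne_zero _ (autJ_ne_zero _ _)
  rw [classicalForm, h1, slashReal, toSL2R_smul_I, Units.val_one, Int.cast_one, one_mul,
    inv_mul_cancel_right₀ h3]

end Automorphic

/-! ### The character of `S` and the functions supported on double cosets -/

section Gamma

variable {k : ℕ}

theorem norm_four_two : ‖(4 : ℚ_[two])‖ = 4⁻¹ := norm_four_eq

theorem norm_two_two : ‖(2 : ℚ_[two])‖ = 2⁻¹ := norm_two_eq

/-- The group `K₀²(4)` as a subgroup. -/
noncomputable def gammaZeroFour : Subgroup SL(2, ℚ_[two]) := gammaZeroPadic two 4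

theorem mem_gammaZeroFour {g : SL(2, ℚ_[two])} : g ∈ gammaZeroFour ↔ g ∈ K0four := Iff.rfl

theorem gammaOneFour_le {g : SL(2, ℚ_[two])} (h : g ∈ gammaOneFour two) : g ∈ gammaZeroFour := h.1

theorem norm_units_of_K0four {g : SL(2, ℚ_[two])} (hg : g ∈ gammaZeroFour) :
    ‖g 0 0‖ = 1 ∧ ‖g 1 1‖ = 1 := by
  have h1 := mem_SL2Zp.1 hg.1
  have h2 : ‖g 0 1 * g 1 0‖ < 1 := by
    refine (norm_mul_le_of_le_one_left (h1 0 1) hg.2).trans_lt ?_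
    rw [norm_four_two]; norm_num
  have h3 : ‖g 0 0 * g 1 1‖ = 1 := by
    apply norm_eq_one_of_norm_sub_one_lt
    rw [show g 0 0 * g 1 1 - 1 = g 0 1 * g 1 0 by linear_combination SL2_det g]
    exact h2
  rw [norm_mul] at h3
  have ha := h1 0 0
  have hd := h1 1 1
  constructor
  · refine le_antisymm ha ?_
    by_contra h
    have := mul_lt_one_of_nonneg_of_lt_one_left (norm_nonneg _) (not_le.1 h) hd
    linarith
  · refine le_antisymm hd ?_
    by_contra h
    have := mul_lt_one_of_nonneg_of_lt_one_right ha (norm_nonneg _) (not_le.1 h)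
    linarith

theorem mem_K1four_iff {g : SL(2, ℚ_[two])} : g ∈ K1four ↔ g ∈ gammaOneFour two := by
  constructor
  · rintro ⟨h, ha⟩
    refine ⟨h, ha, ?_⟩
    have h1 := mem_SL2Zp.1 h.1
    rw [show g 1 1 - 1 = -((g 0 0 - 1) * g 1 1) + g 0 1 * g 1 0 by linear_combination SL2_det g]
    refine norm_add_le_of_le ?_ (norm_mul_le_of_le_one_left (h1 0 1) h.2)
    rw [norm_neg]
    exact norm_mul_le_of_le_one_right ha (h1 1 1)
  · exact fun h => ⟨h.1, h.2.1⟩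

theorem SL2_neg_apply {K : Type*} [Field K] (g : SL(2, K)) (i j : Fin 2) : (-g) i j = -g i j := rfl

theorem neg_one_mem_gammaZeroFour : (-1 : SL(2, ℚ_[two])) ∈ gammaZeroFour := by
  refine ⟨mem_SL2Zp.2 fun i j => ?_, by rw [SL2_neg_apply]; simp⟩
  rw [SL2_neg_apply, norm_neg]
  exact mem_SL2Zp.1 (one_mem _) i j

theorem mem_or_neg_mem_K1four {g : SL(2, ℚ_[two])} (hg : g ∈ gammaZeroFour) :
    g ∈ gammaOneFour two ∨ -g ∈ gammaOneFour two := by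
  have h1 := (norm_units_of_K0four hg).1
  rw [← mem_K1four_iff, ← mem_K1four_iff]
  rcases norm_sub_one_or_add_one h1 with h | h
  · exact Or.inl ⟨hg, h⟩
  · refine Or.inr ⟨?_, h⟩
    rw [← neg_one_mul]
    exact mul_mem neg_one_mem_gammaZeroFour hg

theorem neg_notMem_K1four {g : SL(2, ℚ_[two])} (hg : g ∈ gammaOneFour two) : -g ∉ K1four := by
  rintro ⟨-, h⟩
  have h2 := norm_add_le_of_le hg.2.1 h
  rw [SL2_neg_apply, show g 0 0 - 1 + (-g 0 0 - 1) = -(2 : ℚ_[two]) by ring, norm_neg, norm_two_two,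
    norm_four_two] at h2
  norm_num at h2

theorem kubota_comm {K : Type*} [Field K] {g h : SL(2, K)} (H : g * h = h * g) :
    kubota g h = kubota h g := by
  unfold kubota
  rw [H, hilbertSymbol_comm]

theorem cocyclePadic_comm {p : Nat.Primes} {g h : SL(2, ℚ_[p])} (H : g * h = h * g) :
    cocyclePadic p g h = cocyclePadic p h g := by
  rw [cocyclePadic_eq, cocyclePadic_eq, kubota_comm H, H, mul_assoc (kubota h g),
    mul_comm (sPadic p g), ← mul_assoc]

theorem tau_neg_one {K : Type*} [Field K] : tau (-1 : SL(2, K)) = -1 := by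
  rw [tau_of_eq_zero] <;> simp

theorem tau_one {K : Type*} [Field K] : tau (1 : SL(2, K)) = 1 := by
  rw [tau_of_eq_zero] <;> simp

theorem kubota_neg_one_neg_one {K : Type*} [Field K] :
    kubota (-1 : SL(2, K)) (-1) = hilbertSymbol (-1 : K) (-1) := by
  unfold kubota
  rw [neg_one_mul, neg_neg, tau_one, tau_neg_one, one_mul]

theorem sPadic_neg_one {p : Nat.Primes} : sPadic p (-1) = 1 :=
  sPadic_of_eq_zero (by rw [SL2_neg_apply]; simp)

theorem cocycle_neg_one_neg_one : cocyclePadic two (-1) (-1) = -1 := by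
  rw [cocyclePadic_eq, kubota_neg_one_neg_one, neg_one_mul (-1 : SL(2, ℚ_[two])), neg_neg, sPadic_one,
    sPadic_neg_one, mul_one, mul_one, mul_one]
  exact hilbertSymbol_two_neg_one_neg_one

/-- The central element `(-I, 1)`. -/
noncomputable def centralElt : PadicCover two := ⟨-1, 1⟩

/-- The central element `(I, ε)`. -/
noncomputable def signElt (ε : ℤˣ) : PadicCover two := ⟨1, ε⟩

theorem signElt_comm (x : PadicCover two) (ε : ℤˣ) : x * signElt ε = signElt ε * x :=
  PadicCover.sign_mul_comm x ε

theorem signElt_mul (ε δ : ℤˣ) : signElt ε * signElt δ = signElt (ε * δ) := by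
  unfold signElt
  rw [PadicCover.mk_mul_mk, mul_one, cocyclePadic_one_left, mul_one]

theorem signElt_one : signElt 1 = 1 := rfl

theorem mk_eq_signElt (g : SL(2, ℚ_[two])) (ε : ℤˣ) :
    (⟨g, ε⟩ : PadicCover two) = signElt ε * ⟨g, 1⟩ := by
  unfold signElt
  rw [PadicCover.mk_mul_mk, one_mul, cocyclePadic_one_left, mul_one, mul_one]

theorem centralElt_comm (x : PadicCover two) : x * centralElt = centralElt * x := by
  apply PadicCover.ext
  · rw [PadicCover.mul_mat, PadicCover.mul_mat]
    change x.mat * -1 = -1 * x.mat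
    rw [mul_neg, neg_mul, mul_one, one_mul]
  · rw [PadicCover.mul_sgn, PadicCover.mul_sgn, cocyclePadic_comm, mul_comm x.sgn]
    change x.mat * -1 = -1 * x.mat
    rw [mul_neg, neg_mul, mul_one, one_mul]

/-- Because (-1,-1)₂ = -1 the element (-I, 1) has order four, so a genuine character must send it to
a square root of -1. -/
theorem centralElt_mul_self : centralElt * centralElt = signElt (-1) := by
  unfold centralElt signElt
  rw [PadicCover.mk_mul_mk, cocycle_neg_one_neg_one, neg_one_mul (-1 : SL(2, ℚ_[two])), neg_neg]
  rfl

/-- The section of the cover over `K₁²(4)`. -/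
def lift (κ : SL(2, ℚ_[two])) : PadicCover two := ⟨κ, 1⟩

theorem lift_mul_lift {κ κ' : SL(2, ℚ_[two])} (h : κ ∈ gammaOneFour two)
    (h' : κ' ∈ gammaOneFour two) : lift κ * lift κ' = lift (κ * κ') := by
  unfold lift
  rw [PadicCover.mk_mul_mk, cocyclePadic_eq_one h h', mul_one, mul_one]

theorem gammaChar_lift {κ : SL(2, ℚ_[two])} (h : κ ∈ gammaOneFour two) (ε : ℤˣ) :
    gammaChar k (lift κ * signElt ε) = ((ε : ℤ) : ℂ) := by
  have h1 : lift κ * signElt ε = ⟨κ, ε⟩ := by rw [signElt_comm, lift, ← mk_eq_signElt]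
  rw [h1, gammaChar, if_pos (mem_K1four_iff.2 h)]

theorem gammaChar_lift_central {κ : SL(2, ℚ_[two])} (h : κ ∈ gammaOneFour two) (ε : ℤˣ) :
    gammaChar k (lift κ * (centralElt * signElt ε)) = ((ε : ℤ) : ℂ) * gammaNegOne k := by
  have h1 : lift κ * (centralElt * signElt ε) = ⟨-κ, ε * cocyclePadic two κ (-1)⟩ := by
    rw [signElt_comm centralElt, ← mul_assoc, signElt_comm, mul_assoc, lift, centralElt,
      PadicCover.mk_mul_mk, signElt, PadicCover.mk_mul_mk, cocyclePadic_one_left, mul_neg, mul_one]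
    simp
  rw [h1, gammaChar, if_neg (neg_notMem_K1four h)]
  simp only [neg_neg]
  rw [mul_assoc ε, Int.units_mul_self, mul_one]

theorem coverS_cases {x : PadicCover two} (hx : x ∈ coverS) :
    ∃ κ ∈ gammaOneFour two, ∃ ε, x = lift κ * signElt ε ∨ x = lift κ * (centralElt * signElt ε) := by
  rcases mem_or_neg_mem_K1four (mem_gammaZeroFour.2 hx) with h | h
  · exact ⟨x.mat, h, x.sgn, Or.inl (by rw [signElt_comm, lift, ← mk_eq_signElt])⟩
  · refine ⟨-x.mat, h, x.sgn * cocyclePadic two (-x.mat) (-1), Or.inr ?_⟩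
    rw [signElt_comm centralElt, ← mul_assoc, signElt_comm, mul_assoc, lift, centralElt,
      PadicCover.mk_mul_mk, signElt, PadicCover.mk_mul_mk, cocyclePadic_one_left, mul_neg, mul_one]
    apply PadicCover.ext
    · simp
    · simp [mul_assoc]

theorem mem_coverS {x : PadicCover two} : x ∈ coverS ↔ x.mat ∈ gammaZeroFour := Iff.rfl

theorem coverS_mul {x y : PadicCover two} (hx : x ∈ coverS) (hy : y ∈ coverS) : x * y ∈ coverS :=
  mem_coverS.2 (mul_mem (mem_coverS.1 hx) (mem_coverS.1 hy))

theorem coverS_inv {x : PadicCover two} (hx : x ∈ coverS) : x⁻¹ ∈ coverS :=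
  mem_coverS.2 (inv_mem (mem_coverS.1 hx))

theorem lift_mem_coverS {κ : SL(2, ℚ_[two])} (h : κ ∈ gammaOneFour two) : lift κ ∈ coverS :=
  gammaOneFour_le h

theorem signElt_mem_coverS (ε : ℤˣ) : signElt ε ∈ coverS :=
  mem_coverS.2 (one_mem _)

theorem centralElt_mem_coverS : centralElt ∈ coverS := neg_one_mem_gammaZeroFour

theorem I_pow_odd_mul_self (k : ℕ) : Complex.I ^ (2 * k + 1) * Complex.I ^ (2 * k + 1) = -1 := by
  rw [← mul_pow, Complex.I_mul_I, pow_succ, pow_mul]; simp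

theorem gammaNegOne_mul_self : gammaNegOne k * gammaNegOne k = -1 := by
  rw [gammaNegOne, neg_mul_neg, I_pow_odd_mul_self]

/-- S is generated by the lifted group K₁²(4) and the centre, which commute; the only nontrivial
relation to respect is γ(-I, 1)² = -1. -/
theorem gammaChar_mul {x y : PadicCover two} (hx : x ∈ coverS) (hy : y ∈ coverS) :
    gammaChar k (x * y) = gammaChar k x * gammaChar k y := by
  obtain ⟨κ, hκ, ε, hx⟩ := coverS_cases hx
  obtain ⟨κ', hκ', ε', hy⟩ := coverS_cases hy
  have hm := mul_mem hκ hκ'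
  rcases hx with rfl | rfl <;> rcases hy with rfl | rfl
  · have h : lift κ * signElt ε * (lift κ' * signElt ε') = lift (κ * κ') * signElt (ε * ε') := by
      rw [← lift_mul_lift hκ hκ', ← signElt_mul, mul_assoc, mul_assoc, ← mul_assoc (signElt ε),
        ← signElt_comm (lift κ'), mul_assoc (lift κ')]
    rw [h, gammaChar_lift hm, gammaChar_lift hκ, gammaChar_lift hκ', Units.val_mul, Int.cast_mul]
  · have h : lift κ * signElt ε * (lift κ' * (centralElt * signElt ε')) =
        lift (κ * κ') * (centralElt * signElt (ε * ε')) := by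
      rw [← lift_mul_lift hκ hκ', ← signElt_mul, mul_assoc, mul_assoc, ← mul_assoc (signElt ε),
        ← signElt_comm (lift κ'), mul_assoc (lift κ'), ← mul_assoc (signElt ε),
        ← signElt_comm centralElt, mul_assoc centralElt]
    rw [h, gammaChar_lift_central hm, gammaChar_lift hκ, gammaChar_lift_central hκ',
      Units.val_mul, Int.cast_mul, mul_assoc]
  · have h : lift κ * (centralElt * signElt ε) * (lift κ' * signElt ε') =
        lift (κ * κ') * (centralElt * signElt (ε * ε')) := by
      rw [← lift_mul_lift hκ hκ', ← signElt_mul, mul_assoc, mul_assoc, mul_assoc,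
        ← mul_assoc (signElt ε), ← signElt_comm (lift κ'), mul_assoc (lift κ'),
        ← mul_assoc centralElt, ← centralElt_comm (lift κ'), mul_assoc (lift κ')]
    rw [h, gammaChar_lift_central hm, gammaChar_lift_central hκ, gammaChar_lift hκ',
      Units.val_mul, Int.cast_mul]
    ring
  · have h : lift κ * (centralElt * signElt ε) * (lift κ' * (centralElt * signElt ε')) =
        lift (κ * κ') * signElt (-1 * (ε * ε')) := by
      rw [← lift_mul_lift hκ hκ', ← signElt_mul, ← signElt_mul, ← centralElt_mul_self]
      calc _ = lift κ * (centralElt * (signElt ε * (lift κ' * (centralElt * signElt ε')))) := by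
            simp only [mul_assoc]
        _ = lift κ * (centralElt * (lift κ' * (centralElt * (signElt ε * signElt ε')))) := by
            rw [← mul_assoc (signElt ε), ← signElt_comm (lift κ'), mul_assoc (lift κ'),
              ← mul_assoc (signElt ε), ← signElt_comm centralElt, mul_assoc centralElt]
        _ = _ := by
            rw [← mul_assoc centralElt, ← centralElt_comm (lift κ')]
            simp only [mul_assoc]
    rw [h, gammaChar_lift hm, gammaChar_lift_central hκ, gammaChar_lift_central hκ',
      Units.val_mul, Units.val_mul, Int.cast_mul, Int.cast_mul]
    push_cast
    linear_combination (-((ε : ℤ) : ℂ) * ((ε' : ℤ) : ℂ)) * gammaNegOne_mul_self (k := k)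

theorem gammaChar_one : gammaChar k 1 = 1 := by
  have := gammaChar_lift (k := k) (one_mem (gammaOneFour two)) 1
  rw [signElt_one, mul_one] at this
  rw [show (1 : PadicCover two) = lift 1 from rfl, this]; simp

theorem gammaChar_lift_one {κ : SL(2, ℚ_[two])} (h : κ ∈ gammaOneFour two) :
    gammaChar k (lift κ) = 1 := by
  have := gammaChar_lift (k := k) h 1
  rw [signElt_one, mul_one] at this
  rw [this]; simp

theorem gammaChar_signElt (ε : ℤˣ) : gammaChar k (signElt ε) = ((ε : ℤ) : ℂ) := by
  have := gammaChar_lift (k := k) (one_mem (gammaOneFour two)) ε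
  rwa [show lift 1 = 1 from rfl, one_mul] at this

theorem gammaChar_centralElt : gammaChar k centralElt = gammaNegOne k := by
  have := gammaChar_lift_central (k := k) (one_mem (gammaOneFour two)) 1
  rw [show lift 1 = 1 from rfl, one_mul, signElt_one, mul_one] at this
  rw [this]; simp

theorem gammaChar_inv_mul {x : PadicCover two} (hx : x ∈ coverS) :
    gammaChar k x⁻¹ * gammaChar k x = 1 := by
  rw [← gammaChar_mul (coverS_inv hx) hx, inv_mul_cancel, gammaChar_one]

theorem norm_gammaChar {x : PadicCover two} (hx : x ∈ coverS) : ‖gammaChar k x‖ = 1 := by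
  obtain ⟨κ, hκ, ε, rfl | rfl⟩ := coverS_cases hx
  · rw [gammaChar_lift hκ, norm_sign]
  · rw [gammaChar_lift_central hκ, norm_mul, norm_sign, gammaNegOne]; simp

theorem gammaChar_conj_mul {x : PadicCover two} (hx : x ∈ coverS) :
    starRingEnd ℂ (gammaChar k x) * gammaChar k x = 1 := by
  rw [mul_comm, Complex.mul_conj, Complex.normSq_eq_norm_sq, norm_gammaChar hx]; simp

/-- Compatibility of `γ` with the double coset of `g`. -/
def GammaCompatible (k : ℕ) (g : PadicCover two) : Prop :=
  ∀ s ∈ coverS, ∀ t ∈ coverS, s * g = g * t → gammaChar k s = gammaChar k t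

/-- Two factorizations x g y = x' g y' give an element s with s g = g t, and compatibility says that
γ takes the same value on s and t. -/
theorem supportedOn_apply {g : PadicCover two} (hg : GammaCompatible k g) (c : ℂ)
    {x y : PadicCover two} (hx : x ∈ coverS) (hy : y ∈ coverS) :
    supportedOn k g c (x * g * y) =
      starRingEnd ℂ (gammaChar k x) * c * starRingEnd ℂ (gammaChar k y) := by
  have H : ∃ xy : PadicCover two × PadicCover two,
      xy.1 ∈ coverS ∧ xy.2 ∈ coverS ∧ x * g * y = xy.1 * g * xy.2 := ⟨⟨x, y⟩, hx, hy, rfl⟩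
  unfold supportedOn
  rw [dif_pos H]
  obtain ⟨h1, h2, h3⟩ := H.choose_spec
  set x' := H.choose.1
  set y' := H.choose.2
  have h4 : x'⁻¹ * x * g = g * (y' * y⁻¹) := by
    rw [mul_assoc, inv_mul_eq_iff_eq_mul, ← mul_assoc, ← mul_assoc, ← h3, mul_inv_cancel_right]
  have h5 := hg _ (coverS_mul (coverS_inv h1) hx) _ (coverS_mul h2 (coverS_inv hy)) h4
  rw [gammaChar_mul (coverS_inv h1) hx, gammaChar_mul h2 (coverS_inv hy)] at h5
  have h6 := gammaChar_inv_mul (k := k) h1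
  have h7 := gammaChar_inv_mul (k := k) hy
  have h8 : gammaChar k x * gammaChar k y = gammaChar k x' * gammaChar k y' := by
    linear_combination (-gammaChar k x * gammaChar k y) * h6 + gammaChar k x' * gammaChar k y * h5 +
      gammaChar k x' * gammaChar k y' * h7
  have h9 := congrArg (starRingEnd ℂ) h8
  rw [map_mul, map_mul] at h9
  linear_combination -c * h9

theorem supportedOn_eq_zero {g : PadicCover two} {c : ℂ} {h : PadicCover two}
    (H : ¬ ∃ x ∈ coverS, ∃ y ∈ coverS, h = x * g * y) : supportedOn k g c h = 0 :=
  dif_neg fun ⟨xy, h1, h2, h3⟩ => H ⟨xy.1, h1, xy.2, h2, h3⟩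

theorem isHeckeElement_supportedOn {g : PadicCover two} (hg : GammaCompatible k g) (c : ℂ) :
    IsHeckeElement k (supportedOn k g c) := by
  have equi : ∀ x ∈ coverS, ∀ y ∈ coverS, ∀ h, supportedOn k g c (x * h * y) =
      starRingEnd ℂ (gammaChar k x) * starRingEnd ℂ (gammaChar k y) * supportedOn k g c h := by
    intro x hx y hy h
    by_cases H : ∃ x' ∈ coverS, ∃ y' ∈ coverS, h = x' * g * y'
    · obtain ⟨x', hx', y', hy', rfl⟩ := H
      have : x * (x' * g * y') * y = (x * x') * g * (y' * y) := by simp only [mul_assoc]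
      rw [this, supportedOn_apply hg c (coverS_mul hx hx') (coverS_mul hy' hy),
        supportedOn_apply hg c hx' hy', gammaChar_mul hx hx', gammaChar_mul hy' hy, map_mul, map_mul]
      ring
    · rw [supportedOn_eq_zero H, supportedOn_eq_zero, mul_zero]
      rintro ⟨x', hx', y', hy', h'⟩
      refine H ⟨x⁻¹ * x', coverS_mul (coverS_inv hx) hx', y' * y⁻¹, coverS_mul hy' (coverS_inv hy), ?_⟩
      have : h = x⁻¹ * (x * h * y) * y⁻¹ := by simp only [mul_assoc, mul_inv_cancel, mul_one, inv_mul_cancel_left]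
      rw [this, h']
      simp only [mul_assoc]
  refine ⟨equi, fun h => ⟨K1four, ?_, subset_rfl, fun u hu => ?_⟩, ?_⟩
  · have h1 : K1four = K0four ∩ (fun g : SL(2, ℚ_[two]) => g 0 0) ⁻¹'
        Metric.closedBall (1 : ℚ_[two]) ‖(4 : ℚ_[two])‖ := by
      ext g; simp [K1four, dist_eq_norm]
    have h2 : IsOpen K1four := by
      rw [h1]
      exact isOpen_K0four.inter ((IsUltrametricDist.isOpen_closedBall _
        (by simp)).preimage (continuous_entry 0 0))
    exact h2.mem_nhds ⟨one_mem_K0four, by simp⟩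
  · have hu' := mem_K1four_iff.1 hu
    have := equi 1 (mem_coverS.2 (one_mem _)) (lift u) (lift_mem_coverS hu') h
    rwa [one_mul, gammaChar_one, gammaChar_lift_one hu', map_one, one_mul, one_mul] at this
  · refine ⟨(fun p : SL(2, ℚ_[two]) × SL(2, ℚ_[two]) => p.1 * g.mat * p.2) '' (K0four ×ˢ K0four),
      (isCompact_K0four.prod isCompact_K0four).image (by fun_prop), fun h hh => ?_⟩
    by_contra hne
    refine hh (supportedOn_eq_zero ?_)
    rintro ⟨x, hx, y, hy, rfl⟩
    exact hne ⟨(x.mat, y.mat), ⟨hx, hy⟩, rfl⟩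

/-- The set of pairs `(κ, κ')` in `K₁²(4)` with `κ m = m κ'` in the cover. -/
structure LiftConj (m κ κ' : SL(2, ℚ_[two])) : Prop where
  left : κ ∈ gammaOneFour two
  right : κ' ∈ gammaOneFour two
  eq : lift κ * ⟨m, 1⟩ = ⟨m, 1⟩ * lift κ'

theorem LiftConj.mul {m κ κ' η η' : SL(2, ℚ_[two])} (h : LiftConj m κ κ') (h' : LiftConj m η η') :
    LiftConj m (κ * η) (κ' * η') where
  left := mul_mem h.left h'.left
  right := mul_mem h.right h'.right
  eq := by
    rw [← lift_mul_lift h.left h'.left, ← lift_mul_lift h.right h'.right, mul_assoc, h'.eq,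
      ← mul_assoc, h.eq, mul_assoc]

theorem LiftConj.of_kubota {m κ κ' : SL(2, ℚ_[two])} (hκ : κ ∈ gammaOneFour two)
    (hκ' : κ' ∈ gammaOneFour two) (hm : κ * m = m * κ') (hs : sPadic two κ = 1)
    (hs' : sPadic two κ' = 1) (hk : kubota κ m = kubota m κ') : LiftConj m κ κ' where
  left := hκ
  right := hκ'
  eq := by
    unfold lift
    rw [PadicCover.mk_mul_mk, PadicCover.mk_mul_mk, cocyclePadic_eq, cocyclePadic_eq, hs, hs', hk, hm]
    simp only [mul_one]

/-- Central elements pass through m unchanged and contribute equally on both sides, so only K₁²(4)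
matters, where γ is trivial. -/
theorem gammaCompatible_of_liftConj {m : SL(2, ℚ_[two])}
    (H : ∀ κ ∈ gammaOneFour two, m⁻¹ * κ * m ∈ gammaZeroFour → LiftConj m κ (m⁻¹ * κ * m)) :
    GammaCompatible k ⟨m, 1⟩ := by
  intro s hs t ht hst
  obtain ⟨κ, hκ, ε, hs'⟩ := coverS_cases hs
  have hmat : t.mat = m⁻¹ * s.mat * m := by
    have := congrArg PadicCover.mat hst
    rw [PadicCover.mul_mat, PadicCover.mul_mat] at this
    simp only at this
    rw [mul_assoc, this, inv_mul_cancel_left]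
  rcases hs' with rfl | rfl
  · have hs1 : (lift κ * signElt ε).mat = κ := by
      change κ * 1 = κ; rw [mul_one]
    rw [hs1] at hmat
    have h1 := H κ hκ (hmat ▸ mem_coverS.1 ht)
    have h2 : t = lift (m⁻¹ * κ * m) * signElt ε := by
      apply mul_left_cancel (a := (⟨m, 1⟩ : PadicCover two))
      rw [← hst, mul_assoc, ← signElt_comm, ← mul_assoc, h1.eq, mul_assoc]
    rw [h2, gammaChar_lift hκ, gammaChar_lift h1.right]
  · have hs1 : (lift κ * (centralElt * signElt ε)).mat = -κ := by
      change κ * (-1 * 1) = -κ; rw [mul_one, mul_neg, mul_one]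
    rw [hs1] at hmat
    have h0 : m⁻¹ * κ * m ∈ gammaZeroFour := by
      have : m⁻¹ * κ * m = -1 * t.mat := by rw [hmat]; simp
      rw [this]
      exact mul_mem neg_one_mem_gammaZeroFour (mem_coverS.1 ht)
    have h1 := H κ hκ h0
    have h2 : t = lift (m⁻¹ * κ * m) * (centralElt * signElt ε) := by
      apply mul_left_cancel (a := (⟨m, 1⟩ : PadicCover two))
      rw [← hst, mul_assoc, mul_assoc centralElt, ← signElt_comm, ← mul_assoc centralElt,
        ← centralElt_comm, mul_assoc _ centralElt, ← mul_assoc, h1.eq, mul_assoc]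
    rw [h2, gammaChar_lift_central hκ, gammaChar_lift_central h1.right]

theorem hMat_eq (t : (ℚ_[two])ˣ) : hMat t = diagU t := rfl

@[simp] theorem wMat_00 (t : (ℚ_[two])ˣ) : wMat t 0 0 = 0 := rfl
@[simp] theorem wMat_01 (t : (ℚ_[two])ˣ) : wMat t 0 1 = t := rfl
@[simp] theorem wMat_10 (t : (ℚ_[two])ˣ) : wMat t 1 0 = -(t : ℚ_[two])⁻¹ := by simp [wMat]
@[simp] theorem wMat_11 (t : (ℚ_[two])ˣ) : wMat t 1 1 = 0 := rfl

theorem tau_wMat (t : (ℚ_[two])ˣ) : tau (wMat t) = -(t : ℚ_[two])⁻¹ := by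
  rw [tau_of_ne_zero] <;> simp

theorem iwahori_factors {κ : SL(2, ℚ_[two])} (hκ : κ ∈ gammaOneFour two) :
    ∃ t : (ℚ_[two])ˣ, (t : ℚ_[two]) = κ 0 0 ∧ ‖(t : ℚ_[two])‖ = 1 ∧
      ‖(t : ℚ_[two]) - 1‖ ≤ ‖(4 : ℚ_[two])‖ := by
  have h := (norm_units_of_K0four (gammaOneFour_le hκ)).1
  exact ⟨Units.mk0 (κ 0 0) (ne_zero_of_norm_eq_one h), rfl, h, hκ.2.1⟩

/-- Conjugation by a diagonal matrix preserves the shape of each Iwahori factor. For each factor the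
Kubota symbols on the two sides agree, and membership of the conjugate in K₀²(4) gives the required
integrality. -/
theorem liftConj_diagU (s : (ℚ_[two])ˣ) {κ : SL(2, ℚ_[two])} (hκ : κ ∈ gammaOneFour two)
    (h : (diagU s)⁻¹ * κ * diagU s ∈ gammaZeroFour) :
    LiftConj (diagU s) κ ((diagU s)⁻¹ * κ * diagU s) := by
  obtain ⟨t, ht, ht1, ht4⟩ := iwahori_factors hκ
  have hs : (s : ℚ_[two]) ≠ 0 := s.ne_zero
  have ha : κ 0 0 ≠ 0 := by rw [← ht]; exact t.ne_zero
  have hint := mem_SL2Zp.1 hκ.1.1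
  have hb : ‖κ 0 1 / κ 0 0 / (s : ℚ_[two]) ^ 2‖ ≤ 1 := by
    have := mem_SL2Zp.1 h.1 0 1
    have e : ((diagU s)⁻¹ * κ * diagU s) 0 1 = κ 0 1 / (s : ℚ_[two]) ^ 2 := by
      simp [SL2_mul_zero_one, SL2_mul_zero_zero, SL2_inv_00, SL2_inv_01]
      field_simp
    rw [e] at this
    rw [div_right_comm, norm_div, ← ht, ht1, div_one]
    exact this
  have hc : ‖κ 1 0 / κ 0 0 * (s : ℚ_[two]) ^ 2‖ ≤ ‖(4 : ℚ_[two])‖ := by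
    have := h.2
    have e : ((diagU s)⁻¹ * κ * diagU s) 1 0 = κ 1 0 * (s : ℚ_[two]) ^ 2 := by
      simp [SL2_mul_one_zero, SL2_mul_one_one, SL2_inv_10, SL2_inv_11]
      ring
    rw [e] at this
    rw [div_mul_eq_mul_div, norm_div, ← ht, ht1, div_one]
    exact this
  have h1 : LiftConj (diagU s) (lowerU (κ 1 0 / κ 0 0)) (lowerU (κ 1 0 / κ 0 0 * (s : ℚ_[two]) ^ 2)) := by
    refine LiftConj.of_kubota (lowerU_mem ?_) (lowerU_mem hc) ?_ (sPadic_lowerU _) (sPadic_lowerU _) ?_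
    · rw [norm_div, ← ht, ht1, div_one]; exact hκ.1.2
    · apply SL2_ext <;> simp [SL2_mul_zero_zero, SL2_mul_zero_one, SL2_mul_one_zero, SL2_mul_one_one]
      field_simp
    · set c := κ 1 0 / κ 0 0
      rcases eq_or_ne c 0 with h0 | h0
      · have e1 : lowerU c = 1 := by rw [h0]; apply SL2_ext <;> simp
        have e2 : lowerU (c * (s : ℚ_[two]) ^ 2) = 1 := by rw [h0]; apply SL2_ext <;> simp
        rw [e1, e2, kubota_one_left, kubota_one_right]
      · rw [kubota_diagU_right, tau_lowerU h0]
        unfold kubota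
        rw [tau_mul_of_left_upper (diagU_10 s), tau_lowerU (by simp [h0]), tau_diagU,
          show (s : ℚ_[two])⁻¹ * (c * s ^ 2) * (s : ℚ_[two])⁻¹ = c by field_simp,
          show (s : ℚ_[two])⁻¹ * (c * s ^ 2) * (c * s ^ 2) = s * (c * s) ^ 2 by field_simp,
          hilbertSymbol_mul_sq_right _ _ (mul_ne_zero h0 hs), hilbertSymbol_comm]
  have h2 : LiftConj (diagU s) (diagU t) (diagU t) := by
    have hcomm : diagU t * diagU s = diagU s * diagU t := by
      apply SL2_ext <;> simp [SL2_mul_zero_zero, SL2_mul_zero_one, SL2_mul_one_zero,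
        SL2_mul_one_one, mul_comm]
    exact LiftConj.of_kubota (diagU_mem ht1 ht4) (diagU_mem ht1 ht4) hcomm
      (sPadic_of_eq_zero (diagU_10 t)) (sPadic_of_eq_zero (diagU_10 t)) (kubota_comm hcomm)
  have h3 : LiftConj (diagU s) (upperU (κ 0 1 / κ 0 0)) (upperU (κ 0 1 / κ 0 0 / (s : ℚ_[two]) ^ 2)) := by
    refine LiftConj.of_kubota (upperU_mem ?_) (upperU_mem hb) ?_ (sPadic_of_eq_zero (upperU_10 _))
      (sPadic_of_eq_zero (upperU_10 _)) ?_
    · rw [norm_div, ← ht, ht1, div_one]; exact hint 0 1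
    · apply SL2_ext <;> simp [SL2_mul_zero_zero, SL2_mul_zero_one, SL2_mul_one_zero, SL2_mul_one_one]
      field_simp
    · rw [kubota_upperU_left, kubota_upperU_right]
  have h4 := h1.mul (h2.mul h3)
  rw [← iwahori κ t ht] at h4
  have h5 : (diagU s)⁻¹ * κ * diagU s = lowerU (κ 1 0 / κ 0 0 * (s : ℚ_[two]) ^ 2) * (diagU t * upperU (κ 0 1 / κ 0 0 / (s : ℚ_[two]) ^ 2)) := by
    have := congrArg PadicCover.mat h4.eq
    rw [PadicCover.mul_mat, PadicCover.mul_mat] at this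
    rw [mul_assoc, inv_mul_eq_iff_eq_mul]
    exact this
  rw [h5]
  exact h4

/-- The same argument as for diagonal matrices, except that w exchanges upper and lower unipotents
and inverts the torus. -/
theorem liftConj_wMat (r : (ℚ_[two])ˣ) {κ : SL(2, ℚ_[two])} (hκ : κ ∈ gammaOneFour two)
    (h : (wMat r)⁻¹ * κ * wMat r ∈ gammaZeroFour) :
    LiftConj (wMat r) κ ((wMat r)⁻¹ * κ * wMat r) := by
  obtain ⟨t, ht, ht1, ht4⟩ := iwahori_factors hκ
  have hr : (r : ℚ_[two]) ≠ 0 := r.ne_zero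
  have ha : κ 0 0 ≠ 0 := by rw [← ht]; exact t.ne_zero
  have hint := mem_SL2Zp.1 hκ.1.1
  have hc : ‖-(κ 1 0 / κ 0 0 * (r : ℚ_[two]) ^ 2)‖ ≤ 1 := by
    have := mem_SL2Zp.1 h.1 0 1
    have e : ((wMat r)⁻¹ * κ * wMat r) 0 1 = -(κ 1 0 * (r : ℚ_[two]) ^ 2) := by
      simp [SL2_mul_zero_one, SL2_mul_zero_zero, SL2_inv_00, SL2_inv_01]
      ring
    rw [e, norm_neg] at this
    rw [norm_neg, div_mul_eq_mul_div, norm_div, ← ht, ht1, div_one]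
    exact this
  have hb : ‖-(κ 0 1 / κ 0 0 / (r : ℚ_[two]) ^ 2)‖ ≤ ‖(4 : ℚ_[two])‖ := by
    have := h.2
    have e : ((wMat r)⁻¹ * κ * wMat r) 1 0 = -(κ 0 1 / (r : ℚ_[two]) ^ 2) := by
      simp [SL2_mul_one_zero, SL2_mul_one_one, SL2_inv_10, SL2_inv_11]
      field_simp
    rw [e, norm_neg] at this
    rw [norm_neg, div_right_comm, norm_div, ← ht, ht1, div_one]
    exact this
  have hti : ‖((t⁻¹ : (ℚ_[two])ˣ) : ℚ_[two])‖ = 1 := by rw [Units.val_inv_eq_inv_val, norm_inv, ht1, inv_one]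
  have hti4 : ‖((t⁻¹ : (ℚ_[two])ˣ) : ℚ_[two]) - 1‖ ≤ ‖(4 : ℚ_[two])‖ := by
    rw [Units.val_inv_eq_inv_val, norm_inv_sub_one ht1]; exact ht4
  have h1 : LiftConj (wMat r) (lowerU (κ 1 0 / κ 0 0)) (upperU (-(κ 1 0 / κ 0 0 * (r : ℚ_[two]) ^ 2))) := by
    have hmm : lowerU (κ 1 0 / κ 0 0) * wMat r = wMat r * upperU (-(κ 1 0 / κ 0 0 * (r : ℚ_[two]) ^ 2)) := by
      apply SL2_ext <;> simp [SL2_mul_zero_zero, SL2_mul_zero_one, SL2_mul_one_zero, SL2_mul_one_one]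
      field_simp
    refine LiftConj.of_kubota (lowerU_mem ?_) (upperU_mem hc) hmm (sPadic_lowerU _)
      (sPadic_of_eq_zero (upperU_10 _)) ?_
    · rw [norm_div, ← ht, ht1, div_one]; exact hκ.1.2
    · rw [kubota_upperU_right]
      unfold kubota
      have e : tau (lowerU (κ 1 0 / κ 0 0) * wMat r) = tau (wMat r) := by
        rw [tau_wMat, tau_of_ne_zero] <;> simp [SL2_mul_one_zero]
      rw [e]
      exact hilbertSymbol_isSquare_right _ ⟨_, rfl⟩
  have h2 : LiftConj (wMat r) (diagU t) (diagU t⁻¹) := by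
    have hmm : diagU t * wMat r = wMat r * diagU t⁻¹ := by
      apply SL2_ext <;> simp [SL2_mul_zero_zero, SL2_mul_zero_one, SL2_mul_one_zero,
        SL2_mul_one_one, mul_comm]
    refine LiftConj.of_kubota (diagU_mem ht1 ht4) (diagU_mem hti hti4) hmm
      (sPadic_of_eq_zero (diagU_10 t)) (sPadic_of_eq_zero (diagU_10 _)) ?_
    rw [kubota_diagU_right]
    unfold kubota
    rw [tau_mul_of_left_upper (diagU_10 t), tau_diagU, Units.val_inv_eq_inv_val]
    have hw := tau_ne_zero (wMat r)
    have ht0 : (t : ℚ_[two])⁻¹ ≠ 0 := inv_ne_zero t.ne_zero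
    rw [show (t : ℚ_[two])⁻¹ * tau (wMat r) * (t : ℚ_[two])⁻¹ = tau (wMat r) * (t : ℚ_[two])⁻¹ ^ 2 by ring,
      show (t : ℚ_[two])⁻¹ * tau (wMat r) * tau (wMat r) = (t : ℚ_[two])⁻¹ * tau (wMat r) ^ 2 by ring,
      hilbertSymbol_mul_sq_right _ _ hw, hilbertSymbol_mul_sq_left _ _ ht0, hilbertSymbol_comm]
  have h3 : LiftConj (wMat r) (upperU (κ 0 1 / κ 0 0)) (lowerU (-(κ 0 1 / κ 0 0 / (r : ℚ_[two]) ^ 2))) := by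
    have hmm : upperU (κ 0 1 / κ 0 0) * wMat r = wMat r * lowerU (-(κ 0 1 / κ 0 0 / (r : ℚ_[two]) ^ 2)) := by
      apply SL2_ext <;> simp [SL2_mul_zero_zero, SL2_mul_zero_one, SL2_mul_one_zero, SL2_mul_one_one]
      field_simp
    refine LiftConj.of_kubota (upperU_mem ?_) (lowerU_mem hb) hmm (sPadic_of_eq_zero (upperU_10 _))
      (sPadic_lowerU _) ?_
    · rw [norm_div, ← ht, ht1, div_one]; exact hint 0 1
    · rw [kubota_upperU_left]
      unfold kubota
      rw [← hmm, tau_mul_of_left_upper (upperU_10 _), tau_upperU, one_mul]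
      exact (hilbertSymbol_isSquare_left ⟨_, rfl⟩ _).symm
  have h4 := h1.mul (h2.mul h3)
  rw [← iwahori κ t ht] at h4
  have h5 : (wMat r)⁻¹ * κ * wMat r = upperU (-(κ 1 0 / κ 0 0 * (r : ℚ_[two]) ^ 2)) *
      (diagU t⁻¹ * lowerU (-(κ 0 1 / κ 0 0 / (r : ℚ_[two]) ^ 2))) := by
    have := congrArg PadicCover.mat h4.eq
    rw [PadicCover.mul_mat, PadicCover.mul_mat] at this
    rw [mul_assoc, inv_mul_eq_iff_eq_mul]
    exact this
  rw [h5]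
  exact h4

theorem gammaCompatible_hMat (s : (ℚ_[two])ˣ) : GammaCompatible k ⟨hMat s, 1⟩ :=
  gammaCompatible_of_liftConj fun _ hκ h => liftConj_diagU s hκ h

theorem gammaCompatible_wMat (r : (ℚ_[two])ˣ) : GammaCompatible k ⟨wMat r, 1⟩ :=
  gammaCompatible_of_liftConj fun _ hκ h => liftConj_wMat r hκ h

theorem isHeckeElement_heckeT (k : ℕ) (n : ℤ) : IsHeckeElement k (heckeT k n) :=
  isHeckeElement_supportedOn (gammaCompatible_hMat _) _

theorem isHeckeElement_heckeU (k : ℕ) (n : ℤ) : IsHeckeElement k (heckeU k n) :=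
  isHeckeElement_supportedOn (gammaCompatible_wMat _) _

end Gamma

/-! ### The action of the Hecke algebra on automorphic functions -/

section Action

variable {k N : ℕ} {Φ : AdelicCover → ℂ} {T : PadicCover two → ℂ}

theorem autJ_neg_one (z : ℍ) : autJ (-1) 1 z = -Complex.I := by
  refine autJ_eq_of_sq (Or.inr ⟨by simp, by simp⟩) ?_
  have h10 : (-1 : SL(2, ℝ)) 1 0 = 0 := by rw [SL2_neg_apply]; simp
  have h11 : (-1 : SL(2, ℝ)) 1 1 = -1 := by rw [SL2_neg_apply]; simp
  rw [linDenom_of_eq_zero h10, h11, neg_sq, Complex.I_sq]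
  simp

theorem ratToReal_neg_one : ratToReal (-1) = -1 := by
  ext i j
  rw [ratToReal_apply, SL2_neg_apply, SL2_neg_apply]
  fin_cases i <;> fin_cases j <;> simp

theorem ratToPadic_neg_one (p : Nat.Primes) : ratToPadic p (-1) = -1 := by
  ext i j
  rw [ratToPadic_apply, SL2_neg_apply, SL2_neg_apply]
  fin_cases i <;> fin_cases j <;> simp

theorem splitSign_neg_one : splitSign (-1) = 1 :=
  finprod_eq_one_of_forall_eq_one fun p => by rw [ratToPadic_neg_one, sPadic_neg_one]

theorem rationalSplitting_neg_one_comm (g : AdelicCover) :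
    rationalSplitting (-1) * g = g * rationalSplitting (-1) := by
  have hinf : ratToReal (-1) * g.inf = g.inf * ratToReal (-1) := by
    rw [ratToReal_neg_one, mul_neg, neg_mul, mul_one, one_mul]
  have hfin : ∀ p, ratDiagonal (-1) p * g.fin p = g.fin p * ratDiagonal (-1) p := by
    intro p
    rw [ratDiagonal_apply, ratToPadic_neg_one, mul_neg, neg_mul, mul_one, one_mul]
  apply AdelicCover.ext
  · exact hinf
  · ext1 p
    exact hfin p
  · rw [AdelicCover.mul_sgn, AdelicCover.mul_sgn, mul_comm (rationalSplitting (-1)).sgn]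
    congr 2
    · change cocycleReal (ratToReal (-1)) g.inf = cocycleReal g.inf (ratToReal (-1))
      rw [cocycleReal_eq, cocycleReal_eq, kubota_comm hinf]
    · change cocycleFinite (ratDiagonal (-1)) g.fin = cocycleFinite g.fin (ratDiagonal (-1))
      unfold cocycleFinite
      exact finprod_congr fun p => cocyclePadic_comm (hfin p)

/-- The hypothesis says that N is exactly divisible by 4, so the level group at 2 is all of K₁²(4).
For N = 4M this is where odd M enters. -/
theorem mulSingle_mem_levelFin (hN2 : ‖(N : ℚ_[two])‖ = ‖(4 : ℚ_[two])‖) {κ : SL(2, ℚ_[two])}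
    (hκ : κ ∈ gammaOneFour two) : RestrictedProduct.mulSingle SL2Zp two κ ∈ levelFin N := by
  intro q
  rcases eq_or_ne q two with rfl | hq
  · rw [RestrictedProduct.mulSingle_eq_same]
    exact ⟨⟨hκ.1.1, by rw [hN2]; exact hκ.1.2⟩, hκ⟩
  · rw [RestrictedProduct.mulSingle_eq_of_ne _ _ hq]
    exact one_mem _

theorem norm_eq_one_of_odd_place {q : Nat.Primes} (hq : q ≠ two) : (q : ℕ) ≠ 2 :=
  fun h => hq (Subtype.ext h)

theorem neg_one_mem_gammaZeroPadic {q : Nat.Primes} (x : ℚ_[q]) :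
    (-1 : SL(2, ℚ_[q])) ∈ gammaZeroPadic q x := by
  refine ⟨mem_SL2Zp.2 fun i j => ?_, by rw [SL2_neg_apply]; simp⟩
  rw [SL2_neg_apply, norm_neg]
  exact mem_SL2Zp.1 (one_mem _) i j

theorem ofPadic_mul_ofFinite (x : PadicCover two) {κ : SL2FiniteAdele} (hκ : κ two = 1) :
    ofPadic x * ofFinite κ = ⟨1, RestrictedProduct.mulSingle SL2Zp two x.mat * κ, x.sgn⟩ := by
  apply AdelicCover.ext
  · exact mul_one _
  · rfl
  · rw [AdelicCover.mul_sgn]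
    change x.sgn * 1 * (cocycleReal 1 1 * cocycleFinite (RestrictedProduct.mulSingle SL2Zp two
      x.mat) κ) = x.sgn
    rw [cocycleFinite_eq_one, cocycleReal_one_left, mul_one, mul_one, mul_one]
    intro q
    rcases eq_or_ne q two with rfl | hq
    · rw [hκ, cocyclePadic_one_right]
    · rw [RestrictedProduct.mulSingle_eq_of_ne _ _ hq, cocyclePadic_one_left]

theorem ofReal_mul_mk_one (x : SL(2, ℝ)) (ε δ : ℤˣ) (κ : SL2FiniteAdele) :
    ofReal x ε * ⟨1, κ, δ⟩ = ⟨x, κ, ε * δ⟩ := by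
  apply AdelicCover.ext
  · exact mul_one _
  · exact one_mul _
  · rw [AdelicCover.mul_sgn]
    change ε * δ * (cocycleReal x 1 * cocycleFinite 1 κ) = _
    rw [cocycleFinite_one_left, cocycleReal_one_right, mul_one, mul_one]

/-- The component away from `2` of a finite adele. -/
noncomputable def awayTwo (κ : SL2FiniteAdele) : SL2FiniteAdele :=
  RestrictedProduct.mulSingle SL2Zp two (κ two)⁻¹ * κ

theorem awayTwo_two (κ : SL2FiniteAdele) : awayTwo κ two = 1 := by
  rw [awayTwo, RestrictedProduct.mul_apply, RestrictedProduct.mulSingle_eq_same, inv_mul_cancel]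

theorem awayTwo_of_ne (κ : SL2FiniteAdele) {q : Nat.Primes} (hq : q ≠ two) : awayTwo κ q = κ q := by
  rw [awayTwo, RestrictedProduct.mul_apply, RestrictedProduct.mulSingle_eq_of_ne _ _ hq, one_mul]

theorem mulSingle_mul_awayTwo (κ : SL2FiniteAdele) :
    RestrictedProduct.mulSingle SL2Zp two (κ two) * awayTwo κ = κ := by
  rw [awayTwo, ← mul_assoc, ← RestrictedProduct.mulSingle_mul, mul_inv_cancel,
    RestrictedProduct.mulSingle_one, one_mul]

theorem awayTwo_mem {κ : SL2FiniteAdele}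
    (h : ∀ q, q ≠ two → κ q ∈ gammaZeroPadic q (N : ℚ_[q])) : awayTwo κ ∈ levelFin N := by
  intro q
  rcases eq_or_ne q two with rfl | hq
  · rw [awayTwo_two]; exact one_mem _
  · rw [awayTwo_of_ne κ hq]
    refine ⟨h q hq, ?_⟩
    rw [gammaOneFour_of_ne_two (norm_eq_one_of_odd_place hq)]
    exact (h q hq).1

theorem rationalSplitting_neg_one : rationalSplitting (-1) =
    ofReal (-1) 1 * (ofPadic centralElt * ofFinite (awayTwo (ratDiagonal (-1)))) := by
  rw [ofPadic_mul_ofFinite _ (awayTwo_two _), ofReal_mul_mk_one]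
  apply AdelicCover.ext
  · exact ratToReal_neg_one
  · have h := mulSingle_mul_awayTwo (ratDiagonal (-1))
    rw [ratDiagonal_apply, ratToPadic_neg_one] at h
    exact h.symm
  · exact splitSign_neg_one

theorem IsAutomorphic.mul_signElt (hΦ : IsAutomorphic k N Φ) (g : AdelicCover) (ε : ℤˣ) :
    Φ (g * ofPadic (signElt ε)) = ((ε : ℤ) : ℂ) * Φ g := by
  have h1 : ofPadic (signElt ε) = ofReal 1 ε := by
    apply AdelicCover.ext
    · rfl
    · exact RestrictedProduct.mulSingle_one SL2Zp two
    · rfl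
  rw [h1, hΦ.weight 1 (one_smul _ _), autJ_one]
  simp

theorem neg_I_pow_odd : (-Complex.I) ^ (2 * k + 1) = gammaNegOne k := by
  rw [gammaNegOne, Odd.neg_pow ⟨k, rfl⟩]

/-- s_ℚ(-I) is central and factors into a real part with J = -i, the element (-I, 1) at 2, and a
part in the level group. Left invariance then forces the eigenvalue (-i)^(2k+1) = γ(-I, 1), which
explains the choice of γ. -/
theorem IsAutomorphic.mul_centralElt (hΦ : IsAutomorphic k N Φ) (g : AdelicCover) :
    Φ (g * ofPadic centralElt) = gammaNegOne k * Φ g := by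
  have h1 := hΦ.left (-1) g
  have hmem : awayTwo (ratDiagonal (-1)) ∈ levelFin N := by
    refine awayTwo_mem fun q _ => ?_
    rw [ratDiagonal_apply, ratToPadic_neg_one]
    exact neg_one_mem_gammaZeroPadic _
  have hI : (-1 : SL(2, ℝ)) • UpperHalfPlane.I = UpperHalfPlane.I := by
    rw [neg_smul_SL2, one_smul]
  rw [rationalSplitting_neg_one_comm, rationalSplitting_neg_one, ← mul_assoc, ← mul_assoc,
    hΦ.right _ hmem, mul_assoc, ← ofPadic_mul_ofReal, ← mul_assoc, hΦ.weight _ hI, autJ_neg_one,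
    neg_I_pow_odd] at h1
  have h2 : gammaNegOne k ≠ 0 := by rw [gammaNegOne]; simp
  rw [← h1]
  simp [h2]

theorem ofPadic_lift (κ : SL(2, ℚ_[two])) :
    ofPadic (lift κ) = ofFinite (RestrictedProduct.mulSingle SL2Zp two κ) := rfl

theorem IsAutomorphic.mul_lift (hΦ : IsAutomorphic k N Φ)
    (hN2 : ‖(N : ℚ_[two])‖ = ‖(4 : ℚ_[two])‖) (g : AdelicCover) {κ : SL(2, ℚ_[two])}
    (hκ : κ ∈ gammaOneFour two) : Φ (g * ofPadic (lift κ)) = Φ g := by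
  rw [ofPadic_lift, hΦ.right _ (mulSingle_mem_levelFin hN2 hκ)]

/-- Right translation by S acts through γ, whereas Hecke elements transform by its conjugate; the
two cancel in the Hecke integral. -/
theorem IsAutomorphic.mul_coverS (hΦ : IsAutomorphic k N Φ)
    (hN2 : ‖(N : ℚ_[two])‖ = ‖(4 : ℚ_[two])‖) (g : AdelicCover) {s : PadicCover two}
    (hs : s ∈ coverS) : Φ (g * ofPadic s) = gammaChar k s * Φ g := by
  obtain ⟨κ, hκ, ε, rfl | rfl⟩ := coverS_cases hs
  · rw [← ofPadic_mul_ofPadic, ← mul_assoc, hΦ.mul_signElt, hΦ.mul_lift hN2 _ hκ,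
      gammaChar_lift hκ]
  · rw [← ofPadic_mul_ofPadic, ← ofPadic_mul_ofPadic, ← mul_assoc, ← mul_assoc, hΦ.mul_signElt,
      hΦ.mul_centralElt, hΦ.mul_lift hN2 _ hκ, gammaChar_lift_central hκ, mul_assoc]

theorem IsHeckeElement.mul_right (hT : IsHeckeElement k T) (g : PadicCover two)
    {s : PadicCover two} (hs : s ∈ coverS) :
    T (g * s) = starRingEnd ℂ (gammaChar k s) * T g := by
  have := hT.equivariant 1 (mem_coverS.2 (one_mem _)) s hs g
  rwa [one_mul, gammaChar_one, map_one, one_mul] at this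

theorem IsHeckeElement.mul_left (hT : IsHeckeElement k T) (g : PadicCover two)
    {s : PadicCover two} (hs : s ∈ coverS) :
    T (s * g) = starRingEnd ℂ (gammaChar k s) * T g := by
  have := hT.equivariant s hs 1 (mem_coverS.2 (one_mem _)) g
  rwa [mul_one, gammaChar_one, map_one, mul_one] at this

/-- The integrand of the Hecke action is right invariant under `S`. -/
theorem integrand_mul_coverS (hΦ : IsAutomorphic k N Φ)
    (hN2 : ‖(N : ℚ_[two])‖ = ‖(4 : ℚ_[two])‖) (hT : IsHeckeElement k T) (g : AdelicCover)
    (x : PadicCover two) {s : PadicCover two} (hs : s ∈ coverS) :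
    T (x * s) * Φ (g * ofPadic (x * s)) = T x * Φ (g * ofPadic x) := by
  rw [hT.mul_right x hs, ← ofPadic_mul_ofPadic, ← mul_assoc, hΦ.mul_coverS hN2 _ hs]
  linear_combination T x * Φ (g * ofPadic x) * gammaChar_conj_mul (k := k) hs

theorem mk_eq_mul_signElt (g : SL(2, ℚ_[two])) (ε : ℤˣ) :
    (⟨g, ε⟩ : PadicCover two) = ⟨g, 1⟩ * signElt ε := by
  rw [signElt_comm, ← mk_eq_signElt]

/-- Both functions in the integrand are genuine, so the two sheets contribute equally and the factor
1/2 disappears. -/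
theorem heckeAction_eq (hΦ : IsAutomorphic k N Φ)
    (hN2 : ‖(N : ℚ_[two])‖ = ‖(4 : ℚ_[two])‖) (hT : IsHeckeElement k T) (g : AdelicCover) :
    heckeAction T Φ g =
      ∫ x : SL(2, ℚ_[two]), T ⟨x, 1⟩ * Φ (g * ofPadic (⟨x, 1⟩ : PadicCover two)) ∂haarTwo := by
  unfold heckeAction
  have h1 : ∀ ε : ℤˣ, (∫ x : SL(2, ℚ_[two]), T ⟨x, ε⟩ *
      Φ (g * ofPadic (⟨x, ε⟩ : PadicCover two)) ∂haarTwo) =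
      ∫ x : SL(2, ℚ_[two]), T ⟨x, 1⟩ * Φ (g * ofPadic (⟨x, 1⟩ : PadicCover two)) ∂haarTwo := by
    intro ε
    congr 1
    ext x
    rw [mk_eq_mul_signElt x ε, integrand_mul_coverS hΦ hN2 hT g _ (signElt_mem_coverS ε)]
  simp_rw [h1]
  rw [Finset.sum_const, Finset.card_univ, show Fintype.card ℤˣ = 2 from rfl]
  simp

instance : haarTwo.IsMulLeftInvariant := by
  unfold haarTwo; infer_instance

theorem haarTwo_K0four : haarTwo K0four = 1 := Measure.haarMeasure_self

theorem IsAutomorphic.heckeAction (hΦ : IsAutomorphic k N Φ)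
    (hN2 : ‖(N : ℚ_[two])‖ = ‖(4 : ℚ_[two])‖) (hT : IsHeckeElement k T) :
    IsAutomorphic k N (KohnenPlus.heckeAction T Φ) where
  left α g := by
    rw [heckeAction_eq hΦ hN2 hT, heckeAction_eq hΦ hN2 hT]
    congr 1
    ext x
    rw [mul_assoc, hΦ.left]
  right κ hκ g := by
    rw [heckeAction_eq hΦ hN2 hT, heckeAction_eq hΦ hN2 hT]
    have hκ2 : κ two ∈ gammaOneFour two := (hκ two).2
    -- The substitution x ↦ κ₂x moves the component of κ at 2 through the integral; the components
    -- away from 2 commute with it and are absorbed by Φ.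
    rw [← integral_mul_left_eq_self (fun x : SL(2, ℚ_[two]) => T ⟨x, 1⟩ *
      Φ (g * ofPadic (⟨x, 1⟩ : PadicCover two))) (κ two)]
    congr 1
    ext x
    have hmem : awayTwo κ ∈ levelFin N := awayTwo_mem fun q _ => (hκ q).1
    have h1 : g * ofFinite κ * ofPadic (⟨x, 1⟩ : PadicCover two) =
        g * ofPadic (lift (κ two) * ⟨x, 1⟩) * ofFinite (awayTwo κ) := by
      rw [mul_assoc, ofFinite_mul_ofPadic, ← mul_assoc]
      rfl
    have h2 : lift (κ two) * ⟨x, 1⟩ = (⟨κ two * x, 1⟩ : PadicCover two) *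
        signElt (cocyclePadic two (κ two) x) := by
      rw [← mk_eq_mul_signElt, lift, PadicCover.mk_mul_mk]
      simp
    have h3 : T ⟨x, 1⟩ = T (lift (κ two) * ⟨x, 1⟩) := by
      rw [hT.mul_left _ (lift_mem_coverS hκ2), gammaChar_lift_one hκ2, map_one, one_mul]
    rw [h1, hΦ.right _ hmem, h3, h2, integrand_mul_coverS hΦ hN2 hT g _ (signElt_mem_coverS _)]
  weight r hr ε g := by
    rw [heckeAction_eq hΦ hN2 hT, heckeAction_eq hΦ hN2 hT, ← integral_const_mul]
    congr 1
    ext x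
    rw [mul_assoc g, ← ofPadic_mul_ofReal, ← mul_assoc, hΦ.weight r hr]
    ring

open Classical in
/-- The Hecke action as a finite sum over left cosets. -/
theorem heckeAction_eq_sum (hΦ : IsAutomorphic k N Φ)
    (hN2 : ‖(N : ℚ_[two])‖ = ‖(4 : ℚ_[two])‖) (hT : IsHeckeElement k T) {ι : Type*} [Fintype ι]
    (x : ι → SL(2, ℚ_[two])) (hcover : ∀ h : SL(2, ℚ_[two]), T ⟨h, 1⟩ ≠ 0 →
      ∃ j, (x j)⁻¹ * h ∈ gammaZeroFour)
    (hdisj : ∀ i j, (x i)⁻¹ * x j ∈ gammaZeroFour → i = j) (g : AdelicCover) :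
    heckeAction T Φ g =
      ∑ j, T ⟨x j, 1⟩ * Φ (g * ofPadic (⟨x j, 1⟩ : PadicCover two)) := by
  rw [heckeAction_eq hΦ hN2 hT]
  set G : SL(2, ℚ_[two]) → ℂ := fun h => T ⟨h, 1⟩ * Φ (g * ofPadic (⟨h, 1⟩ : PadicCover two))
  let A : ι → Set SL(2, ℚ_[two]) := fun j => (fun h => (x j)⁻¹ * h) ⁻¹' K0four
  have hA : ∀ j, MeasurableSet (A j) := fun j =>
    (isOpen_K0four.preimage (continuous_const_mul _)).measurableSet
  have hvol : ∀ j, haarTwo (A j) = 1 := fun j => by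
    rw [← haarTwo_K0four]
    exact measure_preimage_mul haarTwo _ _
  -- The integrand is constant on each coset, and each coset has volume one.
  have hG : ∀ j, ∀ h ∈ A j, G h = G (x j) := by
    intro j h hh
    have hs : (⟨(x j)⁻¹ * h, cocyclePadic two (x j) ((x j)⁻¹ * h)⟩ : PadicCover two) ∈ coverS := hh
    have h1 := integrand_mul_coverS hΦ hN2 hT g ⟨x j, 1⟩ hs
    rw [PadicCover.mk_mul_mk, mul_inv_cancel_left, one_mul, Int.units_mul_self] at h1
    exact h1
  have hsum : G = fun h => ∑ j, (A j).indicator (fun _ => G (x j)) h := by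
    ext h
    by_cases hh : ∃ j, h ∈ A j
    · obtain ⟨j, hj⟩ := hh
      rw [Finset.sum_eq_single j, Set.indicator_of_mem hj, hG j h hj]
      · intro i _ hij
        refine Set.indicator_of_notMem (fun hi => hij (hdisj i j ?_)) _
        have h1 : (x i)⁻¹ * h ∈ gammaZeroFour := hi
        have h2 : (x j)⁻¹ * h ∈ gammaZeroFour := hj
        have := mul_mem h1 (inv_mem h2)
        rwa [mul_inv_rev, inv_inv, mul_assoc, mul_inv_cancel_left] at this
      · exact fun h => absurd (Finset.mem_univ j) h
    · push Not at hh
      rw [Finset.sum_eq_zero fun j _ => Set.indicator_of_notMem (hh j) _]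
      have : T ⟨h, 1⟩ = 0 := by
        by_contra hne
        obtain ⟨j, hj⟩ := hcover h hne
        exact hh j hj
      change T ⟨h, 1⟩ * _ = 0
      rw [this, zero_mul]
  rw [hsum, integral_finsetSum]
  · refine Finset.sum_congr rfl fun j _ => ?_
    rw [integral_indicator_const _ (hA j), Measure.real, hvol]
    simp [G]
  · intro j _
    rw [integrable_indicator_iff (hA j)]
    exact integrableOn_const (by rw [hvol]; simp)

/-- The value of an automorphic function at a rational element placed at `2`. -/
theorem IsAutomorphic.mul_ofPadic_rat (hΦ : IsAutomorphic k N Φ) (x : SL(2, ℝ)) (β : SL(2, ℚ))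
    (hβ : ∀ q, q ≠ two → ratToPadic q β ∈ gammaZeroPadic q (N : ℚ_[q])) :
    Φ (ofReal x 1 * ofPadic (⟨ratToPadic two β, 1⟩ : PadicCover two)) =
      (((splitSign β * cocycleReal (ratToReal β) (ratToReal β⁻¹) : ℤˣ) : ℤ) : ℂ) *
        slashReal k (slashReal k (classicalForm k Φ) (ratToReal β⁻¹)) x UpperHalfPlane.I := by
  have hb : ratToReal β * (ratToReal β⁻¹ * x) = x := by
    rw [← mul_assoc, ← map_mul, mul_inv_cancel, map_one, one_mul]
  set κ := (awayTwo (ratDiagonal β))⁻¹ with hκ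
  have hκmem : κ ∈ levelFin N := inv_mem (awayTwo_mem fun q hq => hβ q hq)
  set ε := splitSign β * cocycleReal (ratToReal β) (ratToReal β⁻¹ * x) with hε
  -- The element β at the place 2 alone equals s_ℚ(β) times β⁻¹ at the real place and at the odd
  -- primes; the latter part lies in the level group.
  have h1 : ofReal x 1 * ofPadic (⟨ratToPadic two β, 1⟩ : PadicCover two) =
      rationalSplitting β * (ofReal (ratToReal β⁻¹ * x) ε * ofFinite κ) := by
    have hcoc : cocycleFinite (ratDiagonal β) κ = 1 := by
      refine cocycleFinite_eq_one fun q => ?_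
      rw [hκ, RestrictedProduct.inv_apply]
      rcases eq_or_ne q two with rfl | hq
      · rw [awayTwo_two, inv_one, cocyclePadic_one_right]
      · rw [awayTwo_of_ne _ hq, ratDiagonal_apply]
        apply cocyclePadic_eq_one <;>
          rw [gammaOneFour_of_ne_two (norm_eq_one_of_odd_place hq)]
        · exact (hβ q hq).1
        · exact inv_mem (hβ q hq).1
    rw [ofReal_mul_ofPadic, ofReal_mul_ofFinite, rationalSplitting_mul_mk, hb, hcoc, hε]
    apply AdelicCover.ext
    · rfl
    · change RestrictedProduct.mulSingle SL2Zp two (ratToPadic two β) = ratDiagonal β * κ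
      rw [hκ, eq_mul_inv_iff_mul_eq]
      exact mulSingle_mul_awayTwo (ratDiagonal β)
    · change 1 * 1 = splitSign β * (splitSign β * cocycleReal (ratToReal β) (ratToReal β⁻¹ * x)) *
        (cocycleReal (ratToReal β) (ratToReal β⁻¹ * x) * 1)
      rw [sign_mul_cancel_left, mul_one, mul_one, Int.units_mul_self]
  have h2 : cocycleReal (ratToReal β) (ratToReal β⁻¹ * x) =
      cocycleReal (ratToReal β) (ratToReal β⁻¹) * cocycleReal (ratToReal β⁻¹) x := by
    have := cocycle_assoc (fun _ => 1) (ratToReal β) (ratToReal β⁻¹) x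
    change cocycleReal _ _ * cocycleReal _ _ = cocycleReal _ _ * cocycleReal _ _ at this
    rw [← map_mul, mul_inv_cancel, map_one, cocycleReal_one_left, mul_one] at this
    rw [this, mul_assoc, Int.units_mul_self, mul_one]
  rw [h1, hΦ.left, hΦ.right _ hκmem, hΦ.ofReal_eq, slashReal_slashReal, hε, h2, Pi.smul_apply,
    smul_eq_mul]
  simp only [Units.val_mul, Int.cast_mul]
  ring

/-- The sign with which the slash operator of `β⁻¹` enters the classical Hecke operators. -/
noncomputable def translateSign (β : SL(2, ℚ)) : ℤˣ :=
  splitSign β * cocycleReal (ratToReal β) (ratToReal β⁻¹)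

/-- The classical form of a Hecke operator at `2`. -/
theorem IsAutomorphic.classicalForm_heckeAction (hΦ : IsAutomorphic k N Φ)
    (hN2 : ‖(N : ℚ_[two])‖ = ‖(4 : ℚ_[two])‖) (hT : IsHeckeElement k T)
    {ι : Type*} [Fintype ι] (β : ι → SL(2, ℚ))
    (hβ : ∀ j q, q ≠ two → ratToPadic q (β j) ∈ gammaZeroPadic q (N : ℚ_[q]))
    (hcover : ∀ h : SL(2, ℚ_[two]), T ⟨h, 1⟩ ≠ 0 →
      ∃ j, (ratToPadic two (β j))⁻¹ * h ∈ gammaZeroFour)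
    (hdisj : ∀ i j, (ratToPadic two (β i))⁻¹ * ratToPadic two (β j) ∈ gammaZeroFour → i = j) :
    classicalForm k (KohnenPlus.heckeAction T Φ) = ∑ j, (T ⟨ratToPadic two (β j), 1⟩ *
      ((translateSign (β j) : ℤ) : ℂ)) • slashReal k (classicalForm k Φ) (ratToReal (β j)⁻¹) := by
  ext z
  rw [classicalForm, heckeAction_eq_sum hΦ hN2 hT _ hcover hdisj, Finset.sum_mul,
    Finset.sum_apply]
  refine Finset.sum_congr rfl fun j _ => ?_
  rw [hΦ.mul_ofPadic_rat _ _ (hβ j), Pi.smul_apply, smul_eq_mul,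
    translateSign, slashReal, toSL2R_smul_I]
  have h3 : autJ z.toSL2R 1 UpperHalfPlane.I ^ (2 * k + 1) ≠ 0 :=
    pow_ne_zero _ (autJ_ne_zero _ _)
  field_simp

theorem heckeTranslate_eq (hN : 4 ∣ N) (hN0 : N ≠ 0)
    (hN2 : ‖(N : ℚ_[two])‖ = ‖(4 : ℚ_[two])‖) (hT : IsHeckeElement k T) {f : ℍ → ℂ}
    (hf : ThetaInvariant k N f) {ι : Type*} [Fintype ι] (β : ι → SL(2, ℚ))
    (hβ : ∀ j q, q ≠ two → ratToPadic q (β j) ∈ gammaZeroPadic q (N : ℚ_[q]))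
    (hcover : ∀ h : SL(2, ℚ_[two]), T ⟨h, 1⟩ ≠ 0 →
      ∃ j, (ratToPadic two (β j))⁻¹ * h ∈ gammaZeroFour)
    (hdisj : ∀ i j, (ratToPadic two (β i))⁻¹ * ratToPadic two (β j) ∈ gammaZeroFour → i = j) :
    heckeTranslate k N T f = ∑ j, (T ⟨ratToPadic two (β j), 1⟩ *
      ((translateSign (β j) : ℤ) : ℂ)) • slashReal k f (ratToReal (β j)⁻¹) := by
  have h := (isAutomorphic_adelicLift hN hN0 hf).classicalForm_heckeAction hN2 hT β hβ hcover hdisj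
  rwa [classicalForm_adelicLift hN hN0 hf] at h

theorem isZeroAtImInfty_sum {ι : Type*} (s : Finset ι) (c : ι → ℂ) (f : ι → ℍ → ℂ)
    (h : ∀ j ∈ s, IsZeroAtImInfty (f j)) : IsZeroAtImInfty (∑ j ∈ s, c j • f j) := by
  have h1 := tendsto_finsetSum s fun j hj => (h j hj).const_smul (c j)
  simp only [smul_zero, Finset.sum_const_zero] at h1
  refine h1.congr fun z => ?_
  simp

theorem mdifferentiable_sum_smul {ι : Type*} (s : Finset ι) (c : ι → ℂ) (f : ι → ℍ → ℂ)
    (h : ∀ j ∈ s, MDifferentiable 𝓘(ℂ) 𝓘(ℂ) (f j)) :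
    MDifferentiable 𝓘(ℂ) 𝓘(ℂ) (∑ j ∈ s, c j • f j) := by
  classical
  induction s using Finset.induction_on with
  | empty => exact mdifferentiable_const
  | insert i s hi ih =>
    rw [Finset.sum_insert hi]
    exact ((h i (Finset.mem_insert_self _ _)).const_smul (c i)).add
      (ih fun j hj => h j (Finset.mem_insert_of_mem hj))

/-- Invariance comes from automorphy of the Hecke translate. Holomorphy and vanishing at the cusps
come from its expression as a finite sum of slashes by rational matrices. -/
theorem heckeTranslate_mem (hN : 4 ∣ N) (hN0 : N ≠ 0)
    (hN2 : ‖(N : ℚ_[two])‖ = ‖(4 : ℚ_[two])‖) (hT : IsHeckeElement k T) {f : ℍ → ℂ}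
    (hf : f ∈ cuspForms k N) {ι : Type*} [Fintype ι] (β : ι → SL(2, ℚ))
    (hβ : ∀ j q, q ≠ two → ratToPadic q (β j) ∈ gammaZeroPadic q (N : ℚ_[q]))
    (hcover : ∀ h : SL(2, ℚ_[two]), T ⟨h, 1⟩ ≠ 0 →
      ∃ j, (ratToPadic two (β j))⁻¹ * h ∈ gammaZeroFour)
    (hdisj : ∀ i j, (ratToPadic two (β i))⁻¹ * ratToPadic two (β j) ∈ gammaZeroFour → i = j) :
    heckeTranslate k N T f ∈ cuspForms k N := by
  obtain ⟨h1, h2, h3⟩ := (isCuspForm_iff hN).1 hf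
  have hΦ := (isAutomorphic_adelicLift hN hN0 h2).heckeAction hN2 hT
  have hsum := heckeTranslate_eq hN hN0 hN2 hT h2 β hβ hcover hdisj
  refine (isCuspForm_iff hN).2 ⟨?_, hΦ.thetaInvariant hN, fun α => ?_⟩
  · rw [hsum]
    exact mdifferentiable_sum_smul _ _ _ fun j _ => mdifferentiable_slashReal h1 _
  · rw [hsum, slashReal_sum]
    simp_rw [slashReal_smul]
    refine isZeroAtImInfty_sum _ _ _ fun j _ => ?_
    refine isZeroAtImInfty_congr_norm (fun z => (norm_slashReal_slashReal f _ _ z).symm) ?_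
    rw [intToReal_eq, ← map_mul]
    exact isZeroAtImInfty_slashReal_rat h3 _

end Action

/-! ### Coset representatives for the Hecke operators at `2` -/

section Elementary

variable {p : Nat.Primes}

theorem ratToPadic_upperU (b : ℚ) : ratToPadic p (upperU b) = upperU (b : ℚ_[p]) := by
  apply SL2_ext <;> simp [ratToPadic_apply]

theorem ratToPadic_lowerU (c : ℚ) : ratToPadic p (lowerU c) = lowerU (c : ℚ_[p]) := by
  apply SL2_ext <;> simp [ratToPadic_apply]

theorem ratToReal_upperU (b : ℚ) : ratToReal (upperU b) = upperU (b : ℝ) := by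
  apply SL2_ext <;> simp [ratToReal_apply]

theorem ratToReal_lowerU (c : ℚ) : ratToReal (lowerU c) = lowerU (c : ℝ) := by
  apply SL2_ext <;> simp [ratToReal_apply]

theorem upperU_inv {K : Type*} [Field K] (b : K) : (upperU b)⁻¹ = upperU (-b) := by
  apply SL2_ext <;> simp [SL2_inv_00, SL2_inv_01, SL2_inv_10, SL2_inv_11]

theorem lowerU_inv {K : Type*} [Field K] (b : K) : (lowerU b)⁻¹ = lowerU (-b) := by
  apply SL2_ext <;> simp [SL2_inv_00, SL2_inv_01, SL2_inv_10, SL2_inv_11]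

theorem upperU_mem_gammaZeroPadic {b : ℚ_[p]} (hb : ‖b‖ ≤ 1) (x : ℚ_[p]) :
    upperU b ∈ gammaZeroPadic p x := by
  refine ⟨mem_SL2Zp.2 fun i j => ?_, by simp⟩
  fin_cases i <;> fin_cases j <;> simp [hb]

theorem lowerU_mem_gammaZeroPadic {c x : ℚ_[p]} (hc : ‖c‖ ≤ ‖x‖) (hx : ‖x‖ ≤ 1) :
    lowerU c ∈ gammaZeroPadic p x := by
  refine ⟨mem_SL2Zp.2 fun i j => ?_, by simpa using hc⟩
  fin_cases i <;> fin_cases j <;> simp [hc.trans hx]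

theorem diagU_mem_gammaZeroPadic {t : (ℚ_[p])ˣ} (ht : ‖(t : ℚ_[p])‖ = 1) (x : ℚ_[p]) :
    diagU t ∈ gammaZeroPadic p x := by
  refine ⟨mem_SL2Zp.2 fun i j => ?_, by simp⟩
  fin_cases i <;> fin_cases j <;> simp [ht]

theorem norm_two_of_ne_two {q : Nat.Primes} (hq : q ≠ two) : ‖(2 : ℚ_[q])‖ = 1 := by
  have h := norm_four_of_ne_two (p := q) (norm_eq_one_of_odd_place hq)
  rw [show (4 : ℚ_[q]) = 2 * 2 by norm_num, norm_mul] at h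
  nlinarith [norm_nonneg (2 : ℚ_[q])]

theorem mem_gammaZeroFour_of_norm {g : SL(2, ℚ_[two])} (h00 : ‖g 0 0‖ ≤ 1) (h01 : ‖g 0 1‖ ≤ 1)
    (h10 : ‖g 1 0‖ ≤ 4⁻¹) (h11 : ‖g 1 1‖ ≤ 1) : g ∈ gammaZeroFour := by
  refine ⟨mem_SL2Zp.2 fun i j => ?_, by rwa [norm_four_two]⟩
  fin_cases i <;> fin_cases j
  · exact h00
  · exact h01
  · exact h10.trans (by norm_num)
  · exact h11

theorem norm_of_mem_gammaZeroFour {g : SL(2, ℚ_[two])} (h : g ∈ gammaZeroFour) :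
    (∀ i j, ‖g i j‖ ≤ 1) ∧ ‖g 1 0‖ ≤ 4⁻¹ :=
  ⟨mem_SL2Zp.1 h.1, by rw [← norm_four_two]; exact h.2⟩

theorem norm_le_of_eq_neg {x y : ℚ_[two]} {r : ℝ} (h : ‖y‖ ≤ r) (e : x = -y) : ‖x‖ ≤ r := by
  rwa [e, norm_neg]

theorem exists_fin_four_approx {x : ℚ_[two]} (hx : ‖x‖ ≤ 1) :
    ∃ j : Fin 4, ‖x - ((j : ℕ) : ℚ_[two])‖ ≤ 4⁻¹ := by
  obtain ⟨n, hn⟩ := exists_nat_approx hx (r := 4⁻¹) (by norm_num)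
  refine ⟨⟨n % 4, Nat.mod_lt _ (by norm_num)⟩, ?_⟩
  have h1 : (n : ℚ_[two]) = ((n % 4 : ℕ) : ℚ_[two]) + 4 * ((n / 4 : ℕ) : ℚ_[two]) := by
    exact_mod_cast congrArg (Nat.cast (R := ℚ_[two])) (Nat.mod_add_div n 4).symm
  have h2 : x - ((n % 4 : ℕ) : ℚ_[two]) = -((n : ℚ_[two]) - x) + 4 * ((n / 4 : ℕ) : ℚ_[two]) := by
    linear_combination h1
  rw [h2]
  refine norm_add_le_of_le (by rwa [norm_neg]) (norm_mul_le_of_le_one_right norm_four_two.le ?_)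
  exact_mod_cast Padic.norm_int_le_one (p := 2) ((n / 4 : ℕ) : ℤ)

theorem fin_four_eq_of_norm {i j : Fin 4}
    (h : ‖((i : ℕ) : ℚ_[two]) - ((j : ℕ) : ℚ_[two])‖ ≤ 4⁻¹) : i = j := by
  have h1 : (4 : ℤ) ∣ ((i : ℕ) : ℤ) - ((j : ℕ) : ℤ) := by
    apply four_dvd_of_norm_le
    rw [norm_four_two]
    push_cast
    exact h
  have := i.2
  have := j.2
  ext
  omega

/-- Modulo squares (-4x, 1 + x) is (-x, 1 + x) = 1. The representatives of 𝒰₂ have lower row of this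
shape, which makes all their splitting signs trivial. -/
theorem sPadic_steinberg {g : SL(2, ℚ_[p])} (x : ℚ_[p]) (hc : g 1 0 = -4 * x)
    (hd : g 1 1 = 1 + x) : sPadic p g = 1 := by
  unfold sPadic
  split_ifs with h
  · rw [hc, hd, show (-4 * x : ℚ_[p]) = -x * 2 ^ 2 by ring, hilbertSymbol_mul_sq_left _ _ two_ne_zero,
      show (1 + x : ℚ_[p]) = 1 - -x by ring, hilbertSymbol_one_sub]
  · rfl

theorem sPadic_wMat (t : (ℚ_[two])ˣ) : sPadic two (wMat t) = 1 := by
  unfold sPadic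
  rw [if_neg]
  simp

theorem exists_of_supportedOn_ne_zero {k : ℕ} {g : SL(2, ℚ_[two])} {c : ℂ} {h : SL(2, ℚ_[two])}
    (H : supportedOn k ⟨g, 1⟩ c ⟨h, 1⟩ ≠ 0) :
    ∃ x ∈ gammaZeroFour, ∃ y ∈ gammaZeroFour, h = x * g * y := by
  by_contra hne
  refine H (supportedOn_eq_zero ?_)
  rintro ⟨x, hx, y, hy, e⟩
  exact hne ⟨x.mat, hx, y.mat, hy, congrArg PadicCover.mat e⟩

/-- To cover the support of a Hecke element on `S g S` it suffices to cover `K g` by cosets. -/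
theorem cover_of_forall {k : ℕ} {g : SL(2, ℚ_[two])} {c : ℂ} {ι : Type*} (x : ι → SL(2, ℚ_[two]))
    (H : ∀ y ∈ gammaZeroFour, ∃ j, (x j)⁻¹ * (y * g) ∈ gammaZeroFour) (h : SL(2, ℚ_[two]))
    (hh : supportedOn k ⟨g, 1⟩ c ⟨h, 1⟩ ≠ 0) : ∃ j, (x j)⁻¹ * h ∈ gammaZeroFour := by
  obtain ⟨y, hy, y', hy', rfl⟩ := exists_of_supportedOn_ne_zero hh
  obtain ⟨j, hj⟩ := H y hy
  exact ⟨j, by rw [← mul_assoc]; exact mul_mem hj hy'⟩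

end Elementary

/-! ### Explicit cosets for 𝒯₁, 𝒰₁ and 𝒰₂ -/

section Representatives

attribute [local simp] SL2_mul_zero_zero SL2_mul_zero_one SL2_mul_one_zero SL2_mul_one_one
  SL2_inv_00 SL2_inv_01 SL2_inv_10 SL2_inv_11

variable {k N M : ℕ}

/-- The representatives `n(b) h(2)` for `𝒯₁`. -/
def repT {K : Type*} [Field K] (t : Kˣ) (b : Fin 4) : SL(2, K) := upperU ((b : ℕ) : K) * diagU t

/-- The rational representative for `𝒰₁`. -/
def repU1 {K : Type*} [Field K] (M : ℕ) (t : Kˣ) : SL(2, K) :=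
  lowerU (M : K) * diagU t * upperU (-(M : K) / 4)

/-- The representatives `n⁻(-4Mν) n(-1/4)` for `𝒰₂`. -/
def repU2 {K : Type*} [Field K] (M : ℕ) (ν : Fin 4) : SL(2, K) :=
  lowerU (-4 * M * ((ν : ℕ) : K)) * upperU (-1 / 4)

/-- `2` as a unit of `ℚ`. -/
def twoRat : ℚˣ := Units.mk0 2 two_ne_zero

theorem ratToPadic_diagU (p : Nat.Primes) : ratToPadic p (diagU twoRat) =
    diagU (Units.map (Rat.castHom ℚ_[p] : ℚ →* ℚ_[p]) twoRat) := by
  apply SL2_ext <;> simp [ratToPadic_apply]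

theorem units_map_twoRat : Units.map (Rat.castHom ℚ_[two] : ℚ →* ℚ_[two]) twoRat = twoUnit := by
  ext
  simp [twoRat, twoUnit]

theorem ratToPadic_repT (b : Fin 4) : ratToPadic two (repT twoRat b) = repT twoUnit b := by
  rw [repT, map_mul, ratToPadic_upperU, ratToPadic_diagU, units_map_twoRat, repT]
  simp

theorem ratToPadic_repU1 (M : ℕ) : ratToPadic two (repU1 M twoRat) = repU1 M twoUnit := by
  rw [repU1, map_mul, map_mul, ratToPadic_upperU, ratToPadic_lowerU, ratToPadic_diagU,
    units_map_twoRat, repU1]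
  simp

theorem ratToPadic_repU2 (p : Nat.Primes) (M : ℕ) (ν : Fin 4) :
    ratToPadic p (repU2 M ν) = repU2 M ν := by
  rw [repU2, map_mul, ratToPadic_upperU, ratToPadic_lowerU, repU2]
  simp

theorem norm_natCast_le_one {p : Nat.Primes} (n : ℕ) : ‖(n : ℚ_[p])‖ ≤ 1 := by
  exact_mod_cast Padic.norm_int_le_one (p := p) (n : ℤ)

theorem norm_two_units_of_ne_two {q : Nat.Primes} (hq : q ≠ two) :
    ‖((Units.map (Rat.castHom ℚ_[q] : ℚ →* ℚ_[q]) twoRat : (ℚ_[q])ˣ) : ℚ_[q])‖ = 1 := by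
  simpa [twoRat] using norm_two_of_ne_two hq

theorem repT_mem {q : Nat.Primes} (hq : q ≠ two) (x : ℚ_[q]) (b : Fin 4) :
    ratToPadic q (repT twoRat b) ∈ gammaZeroPadic q x := by
  rw [repT, map_mul, ratToPadic_upperU, ratToPadic_diagU]
  refine mul_mem (upperU_mem_gammaZeroPadic ?_ _)
    (diagU_mem_gammaZeroPadic (norm_two_units_of_ne_two hq) _)
  simpa using norm_natCast_le_one (p := q) b

theorem repU1_mem {q : Nat.Primes} (hq : q ≠ two) (M : ℕ) :
    ratToPadic q (repU1 M twoRat) ∈ gammaZeroPadic q ((4 * M : ℕ) : ℚ_[q]) := by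
  have h4 := norm_four_of_ne_two (p := q) (norm_eq_one_of_odd_place hq)
  rw [repU1, map_mul, map_mul, ratToPadic_upperU, ratToPadic_diagU, ratToPadic_lowerU]
  refine mul_mem (mul_mem (lowerU_mem_gammaZeroPadic ?_ (norm_natCast_le_one _))
    (diagU_mem_gammaZeroPadic (norm_two_units_of_ne_two hq) _)) (upperU_mem_gammaZeroPadic ?_ _)
  · push_cast
    rw [norm_mul, h4, one_mul]
  · push_cast
    rw [norm_div, h4, div_one, norm_neg]
    exact norm_natCast_le_one M

theorem repU2_mem {q : Nat.Primes} (hq : q ≠ two) (M : ℕ) (ν : Fin 4) :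
    ratToPadic q (repU2 M ν) ∈ gammaZeroPadic q ((4 * M : ℕ) : ℚ_[q]) := by
  have h4 := norm_four_of_ne_two (p := q) (norm_eq_one_of_odd_place hq)
  rw [ratToPadic_repU2, repU2]
  refine mul_mem (lowerU_mem_gammaZeroPadic ?_ (norm_natCast_le_one _))
    (upperU_mem_gammaZeroPadic ?_ _)
  · push_cast
    refine norm_mul_le_of_le_one_right ?_ (norm_natCast_le_one _)
    rw [neg_mul, norm_neg]
  · rw [norm_div, h4, div_one, norm_neg, norm_one]

theorem norm_level (hM : Odd M) : ‖((4 * M : ℕ) : ℚ_[two])‖ = ‖(4 : ℚ_[two])‖ := by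
  have h : ‖((M : ℤ) : ℚ_[two])‖ = 1 := norm_int_two (by obtain ⟨m, rfl⟩ := hM; omega)
  push_cast at h ⊢
  rw [norm_mul, h, mul_one]

theorem norm_odd_natCast (hM : Odd M) : ‖(M : ℚ_[two])‖ = 1 := by
  have h : ‖((M : ℤ) : ℚ_[two])‖ = 1 := norm_int_two (by obtain ⟨m, rfl⟩ := hM; omega)
  exact_mod_cast h

theorem norm_sub_div_le {a b d : ℚ_[two]} (hd : ‖d‖ = 1) (h : ‖b / d - a‖ ≤ 4⁻¹) :
    ‖b - a * d‖ ≤ 4⁻¹ := by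
  have hd0 : d ≠ 0 := ne_zero_of_norm_eq_one hd
  rw [show b - a * d = (b / d - a) * d by field_simp, norm_mul, hd, mul_one]
  exact h

theorem norm_div_four_le {x : ℚ_[two]} (h : ‖x‖ ≤ 4⁻¹) : ‖x / 4‖ ≤ 1 := by
  rw [norm_div, norm_four_two, div_inv_eq_mul]
  linarith

theorem norm_four_mul_le {x : ℚ_[two]} (h : ‖x‖ ≤ 1) : ‖4 * x‖ ≤ 4⁻¹ :=
  norm_mul_le_of_le_one_right norm_four_two.le h

theorem twoUnit_val : (twoUnit : ℚ_[two]) = 2 := rfl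

/-- The index j is the residue modulo 4 of the ratio of the right column of y, whose lower entry is
a unit. -/
theorem repT_cover (y : SL(2, ℚ_[two])) (hy : y ∈ gammaZeroFour) :
    ∃ j, (repT twoUnit j)⁻¹ * (y * hMat (twoUnit ^ (1 : ℤ))) ∈ gammaZeroFour := by
  obtain ⟨hn, hc⟩ := norm_of_mem_gammaZeroFour hy
  have hd : ‖y 1 1‖ = 1 := (norm_units_of_K0four hy).2
  obtain ⟨j, hj⟩ := exists_fin_four_approx (x := y 0 1 / y 1 1)
    (by rw [norm_div, hd, div_one]; exact hn 0 1)
  have hb := norm_sub_div_le hd hj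
  refine ⟨j, ?_⟩
  rw [zpow_one, hMat_eq, repT]
  apply mem_gammaZeroFour_of_norm
  · convert norm_sub_le_of_le (hn 0 0) (norm_mul_le_of_le_one_left (norm_natCast_le_one j) (hn 1 0))
      using 2
    simp [twoUnit_val]
    ring
  · convert norm_div_four_le hb using 2
    simp [twoUnit_val]
    ring
  · convert norm_four_mul_le (hn 1 0) using 2
    simp [twoUnit_val]
    ring
  · convert hn 1 1 using 2
    simp [twoUnit_val]
    field_simp

theorem repT_disjoint (i j : Fin 4)
    (h : (repT twoUnit i)⁻¹ * repT twoUnit j ∈ gammaZeroFour) : i = j := by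
  have h1 := (norm_of_mem_gammaZeroFour h).1 0 1
  have h2 : ((repT twoUnit i)⁻¹ * repT twoUnit j) 0 1 =
      (((j : ℕ) : ℚ_[two]) - ((i : ℕ) : ℚ_[two])) / 4 := by
    simp [repT, twoUnit_val]
    ring
  rw [h2, norm_div, norm_four_two, div_inv_eq_mul] at h1
  exact (fin_four_eq_of_norm (by linarith)).symm

theorem twoUnit_zpow_neg_two : ((twoUnit ^ (-2 : ℤ) : (ℚ_[two])ˣ) : ℚ_[two]) = 4⁻¹ := by
  rw [zpow_neg]
  simp [twoUnit_val]
  norm_num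

theorem wMat_conj_mem (y : SL(2, ℚ_[two])) (hy : y ∈ gammaZeroFour) :
    (wMat (twoUnit ^ (-1 : ℤ)))⁻¹ * (y * wMat (twoUnit ^ (-1 : ℤ))) ∈ gammaZeroFour := by
  obtain ⟨hn, hc⟩ := norm_of_mem_gammaZeroFour hy
  apply mem_gammaZeroFour_of_norm
  · convert hn 1 1 using 2
    simp [twoUnit_val, mul_comm]
  · refine norm_le_of_eq_neg (norm_div_four_le hc) ?_
    simp [twoUnit_val]
    ring
  · refine norm_le_of_eq_neg (norm_four_mul_le (hn 0 1)) ?_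
    simp [twoUnit_val]
    ring
  · convert hn 0 0 using 2
    simp [twoUnit_val, mul_comm]

theorem wMat_cover (y : SL(2, ℚ_[two])) (hy : y ∈ gammaZeroFour) :
    ∃ _ : Unit, (wMat (twoUnit ^ (-1 : ℤ)))⁻¹ * (y * wMat (twoUnit ^ (-1 : ℤ))) ∈ gammaZeroFour :=
  ⟨(), wMat_conj_mem y hy⟩

/-- w(1/2) is not in the level group at the primes dividing M. It is replaced by a rational matrix
in the same coset at 2; the upper right entry is integral because M² - 1 = 4m(m + 1) for M = 2m + 1.
-/
theorem repU1_inv_mul_mem (hM : Odd M) :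
    (repU1 M twoUnit)⁻¹ * wMat (twoUnit ^ (-1 : ℤ)) ∈ gammaZeroFour := by
  have hn : ‖(M : ℚ_[two])‖ ≤ 1 := norm_natCast_le_one M
  obtain ⟨m, rfl⟩ := hM
  apply mem_gammaZeroFour_of_norm
  · refine norm_le_of_eq_neg (hn) ?_
    simp [repU1, twoUnit_val]
    ring
  · convert Padic.norm_int_le_one (p := 2) (-(m * (m + 1) : ℤ)) using 2
    simp [repU1, twoUnit_val]
    ring
  · refine norm_le_of_eq_neg (norm_four_two.le) ?_
    simp [repU1, twoUnit_val]
    ring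
  · refine norm_le_of_eq_neg (hn) ?_
    simp [repU1, twoUnit_val]
    ring

theorem repU1_cover (hM : Odd M) (y : SL(2, ℚ_[two])) (hy : y ∈ gammaZeroFour) :
    ∃ _ : Unit, (repU1 M twoUnit)⁻¹ * (y * wMat (twoUnit ^ (-1 : ℤ))) ∈ gammaZeroFour := by
  have := mul_mem (repU1_inv_mul_mem hM) (wMat_conj_mem y hy)
  rw [mul_assoc, mul_inv_cancel_left] at this
  exact ⟨(), this⟩

/-- The representatives `w(1/2) n(b) h(2)` for `𝒰₂`. -/
noncomputable def repU1T (b : Fin 4) : SL(2, ℚ_[two]) := wMat (twoUnit ^ (-1 : ℤ)) * repT twoUnit b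

theorem repU1T_disjoint (i j : Fin 4)
    (h : (repU1T i)⁻¹ * repU1T j ∈ gammaZeroFour) : i = j := by
  apply repT_disjoint
  rwa [repU1T, repU1T, mul_inv_rev, mul_assoc, inv_mul_cancel_left] at h

/-- The products of the representatives of 𝒰₁ and 𝒯₁ lie in K₀²(4)w(1/4), hence in the support of
𝒰₂. -/
theorem repU1T_eq (b : Fin 4) :
    repU1T b = lowerU (-4 * ((b : ℕ) : ℚ_[two])) * wMat (twoUnit ^ (-2 : ℤ)) := by
  apply SL2_ext <;> simp [repU1T, repT, -zpow_neg]
    <;> simp [twoUnit_val] <;> ring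

theorem repU1T_cover (y : SL(2, ℚ_[two])) (hy : y ∈ gammaZeroFour) :
    ∃ j, (repU1T j)⁻¹ * (y * wMat (twoUnit ^ (-2 : ℤ))) ∈ gammaZeroFour := by
  obtain ⟨hn, hc⟩ := norm_of_mem_gammaZeroFour hy
  have ha : ‖y 0 0‖ = 1 := (norm_units_of_K0four hy).1
  obtain ⟨j, hj⟩ := exists_fin_four_approx (x := -(y 1 0 / 4) / y 0 0)
    (by rw [norm_div, ha, div_one, norm_neg]; exact norm_div_four_le hc)
  have hb := norm_sub_div_le ha hj
  refine ⟨j, ?_⟩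
  rw [repU1T_eq]
  have e := twoUnit_zpow_neg_two
  set w := twoUnit ^ (-2 : ℤ)
  apply mem_gammaZeroFour_of_norm
  · convert norm_add_le_of_le (hn 1 1) (norm_mul_le_of_le_one_left (norm_natCast_le_one j)
      ((norm_four_mul_le (hn 0 1)).trans (by norm_num : (4⁻¹ : ℝ) ≤ 1))) using 2
    simp [e]
    ring
  · convert norm_div_four_le hb using 2
    simp [e]
    ring
  · refine norm_le_of_eq_neg (norm_four_mul_le ((norm_four_mul_le (hn 0 1)).trans (by norm_num : (4⁻¹ : ℝ) ≤ 1))) ?_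
    simp [e]
    ring
  · convert hn 0 0 using 2
    simp [e]
    ring

/-- The condition on j is the congruence j M a ≡ -(c/4) - a modulo 4, solvable because M a is a
unit. -/
theorem repU2_cover (hM : Odd M) (y : SL(2, ℚ_[two])) (hy : y ∈ gammaZeroFour) :
    ∃ j, (repU2 M j)⁻¹ * (y * wMat (twoUnit ^ (-2 : ℤ))) ∈ gammaZeroFour := by
  obtain ⟨hn, hc⟩ := norm_of_mem_gammaZeroFour hy
  have ha : ‖y 0 0‖ = 1 := (norm_units_of_K0four hy).1
  have hMn := norm_odd_natCast hM
  have hMa : ‖(M : ℚ_[two]) * y 0 0‖ = 1 := by rw [norm_mul, ha, hMn, one_mul]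
  obtain ⟨j, hj⟩ := exists_fin_four_approx (x := (-(y 1 0 / 4) - y 0 0) / (M * y 0 0))
    (by rw [norm_div, hMa, div_one]
        exact norm_sub_le_of_le (by rw [norm_neg]; exact norm_div_four_le hc) (hn 0 0))
  have hb := norm_sub_div_le hMa hj
  have hj1 : ‖((j : ℕ) : ℚ_[two]) * ((M : ℚ_[two]) * y 0 0)‖ ≤ 1 :=
    norm_mul_le_of_le_one_left (norm_natCast_le_one j) hMa.le
  have hD : ‖4 * ((j : ℕ) : ℚ_[two]) * M * y 0 1 + y 1 1‖ ≤ 1 := by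
    refine norm_add_le_of_le (norm_mul_le_of_le_one_left ?_ (hn 0 1)) (hn 1 1)
    exact_mod_cast norm_natCast_le_one (p := two) (4 * j * M)
  refine ⟨j, ?_⟩
  rw [repU2]
  have e := twoUnit_zpow_neg_two
  set w := twoUnit ^ (-2 : ℤ)
  apply mem_gammaZeroFour_of_norm
  · refine norm_le_of_eq_neg (norm_add_le_of_le ((norm_four_mul_le (hn 0 1)).trans (by norm_num : (4⁻¹ : ℝ) ≤ 1)) hD) ?_
    simp [e]
    ring
  · refine norm_le_of_eq_neg (norm_div_four_le hb) ?_
    simp [e]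
    ring
  · refine norm_le_of_eq_neg (norm_four_mul_le hD) ?_
    simp [e]
    ring
  · convert norm_add_le_of_le (norm_div_four_le hc) hj1 using 2
    simp [e]
    ring

theorem repU2_disjoint (hM : Odd M) (i j : Fin 4)
    (h : (repU2 M i)⁻¹ * repU2 M j ∈ gammaZeroFour) : i = j := by
  have h1 := (norm_of_mem_gammaZeroFour h).1 0 1
  have h2 : ((repU2 M i)⁻¹ * repU2 M j : SL(2, ℚ_[two])) 0 1 =
      M * (((j : ℕ) : ℚ_[two]) - ((i : ℕ) : ℚ_[two])) / 4 := by
    simp [repU2]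
    ring
  rw [h2, norm_div, norm_four_two, div_inv_eq_mul, norm_mul, norm_odd_natCast hM] at h1
  exact (fin_four_eq_of_norm (by linarith)).symm

end Representatives

/-! ### Explicit formulas for the Hecke operators at `2` -/

section HeckeFormulas

variable {k N M : ℕ} {Φ : AdelicCover → ℂ}

theorem cocyclePadic_upper {p : Nat.Primes} (b : ℚ_[p]) {g : SL(2, ℚ_[p])} (hg : g 1 0 = 0) :
    cocyclePadic p (upperU b) g = 1 := by
  rw [cocyclePadic_eq, kubota_upperU_left, sPadic_of_eq_zero (upperU_10 b), sPadic_of_eq_zero hg,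
    sPadic_of_eq_zero (by rw [SL2_mul_one_zero, hg]; simp)]
  simp

theorem one_mem_coverS : (1 : PadicCover two) ∈ coverS := mem_coverS.2 (one_mem _)

theorem heckeT_repT (b : Fin 4) : heckeT k 1 ⟨repT twoUnit b, 1⟩ = 1 := by
  have hb : upperU ((b : ℕ) : ℚ_[two]) ∈ gammaOneFour two := upperU_mem (norm_natCast_le_one _)
  have h1 : (⟨repT twoUnit b, 1⟩ : PadicCover two) =
      lift (upperU ((b : ℕ) : ℚ_[two])) * ⟨hMat (twoUnit ^ (1 : ℤ)), 1⟩ * 1 := by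
    rw [mul_one, lift, PadicCover.mk_mul_mk, cocyclePadic_upper _ rfl, zpow_one, hMat_eq, repT]
    simp
  rw [h1, heckeT, supportedOn_apply (gammaCompatible_hMat _) _ (lift_mem_coverS hb)
    one_mem_coverS, gammaChar_lift_one hb, gammaChar_one]
  simp

theorem heckeU_wMat (n : ℤ) :
    heckeU k n ⟨wMat (twoUnit ^ (-n)), 1⟩ = starRingEnd ℂ (zetaEight k) := by
  have h1 := supportedOn_apply (gammaCompatible_wMat (k := k) (twoUnit ^ (-n)))
    (starRingEnd ℂ (zetaEight k)) one_mem_coverS one_mem_coverS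
  rw [gammaChar_one, map_one, one_mul, mul_one] at h1
  rw [heckeU, h1, one_mul, mul_one]

/-- This is the only symbol left in the cocycle of w(1/2) and n(b)h(2), so 𝒰₁𝒯₁ = 𝒰₂ holds without a
sign. -/
theorem hilbertSymbol_two_neg_two {K : Type*} [Field K] : hilbertSymbol (2 : K) (-2) = 1 :=
  hilbertSymbol_self_neg 2

theorem even_valuation_neg_four : Even (-4 : ℚ_[two]).valuation := by
  rw [show (-4 : ℚ_[two]) = -1 * 2 ^ 2 by norm_num, Padic.valuation_mul (by norm_num)
    (by norm_num), Padic.valuation_pow, valuation_eq_zero_of_norm_eq_one (by simp)]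
  simp

theorem cocyclePadic_wMat_repT (b : Fin 4) :
    cocyclePadic two (wMat (twoUnit ^ (-1 : ℤ))) (repT twoUnit b) = 1 := by
  have h10 : (wMat (twoUnit ^ (-1 : ℤ)) * repT twoUnit b) 1 0 = -4 * 1 := by
    rw [SL2_mul_one_zero]
    simp [repT, SL2_mul_zero_zero, twoUnit_val, SL2_mul_one_zero]
    norm_num
  have h11 : (wMat (twoUnit ^ (-1 : ℤ)) * repT twoUnit b) 1 0 ≠ 0 := by
    rw [h10]; norm_num
  have hT : (repT twoUnit b) 1 0 = 0 := by simp [repT, SL2_mul_one_zero]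
  have h12 : Even ((wMat (twoUnit ^ (-1 : ℤ)) * repT twoUnit b) 1 0).valuation := by
    rw [h10, mul_one]
    exact even_valuation_neg_four
  rw [cocyclePadic_eq, sPadic_wMat, sPadic_of_eq_zero hT, sPadic_of_even h12, kubota, tau_wMat,
    tau_of_ne_zero h11, tau_of_eq_zero hT, h10]
  have e1 : (-4 * 1 * -((twoUnit ^ (-1 : ℤ) : (ℚ_[two])ˣ) : ℚ_[two])⁻¹) = 2 * 2 ^ 2 := by
    simp [twoUnit_val]
    norm_num
  have e2 : (-4 * 1 * (repT twoUnit b) 1 1 : ℚ_[two]) = -2 := by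
    simp [repT, SL2_mul_one_one, twoUnit_val]
    norm_num
  rw [e1, e2, hilbertSymbol_mul_sq_left _ _ two_ne_zero, hilbertSymbol_two_neg_two]
  simp

theorem cocyclePadic_lowerU_wMat (b : Fin 4) : cocyclePadic two
    (lowerU (-4 * ((b : ℕ) : ℚ_[two]))) (wMat (twoUnit ^ (-2 : ℤ))) = 1 := by
  have h10 : (lowerU (-4 * ((b : ℕ) : ℚ_[two])) * wMat (twoUnit ^ (-2 : ℤ))) 1 0 = -4 := by
    rw [SL2_mul_one_zero, wMat_00, wMat_10, twoUnit_zpow_neg_two]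
    simp
  have h11 : (lowerU (-4 * ((b : ℕ) : ℚ_[two])) * wMat (twoUnit ^ (-2 : ℤ))) 1 0 ≠ 0 := by
    rw [h10]; norm_num
  have h12 : Even ((lowerU (-4 * ((b : ℕ) : ℚ_[two])) *
      wMat (twoUnit ^ (-2 : ℤ))) 1 0).valuation := by
    rw [h10]
    exact even_valuation_neg_four
  rw [cocyclePadic_eq, sPadic_wMat, sPadic_lowerU, sPadic_of_even h12, kubota, tau_wMat,
    tau_of_ne_zero h11, h10, twoUnit_zpow_neg_two,
    hilbertSymbol_isSquare_right _ ⟨4, by norm_num⟩]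
  simp

theorem norm_neg_four_mul (b : Fin 4) : ‖-4 * ((b : ℕ) : ℚ_[two])‖ ≤ ‖(4 : ℚ_[two])‖ :=
  norm_mul_le_of_le_one_right (by rw [norm_neg]) (norm_natCast_le_one _)

theorem mk_repU1T (b : Fin 4) : (⟨repU1T b, 1⟩ : PadicCover two) =
    lift (lowerU (-4 * ((b : ℕ) : ℚ_[two]))) * ⟨wMat (twoUnit ^ (-2 : ℤ)), 1⟩ * 1 := by
  rw [mul_one, lift, PadicCover.mk_mul_mk, cocyclePadic_lowerU_wMat, repU1T_eq]
  simp

theorem heckeU_repU1T (b : Fin 4) :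
    heckeU k 2 ⟨repU1T b, 1⟩ = starRingEnd ℂ (zetaEight k) := by
  have hb : lowerU (-4 * ((b : ℕ) : ℚ_[two])) ∈ gammaOneFour two := lowerU_mem (norm_neg_four_mul b)
  rw [mk_repU1T, heckeU, supportedOn_apply (gammaCompatible_wMat _) _ (lift_mem_coverS hb)
    one_mem_coverS, gammaChar_lift_one hb, gammaChar_one]
  simp

theorem heckeAction_heckeT (hΦ : IsAutomorphic k N Φ)
    (hN2 : ‖(N : ℚ_[two])‖ = ‖(4 : ℚ_[two])‖) (g : AdelicCover) : heckeAction (heckeT k 1) Φ g =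
      ∑ b : Fin 4, Φ (g * ofPadic (⟨repT twoUnit b, 1⟩ : PadicCover two)) := by
  rw [heckeAction_eq_sum hΦ hN2 (isHeckeElement_heckeT k 1) (repT twoUnit)
    (cover_of_forall _ repT_cover) repT_disjoint]
  exact Finset.sum_congr rfl fun b _ => by rw [heckeT_repT, one_mul]

theorem heckeAction_heckeU_one (hΦ : IsAutomorphic k N Φ)
    (hN2 : ‖(N : ℚ_[two])‖ = ‖(4 : ℚ_[two])‖) (g : AdelicCover) : heckeAction (heckeU k 1) Φ g =
      starRingEnd ℂ (zetaEight k) *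
        Φ (g * ofPadic (⟨wMat (twoUnit ^ (-1 : ℤ)), 1⟩ : PadicCover two)) := by
  rw [heckeAction_eq_sum hΦ hN2 (isHeckeElement_heckeU k 1)
    (fun _ : Unit => wMat (twoUnit ^ (-1 : ℤ))) (cover_of_forall _ wMat_cover) (fun _ _ _ => rfl),
    Fintype.sum_unique, heckeU_wMat]

/-- The relation `𝒰₂ = 𝒰₁ * 𝒯₁` on automorphic functions. -/
theorem heckeAction_heckeU_heckeT (hΦ : IsAutomorphic k N Φ)
    (hN2 : ‖(N : ℚ_[two])‖ = ‖(4 : ℚ_[two])‖) :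
    heckeAction (heckeU k 1) (heckeAction (heckeT k 1) Φ) = heckeAction (heckeU k 2) Φ := by
  ext g
  -- Both sides become sums over the representatives w(1/2)n(b)h(2), on which 𝒰₂ has the same
  -- constant value as 𝒰₁ on w(1/2).
  rw [heckeAction_heckeU_one (hΦ.heckeAction hN2 (isHeckeElement_heckeT k 1)) hN2,
    heckeAction_heckeT hΦ hN2, heckeAction_eq_sum hΦ hN2 (isHeckeElement_heckeU k 2) repU1T
      (cover_of_forall _ repU1T_cover) repU1T_disjoint, Finset.mul_sum]
  refine Finset.sum_congr rfl fun b _ => ?_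
  rw [heckeU_repU1T, mul_assoc, ofPadic_mul_ofPadic, PadicCover.mk_mul_mk, cocyclePadic_wMat_repT]
  simp [repU1T]

variable {f : ℍ → ℂ}

theorem four_dvd_level : 4 ∣ 4 * M := ⟨M, rfl⟩

theorem level_ne_zero (hM : Odd M) : 4 * M ≠ 0 := by
  obtain ⟨m, rfl⟩ := hM
  omega

theorem heckeTranslate_heckeT_mem (hM : Odd M) (hf : f ∈ cuspForms k (4 * M)) :
    heckeTranslate k (4 * M) (heckeT k 1) f ∈ cuspForms k (4 * M) := by
  refine heckeTranslate_mem four_dvd_level (level_ne_zero hM) (norm_level hM)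
    (isHeckeElement_heckeT k 1) hf (repT twoRat) (fun j _ hq => repT_mem hq _ j) ?_ ?_
  · intro h hh
    obtain ⟨j, hj⟩ := cover_of_forall _ repT_cover h hh
    exact ⟨j, by rwa [ratToPadic_repT]⟩
  · intro i j h
    rw [ratToPadic_repT, ratToPadic_repT] at h
    exact repT_disjoint i j h

theorem repU1_cover' (hM : Odd M) (h : SL(2, ℚ_[two])) (hh : heckeU k 1 ⟨h, 1⟩ ≠ 0) :
    ∃ _ : Unit, (ratToPadic two (repU1 M twoRat))⁻¹ * h ∈ gammaZeroFour := by
  rw [ratToPadic_repU1]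
  exact cover_of_forall (fun _ : Unit => repU1 M twoUnit) (repU1_cover hM) h hh

theorem heckeTranslate_heckeU_one_mem (hM : Odd M) (hf : f ∈ cuspForms k (4 * M)) :
    heckeTranslate k (4 * M) (heckeU k 1) f ∈ cuspForms k (4 * M) :=
  heckeTranslate_mem four_dvd_level (level_ne_zero hM) (norm_level hM)
    (isHeckeElement_heckeU k 1) hf (fun _ : Unit => repU1 M twoRat) (fun _ _ hq => repU1_mem hq M)
    (repU1_cover' hM) (fun _ _ _ => rfl)

theorem heckeTranslate_heckeU_two_mem (hM : Odd M) (hf : f ∈ cuspForms k (4 * M)) :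
    heckeTranslate k (4 * M) (heckeU k 2) f ∈ cuspForms k (4 * M) := by
  refine heckeTranslate_mem four_dvd_level (level_ne_zero hM) (norm_level hM)
    (isHeckeElement_heckeU k 2) hf (repU2 M) (fun j _ hq => repU2_mem hq M j) ?_ ?_
  · intro h hh
    obtain ⟨j, hj⟩ := cover_of_forall _ (repU2_cover hM) h hh
    exact ⟨j, by rwa [ratToPadic_repU2]⟩
  · intro i j h
    rw [ratToPadic_repU2, ratToPadic_repU2] at h
    exact repU2_disjoint hM i j h

/-- The lift of the classical form of 𝒯₁Φ_f need not be compared with 𝒯₁Φ_f itself: q(𝒰₁) is a slash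
by a rational matrix and depends only on the classical form, which is the same for both. -/
theorem heckeTranslate_heckeU_heckeT (hM : Odd M) (hf : f ∈ cuspForms k (4 * M)) :
    heckeTranslate k (4 * M) (heckeU k 1) (heckeTranslate k (4 * M) (heckeT k 1) f) =
      heckeTranslate k (4 * M) (heckeU k 2) f := by
  have hN2 := norm_level hM
  have hΦ := isAutomorphic_adelicLift four_dvd_level (level_ne_zero hM)
    ((isCuspForm_iff four_dvd_level).1 hf).2.1
  have hT := hΦ.heckeAction hN2 (isHeckeElement_heckeT k 1)
  have h1 := heckeTranslate_eq four_dvd_level (level_ne_zero hM) hN2 (isHeckeElement_heckeU k 1)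
    ((isCuspForm_iff four_dvd_level).1 (heckeTranslate_heckeT_mem hM hf)).2.1
    (fun _ : Unit => repU1 M twoRat) (fun _ q hq => repU1_mem hq M) (repU1_cover' hM)
    (fun _ _ _ => rfl)
  have h2 := hT.classicalForm_heckeAction hN2 (isHeckeElement_heckeU k 1)
    (fun _ : Unit => repU1 M twoRat) (fun _ q hq => repU1_mem hq M) (repU1_cover' hM)
    (fun _ _ _ => rfl)
  rw [h1, heckeTranslate, heckeTranslate, ← heckeAction_heckeU_heckeT hΦ hN2, h2]

theorem repU2_one_zero {K : Type*} [Field K] (M : ℕ) (ν : Fin 4) :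
    repU2 (K := K) M ν 1 0 = -4 * (M * ((ν : ℕ) : K)) := by
  simp [repU2, SL2_mul_one_zero, mul_assoc]

theorem repU2_one_one {K : Type*} [Field K] (h4 : (4 : K) ≠ 0) (M : ℕ) (ν : Fin 4) :
    repU2 (K := K) M ν 1 1 = 1 + M * ((ν : ℕ) : K) := by
  simp [repU2, SL2_mul_one_one]
  field_simp
  ring

theorem cocycle_self_inv {K : Type*} [Field K] {g : SL(2, K)} (h : g 1 0 ≠ 0 ∨ g 1 1 = 1) :
    kubota g g⁻¹ = 1 := by
  rw [kubota, mul_inv_cancel, tau_one, one_mul, one_mul]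
  by_cases hc : g 1 0 = 0
  · rw [tau_of_eq_zero hc, h.resolve_left (not_not.2 hc), hilbertSymbol_one_left]
  · rw [tau_of_ne_zero hc, tau_of_ne_zero (by rw [SL2_inv_10]; exact neg_ne_zero.2 hc), SL2_inv_10,
      hilbertSymbol_self_neg]

/-- The local signs vanish by the Steinberg relation, and the real cocycle of g and g⁻¹ is (c, -c) =
1, or trivially 1 when c = 0 and d = 1. -/
theorem translateSign_repU2 (M : ℕ) (ν : Fin 4) : translateSign (repU2 M ν) = 1 := by
  have h1 : splitSign (repU2 M ν) = 1 := by
    refine finprod_eq_one_of_forall_eq_one fun p => ?_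
    rw [ratToPadic_repU2]
    exact sPadic_steinberg _ (repU2_one_zero M ν) (repU2_one_one (by norm_num) M ν)
  rw [translateSign, h1, one_mul, cocycleReal_eq, map_inv, cocycle_self_inv]
  by_cases h : (repU2 (K := ℚ) M ν) 1 0 = 0
  · right
    rw [repU2_one_zero] at h
    have h0 : ((M : ℚ) * ((ν : ℕ) : ℚ)) = 0 := by linarith
    rw [ratToReal_apply, repU2_one_one (by norm_num), h0]
    simp
  · left
    rw [ratToReal_apply]
    exact_mod_cast h

/-- The common value of `𝒰₂` at its representatives. -/
noncomputable def valueU2 (k : ℕ) : ℂ :=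
  (1 + (starRingEnd ℂ Complex.I) ^ (2 * k + 1)) / (Real.sqrt 2 : ℂ)

theorem cocyclePadic_repU2 (M : ℕ) (ν : Fin 4) : cocyclePadic two
    (lowerU (-4 * M * ((ν : ℕ) : ℚ_[two]))) (upperU (-1 / 4)) = 1 := by
  rw [cocyclePadic_eq, kubota_upperU_right, sPadic_lowerU, sPadic_of_eq_zero (upperU_10 _)]
  have := sPadic_steinberg (g := repU2 (K := ℚ_[two]) M ν) _ (repU2_one_zero M ν)
    (repU2_one_one (by norm_num) M ν)
  rw [repU2] at this
  rw [this]
  simp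

theorem lowerU_mul_upperU_mul_lowerU {w : (ℚ_[two])ˣ} (e : (w : ℚ_[two]) = 4⁻¹) :
    lowerU 4 * upperU (-1 / 4) * lowerU 4 = -wMat w := by
  apply SL2_ext <;> rw [SL2_neg_apply] <;>
    simp [SL2_mul_zero_zero, SL2_mul_zero_one, SL2_mul_one_zero, SL2_mul_one_one, e] <;> norm_num

/-- From n⁻(4)n(-1/4)n⁻(4) = -w(1/4) the value at n(-1/4) is that at -w(1/4). In the cover this is
(-I, 1)(I, -1)(w(1/4), 1), which gives -γ̄(1 + γ̄)/√2 = (1 - γ̄)/√2, where γ̄ is the conjugate of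
γ(-I, 1). -/
theorem heckeU_two_upperU : heckeU k 2 ⟨upperU (-1 / 4), 1⟩ = valueU2 k := by
  have hT := isHeckeElement_heckeU k 2
  have h4 : lowerU (4 : ℚ_[two]) ∈ gammaOneFour two := lowerU_mem le_rfl
  set A : SL(2, ℚ_[two]) := lowerU 4 * upperU (-1 / 4) with hA
  have hA10 : A 1 0 = 4 := by simp [hA, SL2_mul_one_zero]
  have hA11 : A 1 1 = 0 := by rw [hA, SL2_mul_one_one]; norm_num
  have hsA : sPadic two A = 1 := by
    unfold sPadic
    rw [if_neg]
    simp [hA11]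
  have hB : A * lowerU 4 = -wMat (twoUnit ^ (-2 : ℤ)) :=
    lowerU_mul_upperU_mul_lowerU twoUnit_zpow_neg_two
  have hw10 : wMat (twoUnit ^ (-2 : ℤ)) 1 0 = -4 := by
    rw [wMat_10, twoUnit_zpow_neg_two, inv_inv]
  have hB10 : (-wMat (twoUnit ^ (-2 : ℤ))) 1 0 = 4 := by
    rw [SL2_neg_apply, hw10, neg_neg]
  have hB11 : (-wMat (twoUnit ^ (-2 : ℤ))) 1 1 = 0 := by
    rw [SL2_neg_apply, wMat_11, neg_zero]
  have hsB : sPadic two (-wMat (twoUnit ^ (-2 : ℤ))) = 1 := by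
    unfold sPadic
    rw [if_neg]
    simp
  have hne : (4 : ℚ_[two]) ≠ 0 := by norm_num
  have c1 : lift (lowerU 4) * ⟨upperU (-1 / 4), 1⟩ = ⟨A, 1⟩ := by
    rw [lift, PadicCover.mk_mul_mk, cocyclePadic_eq, kubota_upperU_right, sPadic_lowerU,
      sPadic_of_eq_zero (upperU_10 _), ← hA, hsA]
    simp
  have c2 : (⟨A, 1⟩ : PadicCover two) * lift (lowerU 4) = ⟨-wMat (twoUnit ^ (-2 : ℤ)), 1⟩ := by
    rw [lift, PadicCover.mk_mul_mk, cocyclePadic_eq, hB, hsA, hsB, sPadic_lowerU, kubota, hB,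
      tau_of_ne_zero (by rw [hB10]; exact hne), tau_of_ne_zero (by rw [hA10]; exact hne),
      tau_lowerU hne, hB10, hA10, hilbertSymbol_isSquare_left ⟨4, rfl⟩]
    simp
  -- The sign -1 is the symbol (-1,-1)₂ in the cocycle of -I with w(1/4).
  have c3 : (⟨-wMat (twoUnit ^ (-2 : ℤ)), 1⟩ : PadicCover two) =
      centralElt * signElt (-1) * ⟨wMat (twoUnit ^ (-2 : ℤ)), 1⟩ * 1 := by
    rw [mul_one, mul_assoc, ← mk_eq_signElt, centralElt, PadicCover.mk_mul_mk, neg_one_mul,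
      cocyclePadic_eq, kubota, neg_one_mul, tau_neg_one, tau_of_ne_zero (by rw [hB10]; exact hne),
      tau_of_ne_zero (by rw [hw10]; exact neg_ne_zero.2 hne), hB10, hw10, sPadic_neg_one,
      sPadic_wMat, hsB, show (4 * -1 : ℚ_[two]) = -1 * 2 ^ 2 by norm_num,
      show (4 * -4 : ℚ_[two]) = -1 * 4 ^ 2 by norm_num, hilbertSymbol_mul_sq_left _ _ two_ne_zero,
      hilbertSymbol_mul_sq_right _ _ hne]
    have h := hilbertSymbol_two_neg_one_neg_one
    rw [show hilbertSymbol (-1 : ℚ_[two]) (-1) = -1 from h]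
    simp
  have h1 := hT.mul_left (⟨upperU (-1 / 4), 1⟩ : PadicCover two) (lift_mem_coverS h4)
  have h2 := hT.mul_right (lift (lowerU 4) * ⟨upperU (-1 / 4), 1⟩) (lift_mem_coverS h4)
  rw [h1, gammaChar_lift_one h4, map_one, one_mul, one_mul, c1, c2, c3] at h2
  rw [← h2, heckeU, supportedOn_apply (gammaCompatible_wMat _) _
    (coverS_mul centralElt_mem_coverS (signElt_mem_coverS _)) one_mem_coverS,
    gammaChar_one, gammaChar_mul centralElt_mem_coverS (signElt_mem_coverS _),
    gammaChar_centralElt, gammaChar_signElt, zetaEight, valueU2]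
  have h3 := congrArg (starRingEnd ℂ) (gammaNegOne_mul_self (k := k))
  have h4 : starRingEnd ℂ (gammaNegOne k) = -(starRingEnd ℂ Complex.I) ^ (2 * k + 1) := by
    simp [gammaNegOne]
  rw [map_mul, h4] at h3
  simp only [map_mul, map_div₀, map_add, map_one, Complex.conj_ofReal, h4]
  simp only [map_neg, map_one, Units.val_neg, Units.val_one, Int.cast_neg, Int.cast_one] at h3 ⊢
  field_simp
  linear_combination -h3

theorem heckeU_two_repU2 (M : ℕ) (ν : Fin 4) :
    heckeU k 2 ⟨repU2 M ν, 1⟩ = valueU2 k := by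
  have hb : lowerU (-4 * M * ((ν : ℕ) : ℚ_[two])) ∈ gammaOneFour two := by
    refine lowerU_mem (norm_mul_le_of_le_one_right (norm_mul_le_of_le_one_right ?_
      (norm_natCast_le_one _)) (norm_natCast_le_one _))
    rw [norm_neg]
  have h1 : (⟨repU2 M ν, 1⟩ : PadicCover two) =
      lift (lowerU (-4 * M * ((ν : ℕ) : ℚ_[two]))) * ⟨upperU (-1 / 4), 1⟩ := by
    rw [lift, PadicCover.mk_mul_mk, cocyclePadic_repU2, repU2]
    simp
  rw [h1, (isHeckeElement_heckeU k 2).mul_left _ (lift_mem_coverS hb), gammaChar_lift_one hb,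
    heckeU_two_upperU]
  simp

/-- The explicit form of `q(𝒰₂)`. -/
theorem heckeTranslate_heckeU_two (hM : Odd M) (hf : f ∈ cuspForms k (4 * M)) :
    heckeTranslate k (4 * M) (heckeU k 2) f = valueU2 k • ∑ ν : Fin 4,
      slashReal k f (upperU (1 / 4) * lowerU (4 * M * ((ν : ℕ) : ℝ))) := by
  rw [heckeTranslate_eq four_dvd_level (level_ne_zero hM) (norm_level hM)
    (isHeckeElement_heckeU k 2) ((isCuspForm_iff four_dvd_level).1 hf).2.1 (repU2 M)
    (fun j q hq => repU2_mem hq M j), Finset.smul_sum]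
  · refine Finset.sum_congr rfl fun ν _ => ?_
    rw [ratToPadic_repU2, heckeU_two_repU2, translateSign_repU2, repU2, mul_inv_rev, upperU_inv,
      lowerU_inv, map_mul, ratToReal_upperU, ratToReal_lowerU]
    push_cast
    rw [mul_one]
    congr 4 <;> ring
  · intro h hh
    obtain ⟨j, hj⟩ := cover_of_forall _ (repU2_cover hM) h hh
    exact ⟨j, by rwa [ratToPadic_repU2]⟩
  · intro i j h
    rw [ratToPadic_repU2, ratToPadic_repU2] at h
    exact repU2_disjoint hM i j h

end HeckeFormulas

/-! ### The cosets of Kohnen's operator -/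

section Cosets

variable {k N M : ℕ} {f : ℍ → ℂ}

theorem ShimuraGroup.mul_assoc' (ξ η ζ : ShimuraGroup) : ξ * η * ζ = ξ * (η * ζ) := by
  apply ShimuraGroup.ext
  · exact mul_assoc ξ.mat η.mat ζ.mat
  · funext z
    change ξ.aut (η.mat • ζ.mat • z) * η.aut (ζ.mat • z) * ζ.aut z =
      ξ.aut ((η.mat * ζ.mat) • z) * (η.aut (ζ.mat • z) * ζ.aut z)
    rw [mul_smul, mul_assoc]

theorem slash_mul (ξ η : ShimuraGroup) : slash k f (ξ * η) = slash k (slash k f ξ) η := by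
  ext z
  change f ((ξ.mat * η.mat) • z) * ((ξ.aut (η.mat • z) * η.aut z) ^ (2 * k + 1))⁻¹ = _
  rw [slash, slash, mul_smul, mul_pow, mul_inv, mul_assoc]

/-- The element `ξ` is `(s g, t J(g, z))`. -/
def Represents (ξ : ShimuraGroup) (s : ℝ) (g : SL(2, ℝ)) (t : ℂ) : Prop :=
  (∀ i j, ξ.mat i j = s * g i j) ∧ ∀ z, ξ.aut z = t * autJ g 1 z

theorem Represents.eq {ξ η : ShimuraGroup} {s : ℝ} {g : SL(2, ℝ)} {t : ℂ}
    (hξ : Represents ξ s g t) (hη : Represents η s g t) : ξ = η := by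
  apply ShimuraGroup.ext
  · ext i j
    rw [hξ.1, hη.1]
  · funext z
    rw [hξ.2, hη.2]

theorem Represents.smul_eq {ξ : ShimuraGroup} {s : ℝ} {g : SL(2, ℝ)} {t : ℂ}
    (hξ : Represents ξ s g t) (z : ℍ) : ξ.mat • z = g • z := by
  have hs : s ≠ 0 := by
    rintro rfl
    have := ξ.det_pos
    rw [Matrix.GeneralLinearGroup.val_det_apply, Matrix.det_fin_two] at this
    simp [hξ.1] at this
  rw [← toGL_smul]
  ext1
  rw [UpperHalfPlane.coe_smul_of_det_pos ξ.det_pos, UpperHalfPlane.coe_smul_of_det_pos (by simp)]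
  simp only [UpperHalfPlane.num, UpperHalfPlane.denom, hξ.1]
  have h := linDenom_ne_zero g z
  rw [linDenom] at h
  have hs' : (s : ℂ) ≠ 0 := by exact_mod_cast hs
  push_cast
  rw [mul_assoc, mul_assoc, ← mul_add, ← mul_add, mul_div_mul_left _ _ hs']
  rfl

theorem Represents.mul {ξ η : ShimuraGroup} {s s' : ℝ} {g g' : SL(2, ℝ)} {t t' : ℂ}
    (hξ : Represents ξ s g t) (hη : Represents η s' g' t') :
    Represents (ξ * η) (s * s') (g * g') (t * t' * ((cocycleReal g g' : ℤ) : ℂ)) := by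
  refine ⟨fun i j => ?_, fun z => ?_⟩
  · change (ξ.mat * η.mat) i j = _
    rw [Matrix.GeneralLinearGroup.coe_mul, Matrix.mul_apply, Matrix.SpecialLinearGroup.coe_mul,
      Matrix.mul_apply, Finset.mul_sum]
    refine Finset.sum_congr rfl fun l _ => ?_
    rw [hξ.1, hη.1]
    ring
  · change ξ.aut (η.mat • z) * η.aut z = _
    rw [hη.smul_eq, hξ.2, hη.2]
    linear_combination t * t' * autJ_mul g g' z

theorem Represents.slash_eq {ξ : ShimuraGroup} {s : ℝ} {g : SL(2, ℝ)} {t : ℂ}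
    (hξ : Represents ξ s g t) : slash k f ξ = (t ^ (2 * k + 1))⁻¹ • slashReal k f g :=
  slash_eq_of_aut hξ.smul_eq hξ.2

theorem autJ_upperU (b : ℝ) (z : ℍ) : autJ (upperU b) 1 z = 1 :=
  autJ_eq_of_sq (Or.inl (by simp)) (by rw [linDenom_of_eq_zero (upperU_10 b)]; simp)

/-- The multiplier of `ρ`. -/
noncomputable def rhoPhase : ℂ := Complex.exp (Real.pi * Complex.I / 4)

theorem represents_rho : Represents rho 4 (upperU (1 / 4)) rhoPhase := by
  refine ⟨fun i j => ?_, fun z => ?_⟩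
  · fin_cases i <;> fin_cases j <;> simp [rho, Matrix.GeneralLinearGroup.mkOfDetNeZero]
  · rw [autJ_upperU, mul_one]
    rfl

theorem mem_Delta0_iff_represents (hN : 4 ∣ N) {ξ : ShimuraGroup} : ξ ∈ Delta0 N ↔
    ∃ δ ∈ levelInt N, ∃ ε : ℤˣ, Represents ξ ((ε : ℤ) : ℝ) (intToReal δ)
      ((splitSign (intToRat δ) : ℤ) : ℂ) := by
  have key : ∀ (g : GL (Fin 2) ℝ) (δ : SL(2, ℤ)), g = Matrix.SpecialLinearGroup.mapGL ℝ δ ↔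
      ∀ i j, g i j = intToReal δ i j := by
    intro g δ
    rw [← toGL_intToReal]
    exact ⟨fun h i j => by rw [h]; rfl, fun h => by ext i j; rw [h]; rfl⟩
  rw [mem_Delta0_iff hN]
  refine exists_congr fun δ => and_congr_right fun hδ => ?_
  have hneg : ∀ i j, (-intToReal δ) i j = -(intToReal δ i j) := SL2_neg_apply _
  constructor
  · rintro ⟨h | h, haut⟩
    · exact ⟨1, fun i j => by rw [(key _ _).1 h]; simp, haut⟩
    · exact ⟨-1, fun i j => by rw [(key _ _).1 h, intToReal_neg, hneg]; simp, haut⟩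
  · rintro ⟨ε, h, haut⟩
    refine ⟨?_, haut⟩
    rcases Int.units_eq_one_or ε with rfl | rfl
    · exact Or.inl ((key _ _).2 fun i j => by rw [h]; simp)
    · exact Or.inr ((key _ _).2 fun i j => by rw [h, intToReal_neg, hneg]; simp)

/-- The element of `Δ₀(N)` over `δ`. -/
noncomputable def deltaElt (δ : SL(2, ℤ)) : ShimuraGroup :=
  shimuraElt (intToReal δ) ((splitSign (intToRat δ) : ℤ) : ℂ) (norm_sign _)

theorem represents_deltaElt (δ : SL(2, ℤ)) : Represents (deltaElt δ) 1 (intToReal δ)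
    ((splitSign (intToRat δ) : ℤ) : ℂ) :=
  ⟨fun _ _ => (one_mul _).symm, fun _ => rfl⟩

theorem deltaElt_mem (hN : 4 ∣ N) {δ : SL(2, ℤ)} (hδ : δ ∈ levelInt N) : deltaElt δ ∈ Delta0 N :=
  (mem_Delta0_iff_represents hN).2 ⟨δ, hδ, 1, by simpa using represents_deltaElt δ⟩

theorem splitSign_intToRat_mul (hN : 4 ∣ N) {δ δ' : SL(2, ℤ)} (h : δ ∈ levelInt N)
    (h' : δ' ∈ levelInt N) : ((splitSign (intToRat δ) : ℤ) : ℂ) *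
      ((splitSign (intToRat δ') : ℤ) : ℂ) *
      ((cocycleReal (intToReal δ) (intToReal δ') : ℤ) : ℂ) =
      ((splitSign (intToRat (δ * δ')) : ℤ) : ℂ) := by
  rw [splitSign_mul_of_mem hN h h']
  simp [intToReal_eq]

theorem Delta0_mul (hN : 4 ∣ N) {ξ η : ShimuraGroup} (hξ : ξ ∈ Delta0 N) (hη : η ∈ Delta0 N) :
    ξ * η ∈ Delta0 N := by
  obtain ⟨δ, hδ, ε, h⟩ := (mem_Delta0_iff_represents hN).1 hξ
  obtain ⟨δ', hδ', ε', h'⟩ := (mem_Delta0_iff_represents hN).1 hη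
  refine (mem_Delta0_iff_represents hN).2 ⟨δ * δ', mul_mem hδ hδ', ε * ε', ?_⟩
  have := h.mul h'
  rw [splitSign_intToRat_mul hN hδ hδ', ← map_mul] at this
  simpa using this

theorem Represents.one_mul {ξ η : ShimuraGroup} (hξ : Represents ξ 1 1 1) : ξ * η = η := by
  apply ShimuraGroup.ext
  · have h : ξ.mat = 1 := by
      ext i j
      rw [hξ.1, _root_.one_mul]
      rfl
    change ξ.mat * η.mat = η.mat
    rw [h, _root_.one_mul]
  · funext z
    change ξ.aut (η.mat • z) * η.aut z = η.aut z
    rw [hξ.2, autJ_one, _root_.one_mul, _root_.one_mul]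

theorem splitSign_one : splitSign 1 = 1 :=
  finprod_eq_one_of_forall_eq_one fun p => by rw [map_one, sPadic_one]

theorem deltaElt_one_mul (η : ShimuraGroup) : deltaElt 1 * η = η := by
  apply Represents.one_mul
  have := represents_deltaElt 1
  rw [map_one, map_one, splitSign_one] at this
  simpa using this

/-- Both matrices δ and -δ occur in Δ₀(N) with the same automorphy factor, so the sign of the matrix
is recorded separately from g. -/
theorem exists_represents (ε : ℤˣ) (g : SL(2, ℝ)) {t : ℂ} (ht : ‖t‖ = 1) :
    ∃ ξ, Represents ξ ((ε : ℤ) : ℝ) g t := by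
  rcases Int.units_eq_one_or ε with rfl | rfl
  · exact ⟨shimuraElt g t ht, fun i j => by simp [shimuraElt], fun z => rfl⟩
  · refine ⟨{ mat := Matrix.SpecialLinearGroup.toGL (-g)
              aut := fun z => t * autJ g 1 z
              det_pos := by simp
              holo := mdifferentiable_const.mul (mdifferentiable_autJ g)
              sq := ⟨-t ^ 2, by rw [norm_neg, norm_pow, ht, one_pow], fun z => ?_⟩ },
      fun i j => ?_, fun z => rfl⟩
    · rw [mul_pow, autJ_sq, ← linDenom_eq, linDenom, linDenom, SL2_neg_apply, SL2_neg_apply]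
      simp
      ring
    · change (-g) i j = _
      rw [SL2_neg_apply]
      simp

/-- Invertibility is expressed as left cancellation, which is the form needed to compare left
cosets. -/
theorem Delta0_exists_inv (hN : 4 ∣ N) {ξ : ShimuraGroup} (hξ : ξ ∈ Delta0 N) :
    ∃ ξ' ∈ Delta0 N, ∀ η, ξ' * (ξ * η) = η := by
  obtain ⟨δ, hδ, ε, h⟩ := (mem_Delta0_iff_represents hN).1 hξ
  obtain ⟨ξ', h'⟩ := exists_represents ε (intToReal δ⁻¹) (norm_sign (splitSign (intToRat δ⁻¹)))
  refine ⟨ξ', (mem_Delta0_iff_represents hN).2 ⟨δ⁻¹, inv_mem hδ, ε, h'⟩, fun η => ?_⟩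
  rw [← ShimuraGroup.mul_assoc']
  apply Represents.one_mul
  have h1 := h'.mul h
  rw [splitSign_intToRat_mul hN (inv_mem hδ) hδ, ← map_mul, inv_mul_cancel, map_one, map_one,
    splitSign_one] at h1
  convert h1 using 1
  · rw [← Int.cast_mul, ← Units.val_mul, Int.units_mul_self]
    simp
  · simp

/-- The matrix `(1, 0; c, 1)` in `SL₂(ℤ)`. -/
def intLower (c : ℤ) : SL(2, ℤ) := ⟨!![1, 0; c, 1], by simp [Matrix.det_fin_two]⟩

theorem intToRat_intLower (c : ℤ) : intToRat (intLower c) = lowerU (c : ℚ) := by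
  apply SL2_ext <;> rw [intToRat_apply] <;> simp [intLower]

theorem intToReal_intLower (c : ℤ) : intToReal (intLower c) = lowerU (c : ℝ) := by
  rw [intToReal_eq, intToRat_intLower, ratToReal_lowerU]
  simp

theorem intLower_inv (c : ℤ) : (intLower c)⁻¹ = intLower (-c) := by
  rw [inv_eq_iff_mul_eq_one]
  ext i j
  rw [Matrix.SpecialLinearGroup.coe_mul, Matrix.mul_apply, Fin.sum_univ_two]
  fin_cases i <;> fin_cases j <;> simp [intLower]

theorem splitSign_lowerU (c : ℚ) : splitSign (lowerU c) = 1 :=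
  finprod_eq_one_of_forall_eq_one fun p => by rw [ratToPadic_lowerU, sPadic_lowerU]

theorem intLower_mem (hN : 4 ∣ N) {c : ℤ} (hc : (N : ℤ) ∣ c) : intLower c ∈ levelInt N :=
  (mem_levelInt_iff hN).2 ⟨hc, by simp [intLower]⟩

/-- The quotient 1 - 4c/d is a square: odd valuation forces |4c| < |4|, while d is a unit. -/
theorem hilbertSymbol_sub_quarter {p : Nat.Primes} {c d : ℤ} (hc : c ≠ 0) (hd : ‖(d : ℚ_[p])‖ = 1)
    (hodd : Odd ((16 * c : ℤ) : ℚ_[p]).valuation) :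
    hilbertSymbol ((16 * c : ℤ) : ℚ_[p]) ((d - 4 * c : ℤ) : ℚ_[p]) =
      hilbertSymbol ((16 * c : ℤ) : ℚ_[p]) (d : ℚ_[p]) := by
  have hd0 : (d : ℚ_[p]) ≠ 0 := ne_zero_of_norm_eq_one hd
  have h4 : (4 : ℚ_[p]) ≠ 0 := by norm_num
  have hc0 : (c : ℚ_[p]) ≠ 0 := by exact_mod_cast hc
  have h1 : Odd (4 * c : ℚ_[p]).valuation := by
    push_cast at hodd
    rw [show (16 * c : ℚ_[p]) = (2 * 2) * (4 * c) by ring,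
      Padic.valuation_mul (by norm_num) (mul_ne_zero h4 hc0),
      Padic.valuation_mul two_ne_zero two_ne_zero] at hodd
    rw [Int.odd_iff] at hodd ⊢
    omega
  have h2 : ‖(4 * c : ℚ_[p])‖ < ‖(4 : ℚ_[p])‖ :=
    norm_lt_four_of_odd (norm_mul_le_of_le_one_right le_rfl (Padic.norm_int_le_one c)) h1
  have h3 : IsSquare (1 - 4 * c / d : ℚ_[p]) := by
    apply isSquare_of_norm_sub_one_lt
    rw [show (1 - 4 * c / d - 1 : ℚ_[p]) = -(4 * c / d) by ring, norm_neg, norm_div, hd, div_one]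
    exact h2
  obtain ⟨r, hr⟩ := h3
  have hr0 : r ≠ 0 := by
    rintro rfl
    rw [mul_zero] at hr
    have h5 : (4 * c : ℚ_[p]) = d := by
      field_simp at hr
      linear_combination -hr
    rw [h5, hd] at h2
    exact absurd h2 (not_lt.2 norm_four_le_one)
  rw [show ((d - 4 * c : ℤ) : ℚ_[p]) = d * r ^ 2 by
    rw [sq, ← hr]; push_cast; field_simp, hilbertSymbol_mul_sq_right _ _ hr0]

/-- Conjugation by `n(1/4)` for elements of level divisible by `16`. -/
theorem exists_conj_upper (hN : 4 ∣ N) {δ : SL(2, ℤ)} (hδ : δ ∈ levelInt N) (h16 : 16 ∣ δ 1 0) :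
    ∃ δ' ∈ levelInt N, upperU (1 / 4) * intToReal δ = intToReal δ' * upperU (1 / 4) ∧
      splitSign (intToRat δ') = splitSign (intToRat δ) := by
  obtain ⟨c, hc⟩ := h16
  have hd := ((mem_levelInt_iff hN).1 hδ).2
  have ha := zero_zero_of_mem hN hδ
  obtain ⟨e, he⟩ : (4 : ℤ) ∣ δ 1 1 - δ 0 0 := by omega
  have hdet := SL2_det_int δ
  -- The conjugate n(1/4)δn(-1/4), integral because 16 divides the lower left entry and a ≡ d modulo
  -- 4.
  let δ' : SL(2, ℤ) := ⟨!![δ 0 0 + 4 * c, δ 0 1 + e - c; δ 1 0, δ 1 1 - 4 * c], by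
    rw [Matrix.det_fin_two_of]
    rw [hc] at hdet ⊢
    linear_combination hdet + 4 * c * he⟩
  have h00 : δ' 0 0 = δ 0 0 + 4 * c := rfl
  have h01 : δ' 0 1 = δ 0 1 + e - c := rfl
  have h10 : δ' 1 0 = δ 1 0 := rfl
  have h11 : δ' 1 1 = δ 1 1 - 4 * c := rfl
  have he' : (δ 1 1 : ℝ) - δ 0 0 = 4 * e := by exact_mod_cast he
  have hc' : (δ 1 0 : ℝ) = 16 * c := by exact_mod_cast hc
  refine ⟨δ', (mem_levelInt_iff hN).2 ⟨h10 ▸ ((mem_levelInt_iff hN).1 hδ).1, by omega⟩, ?_, ?_⟩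
  · apply SL2_ext <;> simp only [SL2_mul_zero_zero, SL2_mul_zero_one, SL2_mul_one_zero,
      SL2_mul_one_one, intToReal_apply, h00, h01, h10, h11, upperU_00, upperU_01, upperU_10,
      upperU_11] <;> push_cast <;> linarith
  · refine finprod_congr fun p => ?_
    have e10 : ratToPadic p (intToRat δ') 1 0 = ((16 * c : ℤ) : ℚ_[p]) := by
      rw [ratToPadic_apply, intToRat_apply, h10, hc]; simp
    have e10' : ratToPadic p (intToRat δ) 1 0 = ((16 * c : ℤ) : ℚ_[p]) := by
      rw [ratToPadic_apply, intToRat_apply, hc]; simp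
    have e11 : ratToPadic p (intToRat δ') 1 1 = ((δ 1 1 - 4 * c : ℤ) : ℚ_[p]) := by
      rw [ratToPadic_apply, intToRat_apply, h11]; simp
    have e11' : ratToPadic p (intToRat δ) 1 1 = (δ 1 1 : ℚ_[p]) := by
      rw [ratToPadic_apply, intToRat_apply]; simp
    -- Conjugation fixes the lower left entry and replaces d by d - 4c, so s_p could change only
    -- where that entry has odd valuation; there p divides it and d is a unit.
    by_cases hodd : Odd ((16 * c : ℤ) : ℚ_[p]).valuation
    · have hc0 : c ≠ 0 := by
        rintro rfl
        simp at hodd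
      have hcn : ‖((16 * c : ℤ) : ℚ_[p])‖ < 1 := by
        refine lt_of_le_of_ne (Padic.norm_int_le_one _) fun h => ?_
        rw [valuation_eq_zero_of_norm_eq_one h] at hodd
        simp at hodd
      have hdn : ‖(δ 1 1 : ℚ_[p])‖ = 1 := by
        apply norm_int_eq_one
        intro hdvd
        have hdvd' := (Padic.norm_intCast_lt_one_iff (p := p)).1 hcn
        rw [← hc] at hdvd'
        have : ((p : ℕ) : ℤ) ∣ 1 := by
          rw [← hdet]
          exact dvd_sub (Dvd.dvd.mul_left hdvd _) (Dvd.dvd.mul_left hdvd' _)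
        exact p.2.one_lt.ne' (by exact_mod_cast Int.eq_one_of_dvd_one (by positivity) this)
      have h0 : ((16 * c : ℤ) : ℚ_[p]) ≠ 0 := by exact_mod_cast mul_ne_zero (by norm_num) hc0
      have hnd : ((δ 1 1 - 4 * c : ℤ) : ℚ_[p]) ≠ 0 := by
        have : δ 1 1 - 4 * c ≠ 0 := by omega
        exact_mod_cast this
      have hnd' : (δ 1 1 : ℚ_[p]) ≠ 0 := ne_zero_of_norm_eq_one hdn
      unfold sPadic
      rw [e10, e10', e11, e11', if_pos ⟨mul_ne_zero h0 hnd, hodd⟩,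
        if_pos ⟨mul_ne_zero h0 hnd', hodd⟩, hilbertSymbol_sub_quarter hc0 hdn hodd]
    · unfold sPadic
      rw [e10, e10', if_neg (fun h => hodd h.2), if_neg (fun h => hodd h.2)]

theorem splitSign_intToRat_intLower (c : ℤ) : splitSign (intToRat (intLower c)) = 1 := by
  rw [intToRat_intLower, splitSign_lowerU]

theorem cocycleReal_upperU_left (b : ℝ) (g : SL(2, ℝ)) : cocycleReal (upperU b) g = 1 := by
  rw [cocycleReal_eq, kubota_upperU_left]

theorem cocycleReal_upperU_right (g : SL(2, ℝ)) (b : ℝ) : cocycleReal g (upperU b) = 1 := by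
  rw [cocycleReal_eq, kubota_upperU_right]

/-- Elements of `Δ₀(N)` of level divisible by `16` can be moved to the left of `ρ`. -/
theorem exists_rho_mul (hN : 4 ∣ N) {ξ : ShimuraGroup} {δ : SL(2, ℤ)} (hδ : δ ∈ levelInt N)
    (h16 : 16 ∣ δ 1 0) {ε : ℤˣ} (h : Represents ξ ((ε : ℤ) : ℝ) (intToReal δ)
      ((splitSign (intToRat δ) : ℤ) : ℂ)) : ∃ ξ' ∈ Delta0 N, rho * ξ = ξ' * rho := by
  obtain ⟨δ', hδ', hconj, hsign⟩ := exists_conj_upper hN hδ h16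
  obtain ⟨ξ', h'⟩ := exists_represents ε (intToReal δ') (norm_sign (splitSign (intToRat δ')))
  refine ⟨ξ', (mem_Delta0_iff_represents hN).2 ⟨δ', hδ', ε, h'⟩, ?_⟩
  have h1 := represents_rho.mul h
  have h2 := h'.mul represents_rho
  rw [cocycleReal_upperU_left, hconj] at h1
  rw [cocycleReal_upperU_right, hsign] at h2
  refine h1.eq ?_
  convert h2 using 1 <;> ring

/-- The representatives `δ_ν` of the cosets. -/
noncomputable def cosetElt (M : ℕ) (ν : Fin 4) : ShimuraGroup :=
  deltaElt (intLower (4 * M * ((ν : ℕ) : ℤ)))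

theorem cosetElt_mem (M : ℕ) (ν : Fin 4) : cosetElt M ν ∈ Delta0 (4 * M) :=
  deltaElt_mem four_dvd_level (intLower_mem four_dvd_level (by push_cast; exact ⟨_, rfl⟩))

theorem represents_cosetElt (M : ℕ) (ν : Fin 4) :
    Represents (cosetElt M ν) 1 (lowerU (4 * M * ((ν : ℕ) : ℝ))) 1 := by
  have := represents_deltaElt (intLower (4 * M * ((ν : ℕ) : ℤ)))
  rw [intToReal_intLower, splitSign_intToRat_intLower] at this
  rw [cosetElt]
  simpa using this

theorem represents_rho_mul_cosetElt (M : ℕ) (ν : Fin 4) : Represents (rho * cosetElt M ν) 4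
    (upperU (1 / 4) * lowerU (4 * M * ((ν : ℕ) : ℝ))) rhoPhase := by
  have := represents_rho.mul (represents_cosetElt M ν)
  rw [cocycleReal_upperU_left] at this
  simpa using this

/-- For lower left entry 4Mc the index is ν ≡ c modulo 4. Since d ≡ 1 modulo 4, multiplying by
n⁻(-4Mν) on the right makes the entry divisible by 16, and the resulting element passes through ρ.
-/
theorem exists_rho_mul_eq {ξ : ShimuraGroup} (hξ : ξ ∈ Delta0 (4 * M)) :
    ∃ ν : Fin 4, ∃ ξ' ∈ Delta0 (4 * M), rho * ξ = ξ' * (rho * cosetElt M ν) := by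
  have hN : 4 ∣ 4 * M := four_dvd_level
  obtain ⟨δ, hδ, ε, h⟩ := (mem_Delta0_iff_represents hN).1 hξ
  obtain ⟨⟨c, hc⟩, hd⟩ := (mem_levelInt_iff hN).1 hδ
  push_cast at hc
  have hlt : (c % 4).toNat < 4 := by omega
  let ν : Fin 4 := ⟨(c % 4).toNat, hlt⟩
  have hν : ((ν : ℕ) : ℤ) = c % 4 := by
    change (((c % 4).toNat : ℕ) : ℤ) = c % 4
    omega
  set x : ℤ := 4 * M * ((ν : ℕ) : ℤ) with hx
  have hlow : intLower x ∈ levelInt (4 * M) :=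
    intLower_mem hN (by push_cast; exact ⟨_, rfl⟩)
  have hmem : δ * (intLower x)⁻¹ ∈ levelInt (4 * M) := mul_mem hδ (inv_mem hlow)
  have hinv10 : ((intLower x)⁻¹ : SL(2, ℤ)) 1 0 = -x := by
    rw [intLower_inv]; rfl
  have hinv00 : ((intLower x)⁻¹ : SL(2, ℤ)) 0 0 = 1 := by
    rw [intLower_inv]; rfl
  have h16 : 16 ∣ (δ * (intLower x)⁻¹) 1 0 := by
    rw [Matrix.SpecialLinearGroup.coe_mul, Matrix.mul_apply, Fin.sum_univ_two, hinv00, hinv10, hc,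
      hx, hν]
    have h4 : 4 ∣ c - δ 1 1 * (c % 4) := by
      obtain ⟨e, he⟩ : ∃ e, δ 1 1 = 4 * e + 1 := ⟨δ 1 1 / 4, by omega⟩
      rw [he, show c - (4 * e + 1) * (c % 4) = (c - c % 4) - 4 * (e * (c % 4)) by ring]
      exact dvd_sub (Int.dvd_self_sub_of_emod_eq rfl) ⟨_, rfl⟩
    obtain ⟨e, he⟩ := h4
    exact ⟨M * e, by linear_combination 4 * (M : ℤ) * he⟩
  obtain ⟨η, hη⟩ := exists_represents ε (intToReal (δ * (intLower x)⁻¹))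
    (norm_sign (splitSign (intToRat (δ * (intLower x)⁻¹))))
  obtain ⟨ξ', hξ', he⟩ := exists_rho_mul hN hmem h16 hη
  refine ⟨ν, ξ', hξ', ?_⟩
  have hprod : ξ = η * cosetElt M ν := by
    have h1 := hη.mul (represents_deltaElt (intLower x))
    rw [splitSign_intToRat_mul hN hmem hlow, ← map_mul, inv_mul_cancel_right, mul_one] at h1
    exact h.eq h1
  rw [hprod, ← ShimuraGroup.mul_assoc', he, ShimuraGroup.mul_assoc']

/-- Comparing the top rows gives 4 ∣ M(ν - μ), and M is odd. -/
theorem cosetElt_injective (hM : Odd M) {ν μ : Fin 4} {ξ : ShimuraGroup}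
    (hξ : ξ ∈ Delta0 (4 * M)) (h : rho * cosetElt M ν = ξ * (rho * cosetElt M μ)) : ν = μ := by
  obtain ⟨δ, hδ, ε, hr⟩ := (mem_Delta0_iff_represents four_dvd_level).1 hξ
  have h1 := (represents_rho_mul_cosetElt M ν).1
  have h2 := (hr.mul (represents_rho_mul_cosetElt M μ)).1
  rw [← h] at h2
  have key : ∀ i j, (upperU (1 / 4) * lowerU (4 * M * ((ν : ℕ) : ℝ)) : SL(2, ℝ)) i j =
      ((ε : ℤ) : ℝ) * (intToReal δ * (upperU (1 / 4) * lowerU (4 * M * ((μ : ℕ) : ℝ))) :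
        SL(2, ℝ)) i j := by
    intro i j
    have := (h1 i j).symm.trans (h2 i j)
    linarith
  have k00 := key 0 0
  have k01 := key 0 1
  simp only [SL2_mul_zero_zero, SL2_mul_zero_one, SL2_mul_one_zero, SL2_mul_one_one, upperU_00,
    upperU_01, upperU_10, upperU_11, lowerU_00, lowerU_01, lowerU_10, lowerU_11,
    intToReal_apply] at k00 k01
  have e4 : (M : ℤ) * (((ν : ℕ) : ℤ) - ((μ : ℕ) : ℤ)) =
      4 * (-((ε : ℤ) * δ 0 1)) := by
    have : (M : ℝ) * (((ν : ℕ) : ℝ) - ((μ : ℕ) : ℝ)) = 4 * (-(((ε : ℤ) : ℝ) * (δ 0 1 : ℝ))) := by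
      linear_combination k00 - (1 + M * ((μ : ℕ) : ℝ)) * 4 * k01
    exact_mod_cast this
  have hcop : IsCoprime (4 : ℤ) (M : ℤ) := by
    have : Nat.Coprime (2 ^ 2) M := Nat.Coprime.pow_left 2 (Nat.coprime_two_left.2 hM)
    exact_mod_cast Nat.isCoprime_iff_coprime.2 this
  have h4 : (4 : ℤ) ∣ ((ν : ℕ) : ℤ) - ((μ : ℕ) : ℤ) := hcop.dvd_of_dvd_mul_left ⟨_, e4⟩
  have := ν.2
  have := μ.2
  ext
  omega

theorem slash_cosetElt {x : ShimuraGroup} (hf : f ∈ cuspForms k N) {ξ : ShimuraGroup}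
    (hξ : ξ ∈ Delta0 N) : slash k f (ξ * x) = slash k f x := by
  rw [slash_mul, hf.invariant ξ hξ]

/-- The coset of `ρ δ_ν`. -/
noncomputable def leftCoset (M : ℕ) (ν : Fin 4) : leftCosets (Delta0 (4 * M)) rho :=
  ⟨{x | ∃ δ ∈ Delta0 (4 * M), x = δ * (rho * cosetElt M ν)}, rho * cosetElt M ν,
    ⟨deltaElt 1, deltaElt_mem four_dvd_level (one_mem _), cosetElt M ν, cosetElt_mem M ν, by
      rw [deltaElt_one_mul]⟩, rfl⟩

theorem leftCoset_bijective (hM : Odd M) : Function.Bijective (leftCoset M) := by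
  constructor
  · intro ν μ h
    have h1 : rho * cosetElt M ν ∈ (leftCoset M ν).1 :=
      ⟨deltaElt 1, deltaElt_mem four_dvd_level (one_mem _), (deltaElt_one_mul _).symm⟩
    rw [h] at h1
    obtain ⟨ξ, hξ, he⟩ := h1
    exact cosetElt_injective hM hξ he
  · rintro ⟨C, η, ⟨δ, hδ, δ', hδ', rfl⟩, rfl⟩
    obtain ⟨ν, ξ', hξ', he⟩ := exists_rho_mul_eq hδ'
    refine ⟨ν, Subtype.ext (Set.ext fun x => ?_)⟩
    have he' : δ * rho * δ' = δ * ξ' * (rho * cosetElt M ν) := by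
      rw [ShimuraGroup.mul_assoc', he, ShimuraGroup.mul_assoc']
    constructor
    · rintro ⟨δ₁, hδ₁, rfl⟩
      obtain ⟨ζ, hζ, hinv⟩ := Delta0_exists_inv four_dvd_level (Delta0_mul four_dvd_level hδ hξ')
      refine ⟨δ₁ * ζ, Delta0_mul four_dvd_level hδ₁ hζ, ?_⟩
      rw [he', ShimuraGroup.mul_assoc', hinv]
    · rintro ⟨δ₁, hδ₁, rfl⟩
      refine ⟨δ₁ * (δ * ξ'), Delta0_mul four_dvd_level hδ₁ (Delta0_mul four_dvd_level hδ hξ'), ?_⟩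
      rw [he', ShimuraGroup.mul_assoc' δ₁]

/-- The explicit form of `Q`. -/
theorem kohnenQ_eq (hM : Odd M) (hf : f ∈ cuspForms k (4 * M)) :
    kohnenQ k (4 * M) f = (rhoPhase ^ (2 * k + 1))⁻¹ • ∑ ν : Fin 4,
      slashReal k f (upperU (1 / 4) * lowerU (4 * M * ((ν : ℕ) : ℝ))) := by
  ext z
  -- The representative chosen in each coset is irrelevant, because f is invariant under Δ₀(4M).
  have h1 : ∀ ν, slash k f (leftCoset M ν).2.choose = slash k f (rho * cosetElt M ν) := by
    intro ν
    have h2 := (leftCoset M ν).2.choose_spec.2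
    have h3 : (leftCoset M ν).2.choose ∈ (leftCoset M ν).1 := h2.symm.subset
      ⟨deltaElt 1, deltaElt_mem four_dvd_level (one_mem _), (deltaElt_one_mul _).symm⟩
    obtain ⟨ξ, hξ, he⟩ := h3
    rw [he, slash_cosetElt hf hξ]
  rw [kohnenQ, doubleCosetOperator, ← finsum_comp_equiv
    (Equiv.ofBijective _ (leftCoset_bijective hM)), finsum_eq_sum_of_fintype, Finset.smul_sum,
    Finset.sum_apply]
  refine Finset.sum_congr rfl fun ν _ => ?_
  rw [Equiv.ofBijective_apply, h1, (represents_rho_mul_cosetElt M ν).slash_eq]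

end Cosets

/-! ### The plus space as an eigenspace -/

section Phase

variable {k : ℕ}

theorem rhoPhase_sq : rhoPhase ^ 2 = Complex.I := by
  rw [rhoPhase, ← Complex.exp_nat_mul]
  have : ((2 : ℕ) : ℂ) * (Real.pi * Complex.I / 4) = Real.pi / 2 * Complex.I := by
    push_cast; ring
  rw [this, Complex.exp_pi_div_two_mul_I]

theorem rhoPhase_eq : (Real.sqrt 2 : ℂ) * rhoPhase = 1 + Complex.I := by
  have h1 : (Real.pi * Complex.I / 4 : ℂ) = ((Real.pi / 4 : ℝ) : ℂ) * Complex.I := by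
    push_cast; ring
  rw [rhoPhase, h1, Complex.exp_mul_I, ← Complex.ofReal_cos, ← Complex.ofReal_sin,
    Real.cos_pi_div_four, Real.sin_pi_div_four]
  have h2 : (Real.sqrt 2 : ℂ) * (Real.sqrt 2 : ℂ) = 2 := by
    rw [← Complex.ofReal_mul, Real.mul_self_sqrt (by norm_num)]; simp
  push_cast
  linear_combination (1 + Complex.I) / 2 * h2

theorem sqrt_two_mul_self : (Real.sqrt 2 : ℂ) * (Real.sqrt 2 : ℂ) = 2 := by
  rw [← Complex.ofReal_mul, Real.mul_self_sqrt (by norm_num)]; simp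

theorem jacobiSym_two_mul_self (k : ℕ) :
    (jacobiSym 2 (2 * k + 1) : ℂ) * (jacobiSym 2 (2 * k + 1) : ℂ) = 1 := by
  have h : (2 : ℤ).gcd ((2 * k + 1 : ℕ) : ℤ) = 1 :=
    Int.isCoprime_iff_gcd_eq_one.1 ⟨-k, 1, by push_cast; ring⟩
  have := jacobiSym.sq_one h
  rw [sq] at this
  exact_mod_cast this

theorem rhoPhase_pow_sq : (rhoPhase ^ (2 * k + 1)) ^ 2 = Complex.I ^ (2 * k + 1) := by
  rw [← pow_mul, mul_comm, pow_mul, rhoPhase_sq]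

theorem rhoPhase_ne_zero : rhoPhase ≠ 0 := Complex.exp_ne_zero _

/-- The quadratic Gauss sum identity behind the eigenvalue of `Q`. -/
theorem one_add_I_pow (k : ℕ) : 1 + Complex.I ^ (2 * k + 1) =
    (jacobiSym 2 (2 * k + 1) : ℂ) * (Real.sqrt 2 : ℂ) * rhoPhase ^ (2 * k + 1) := by
  rw [pow_succ rhoPhase, pow_mul, rhoPhase_sq,
    show (jacobiSym 2 (2 * k + 1) : ℂ) * (Real.sqrt 2 : ℂ) * (Complex.I ^ k * rhoPhase) =
      (jacobiSym 2 (2 * k + 1) : ℂ) * Complex.I ^ k * ((Real.sqrt 2 : ℂ) * rhoPhase) by ring,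
    rhoPhase_eq, jacobiSym.at_two ⟨k, rfl⟩, pow_succ Complex.I, pow_mul, Complex.I_sq]
  -- After the even powers are removed the claim depends only on k modulo 4.
  obtain ⟨q, r, hr, rfl⟩ : ∃ q r, r < 4 ∧ k = 4 * q + r :=
    ⟨k / 4, k % 4, Nat.mod_lt _ (by norm_num), (Nat.div_add_mod k 4).symm⟩
  have h8 : (((2 * (4 * q + r) + 1 : ℕ)) : ZMod 8) = ((2 * r + 1 : ℕ) : ZMod 8) := by
    have : (8 : ZMod 8) = 0 := by decide
    push_cast
    linear_combination q * this
  have h4 : (-1 : ℂ) ^ (4 * q + r) = (-1) ^ r := by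
    rw [pow_add, pow_mul]; norm_num
  rw [h8, h4, pow_add, pow_mul, Complex.I_pow_four, one_pow, one_mul]
  interval_cases r
  · have : ZMod.χ₈ ((2 * 0 + 1 : ℕ) : ZMod 8) = 1 := by decide
    rw [this]; simp
  · have : ZMod.χ₈ ((2 * 1 + 1 : ℕ) : ZMod 8) = -1 := by decide
    rw [this]; push_cast; linear_combination Complex.I_sq
  · have : ZMod.χ₈ ((2 * 2 + 1 : ℕ) : ZMod 8) = -1 := by decide
    rw [this, Complex.I_sq]; simp
  · have : ZMod.χ₈ ((2 * 3 + 1 : ℕ) : ZMod 8) = 1 := by decide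
    rw [this, pow_succ Complex.I 2, Complex.I_sq]; push_cast; linear_combination Complex.I_sq

/-- This is where the Jacobi symbol arises. With s that symbol, conjugating the Gauss sum 1 + J =
s√2 e^(πi(2k+1)/4) gives the value (1 - J)/√2 of 𝒰₂ as s e^(-πi(2k+1)/4). -/
theorem inv_rhoPhase_pow (k : ℕ) : (rhoPhase ^ (2 * k + 1))⁻¹ =
    (jacobiSym 2 (2 * k + 1) : ℂ) * valueU2 k := by
  have h0 : rhoPhase ^ (2 * k + 1) ≠ 0 := pow_ne_zero _ rhoPhase_ne_zero
  have h1 := one_add_I_pow k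
  have h2 := jacobiSym_two_mul_self k
  have h3 := sqrt_two_mul_self
  have h4 : (Real.sqrt 2 : ℂ) ≠ 0 := by
    intro h; rw [h] at h3; simp at h3
  have h5 := I_pow_odd_mul_self k
  have h6 : (starRingEnd ℂ Complex.I) ^ (2 * k + 1) = -Complex.I ^ (2 * k + 1) := by
    rw [Complex.conj_I, Odd.neg_pow ⟨k, rfl⟩]
  rw [valueU2, h6, eq_comm]
  apply eq_inv_of_mul_eq_one_left
  set s := (jacobiSym 2 (2 * k + 1) : ℂ)
  set J := Complex.I ^ (2 * k + 1)
  have h7 : s * (1 - J) * rhoPhase ^ (2 * k + 1) = (Real.sqrt 2 : ℂ) := by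
    have : (Real.sqrt 2 : ℂ) * (s * (1 - J) * rhoPhase ^ (2 * k + 1)) =
        (Real.sqrt 2 : ℂ) * (Real.sqrt 2 : ℂ) := by
      linear_combination (-(1 - J)) * h1 - h5 - h3
    exact mul_left_cancel₀ h4 this
  rw [← sub_eq_add_neg, mul_div_assoc', div_mul_eq_mul_div, h7, div_self h4]

end Phase

/-! ### Relations among the slashes of f by n(1/4)n⁻(4x) -/

section Relations

variable {k M N : ℕ} {f : ℍ → ℂ}

theorem slashReal_neg_one (k : ℕ) (f : ℍ → ℂ) :
    slashReal k f (-1) = Complex.I ^ (2 * k + 1) • f := by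
  ext z
  rw [slashReal, autJ_neg_one, neg_smul_SL2, one_smul, Pi.smul_apply, smul_eq_mul, mul_comm]
  congr 1
  rw [Odd.neg_pow ⟨k, rfl⟩]
  apply inv_eq_of_mul_eq_one_left
  linear_combination -I_pow_odd_mul_self k

theorem tau_neg {g : SL(2, ℝ)} : tau (-g) = -tau g := by
  unfold tau
  simp only [SL2_neg_apply, ne_eq, neg_eq_zero]
  split_ifs <;> rfl

/-- Changing the sign of a matrix costs i^(2k+1); the real cocycle adds a further sign exactly when
the lower left entry is negative. -/
theorem slashReal_neg_of_pos (f : ℍ → ℂ) {g : SL(2, ℝ)} (hg : 0 < g 1 0) :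
    slashReal k f (-g) = Complex.I ^ (2 * k + 1) • slashReal k f g := by
  have h := slashReal_slashReal k f (-1) g
  rw [slashReal_neg_one, slashReal_smul, neg_one_mul, cocycleReal_eq_ite, if_neg] at h
  · simpa using h.symm
  · rw [neg_one_mul, tau_neg, tau_neg_one, tau_of_ne_zero hg.ne']
    rintro ⟨h1, -⟩
    linarith

theorem slashReal_neg_of_neg (f : ℍ → ℂ) {g : SL(2, ℝ)} (hg : g 1 0 < 0) :
    slashReal k f (-g) = -(Complex.I ^ (2 * k + 1) • slashReal k f g) := by
  have h := slashReal_slashReal k f (-1) g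
  rw [slashReal_neg_one, slashReal_smul, neg_one_mul, cocycleReal_eq_ite, if_pos] at h
  · rw [h]; simp
  · rw [neg_one_mul, tau_neg, tau_neg_one, tau_of_ne_zero hg.ne]
    constructor <;> nlinarith

theorem slashReal_upperU (f : ℍ → ℂ) (g : SL(2, ℝ)) (b : ℝ) :
    slashReal k (slashReal k f g) (upperU b) = slashReal k f (g * upperU b) := by
  rw [slashReal_slashReal, cocycleReal_upperU_right]
  simp

theorem slashReal_upperU_apply (f : ℍ → ℂ) (b : ℝ) (z : ℍ) :
    slashReal k f (upperU b) z = f (b +ᵥ z) := by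
  rw [slashReal, autJ_upperU, one_pow, inv_one, mul_one]
  congr 1
  ext1
  rw [coe_smul_SL2, linDenom_of_eq_zero (upperU_10 b), coe_vadd]
  simp [add_comm]

/-- The function `f|n(1/4) n⁻(4x)`. -/
noncomputable def quarterSlash (k : ℕ) (f : ℍ → ℂ) (x : ℝ) : ℍ → ℂ :=
  slashReal k f (upperU (1 / 4) * lowerU (4 * x))

theorem lowerU_mul_lowerU {K : Type*} [Field K] (x y : K) : lowerU x * lowerU y = lowerU (x + y) := by
  apply SL2_ext <;> simp [SL2_mul_zero_zero, SL2_mul_zero_one, SL2_mul_one_zero, SL2_mul_one_one]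

theorem upperU_mul_upperU {K : Type*} [Field K] (x y : K) : upperU x * upperU y = upperU (x + y) := by
  apply SL2_ext <;> simp [SL2_mul_zero_zero, SL2_mul_zero_one, SL2_mul_one_zero, SL2_mul_one_one,
    add_comm]

theorem tau_lowerU_pos {x : ℝ} (hx : 0 ≤ x) : 0 < tau (lowerU x) := by
  rcases hx.eq_or_lt with rfl | hx
  · rw [tau_of_eq_zero] <;> simp
  · rwa [tau_lowerU hx.ne']

/-- Nonnegativity of x and y keeps the relevant τ-values positive, so no cocycle sign appears. -/
theorem quarterSlash_lowerU {x y : ℝ} (hx : 0 ≤ x) (hy : 0 ≤ y) :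
    slashReal k (quarterSlash k f x) (lowerU (4 * y)) = quarterSlash k f (x + y) := by
  rw [quarterSlash, slashReal_slashReal, mul_assoc, lowerU_mul_lowerU, ← mul_add, quarterSlash,
    cocycleReal_eq_ite, if_neg]
  · simp
  · rw [mul_assoc, lowerU_mul_lowerU, tau_mul_of_left_upper (upperU_10 _), ← mul_add,
      tau_mul_of_left_upper (upperU_10 _)]
    rintro ⟨-, h⟩
    have h1 := tau_lowerU_pos (x := 4 * (x + y)) (by positivity)
    have h2 := tau_lowerU_pos (x := 4 * y) (by positivity)
    rw [tau_upperU, one_mul] at h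
    nlinarith [mul_pos h1 h2]

theorem tau_upperU_mul_lowerU (b x : ℝ) : tau (upperU b * lowerU x) = tau (lowerU x) := by
  rw [tau_mul_of_left_upper (upperU_10 _), tau_upperU, one_mul]

theorem quarterSlash_zero (k : ℕ) (f : ℍ → ℂ) :
    quarterSlash k f 0 = slashReal k f (upperU (1 / 4)) := by
  have : lowerU (4 * 0 : ℝ) = 1 := by apply SL2_ext <;> simp
  rw [quarterSlash, this, mul_one]

/-- `f` is an eigenfunction of each element of `Γ₀(N)` that lies in `-Γ₁(4)`. -/
theorem ThetaInvariant.slashReal_of_neg_mem (hf : ThetaInvariant k N f) {δ : SL(2, ℤ)}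
    (hδ : -δ ∈ levelInt N) {ε : ℤˣ} (hε : (0 < δ 1 0 ∧ ε = 1) ∨ (δ 1 0 < 0 ∧ ε = -1)) :
    slashReal k f (intToReal δ) = (((-ε * splitSign (intToRat (-δ)) : ℤˣ) : ℤ) : ℂ) •
      Complex.I ^ (2 * k + 1) • f := by
  have h1 := hf _ hδ
  have h2 := I_pow_odd_mul_self k
  have h3 : slashReal k f (-intToReal δ) =
      (((ε : ℤˣ) : ℤ) : ℂ) • Complex.I ^ (2 * k + 1) • slashReal k f (intToReal δ) := by
    rcases hε with ⟨hc, rfl⟩ | ⟨hc, rfl⟩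
    · rw [slashReal_neg_of_pos f (by rw [intToReal_apply]; exact_mod_cast hc)]
      simp
    · rw [slashReal_neg_of_neg f (by rw [intToReal_apply]; exact_mod_cast hc)]
      simp
  rw [intToReal_neg, h3] at h1
  have h4 := sign_mul_self_complex ε
  ext z
  have h5 := congrFun h1 z
  simp only [Pi.smul_apply, smul_eq_mul, Units.val_mul, Units.val_neg, Int.cast_mul,
    Int.cast_neg] at h5 ⊢
  linear_combination (-((ε : ℤ) : ℂ) * Complex.I ^ (2 * k + 1)) * h5 -
    slashReal k f (intToReal δ) z * h4 +
    slashReal k f (intToReal δ) z * ((ε : ℤ) : ℂ) * ((ε : ℤ) : ℂ) * h2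

/-- The relation `f|n(1/4) n⁻(8M) n(1/4) = i^(2k+1) f`. -/
theorem quarterSlash_two (hM : Odd M) (hf : ThetaInvariant k (4 * M) f) :
    slashReal k (quarterSlash k f (M * 2)) (upperU (1 / 4)) = Complex.I ^ (2 * k + 1) • f := by
  obtain ⟨m, rfl⟩ := hM
  -- The product n(1/4)n⁻(8M)n(1/4) for M = 2m + 1. It is integral, and its negative has d ≡ 1
  -- modulo 4.
  let δ : SL(2, ℤ) := ⟨!![4 * m + 3, m + 1; 16 * m + 8, 4 * m + 3], by
    rw [Matrix.det_fin_two_of]; ring⟩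
  have h00 : δ 0 0 = 4 * m + 3 := rfl
  have h01 : δ 0 1 = m + 1 := rfl
  have h10 : δ 1 0 = 16 * m + 8 := rfl
  have h11 : δ 1 1 = 4 * m + 3 := rfl
  have hn10 : (-δ) 1 0 = -(16 * m + 8) := rfl
  have hn11 : (-δ) 1 1 = -(4 * m + 3) := rfl
  have hmem : -δ ∈ levelInt (4 * (2 * m + 1)) :=
    (mem_levelInt_iff four_dvd_level).2 ⟨⟨-2, by rw [hn10]; push_cast; ring⟩, by omega⟩
  -- Both entries of the lower row are negative, which gives the sign, and -(16m + 8) ≡ 4 modulo 4m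
  -- + 3 makes the Jacobi symbol 1.
  have hS : splitSign (intToRat (-δ)) = -1 := by
    apply Units.ext
    rw [splitSign_eq_shimuraSymbol (four_dvd_of_mem four_dvd_level hmem) (by omega), hn10, hn11,
      shimuraSymbol, if_pos ⟨by omega, by omega⟩,
      show (-(4 * (m : ℤ) + 3)).natAbs = 4 * m + 3 by omega,
      jacobiSym.mod_left' (a₂ := 4) (Int.modEq_iff_dvd.2 ⟨4, by push_cast; ring⟩),
      jacobiSym.at_four ⟨2 * m + 1, by ring⟩]
    rfl
  have hg : upperU (1 / 4) * lowerU (4 * (((2 * m + 1 : ℕ) : ℝ) * 2)) * upperU (1 / 4) =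
      intToReal δ := by
    apply SL2_ext <;> simp only [SL2_mul_zero_zero, SL2_mul_zero_one, SL2_mul_one_zero,
      SL2_mul_one_one, intToReal_apply, h00, h01, h10, h11, upperU_00, upperU_01, upperU_10,
      upperU_11, lowerU_00, lowerU_01, lowerU_10, lowerU_11] <;> push_cast <;> ring
  rw [quarterSlash, slashReal_upperU, hg, hf.slashReal_of_neg_mem hmem
    (Or.inl ⟨by rw [h10]; positivity, rfl⟩), hS]
  simp

/-- For odd `x` the function `f|n(1/4) n⁻(4x)` is an eigenfunction of `n(1/4)`. -/
theorem quarterSlash_odd {x y : ℕ} (hx : x = 2 * y + 1) (hMx : M ∣ x)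
    (hf : ThetaInvariant k (4 * M) f) :
    ∃ c : ℂ, (c = 1 ∨ c = Complex.I ^ (2 * k + 1)) ∧
      slashReal k (quarterSlash k f x) (upperU (1 / 4)) = c • quarterSlash k f x := by
  -- The conjugate of n(1/4) by n(1/4)n⁻(4x). Its upper right entry is (x + 1)²/4, integral because
  -- x is odd.
  let δ : SL(2, ℤ) := ⟨!![1 - x - x ^ 2, (y + 1) ^ 2; -4 * x ^ 2, 1 + x + x ^ 2], by
    rw [Matrix.det_fin_two_of, hx]; push_cast; ring⟩
  have h00 : δ 0 0 = 1 - x - x ^ 2 := rfl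
  have h01 : δ 0 1 = (y + 1) ^ 2 := rfl
  have h10 : δ 1 0 = -4 * x ^ 2 := rfl
  have h11 : δ 1 1 = 1 + x + x ^ 2 := rfl
  have hn10 : (-δ) 1 0 = -(-4 * x ^ 2) := rfl
  have hn11 : (-δ) 1 1 = -(1 + x + x ^ 2) := rfl
  have hx0 : (0 : ℝ) < x := by rw [hx]; positivity
  have hxz : (0 : ℤ) < x := by rw [hx]; positivity
  have hdvd : ((4 * M : ℕ) : ℤ) ∣ 4 * (x : ℤ) ^ 2 := by
    obtain ⟨n, rfl⟩ := hMx
    exact ⟨M * n ^ 2, by push_cast; ring⟩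
  have hg : upperU (1 / 4) * lowerU (4 * (x : ℝ)) * upperU (1 / 4) =
      intToReal δ * (upperU (1 / 4) * lowerU (4 * (x : ℝ))) := by
    have hy : (x : ℝ) = 2 * y + 1 := by rw [hx]; push_cast; ring
    apply SL2_ext <;> simp only [SL2_mul_zero_zero, SL2_mul_zero_one, SL2_mul_one_zero,
      SL2_mul_one_one, intToReal_apply, h00, h01, h10, h11, upperU_00, upperU_01, upperU_10,
      upperU_11, lowerU_00, lowerU_01, lowerU_10, lowerU_11] <;> push_cast <;> rw [hy] <;> ring
  have hσ : cocycleReal (intToReal δ) (upperU (1 / 4) * lowerU (4 * (x : ℝ))) = 1 := by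
    have h1 : tau (upperU (1 / 4) * lowerU (4 * (x : ℝ))) = 4 * (x : ℝ) := by
      rw [tau_upperU_mul_lowerU, tau_lowerU (by positivity)]
    have h2 : tau (upperU (1 / 4) * lowerU (4 * (x : ℝ)) * upperU (1 / 4)) = 4 * (x : ℝ) := by
      have : (upperU (1 / 4) * lowerU (4 * (x : ℝ)) * upperU (1 / 4) : SL(2, ℝ)) 1 0 = 4 * x := by
        simp [SL2_mul_one_zero, SL2_mul_one_one]
      rw [tau_of_ne_zero (by rw [this]; positivity), this]
    rw [cocycleReal_eq_ite, ← hg, h1, h2, if_neg]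
    rintro ⟨-, h⟩
    nlinarith
  have key : ∀ c : ℂ, slashReal k f (intToReal δ) = c • f →
      slashReal k (quarterSlash k f x) (upperU (1 / 4)) = c • quarterSlash k f x := by
    intro c hc
    have h1 := slashReal_slashReal k f (intToReal δ) (upperU (1 / 4) * lowerU (4 * (x : ℝ)))
    rw [hσ, hc, slashReal_smul] at h1
    rw [quarterSlash, slashReal_upperU, hg, h1]
    simp
  have hjac : jacobiSym (4 * (x : ℤ) ^ 2) (1 + x + x ^ 2) = 1 := by
    rw [show 4 * (x : ℤ) ^ 2 = (2 * x) ^ 2 by ring]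
    exact jacobiSym.sq_one' (Int.isCoprime_iff_gcd_eq_one.1
      ⟨-(y + 1), 1, by rw [hx]; push_cast; ring⟩)
  have hodd : Odd (1 + x + x ^ 2) := ⟨x * (y + 1), by rw [hx]; ring⟩
  have hnat' : (1 + (x : ℤ) + x ^ 2).natAbs = 1 + x + x ^ 2 := by
    have : 1 + (x : ℤ) + x ^ 2 = ((1 + x + x ^ 2 : ℕ) : ℤ) := by push_cast; ring
    rw [this, Int.natAbs_natCast]
  have hnat : (-(1 + (x : ℤ) + x ^ 2)).natAbs = 1 + x + x ^ 2 := by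
    rw [Int.natAbs_neg, hnat']
  have hpar : (x : ℤ) % 4 = 1 ∨ (x : ℤ) % 4 = 3 := by omega
  -- For x ≡ 1 modulo 4 it is -δ that lies in Γ₁(4), with eigenvalue i^(2k+1); for x ≡ 3 it is δ,
  -- with eigenvalue 1.
  rcases hpar with h | h
  · have h4 : (-(1 + (x : ℤ) + x ^ 2)) % 4 = 1 := by
      obtain ⟨e, he⟩ : ∃ e : ℤ, (x : ℤ) = 4 * e + 1 := ⟨x / 4, by omega⟩
      rw [he, show -(1 + (4 * e + 1) + (4 * e + 1) ^ 2) = 1 + 4 * (-4 * e ^ 2 - 3 * e - 1) by ring]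
      omega
    have hmem : -δ ∈ levelInt (4 * M) := (mem_levelInt_iff four_dvd_level).2
      ⟨by rw [hn10]; simpa using hdvd, by rw [hn11]; exact h4⟩
    have hS : splitSign (intToRat (-δ)) = 1 := by
      apply Units.ext
      rw [splitSign_eq_shimuraSymbol (four_dvd_of_mem four_dvd_level hmem) (by rw [hn11]; exact h4),
        hn10, hn11, shimuraSymbol, if_neg (by rintro ⟨h, -⟩; nlinarith [pow_pos hxz 2]), hnat,
        show -(-4 * (x : ℤ) ^ 2) = 4 * x ^ 2 by ring, hjac]
      rfl
    refine ⟨_, Or.inr rfl, key _ ?_⟩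
    rw [hf.slashReal_of_neg_mem hmem (ε := -1)
      (Or.inr ⟨by rw [h10]; nlinarith [pow_pos hxz 2], rfl⟩), hS]
    simp
  · have h4 : (1 + (x : ℤ) + x ^ 2) % 4 = 1 := by
      obtain ⟨e, he⟩ : ∃ e : ℤ, (x : ℤ) = 4 * e + 3 := ⟨x / 4, by omega⟩
      rw [he, show 1 + (4 * e + 3) + (4 * e + 3) ^ 2 = 1 + 4 * (4 * e ^ 2 + 7 * e + 3) by ring]
      omega
    have hmem : δ ∈ levelInt (4 * M) := (mem_levelInt_iff four_dvd_level).2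
      ⟨by rw [h10]; simpa using hdvd, by rw [h11]; exact h4⟩
    have hS : splitSign (intToRat δ) = 1 := by
      apply Units.ext
      rw [splitSign_eq_shimuraSymbol (four_dvd_of_mem four_dvd_level hmem) (by rw [h11]; exact h4),
        h10, h11, shimuraSymbol, if_neg (by rintro ⟨-, h⟩; nlinarith [pow_pos hxz 2]), hnat',
        show -4 * (x : ℤ) ^ 2 = -(4 * x ^ 2) by ring, jacobiSym.neg _ hodd, hjac,
        ZMod.χ₄_nat_one_mod_four (by zify; exact h4)]
      rfl
    refine ⟨_, Or.inl rfl, key _ ?_⟩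
    rw [hf _ hmem, hS]
    simp

/-- The matrix `(1, b; 0, 1)` in `SL₂(ℤ)`. -/
def intUpper (b : ℤ) : SL(2, ℤ) := ⟨!![1, b; 0, 1], by simp [Matrix.det_fin_two]⟩

theorem intToReal_intUpper (b : ℤ) : intToReal (intUpper b) = upperU (b : ℝ) := by
  apply SL2_ext <;> rw [intToReal_apply] <;> simp [intUpper]

theorem ThetaInvariant.slashReal_upperU_int (hN : 4 ∣ N) (hf : ThetaInvariant k N f) (b : ℤ) :
    slashReal k f (upperU (b : ℝ)) = f := by
  have hmem : intUpper b ∈ levelInt N := (mem_levelInt_iff hN).2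
    ⟨by simp [intUpper], by simp [intUpper]⟩
  have hS : splitSign (intToRat (intUpper b)) = 1 := by
    refine finprod_eq_one_of_forall_eq_one fun p => sPadic_of_eq_zero ?_
    rw [ratToPadic_apply, intToRat_apply]
    simp [intUpper]
  rw [← intToReal_intUpper, hf _ hmem, hS]
  simp

theorem ThetaInvariant.slashReal_lowerU_int (hN : 4 ∣ N) (hf : ThetaInvariant k N f) {c : ℤ}
    (hc : (N : ℤ) ∣ c) : slashReal k f (lowerU (c : ℝ)) = f := by
  rw [← intToReal_intLower, hf _ (intLower_mem hN hc), splitSign_intToRat_intLower]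
  simp

theorem slashReal_upperU_upperU (f : ℍ → ℂ) (b c : ℝ) :
    slashReal k (slashReal k f (upperU b)) (upperU c) = slashReal k f (upperU (b + c)) := by
  rw [slashReal_upperU, upperU_mul_upperU]

theorem quarterSlash_two_eq (hM : Odd M) (hf : ThetaInvariant k (4 * M) f) :
    quarterSlash k f (M * 2) = Complex.I ^ (2 * k + 1) • slashReal k f (upperU (-(1 / 4))) := by
  have h := congrArg (fun g => slashReal k g (upperU (-(1 / 4)))) (quarterSlash_two hM hf)
  simp only [slashReal_smul] at h
  have : upperU (1 / 4 + -(1 / 4) : ℝ) = 1 := by apply SL2_ext <;> simp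
  rw [← h, slashReal_upperU_upperU, this, slashReal_one]

/-- The sum over the four cosets. -/
theorem sum_quarterSlash (k M : ℕ) (f : ℍ → ℂ) :
    ∑ ν : Fin 4, slashReal k f (upperU (1 / 4) * lowerU (4 * M * ((ν : ℕ) : ℝ))) =
      (quarterSlash k f 0 + quarterSlash k f (M * 2)) +
        (quarterSlash k f M + quarterSlash k f (M * 3)) := by
  rw [Fin.sum_univ_four]
  simp only [quarterSlash, Fin.val_zero, Fin.val_one, Fin.val_two, Nat.cast_zero, Nat.cast_one,
    Nat.cast_ofNat, mul_zero, mul_one, mul_assoc,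
    show ((3 : Fin 4) : ℕ) = 3 from rfl]
  abel

/-- `Q f = α f` for `α = 2 √2 s` is equivalent to `f|ρ + f|ρ⁻¹ = √2 s f`. -/
theorem eigen_iff (hM : Odd M) (hf : ThetaInvariant k (4 * M) f) {θ s r : ℂ} (hs : s * s = 1)
    (hr : r * r = 2) (hθ : θ * θ * Complex.I ^ (2 * k + 1) = 1)
    (hθ' : θ * (1 + Complex.I ^ (2 * k + 1)) = r * s) :
    θ • ((quarterSlash k f 0 + quarterSlash k f (M * 2)) +
        (quarterSlash k f M + quarterSlash k f (M * 3))) = (2 * r * s) • f ↔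
      θ • (quarterSlash k f 0 + quarterSlash k f (M * 2)) = (r * s) • f := by
  obtain ⟨m, hm⟩ := hM
  have hM : Odd M := ⟨m, hm⟩
  obtain ⟨c₁, hc₁, e₁⟩ := quarterSlash_odd hm dvd_rfl hf
  obtain ⟨c₃, hc₃, e₃⟩ := quarterSlash_odd (x := M * 3) (y := 3 * m + 1) (by rw [hm]; ring)
    (dvd_mul_right _ _) hf
  push_cast at e₃
  have hJ := I_pow_odd_mul_self k
  set J := Complex.I ^ (2 * k + 1) with hJdef
  have e₂ := quarterSlash_two hM hf
  have e₂' := quarterSlash_two_eq hM hf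
  have e₀ := quarterSlash_zero k f
  rw [← hJdef] at e₂ e₂'
  have p₃ : slashReal k f (upperU (3 / 4)) = slashReal k f (upperU (-(1 / 4))) := by
    have h := hf.slashReal_upperU_int four_dvd_level 1
    have h2 := congrArg (fun g => slashReal k g (upperU (-(1 / 4)))) h
    simp only [slashReal_upperU_upperU] at h2
    rw [← h2]
    congr 2
    push_cast
    norm_num
  have p₄ : slashReal k f (upperU 1) = f := by
    simpa using hf.slashReal_upperU_int four_dvd_level 1
  set v₀ := quarterSlash k f 0 with hv₀
  set v₁ := quarterSlash k f M
  set v₂ := quarterSlash k f (M * 2) with hv₂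
  set v₃ := quarterSlash k f (M * 3)
  set g := slashReal k f (upperU (1 / 2)) with hg
  have a₀ : slashReal k v₀ (upperU (1 / 4)) = g := by
    rw [e₀, slashReal_upperU_upperU, hg]; norm_num
  -- Translation by 3/4 is translation by -1/4, which is -J v₂ because J² = -1.
  have ag : slashReal k g (upperU (1 / 4)) = -J • v₂ := by
    rw [hg, slashReal_upperU_upperU, e₂', smul_smul, neg_mul, hJ, neg_neg, one_smul, ← p₃]
    norm_num
  constructor
  · intro h
    -- The eigenvalue equation is translated by 1/4, 1/2 and 3/4. The combination E1 + J·E3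
    -- eliminates f(z + 1/2), since J² = -1, and gives both v₁ and v₃ the coefficient 1 + J, since c
    -- + Jc³ = 1 + J for c = 1 and for c = J.
    have E1 := congrArg (fun u => slashReal k u (upperU (1 / 4))) h
    simp only [slashReal_smul, slashReal_add, a₀, e₁, e₂, e₃] at E1
    rw [← e₀] at E1
    have E2 := congrArg (fun u => slashReal k u (upperU (1 / 4))) E1
    simp only [slashReal_smul, slashReal_add, a₀, ag, e₁, e₃] at E2
    rw [← e₀] at E2
    have E3 := congrArg (fun u => slashReal k u (upperU (1 / 4))) E2
    simp only [slashReal_smul, slashReal_add, a₀, ag, e₁, e₂, e₃] at E3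
    ext z
    have h0 := congrFun h z
    have h1 := congrFun E1 z
    have h3 := congrFun E3 z
    simp only [Pi.smul_apply, Pi.add_apply, smul_eq_mul] at h0 h1 h3 ⊢
    have k₁ : c₁ + J * c₁ * c₁ * c₁ = 1 + J := by
      rcases hc₁ with rfl | rfl
      · ring
      · linear_combination (J * J - 1) * hJ
    have k₃ : c₃ + J * c₃ * c₃ * c₃ = 1 + J := by
      rcases hc₃ with rfl | rfl
      · ring
      · linear_combination (J * J - 1) * hJ
    have E : θ * (2 * J * f z + (1 + J) * (v₁ z + v₃ z)) = 2 * r * s * (v₀ z + v₂ z) := by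
      linear_combination h1 + J * h3 - θ * v₁ z * k₁ - θ * v₃ z * k₃ -
        (2 * r * s * v₂ z + θ * g z - θ * J * f z) * hJ
    have hrs : r * s * (r * s) = 2 := by linear_combination s * s * hr + 2 * hs
    -- With X = θ(v₀ + v₂), the previous identity times θ reads 2f + rs θ(v₁ + v₃) = 2rs X.
    -- Inserting θ(v₁ + v₃) = 2rs f - X and (rs)² = 2 leaves 3rs X = 6f.
    have E' : 3 * (r * s) * (θ * (v₀ z + v₂ z)) = 6 * f z := by
      linear_combination -θ * E + 2 * f z * hθ + θ * (v₁ z + v₃ z) * hθ' + r * s * h0 + 2 * f z * hrs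
    linear_combination (r * s / 6) * E' - (θ * (v₀ z + v₂ z) / 2) * hrs
  · intro h
    -- Conversely, slashing with n⁻(4M) fixes f and turns v₀ + v₂ into v₁ + v₃, so the second half
    -- of the sum contributes the same multiple of f.
    have E1 := congrArg (fun u => slashReal k u (lowerU (4 * (M : ℝ)))) h
    have hM0 : (0 : ℝ) ≤ M := Nat.cast_nonneg M
    have hfl : slashReal k f (lowerU (4 * (M : ℝ))) = f := by
      have := hf.slashReal_lowerU_int four_dvd_level (c := 4 * M) (by simp)
      simpa using this
    simp only [slashReal_smul, slashReal_add, hv₀, hv₂] at E1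
    rw [quarterSlash_lowerU le_rfl hM0, quarterSlash_lowerU (by positivity) hM0, hfl, zero_add,
      show (M * 2 + M : ℝ) = M * 3 by ring] at E1
    rw [smul_add, h, E1, ← add_smul]
    congr 1
    ring

end Relations

/-! ### Fourier coefficients and the plus condition -/

section PlusSpace

variable {k M : ℕ} {f : ℍ → ℂ} {θ w : ℂ}

theorem cuspForms_smul {N : ℕ} (hN : 4 ∣ N) (c : ℂ) (hf : f ∈ cuspForms k N) :
    c • f ∈ cuspForms k N := by
  obtain ⟨h1, h2, h3⟩ := (isCuspForm_iff hN).1 hf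
  refine (isCuspForm_iff hN).2 ⟨h1.const_smul c, fun δ hδ => ?_, fun α => ?_⟩
  · rw [slashReal_smul, h2 δ hδ, smul_comm]
  · rw [slashReal_smul]
    have h := (h3 α).const_smul c
    rwa [smul_zero] at h

/-- The eigenvalue of `f ↦ θ f(z + 1/4) + θ i^(2k+1) f(z - 1/4)` on `exp(2πinz)`. -/
def quarterEigenvalue (k : ℕ) (θ : ℂ) (n : ℕ) : ℂ :=
  θ * (Complex.I ^ n + Complex.I ^ (2 * k + 1) * (-Complex.I) ^ n)

/-- As i^(2k+1) = (-1)^k i, the eigenvalue depends only on n modulo 4 and the parity of k, and it is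
always w or -w. The plus condition singles out the value w. -/
theorem quarterEigenvalue_eq (hθ : θ * (1 + Complex.I ^ (2 * k + 1)) = w) (n : ℕ) :
    quarterEigenvalue k θ n =
      if ((-1 : ℤ) ^ k * n) % 4 = 0 ∨ ((-1 : ℤ) ^ k * n) % 4 = 1 then w else -w := by
  obtain ⟨q, r, hr, rfl⟩ : ∃ q r, r < 4 ∧ n = 4 * q + r :=
    ⟨n / 4, n % 4, Nat.mod_lt _ (by norm_num), (Nat.div_add_mod n 4).symm⟩
  have hI : Complex.I ^ (4 * q) = 1 := by rw [pow_mul, Complex.I_pow_four, one_pow]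
  have hI' : (-Complex.I) ^ (4 * q) = 1 := by
    rw [pow_mul, show (-Complex.I) ^ 4 = Complex.I ^ 4 by ring, Complex.I_pow_four, one_pow]
  have h3 : Complex.I ^ 3 = -Complex.I := Complex.I_pow_three
  have h3' : (-Complex.I) ^ 3 = Complex.I := by rw [Odd.neg_pow (by decide), h3, neg_neg]
  have hII := Complex.I_mul_I
  rw [quarterEigenvalue, pow_add, pow_add (-Complex.I), hI, hI', ← hθ, pow_succ, pow_mul, Complex.I_sq]
  rcases Nat.even_or_odd k with hk | hk <;> rw [hk.neg_one_pow, hk.neg_one_pow] <;>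
    interval_cases r
  all_goals first
    | rw [if_pos (by push_cast; omega)]
    | rw [if_neg (by push_cast; omega)]
  all_goals
    simp only [pow_zero, pow_one, h3, h3', sq, neg_mul_neg, hII]
    first
    | ring1
    | linear_combination θ * hII
    | linear_combination -θ * hII

/-- The exponential `exp(2πinz)`. -/
noncomputable def expTerm (n : ℕ) (z : ℂ) : ℂ := Complex.exp (2 * Real.pi * Complex.I * n * z)

theorem expTerm_quarter_add (n : ℕ) (z : ℂ) :
    expTerm n (1 / 4 + z) = Complex.I ^ n * expTerm n z := by
  rw [expTerm, expTerm, show 2 * (Real.pi : ℂ) * Complex.I * n * (1 / 4 + z) =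
    n * (Real.pi / 2 * Complex.I) + 2 * Real.pi * Complex.I * n * z by ring, Complex.exp_add,
    Complex.exp_nat_mul, Complex.exp_pi_div_two_mul_I]

theorem expTerm_neg_quarter_add (n : ℕ) (z : ℂ) :
    expTerm n (-(1 / 4) + z) = (-Complex.I) ^ n * expTerm n z := by
  rw [expTerm, expTerm, show 2 * (Real.pi : ℂ) * Complex.I * n * (-(1 / 4) + z) =
    n * (-Real.pi / 2 * Complex.I) + 2 * Real.pi * Complex.I * n * z by ring, Complex.exp_add,
    Complex.exp_nat_mul, Complex.exp_neg_pi_div_two_mul_I]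

theorem hasSum_quarter {a : ℕ → ℂ}
    (ha : ∀ z : ℍ, HasSum (fun n : ℕ => a n * expTerm n (z : ℂ)) (f z)) (θ : ℂ) (z : ℍ) :
    HasSum (fun n : ℕ => quarterEigenvalue k θ n * (a n * expTerm n (z : ℂ)))
      (θ * (f ((1 / 4 : ℝ) +ᵥ z) + Complex.I ^ (2 * k + 1) * f ((-(1 / 4) : ℝ) +ᵥ z))) := by
  have h := ((ha ((1 / 4 : ℝ) +ᵥ z)).add
    ((ha ((-(1 / 4) : ℝ) +ᵥ z)).mul_left (Complex.I ^ (2 * k + 1)))).mul_left θ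
  refine h.congr_fun fun n => ?_
  have h1 : (((1 / 4 : ℝ) +ᵥ z : ℍ) : ℂ) = 1 / 4 + z := by simp
  have h2 : (((-(1 / 4) : ℝ) +ᵥ z : ℍ) : ℂ) = -(1 / 4) + z := by simp
  rw [h1, h2, expTerm_quarter_add, expTerm_neg_quarter_add, quarterEigenvalue]
  ring

/-- Invariance under n(1) gives period 1, and vanishing at i∞ gives the boundedness needed for the
q-expansion. -/
theorem hasSum_qExpansion_of_mem (hf : f ∈ cuspForms k (4 * M)) (z : ℍ) :
    HasSum (fun n : ℕ => (qExpansion 1 f).coeff n * expTerm n (z : ℂ)) (f z) := by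
  obtain ⟨h1, h2, h3⟩ := (isCuspForm_iff four_dvd_level).1 hf
  have hper : Function.Periodic (f ∘ ofComplex) 1 := by
    intro w
    by_cases hw : 0 < w.im
    · have hw' : 0 < (w + 1).im := by simpa using hw
      have h := congrFun (h2.slashReal_upperU_int four_dvd_level 1) ⟨w, hw⟩
      rw [slashReal_upperU_apply] at h
      rw [Function.comp_apply, Function.comp_apply, ofComplex_apply_of_im_pos hw,
        ofComplex_apply_of_im_pos hw', ← h]
      congr 1
      ext1
      simp [add_comm]
    · have hw' : ¬ 0 < (w + 1).im := by simpa using hw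
      rw [Function.comp_apply, Function.comp_apply,
        ofComplex_apply_of_im_nonpos (not_lt.1 hw), ofComplex_apply_of_im_nonpos (not_lt.1 hw')]
  have hbdd : IsBoundedAtImInfty f := by
    have := h3 1
    rw [map_one, slashReal_one] at this
    exact this.isBoundedAtImInfty
  have h := UpperHalfPlane.hasSum_qExpansion one_pos (by simpa using hper) h1 hbdd z
  refine h.congr_fun fun n => ?_
  rw [smul_eq_mul, expTerm, Function.Periodic.qParam, ← Complex.exp_nat_mul]
  congr 2
  push_cast
  ring

/-- The plus condition on the coefficients as an identity between translates of `f`. -/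
theorem mem_plusSpace_iff (hθ : θ * (1 + Complex.I ^ (2 * k + 1)) = w) (hw : w ≠ 0)
    (hf : f ∈ cuspForms k (4 * M)) : f ∈ plusSpace k M ↔ ∀ z : ℍ,
      θ * (f ((1 / 4 : ℝ) +ᵥ z) + Complex.I ^ (2 * k + 1) * f ((-(1 / 4) : ℝ) +ᵥ z)) = w * f z := by
  constructor
  · rintro ⟨-, a, ha, hplus⟩ z
    refine (hasSum_quarter ha θ z).unique ?_
    refine ((ha z).mul_left w).congr_fun fun n => ?_
    by_cases h0 : a n = 0
    · simp [h0]
    · rw [quarterEigenvalue_eq hθ, if_pos (hplus n h0)]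
      rfl
  · intro h
    -- The factor projects onto eigenvalue w: it is 1 or 0 according to the plus condition, and the
    -- modified series still sums to f because f satisfies the translation identity. Uniqueness of
    -- Fourier coefficients is not needed.
    refine ⟨hf, fun n => (quarterEigenvalue k θ n + w) / (2 * w) * (qExpansion 1 f).coeff n,
      fun z => ?_, fun n hn => ?_⟩
    · have h1 := hasSum_quarter (k := k) (hasSum_qExpansion_of_mem hf) θ z
      rw [h z] at h1
      have h2 := (h1.add ((hasSum_qExpansion_of_mem hf z).mul_left w)).mul_left (1 / (2 * w))
      rw [show 1 / (2 * w) * (w * f z + w * f z) = f z by field_simp; ring] at h2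
      refine h2.congr_fun fun n => ?_
      rw [← expTerm]
      ring
    · by_contra hc
      refine hn ?_
      simp only [quarterEigenvalue_eq hθ, if_neg hc, neg_add_cancel, zero_div, zero_mul]

theorem kohnenQ_eq_heckeU_two (hM : Odd M) (hf : f ∈ cuspForms k (4 * M)) :
    kohnenQ k (4 * M) f =
      (jacobiSym 2 (2 * k + 1) : ℂ) • heckeTranslate k (4 * M) (heckeU k 2) f := by
  rw [kohnenQ_eq hM hf, heckeTranslate_heckeU_two hM hf, inv_rhoPhase_pow, smul_smul]

/-- The constant θ = e^(-πi(2k+1)/4) satisfies θ²J = 1 and θ(1 + J) = √2 s with s the Jacobi symbol.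
Thus the plus condition is θ(v₀ + v₂) = √2 s f, equivalently Qf = 2√2 s f, and s cancels against the
factor between `Q` and q(𝒰₂). -/
theorem mem_plusSpace_iff_heckeU_two (hM : Odd M) (hf : f ∈ cuspForms k (4 * M)) :
    f ∈ plusSpace k M ↔
      ((Real.sqrt 2 : ℂ)⁻¹) • heckeTranslate k (4 * M) (heckeU k 2) f = (2 : ℂ) • f := by
  have hf' := ((isCuspForm_iff four_dvd_level).1 hf).2.1
  have h0 : rhoPhase ^ (2 * k + 1) ≠ 0 := pow_ne_zero _ rhoPhase_ne_zero
  have hs := jacobiSym_two_mul_self k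
  have hr := sqrt_two_mul_self
  have hQ := kohnenQ_eq hM hf
  rw [kohnenQ_eq_heckeU_two hM hf, sum_quarterSlash] at hQ
  have hθ' : (rhoPhase ^ (2 * k + 1))⁻¹ * (1 + Complex.I ^ (2 * k + 1)) =
      (Real.sqrt 2 : ℂ) * (jacobiSym 2 (2 * k + 1) : ℂ) := by
    rw [one_add_I_pow]
    field_simp
  have hθ : (rhoPhase ^ (2 * k + 1))⁻¹ * (rhoPhase ^ (2 * k + 1))⁻¹ * Complex.I ^ (2 * k + 1) =
      1 := by
    rw [← rhoPhase_pow_sq]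
    field_simp
  set θ := (rhoPhase ^ (2 * k + 1))⁻¹
  set s := (jacobiSym 2 (2 * k + 1) : ℂ)
  set r := (Real.sqrt 2 : ℂ)
  have hs0 : s ≠ 0 := left_ne_zero_of_mul_eq_one hs
  have hr0 : r ≠ 0 := fun h => by simp [h] at hr
  have h1 : (∀ z : ℍ, θ * (f ((1 / 4 : ℝ) +ᵥ z) +
      Complex.I ^ (2 * k + 1) * f ((-(1 / 4) : ℝ) +ᵥ z)) = r * s * f z) ↔
      θ • (quarterSlash k f 0 + quarterSlash k f (M * 2)) = (r * s) • f := by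
    rw [funext_iff]
    refine forall_congr' fun z => ?_
    rw [Pi.smul_apply, Pi.add_apply, Pi.smul_apply, quarterSlash_zero, quarterSlash_two_eq hM hf',
      Pi.smul_apply, slashReal_upperU_apply, slashReal_upperU_apply]
    rfl
  rw [mem_plusSpace_iff hθ' (mul_ne_zero hr0 hs0) hf, h1, ← eigen_iff hM hf' hs hr hθ hθ', ← hQ,
    funext_iff, funext_iff]
  refine forall_congr' fun z => ?_
  simp only [Pi.smul_apply, smul_eq_mul]
  rw [show 2 * r * s * f z = s * (2 * r * f z) by ring, mul_right_inj' hs0,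
    inv_mul_eq_iff_eq_mul₀ hr0, show r * (2 * f z) = 2 * r * f z by ring]

end PlusSpace

end KohnenPlus

theorem mainTheorem11 (k M : ℕ) (hk : 1 ≤ k) (hM : Odd M) :
    (IsHeckeElement k (heckeT k 1) ∧ IsHeckeElement k (heckeU k 1) ∧
      IsHeckeElement k (heckeU k 2)) ∧
    (∀ f ∈ cuspForms k (4 * M),
      kohnenQ k (4 * M) f ∈ cuspForms k (4 * M) ∧
      heckeTranslate k (4 * M) (heckeT k 1) f ∈ cuspForms k (4 * M) ∧
      heckeTranslate k (4 * M) (heckeU k 1) f ∈ cuspForms k (4 * M) ∧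
      heckeTranslate k (4 * M) (heckeU k 2) f ∈ cuspForms k (4 * M)) ∧
    (∀ f ∈ cuspForms k (4 * M),
      kohnenQ k (4 * M) f =
        (jacobiSym 2 (2 * k + 1) : ℂ) • heckeTranslate k (4 * M) (heckeU k 2) f ∧
      kohnenQ k (4 * M) f =
        (jacobiSym 2 (2 * k + 1) : ℂ) •
          heckeTranslate k (4 * M) (heckeU k 1) (heckeTranslate k (4 * M) (heckeT k 1) f)) ∧
    plusSpace k M = {f | f ∈ cuspForms k (4 * M) ∧
      ((Real.sqrt 2 : ℂ)⁻¹) •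
        heckeTranslate k (4 * M) (heckeU k 1) (heckeTranslate k (4 * M) (heckeT k 1) f) =
          (2 : ℂ) • f} := by
  refine ⟨⟨isHeckeElement_heckeT k 1, isHeckeElement_heckeU k 1, isHeckeElement_heckeU k 2⟩,
    fun f hf => ⟨?_, heckeTranslate_heckeT_mem hM hf, heckeTranslate_heckeU_one_mem hM hf,
      heckeTranslate_heckeU_two_mem hM hf⟩, fun f hf => ⟨kohnenQ_eq_heckeU_two hM hf, ?_⟩, ?_⟩
  · rw [kohnenQ_eq_heckeU_two hM hf]
    exact cuspForms_smul four_dvd_level _ (heckeTranslate_heckeU_two_mem hM hf)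
  · rw [kohnenQ_eq_heckeU_two hM hf, heckeTranslate_heckeU_heckeT hM hf]
  · ext f
    refine ⟨fun h => ⟨h.1, ?_⟩, fun h => ?_⟩
    · rw [heckeTranslate_heckeU_heckeT hM h.1]
      exact (mem_plusSpace_iff_heckeU_two hM h.1).1 h
    · obtain ⟨hf, h⟩ := h
      rw [heckeTranslate_heckeU_heckeT hM hf] at h
      exact (mem_plusSpace_iff_heckeU_two hM hf).2 h
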